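/- A Markov chain $M=(S,P,\pi)$ consists of a finite set $S$ of states, rational transition probabilities $P:S\times S\to[0,1]$ with $\sum_{t\in S}P(s,t)=1$ for every $s\in S$, and a rational initial distribution $\pi$ on $S$; $\Pr_M$ denotes the law of its trajectory $s_0s_1s_2\ldots\in S^\omega$. A nondeterministic Büchi automaton $A=(S,Q,Q_0,\delta,F)$ over the alphabet $S$ has a finite set $Q$ of states, initial states $Q_0\subseteq Q$, a transition function $\delta:Q\times S\to 2^Q$ and accepting states $F\subseteq Q$; an accepting run on $w_0w_1\ldots\in S^\omega$ is a sequence $q_0q_1\ldots\in Q^\omega$ with $q_0\in Q_0$, $q_{i+1}\in\delta(q_i,w_i)$ for all $i$, and $q_i\in F$ for infinitely many $i$. The language $L(A)$ is the set of the words that have an accepting run, and $A$ is unambiguous if every word in $S^\omega$ has at most one accepting run. Let $\|M\|$ and $\|A\|$ be the lengths of the representations of $M$ and $A$, with integers encoded in binary and rationals given by numerator and denominator. Theorem. There is an algorithm that, given a Markov chain $M=(S,P,\pi)$ and an unambiguous (not necessarily separated) Büchi automaton $A=(S,Q,Q_0,\delta,F)$, computes $\Pr_M(L(A))$, which is a rational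 number, as a fraction of two integers with positive denominator, in time polynomial in $\|M\|$ and $\|A\|$. (Time is the cost of a program of a random access machine on integers, each operation being charged according to the binary lengths of the integers and addresses it handles.) -/

import Mathlib

open MeasureTheory ProbabilityTheory Filter

/-! ### Markov chains with rational data -/

/-- A Markov chain with state set `{0, …, n - 1}`, rational transition probabilities
`P s t` and rational initial distribution `π`. -/
structure MarkovChain (n : ℕ) where
  P : Fin n → Fin n → ℚ
  π : Fin n → ℚ
  P_nonneg : ∀ s t, 0 ≤ P s t
  P_sum : ∀ s, ∑ t, P s t = 1
  π_nonneg : ∀ s, 0 ≤ π s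
  π_sum : ∑ s, π s = 1

/-- The probability mass function with rational weights `w`. -/
noncomputable def ratPMF {n : ℕ} (w : Fin n → ℚ) (h0 : ∀ s, 0 ≤ w s) (h1 : ∑ s, w s = 1) :
    PMF (Fin n) :=
  PMF.ofFintype (fun s => ENNReal.ofReal (w s : ℝ)) (by
    rw [← ENNReal.ofReal_sum_of_nonneg (fun s _ => by exact_mod_cast h0 s)]
    have h : ∑ s, (w s : ℝ) = 1 := by exact_mod_cast h1
    rw [h, ENNReal.ofReal_one])

namespace MarkovChain

variable {n : ℕ}

/-- The initial distribution of the chain. -/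
noncomputable def initialLaw (M : MarkovChain n) : Measure (Fin n) :=
  (ratPMF M.π M.π_nonneg M.π_sum).toMeasure

/-- The distribution of the next state, given that the current state is `s`. -/
noncomputable def stepLaw (M : MarkovChain n) (s : Fin n) : Measure (Fin n) :=
  (ratPMF (M.P s) (M.P_nonneg s) (M.P_sum s)).toMeasure

/-- The distribution of the state at time `k + 1`, given the states at times `0, …, k`. -/
noncomputable def historyKernel (M : MarkovChain n) (k : ℕ) :
    Kernel ((i : Finset.Iic k) → (fun _ : ℕ => Fin n) i) ((fun _ : ℕ => Fin n) (k + 1)) :=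
  Kernel.ofFunOfCountable fun x => M.stepLaw (x ⟨k, Finset.mem_Iic.mpr le_rfl⟩)

instance (M : MarkovChain n) (k : ℕ) : IsMarkovKernel (M.historyKernel k) :=
  ⟨fun _ => PMF.toMeasure.isProbabilityMeasure _⟩

/-- The law of the trajectory of the chain: a measure on the infinite words over the states. -/
noncomputable def trajectoryLaw (M : MarkovChain n) : Measure (ℕ → Fin n) :=
  Kernel.trajMeasure (X := fun _ => Fin n) M.initialLaw M.historyKernel

end MarkovChain

/-! ### Büchi automata

A nondeterministic automaton (alphabet, states, initial states, transition function, accepting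
states) is Mathlib's `NFA`; here it is read as an acceptor of infinite words. -/

namespace Buchi

variable {α σ : Type}

/-- `ρ` is an accepting run of `A` on the infinite word `w`: it starts in an initial state,
follows the transitions, and visits accepting states infinitely often. -/
def IsAcceptingRun (A : NFA α σ) (w : ℕ → α) (ρ : ℕ → σ) : Prop :=
  ρ 0 ∈ A.start ∧ (∀ i, ρ (i + 1) ∈ A.step (ρ i) (w i)) ∧ ∃ᶠ i in atTop, ρ i ∈ A.accept

/-- The language of infinite words accepted by `A`. -/
def language (A : NFA α σ) : Set (ℕ → α) :=
  {w | ∃ ρ, IsAcceptingRun A w ρ}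

/-- Each infinite word has at most one accepting run. -/
def IsUnambiguous (A : NFA α σ) : Prop :=
  ∀ w ρ ρ', IsAcceptingRun A w ρ → IsAcceptingRun A w ρ' → ρ = ρ'

end Buchi

/-! ### A random access machine with logarithmic cost

A program works on integer registers `reg r` and integer arrays `arr a`, indexed by natural
numbers; it mentions only finitely many registers and arrays by name. Cells of an array are
addressed indirectly, through computed values. Each operation is charged for the binary length
of the integers that it handles, including addresses. -/

namespace RAM

/-- Length of an integer in binary, with one more symbol for its sign. -/
def len (x : ℤ) : ℕ := x.natAbs.size + 1

/-- Memory of the machine. -/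
structure State where
  reg : ℕ → ℤ
  arr : ℕ → ℕ → ℤ

/-- Arithmetical operations. -/
inductive Op
  | add
  | sub
  | mul
  | div

/-- Integer arithmetic; `div` is division with remainder (with `x / 0 = 0`). -/
def Op.eval : Op → ℤ → ℤ → ℤ
  | .add, x, y => x + y
  | .sub, x, y => x - y
  | .mul, x, y => x * y
  | .div, x, y => x / y

/-- Expressions: constants, registers, array cells, arithmetical operations. -/
inductive Expr
  | const (c : ℤ)
  | reg (r : ℕ)
  | get (a : ℕ) (i : Expr)
  | op (o : Op) (e f : Expr)

/-- The value of an expression. A negative index is read as `0`. -/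
def Expr.eval (s : State) : Expr → ℤ
  | .const c => c
  | .reg r => s.reg r
  | .get a i => s.arr a (i.eval s).toNat
  | .op o e f => o.eval (e.eval s) (f.eval s)

/-- The cost of evaluating an expression. An arithmetical operation on `x` and `y` costs
`len x * len y` bit operations. -/
def Expr.cost (s : State) : Expr → ℕ
  | .const c => len c
  | .reg r => len (s.reg r)
  | .get a i => i.cost s + len (i.eval s) + len (s.arr a (i.eval s).toNat)
  | .op _ e f => e.cost s + f.cost s + len (e.eval s) * len (f.eval s)

/-- Programs. -/
inductive Program
  | assign (r : ℕ) (e : Expr)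
  | put (a : ℕ) (i e : Expr)
  | seq (c d : Program)
  | cond (e : Expr) (c d : Program)
  | loop (e : Expr) (c : Program)

/-- Store a value in a register. -/
def State.setReg (s : State) (r : ℕ) (x : ℤ) : State :=
  { s with reg := Function.update s.reg r x }

/-- Store a value in a cell of an array. -/
def State.setArr (s : State) (a k : ℕ) (x : ℤ) : State :=
  { s with arr := Function.update s.arr a (Function.update (s.arr a) k x) }

/-- `Exec c s s' t`: the program `c`, started in memory `s`, halts in memory `s'` at total
cost `t`. Conditionals and loops test whether an expression is positive. -/
inductive Exec : Program → State → State → ℕ → Prop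
  | assign (r : ℕ) (e : Expr) (s : State) :
      Exec (.assign r e) s (s.setReg r (e.eval s)) (e.cost s + 1)
  | put (a : ℕ) (i e : Expr) (s : State) :
      Exec (.put a i e) s (s.setArr a (i.eval s).toNat (e.eval s)) (i.cost s + e.cost s + 1)
  | seq {c d : Program} {s s' s'' : State} {t t' : ℕ} :
      Exec c s s' t → Exec d s' s'' t' → Exec (.seq c d) s s'' (t + t')
  | cond_true {e : Expr} {c d : Program} {s s' : State} {t : ℕ} :
      0 < e.eval s → Exec c s s' t → Exec (.cond e c d) s s' (e.cost s + 1 + t)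
  | cond_false {e : Expr} {c d : Program} {s s' : State} {t : ℕ} :
      ¬ 0 < e.eval s → Exec d s s' t → Exec (.cond e c d) s s' (e.cost s + 1 + t)
  | loop_true {e : Expr} {c : Program} {s s' s'' : State} {t t' : ℕ} :
      0 < e.eval s → Exec c s s' t → Exec (.loop e c) s' s'' t' →
        Exec (.loop e c) s s'' (e.cost s + 1 + t + t')
  | loop_false {e : Expr} {c : Program} {s : State} :
      ¬ 0 < e.eval s → Exec (.loop e c) s s (e.cost s + 1)

/-- The memory at the start: the input is stored in array `0`, everything else is `0`. -/
def start (input : List ℤ) : State where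
  reg := fun _ => 0
  arr := fun a i => if a = 0 then input.getD i 0 else 0

/-- The length of a list of integers, encoded in binary. -/
def inputLength (input : List ℤ) : ℕ := (input.map len).sum

end RAM

/-! ### Representation of the inputs as lists of integers -/

/-- A rational number is represented by its numerator and its denominator. -/
def encodeRat (q : ℚ) : List ℤ := [q.num, (q.den : ℤ)]

open Classical in
/-- A truth value is represented by `1` or `0`. -/
noncomputable def encodeProp (p : Prop) : List ℤ := if p then [1] else [0]

/-- A Markov chain is represented by the number of its states, its initial distribution and its
transition matrix, row by row. -/
def MarkovChain.encode {n : ℕ} (M : MarkovChain n) : List ℤ :=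
  (n : ℤ) :: ((List.finRange n).flatMap fun s => encodeRat (M.π s)) ++
    (List.finRange n).flatMap fun s => (List.finRange n).flatMap fun t => encodeRat (M.P s t)

/-- An automaton is represented by the numbers of its letters and of its states, the tables of its
initial and of its accepting states, and the table of its transitions `q' ∈ δ (q, a)`. -/
noncomputable def Buchi.encode {n m : ℕ} (A : NFA (Fin n) (Fin m)) : List ℤ :=
  [(n : ℤ), (m : ℤ)] ++ ((List.finRange m).flatMap fun q => encodeProp (q ∈ A.start)) ++
    ((List.finRange m).flatMap fun q => encodeProp (q ∈ A.accept)) ++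
    (List.finRange m).flatMap fun q => (List.finRange n).flatMap fun a =>
      (List.finRange m).flatMap fun q' => encodeProp (q' ∈ A.step q a)

set_option linter.unusedSectionVars false

/-! ### The law of the trajectory: dependence on the first state -/

/-! On the product of chain and automaton, put `B (q, s) (q', t) = P s t` if `q'` is a successor of
`q` under `s`, and `0` otherwise. Unambiguity makes the languages of the successors disjoint on the
words read, so at reachable states the acceptance probabilities `x` satisfy `x = B x`
(`acceptProb_eq_mulVec`), and the wanted number is the product of the initial weights with `x`. But
`B` may have many fixed points; both the support and the scaling of `x` have to be found.

Everything rests on a bound for powers. Two runs between the same states over the same letters can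
be continued by one accepting run, which would contradict unambiguity. So the entries of `B ^ k`
from unambiguous states to states with nonempty language are at most one, and the same holds for the
product with two copies of the automaton (`productMatrix_pow_le_one`, `pairMatrix_pow_le_one`). For
a power-bounded matrix the space is the sum of the kernel and the range of `1 - B`
(`Matrix.exists_fixed_add_sub`). Hence the Cesàro limit `u` of `B ^ k b` is found by solving `B u =
u`, `u + (g - B g) = b`, even if the powers do not converge.

Support. Keep only the edges on closed walks through accepting states, and let `u` be the Cesàro
limit for the vector `1`. Then `x` is positive exactly at the states that reach the support of `u`
(`acceptProb_pos_iff`). On the one hand, `x` cut off to a bottom component of the positive states is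
a subsolution bounded by one, hence at most `u`. On the other hand, `u i > 0` bounds from below the
probability that arbitrarily long runs along the kept edges exist; König's lemma turns these into
infinite runs, and by a maximum principle almost surely no such run avoids the accepting states from
some time on.

Scaling. Let `v` be a fixed point of `B` restricted to the live states, those that are reachable and
reach the support of `u`. Let `V_k` and `X_k` be the sums of `v` and `x` over the ends of the runs
on a random prefix of length `k + 1`. Then `X_k` is the conditional probability of acceptance
(`condExp_language`), so by Lévy's theorem it tends to the indicator of the language. As `|v| ≤ C
x`, also `|V_k| ≤ C X_k`, and `E[X_k V_k] - E[V_k]` tends to zero (`tendsto_integral_mul_sub`). Here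
`E[V_k]` is constant in `k`, and `E[X_k V_k]` is given by powers of the matrix of pairs. If `c` is
the projection of the initial weights of pairs to the left fixed points of that matrix, it follows
that `c` paired with `x ⊗ v` is the product of the initial weights with `v` (`dotProduct_pairVec`).
The bilinear form of `c` can be computed without knowing `x`. Requiring `B v = v` and that the form
applied to `v` equal the initial weights up to the range of `1 - Bᵀ` gives a linear system. It is
solved by `x` (`exists_isAcceptSolution`), and pairing it with `x` shows that every solution yields
the right probability (`IsAcceptSolution.trajectoryLaw_real_language`). No uniqueness is needed.

Complexity. Reachability, too, is read off from a linear system, as the support of a resolvent. All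
systems are solved by fraction-free Gauss–Jordan elimination, in which each entry is a determinant
built from columns of the input (`Matrix.IsTableau.apply_eq_det`, `Matrix.IsTableau.pivot`), so that
integers keep polynomial length. The relation `RAM.Runs` combines correctness with polynomial bounds
for cost and lengths, and is closed under the constructions of programs that are used. -/

/-- Prepend a letter to an infinite word. -/
def consWord {α : Type*} (a : α) (w : ℕ → α) : ℕ → α
  | 0 => a
  | i + 1 => w i

@[simp] lemma consWord_zero {α : Type*} (a : α) (w : ℕ → α) : consWord a w 0 = a := rfl

@[simp] lemma consWord_succ {α : Type*} (a : α) (w : ℕ → α) (i : ℕ) :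
    consWord a w (i + 1) = w i := rfl

/-- Forget the first letter of an infinite word. -/
def tailWord {α : Type*} (w : ℕ → α) : ℕ → α := fun i => w (i + 1)

@[simp] lemma tailWord_apply {α : Type*} (w : ℕ → α) (i : ℕ) : tailWord w i = w (i + 1) := rfl

@[simp] lemma tailWord_consWord {α : Type*} (a : α) (w : ℕ → α) : tailWord (consWord a w) = w := rfl

lemma measurable_consWord {n : ℕ} (a : Fin n) : Measurable (consWord a) := by
  rw [measurable_pi_iff]
  rintro (_ | i)
  · exact measurable_const
  · exact measurable_pi_apply i

lemma measurable_tailWord {n : ℕ} : Measurable (tailWord : (ℕ → Fin n) → _) :=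
  measurable_pi_iff.2 fun i => measurable_pi_apply (i + 1)

/-- By Lusin–Souslin, an injective measurable map between standard Borel spaces is an embedding.
Therefore the first-step formula `law_apply` holds for arbitrary sets of words, and the union bounds
over runs need no measurability. -/
lemma measurableEmbedding_consWord {n : ℕ} (a : Fin n) : MeasurableEmbedding (consWord a) :=
  (measurable_consWord a).measurableEmbedding fun _ _ h => congrArg tailWord h

namespace MarkovChain

variable {n : ℕ}

instance (M : MarkovChain n) : IsProbabilityMeasure M.initialLaw :=
  PMF.toMeasure.isProbabilityMeasure _

instance (M : MarkovChain n) : IsProbabilityMeasure M.trajectoryLaw := by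
  unfold trajectoryLaw; infer_instance

lemma initialLaw_singleton (M : MarkovChain n) (s : Fin n) :
    M.initialLaw {s} = ENNReal.ofReal (M.π s) := by
  rw [initialLaw, PMF.toMeasure_apply_singleton _ _ (measurableSet_singleton _)]
  rfl

lemma stepLaw_singleton (M : MarkovChain n) (s t : Fin n) :
    M.stepLaw s {t} = ENNReal.ofReal (M.P s t) := by
  rw [stepLaw, PMF.toMeasure_apply_singleton _ _ (measurableSet_singleton _)]
  rfl

/-- Weight of the prefix of length `k + 1` of a word. -/
noncomputable def prefixWeight (M : MarkovChain n) (k : ℕ) (v : ℕ → Fin n) : ℝ :=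
  M.π (v 0) * ∏ i ∈ Finset.range k, (M.P (v i) (v (i + 1)) : ℝ)

lemma trajectoryLaw_map_zero (M : MarkovChain n) :
    M.trajectoryLaw.map (Preorder.frestrictLe (π := fun _ => Fin n) 0) =
      M.initialLaw.map (MeasurableEquiv.piUnique (fun _ : Finset.Iic 0 => Fin n)).symm := by
  have e := Kernel.traj_map_frestrictLe (X := fun _ => Fin n) (κ := M.historyKernel) 0 0
  rw [Kernel.partialTraj_self] at e
  rw [trajectoryLaw, Kernel.trajMeasure, Measure.map_comp _ _ (by fun_prop), e]
  exact Measure.id_comp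

/-- Each further state contributes one composition with the history kernel, which sees only the last
state; hence one factor `P` per step. -/
lemma trajectoryLaw_map_singleton (M : MarkovChain n) (k : ℕ) (v : ℕ → Fin n) :
    M.trajectoryLaw.map (Preorder.frestrictLe (π := fun _ => Fin n) k)
      {Preorder.frestrictLe (π := fun _ => Fin n) k v} = ENNReal.ofReal (M.prefixWeight k v) := by
  induction k with
  | zero =>
    rw [trajectoryLaw_map_zero, Measure.map_apply (MeasurableEquiv.measurable _)
      (measurableSet_singleton _)]
    have : (⇑(MeasurableEquiv.piUnique (fun _ : Finset.Iic 0 => Fin n)).symm ⁻¹'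
        {Preorder.frestrictLe (π := fun _ => Fin n) 0 v}) = {v 0} := by
      ext x
      simp only [Set.mem_preimage, Set.mem_singleton_iff]
      rw [MeasurableEquiv.symm_apply_eq]
      rfl
    rw [this, initialLaw_singleton]
    simp [prefixWeight]
  | succ k ih =>
    have h := Kernel.map_frestrictLe_trajMeasure_compProd_eq_map_trajMeasure
      (X := fun _ => Fin n) (μ₀ := M.initialLaw) (κ := M.historyKernel) (a := k)
    change M.trajectoryLaw.map _ ⊗ₘ _ = M.trajectoryLaw.map _ at h
    have h2 := congrArg (fun μ => μ ({Preorder.frestrictLe (π := fun _ => Fin n) k v} ×ˢ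
      {v (k + 1)})) h
    rw [Measure.compProd_apply_prod (measurableSet_singleton _) (measurableSet_singleton _),
      lintegral_singleton, ih, Measure.map_apply
        ((Preorder.measurable_frestrictLe k).prodMk (measurable_pi_apply _))
        ((measurableSet_singleton _).prod (measurableSet_singleton _))] at h2
    rw [Measure.map_apply (Preorder.measurable_frestrictLe _) (measurableSet_singleton _)]
    have hs : (Preorder.frestrictLe (π := fun _ => Fin n) (k + 1) ⁻¹'
        {Preorder.frestrictLe (π := fun _ => Fin n) (k + 1) v}) =
        ((fun x : ℕ → Fin n => (Preorder.frestrictLe (π := fun _ => Fin n) k x, x (k + 1))) ⁻¹'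
          ({Preorder.frestrictLe (π := fun _ => Fin n) k v} ×ˢ {v (k + 1)})) := by
      ext x
      simp only [Set.mem_preimage, Set.mem_singleton_iff, Set.mem_prod]
      constructor
      · intro h
        refine ⟨?_, ?_⟩
        · funext i
          exact congrFun h ⟨i.1, Finset.mem_Iic.2 (le_trans (Finset.mem_Iic.1 i.2) (Nat.le_succ k))⟩
        · exact congrFun h ⟨k + 1, Finset.mem_Iic.2 le_rfl⟩
      · rintro ⟨h1, h2⟩
        funext ⟨i, hi⟩
        rcases Nat.le_succ_iff.1 (Finset.mem_Iic.1 hi) with hi' | hi'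
        · exact congrFun h1 ⟨i, Finset.mem_Iic.2 hi'⟩
        · subst hi'; exact h2
    rw [hs, ← h2]
    have hk : (M.historyKernel k) (Preorder.frestrictLe (π := fun _ => Fin n) k v) {v (k + 1)} =
        ENNReal.ofReal (M.P (v k) (v (k + 1))) := stepLaw_singleton _ _ _
    rw [hk, ← ENNReal.ofReal_mul (by exact_mod_cast M.P_nonneg _ _)]
    congr 1
    rw [prefixWeight, prefixWeight, Finset.prod_range_succ]
    ring

/-- A finite measure on infinite words is determined by the weights of the prefixes. -/
lemma ext_of_prefixes {μ ν : Measure (ℕ → Fin n)} [IsFiniteMeasure μ] [IsFiniteMeasure ν]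
    (h : ∀ k v, μ.map (Preorder.frestrictLe (π := fun _ => Fin n) k)
        {Preorder.frestrictLe (π := fun _ => Fin n) k v} =
      ν.map (Preorder.frestrictLe (π := fun _ => Fin n) k)
        {Preorder.frestrictLe (π := fun _ => Fin n) k v}) : μ = ν := by
  have hm : ∀ k, μ.map (Preorder.frestrictLe (π := fun _ => Fin n) k) =
      ν.map (Preorder.frestrictLe (π := fun _ => Fin n) k) := by
    intro k
    refine Measure.ext_of_singleton fun x => ?_
    have hx : ∃ v : ℕ → Fin n, Preorder.frestrictLe (π := fun _ => Fin n) k v = x := by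
      refine ⟨fun i => if hi : i ≤ k then x ⟨i, Finset.mem_Iic.2 hi⟩
        else x ⟨0, Finset.mem_Iic.2 (Nat.zero_le k)⟩, ?_⟩
      funext i
      have := Finset.mem_Iic.1 i.2
      simp [Preorder.frestrictLe_apply, this]
    obtain ⟨v, rfl⟩ := hx
    exact h k v
  -- Both measures are projective limits of the marginals of `μ`, since every finite set of times
  -- lies in an initial segment.
  let Q : (I : Finset ℕ) → Measure (I → Fin n) := fun I => μ.map I.restrict
  have hμ : IsProjectiveLimit μ Q := fun I => rfl
  have hν : IsProjectiveLimit ν Q := by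
    intro I
    have hI := I.subset_Iic_sup_id
    have e1 : ∀ ρ : Measure (ℕ → Fin n), ρ.map I.restrict =
        (ρ.map (Preorder.frestrictLe (π := fun _ => Fin n) (I.sup id))).map
          (Finset.restrict₂ (π := fun _ => Fin n) hI) := by
      intro ρ
      rw [Measure.map_map (Finset.measurable_restrict₂ _) (Preorder.measurable_frestrictLe _)]
      rfl
    rw [e1 ν, ← hm, ← e1]
  have : ∀ I, IsFiniteMeasure (Q I) := fun I => by
    simp only [Q]; infer_instance
  exact hμ.unique hν

/-- The chain with the same transition probabilities, started in a given state. -/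
def startingAt (M : MarkovChain n) (s : Fin n) : MarkovChain n where
  P := M.P
  π := Pi.single s 1
  P_nonneg := M.P_nonneg
  P_sum := M.P_sum
  π_nonneg t := by
    by_cases h : t = s
    · subst h; simp
    · simp [h]
  π_sum := by simp

/-- The law of the trajectory started in the state `s`. -/
noncomputable def law (M : MarkovChain n) (s : Fin n) : Measure (ℕ → Fin n) :=
  (M.startingAt s).trajectoryLaw

instance (M : MarkovChain n) (s : Fin n) : IsProbabilityMeasure (M.law s) := by
  unfold law; infer_instance

lemma sum_ofReal_P (M : MarkovChain n) (s : Fin n) : ∑ t, ENNReal.ofReal (M.P s t) = 1 := by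
  rw [← ENNReal.ofReal_sum_of_nonneg (fun t _ => by exact_mod_cast M.P_nonneg s t)]
  have h : ∑ t, (M.P s t : ℝ) = 1 := by exact_mod_cast M.P_sum s
  rw [h, ENNReal.ofReal_one]

lemma frestrictLe_eq_iff (k : ℕ) (v w : ℕ → Fin n) :
    Preorder.frestrictLe (π := fun _ => Fin n) k w = Preorder.frestrictLe (π := fun _ => Fin n) k v ↔
      ∀ i ≤ k, w i = v i := by
  constructor
  · intro h i hi
    exact congrFun h ⟨i, Finset.mem_Iic.2 hi⟩
  · intro h
    funext i
    exact h i.1 (Finset.mem_Iic.1 i.2)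

lemma sum_smul_isFiniteMeasure {ι : Type*} [Fintype ι] (c : ι → ℝ) (μ : ι → Measure (ℕ → Fin n))
    [∀ i, IsFiniteMeasure (μ i)] :
    IsFiniteMeasure (∑ i, ENNReal.ofReal (c i) • μ i) := by
  refine ⟨?_⟩
  simp only [Measure.coe_finsetSum, Measure.coe_smul, Finset.sum_apply, Pi.smul_apply, smul_eq_mul]
  exact ENNReal.sum_lt_top.2 fun i _ => ENNReal.mul_lt_top ENNReal.ofReal_lt_top (measure_lt_top _ _)

lemma map_singleton (μ : Measure (ℕ → Fin n)) (k : ℕ) (v : ℕ → Fin n) :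
    μ.map (Preorder.frestrictLe (π := fun _ => Fin n) k)
        {Preorder.frestrictLe (π := fun _ => Fin n) k v} = μ {w | ∀ i ≤ k, w i = v i} := by
  rw [Measure.map_apply (Preorder.measurable_frestrictLe _) (measurableSet_singleton _)]
  congr 1
  ext w
  exact frestrictLe_eq_iff k v w

lemma law_prefix (M : MarkovChain n) (s : Fin n) (k : ℕ) (v : ℕ → Fin n) :
    M.law s {w | ∀ i ≤ k, w i = v i} = ENNReal.ofReal
      ((if v 0 = s then 1 else 0) * ∏ i ∈ Finset.range k, (M.P (v i) (v (i + 1)) : ℝ)) := by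
  rw [law, ← map_singleton, trajectoryLaw_map_singleton]
  congr 2
  simp only [prefixWeight, startingAt, Pi.single_apply]
  split_ifs <;> simp

theorem trajectoryLaw_eq_sum (M : MarkovChain n) :
    M.trajectoryLaw = ∑ s, ENNReal.ofReal (M.π s) • M.law s := by
  have := sum_smul_isFiniteMeasure (fun s => (M.π s : ℝ)) M.law
  refine ext_of_prefixes fun k v => ?_
  rw [trajectoryLaw_map_singleton, map_singleton]
  simp only [Measure.coe_finsetSum, Measure.coe_smul, Finset.sum_apply, Pi.smul_apply, smul_eq_mul,
    law_prefix]
  rw [Finset.sum_eq_single (v 0)]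
  · rw [← ENNReal.ofReal_mul (by exact_mod_cast M.π_nonneg _)]
    simp [prefixWeight]
  · intro s _ hs
    simp [hs.symm]
  · simp

/-- The Markov property at time one, checked on prefix weights. All recursions over the first letter
come from it. -/
theorem law_eq_sum (M : MarkovChain n) (s : Fin n) :
    M.law s = ∑ t, ENNReal.ofReal (M.P s t) • (M.law t).map (consWord s) := by
  have := fun t => Measure.isFiniteMeasure_map (M.law t) (consWord s)
  have := sum_smul_isFiniteMeasure (fun t => (M.P s t : ℝ)) (fun t => (M.law t).map (consWord s))
  refine ext_of_prefixes fun k v => ?_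
  rw [map_singleton, map_singleton, law_prefix]
  simp only [Measure.coe_finsetSum, Measure.coe_smul, Finset.sum_apply, Pi.smul_apply, smul_eq_mul,
    (measurableEmbedding_consWord s).map_apply]
  have hpre : (consWord s ⁻¹' {w : ℕ → Fin n | ∀ i ≤ k, w i = v i}) =
      {w | v 0 = s ∧ ∀ i < k, w i = v (i + 1)} := by
    ext w
    simp only [Set.mem_preimage, Set.mem_ofPred_eq]
    constructor
    · intro h
      exact ⟨(h 0 (Nat.zero_le k)).symm, fun i hi => h (i + 1) hi⟩
    · rintro ⟨h0, h⟩ (_ | i) hi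
      · exact h0.symm
      · exact h i hi
  rw [hpre]
  by_cases hv : v 0 = s
  · cases k with
    | zero => simp [hv, sum_ofReal_P]
    | succ k =>
      have : {w : ℕ → Fin n | v 0 = s ∧ ∀ i < k + 1, w i = v (i + 1)} =
          {w | ∀ i ≤ k, w i = tailWord v i} := by
        ext w
        simp [hv]
      simp only [this, law_prefix]
      rw [Finset.sum_eq_single (v 1)]
      · rw [← ENNReal.ofReal_mul (by exact_mod_cast M.P_nonneg _ _), Finset.prod_range_succ']
        simp [hv, mul_comm]
      · intro t _ ht
        simp [ht.symm]
      · simp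
  · simp [hv]

lemma law_apply (M : MarkovChain n) (s : Fin n) (A : Set (ℕ → Fin n)) :
    M.law s A = ∑ t, ENNReal.ofReal (M.P s t) * M.law t (consWord s ⁻¹' A) := by
  conv_lhs => rw [law_eq_sum]
  simp only [Measure.coe_finsetSum, Measure.coe_smul, Finset.sum_apply, Pi.smul_apply, smul_eq_mul,
    (measurableEmbedding_consWord s).map_apply]

lemma law_real (M : MarkovChain n) (s : Fin n) (A : Set (ℕ → Fin n)) :
    (M.law s).real A = ∑ t, (M.P s t : ℝ) * (M.law t).real (consWord s ⁻¹' A) := by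
  rw [measureReal_def, law_apply, ENNReal.toReal_sum
    (fun t _ => ENNReal.mul_ne_top ENNReal.ofReal_ne_top (measure_ne_top _ _))]
  refine Finset.sum_congr rfl fun t _ => ?_
  rw [ENNReal.toReal_mul, ENNReal.toReal_ofReal (by exact_mod_cast M.P_nonneg _ _), measureReal_def]

lemma integrable_of_bounded {μ : Measure (ℕ → Fin n)} [IsFiniteMeasure μ] {f : (ℕ → Fin n) → ℝ}
    (hf : Measurable f) {C : ℝ} (hC : ∀ w, |f w| ≤ C) : Integrable f μ :=
  Integrable.of_bound hf.aestronglyMeasurable C (ae_of_all _ hC)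

lemma law_integral (M : MarkovChain n) (s : Fin n) {f : (ℕ → Fin n) → ℝ} (hf : Measurable f)
    {C : ℝ} (hC : ∀ w, |f w| ≤ C) :
    ∫ w, f w ∂M.law s = ∑ t, (M.P s t : ℝ) * ∫ w, f (consWord s w) ∂M.law t := by
  have := fun t => Measure.isFiniteMeasure_map (M.law t) (consWord s)
  conv_lhs => rw [law_eq_sum]
  rw [integral_finsetSum_measure
    (fun t _ => (integrable_of_bounded hf hC).smul_measure ENNReal.ofReal_ne_top)]
  refine Finset.sum_congr rfl fun t _ => ?_
  rw [integral_smul_measure, ENNReal.toReal_ofReal (by exact_mod_cast M.P_nonneg _ _),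
    (measurableEmbedding_consWord s).integral_map, smul_eq_mul]

lemma trajectoryLaw_integral (M : MarkovChain n) {f : (ℕ → Fin n) → ℝ} (hf : Measurable f)
    {C : ℝ} (hC : ∀ w, |f w| ≤ C) :
    ∫ w, f w ∂M.trajectoryLaw = ∑ s, (M.π s : ℝ) * ∫ w, f w ∂M.law s := by
  rw [trajectoryLaw_eq_sum, integral_finsetSum_measure
    (fun t _ => (integrable_of_bounded hf hC).smul_measure ENNReal.ofReal_ne_top)]
  refine Finset.sum_congr rfl fun t _ => ?_
  rw [integral_smul_measure, ENNReal.toReal_ofReal (by exact_mod_cast M.π_nonneg _), smul_eq_mul]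

lemma ae_law_zero (M : MarkovChain n) (s : Fin n) : ∀ᵐ w ∂M.law s, w 0 = s := by
  rw [ae_iff, law_apply]
  simp

end MarkovChain

namespace Buchi

/-! ### Runs from a given state -/

section Runs

variable {α σ : Type} (A : NFA α σ)

/-- `ρ` is an accepting run on `w` that starts in the state `q`. -/
def AcceptingFrom (q : σ) (w : ℕ → α) (ρ : ℕ → σ) : Prop :=
  ρ 0 = q ∧ (∀ i, ρ (i + 1) ∈ A.step (ρ i) (w i)) ∧ ∃ᶠ i in atTop, ρ i ∈ A.accept

/-- The infinite words with an accepting run from `q`. -/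
def langFrom (q : σ) : Set (ℕ → α) := {w | ∃ ρ, AcceptingFrom A q w ρ}

/-- Each infinite word has at most one accepting run from `q`. -/
def UnambFrom (q : σ) : Prop :=
  ∀ w ρ ρ', AcceptingFrom A q w ρ → AcceptingFrom A q w ρ' → ρ = ρ'

variable {A}

lemma frequently_tailWord {β : Type*} (ρ : ℕ → β) (S : Set β) :
    (∃ᶠ i in atTop, tailWord ρ i ∈ S) ↔ ∃ᶠ i in atTop, ρ i ∈ S := by
  simp only [frequently_atTop, tailWord_apply]
  constructor
  · intro h a
    obtain ⟨b, hb, hS⟩ := h a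
    exact ⟨b + 1, by omega, hS⟩
  · intro h a
    obtain ⟨b, hb, hS⟩ := h (a + 1)
    refine ⟨b - 1, by omega, ?_⟩
    rwa [Nat.sub_add_cancel (by omega)]

lemma AcceptingFrom.tail {q : σ} {w : ℕ → α} {ρ : ℕ → σ} (h : AcceptingFrom A q w ρ) :
    AcceptingFrom A (ρ 1) (tailWord w) (tailWord ρ) :=
  ⟨rfl, fun i => h.2.1 (i + 1), (frequently_tailWord ρ _).2 h.2.2⟩

lemma AcceptingFrom.cons {q q' : σ} {w : ℕ → α} {ρ : ℕ → σ} (hq : q' ∈ A.step q (w 0))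
    (h : AcceptingFrom A q' (tailWord w) ρ) : AcceptingFrom A q w (consWord q ρ) := by
  refine ⟨rfl, ?_, (frequently_tailWord (consWord q ρ) _).1 h.2.2⟩
  rintro (_ | i)
  · simpa [h.1] using hq
  · exact h.2.1 i

lemma mem_langFrom_iff {q : σ} {w : ℕ → α} :
    w ∈ langFrom A q ↔ ∃ q' ∈ A.step q (w 0), tailWord w ∈ langFrom A q' := by
  constructor
  · rintro ⟨ρ, h⟩
    refine ⟨ρ 1, ?_, _, h.tail⟩
    have := h.2.1 0
    rwa [h.1] at this
  · rintro ⟨q', hq, ρ, h⟩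
    exact ⟨_, h.cons hq⟩

/-- Two accepting runs from `q'` become two accepting runs from `q` on one word by prepending `q`
and the letter `a`. -/
lemma UnambFrom.step {q q' : σ} {a : α} (hu : UnambFrom A q) (hq : q' ∈ A.step q a) :
    UnambFrom A q' := by
  intro w ρ ρ' h h'
  have h1 := AcceptingFrom.cons (w := consWord a w) hq h
  have h2 := AcceptingFrom.cons (w := consWord a w) hq h'
  exact congrArg tailWord (hu _ _ _ h1 h2)

/-- The future of the word selects the successor: an accepted tail extends to an accepting run from
`q` whose second state is prescribed. -/
lemma UnambFrom.eq_of_mem {q q₁ q₂ : σ} {w : ℕ → α} (hu : UnambFrom A q)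
    (h₁ : q₁ ∈ A.step q (w 0)) (h₂ : q₂ ∈ A.step q (w 0)) (hw₁ : tailWord w ∈ langFrom A q₁)
    (hw₂ : tailWord w ∈ langFrom A q₂) : q₁ = q₂ := by
  obtain ⟨ρ₁, hρ₁⟩ := hw₁
  obtain ⟨ρ₂, hρ₂⟩ := hw₂
  have := congrFun (hu _ _ _ (hρ₁.cons h₁) (hρ₂.cons h₂)) 1
  simpa [hρ₁.1, hρ₂.1] using this

lemma isAcceptingRun_iff {w : ℕ → α} {ρ : ℕ → σ} :
    IsAcceptingRun A w ρ ↔ ∃ q ∈ A.start, AcceptingFrom A q w ρ :=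
  ⟨fun h => ⟨ρ 0, h.1, rfl, h.2⟩, fun ⟨_, hq, h⟩ => ⟨h.1 ▸ hq, h.2⟩⟩

lemma mem_language_iff {w : ℕ → α} : w ∈ language A ↔ ∃ q ∈ A.start, w ∈ langFrom A q := by
  constructor
  · rintro ⟨ρ, h⟩
    obtain ⟨q, hq, h⟩ := isAcceptingRun_iff.1 h
    exact ⟨q, hq, ρ, h⟩
  · rintro ⟨q, hq, ρ, h⟩
    exact ⟨ρ, isAcceptingRun_iff.2 ⟨q, hq, h⟩⟩

lemma IsUnambiguous.unambFrom (hA : IsUnambiguous A) {q : σ} (hq : q ∈ A.start) :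
    UnambFrom A q := fun w ρ ρ' h h' =>
  hA w ρ ρ' (isAcceptingRun_iff.2 ⟨q, hq, h⟩) (isAcceptingRun_iff.2 ⟨q, hq, h'⟩)

lemma IsUnambiguous.eq_of_mem (hA : IsUnambiguous A) {q₁ q₂ : σ} {w : ℕ → α}
    (h₁ : q₁ ∈ A.start) (h₂ : q₂ ∈ A.start) (hw₁ : w ∈ langFrom A q₁) (hw₂ : w ∈ langFrom A q₂) :
    q₁ = q₂ := by
  obtain ⟨ρ₁, hρ₁⟩ := hw₁
  obtain ⟨ρ₂, hρ₂⟩ := hw₂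
  have := hA w ρ₁ ρ₂ (isAcceptingRun_iff.2 ⟨q₁, h₁, hρ₁⟩) (isAcceptingRun_iff.2 ⟨q₂, h₂, hρ₂⟩)
  rw [← hρ₁.1, ← hρ₂.1, this]

-- Unambiguity enters as linearity: at most one successor accepts the tail, so the union over the
-- successors is disjoint and the indicators add up.
open Classical in
lemma indicator_langFrom [Fintype σ] {q : σ} (hu : UnambFrom A q) (w : ℕ → α) :
    (langFrom A q).indicator (1 : (ℕ → α) → ℝ) w =
      ∑ q', (if q' ∈ A.step q (w 0) then 1 else 0) *
        (langFrom A q').indicator (1 : (ℕ → α) → ℝ) (tailWord w) := by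
  by_cases hw : w ∈ langFrom A q
  · obtain ⟨q', hq', hw'⟩ := mem_langFrom_iff.1 hw
    rw [Finset.sum_eq_single q']
    · simp [hw, hw', hq']
    · intro q'' _ hne
      by_cases h1 : q'' ∈ A.step q (w 0)
      · have : tailWord w ∉ langFrom A q'' := fun h2 => hne (hu.eq_of_mem h1 hq' h2 hw')
        simp [this]
      · simp [h1]
    · simp
  · rw [Set.indicator_of_notMem hw]
    refine (Finset.sum_eq_zero fun q' _ => ?_).symm
    by_cases h1 : q' ∈ A.step q (w 0)
    · have : tailWord w ∉ langFrom A q' := fun h2 => hw (mem_langFrom_iff.2 ⟨q', h1, h2⟩)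
      simp [this]
    · simp [h1]

open Classical in
lemma indicator_language [Fintype σ] (hA : IsUnambiguous A) (w : ℕ → α) :
    (language A).indicator (1 : (ℕ → α) → ℝ) w =
      ∑ q, (if q ∈ A.start then 1 else 0) * (langFrom A q).indicator (1 : (ℕ → α) → ℝ) w := by
  by_cases hw : w ∈ language A
  · obtain ⟨q', hq', hw'⟩ := mem_language_iff.1 hw
    rw [Finset.sum_eq_single q']
    · simp [hw, hw', hq']
    · intro q'' _ hne
      by_cases h1 : q'' ∈ A.start
      · have : w ∉ langFrom A q'' := fun h2 => hne (hA.eq_of_mem h1 hq' h2 hw')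
        simp [this]
      · simp [h1]
    · simp
  · rw [Set.indicator_of_notMem hw]
    refine (Finset.sum_eq_zero fun q' _ => ?_).symm
    by_cases h1 : q' ∈ A.start
    · have : w ∉ langFrom A q' := fun h2 => hw (mem_language_iff.2 ⟨q', h1, h2⟩)
      simp [this]
    · simp [h1]

end Runs

/-! ### Measurability -/

section Measurability

variable {n m : ℕ} (A : NFA (Fin n) (Fin m))

lemma measurableSet_acceptingFrom (q : Fin m) :
    MeasurableSet {x : (ℕ → Fin n) × (ℕ → Fin m) | AcceptingFrom A q x.1 x.2} := by
  have h1 : MeasurableSet {x : (ℕ → Fin n) × (ℕ → Fin m) | x.2 0 = q} :=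
    (measurableSet_singleton q).preimage ((measurable_pi_apply 0).comp measurable_snd)
  have h2 : ∀ i, MeasurableSet {x : (ℕ → Fin n) × (ℕ → Fin m) |
      x.2 (i + 1) ∈ A.step (x.2 i) (x.1 i)} := by
    intro i
    have hm : Measurable fun x : (ℕ → Fin n) × (ℕ → Fin m) => (x.2 (i + 1), x.2 i, x.1 i) :=
      ((measurable_pi_apply _).comp measurable_snd).prodMk
        (((measurable_pi_apply _).comp measurable_snd).prodMk
          ((measurable_pi_apply _).comp measurable_fst))
    exact hm (Set.toFinite {y : Fin m × Fin m × Fin n | y.1 ∈ A.step y.2.1 y.2.2}).measurableSet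
  have h3 : ∀ i, MeasurableSet {x : (ℕ → Fin n) × (ℕ → Fin m) | x.2 i ∈ A.accept} := fun i =>
    ((measurable_pi_apply i).comp measurable_snd) (Set.toFinite A.accept).measurableSet
  have : {x : (ℕ → Fin n) × (ℕ → Fin m) | AcceptingFrom A q x.1 x.2} =
      {x | x.2 0 = q} ∩ ((⋂ i, {x | x.2 (i + 1) ∈ A.step (x.2 i) (x.1 i)}) ∩
        ⋂ a : ℕ, ⋃ b : ℕ, ⋃ _ : a ≤ b, {x | x.2 b ∈ A.accept}) := by
    ext x
    simp [AcceptingFrom, frequently_atTop]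
  rw [this]
  exact h1.inter ((MeasurableSet.iInter h2).inter
    (MeasurableSet.iInter fun a => MeasurableSet.iUnion fun b => MeasurableSet.iUnion fun _ => h3 b))

/-- The pairs of a word and an accepting run form a Borel set, and unambiguity makes the projection
to the words injective on it; by Lusin–Souslin its image is Borel. No determinization is involved.
-/
lemma UnambFrom.measurableSet_langFrom {A : NFA (Fin n) (Fin m)} {q : Fin m}
    (hu : UnambFrom A q) : MeasurableSet (langFrom A q) := by
  have := (measurableSet_acceptingFrom A q).image_of_measurable_injOn (f := Prod.fst)
    measurable_fst (by
      rintro ⟨w, ρ⟩ h ⟨w', ρ'⟩ h' e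
      obtain rfl : w = w' := e
      exact Prod.ext rfl (hu w ρ ρ' h h'))
  convert this
  ext w
  simp [langFrom]

lemma IsUnambiguous.measurableSet_language {A : NFA (Fin n) (Fin m)} (hA : IsUnambiguous A) :
    MeasurableSet (language A) := by
  have : language A = ⋃ q : Fin m, ⋃ _ : q ∈ A.start, langFrom A q := by
    ext w; simp [mem_language_iff]
  rw [this]
  exact MeasurableSet.iUnion fun q => MeasurableSet.iUnion fun hq =>
    (hA.unambFrom hq).measurableSet_langFrom

end Measurability

end Buchi

/-! ### Sums over the runs on a prefix of a word -/

section RunSum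

variable {n : ℕ} {σ τ : Type} [Fintype σ] [Fintype τ]

/-- The sum over the runs `q = q₀, …, q_k` on a prefix of `w` of the products of the weights
`h (q_i, w_i) (q_{i+1}, w_{i+1})`, times `y (q_k, w_k)`. -/
noncomputable def runSum (h : σ × Fin n → σ × Fin n → ℝ) (y : σ × Fin n → ℝ) :
    ℕ → σ → (ℕ → Fin n) → ℝ
  | 0, q, w => y (q, w 0)
  | k + 1, q, w => ∑ q', h (q, w 0) (q', w 1) * runSum h y k q' (tailWord w)

variable (h : σ × Fin n → σ × Fin n → ℝ) (y : σ × Fin n → ℝ)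

lemma measurable_runSum (k : ℕ) (q : σ) : Measurable (runSum h y k q) := by
  induction k generalizing q with
  | zero => exact (measurable_of_countable fun s => y (q, s)).comp (measurable_pi_apply 0)
  | succ k ih =>
    refine Finset.measurable_sum _ fun q' _ => Measurable.mul ?_ ((ih q').comp measurable_tailWord)
    exact (measurable_of_countable fun x : Fin n × Fin n => h (q, x.1) (q', x.2)).comp
      ((measurable_pi_apply (X := fun _ => Fin n) 0).prodMk (measurable_pi_apply 1))

lemma exists_bound_runSum (k : ℕ) : ∃ C, ∀ q w, |runSum h y k q w| ≤ C := by
  induction k with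
  | zero =>
    refine ⟨∑ i, |y i|, fun q w => ?_⟩
    exact Finset.single_le_sum (f := fun i => |y i|) (fun i _ => abs_nonneg _) (Finset.mem_univ _)
  | succ k ih =>
    obtain ⟨C, hC⟩ := ih
    refine ⟨∑ _q' : σ, (∑ i, ∑ j, |h i j|) * C, fun q w => ?_⟩
    refine (Finset.abs_sum_le_sum_abs _ _).trans (Finset.sum_le_sum fun q' _ => ?_)
    rw [abs_mul]
    refine mul_le_mul ?_ (hC _ _) (abs_nonneg _)
      (Finset.sum_nonneg fun i _ => Finset.sum_nonneg fun j _ => abs_nonneg _)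
    exact (Finset.single_le_sum (f := fun j => |h (q, w 0) j|) (fun i _ => abs_nonneg _)
      (Finset.mem_univ (q', w 1))).trans (Finset.single_le_sum (f := fun i => ∑ j, |h i j|)
      (fun i _ => Finset.sum_nonneg fun j _ => abs_nonneg _) (Finset.mem_univ _))

lemma runSum_congr (k : ℕ) (q : σ) {w w' : ℕ → Fin n} (hw : ∀ i ≤ k, w i = w' i) :
    runSum h y k q w = runSum h y k q w' := by
  induction k generalizing q w w' with
  | zero => simp [runSum, hw]
  | succ k ih =>
    simp only [runSum, hw 0 (Nat.zero_le _), hw 1 (by omega)]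
    refine Finset.sum_congr rfl fun q' _ => ?_
    rw [ih q' (w := tailWord w) (w' := tailWord w') fun i hi => hw (i + 1) (by omega)]

variable {h y} in
lemma runSum_nonneg (hh : ∀ i j, 0 ≤ h i j) (hy : ∀ i, 0 ≤ y i) (k : ℕ) (q : σ) (w : ℕ → Fin n) :
    0 ≤ runSum h y k q w := by
  induction k generalizing q w with
  | zero => exact hy _
  | succ k ih => exact Finset.sum_nonneg fun q' _ => mul_nonneg (hh _ _) (ih _ _)

variable {h y} in
lemma abs_runSum_le (hh : ∀ i j, 0 ≤ h i j) {z : σ × Fin n → ℝ} (hyz : ∀ i, |y i| ≤ z i) (k : ℕ)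
    (q : σ) (w : ℕ → Fin n) : |runSum h y k q w| ≤ runSum h z k q w := by
  induction k generalizing q w with
  | zero => exact hyz _
  | succ k ih =>
    refine (Finset.abs_sum_le_sum_abs _ _).trans (Finset.sum_le_sum fun q' _ => ?_)
    rw [abs_mul, abs_of_nonneg (hh _ _)]
    exact mul_le_mul_of_nonneg_left (ih _ _) (hh _ _)

lemma runSum_smul (c : ℝ) (k : ℕ) (q : σ) (w : ℕ → Fin n) :
    runSum h (fun i => c * y i) k q w = c * runSum h y k q w := by
  induction k generalizing q w with
  | zero => rfl
  | succ k ih =>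
    simp only [runSum, ih, Finset.mul_sum]
    exact Finset.sum_congr rfl fun q' _ => by ring

lemma runSum_sum {ι : Type*} (s : Finset ι) (y : ι → σ × Fin n → ℝ) (k : ℕ) (q : σ)
    (w : ℕ → Fin n) :
    runSum h (fun i => ∑ a ∈ s, y a i) k q w = ∑ a ∈ s, runSum h (y a) k q w := by
  induction k generalizing q w with
  | zero => rfl
  | succ k ih =>
    simp only [runSum, ih, Finset.mul_sum]
    rw [Finset.sum_comm]

/-- Weights of pairs of runs. -/
def pairWeight (h : σ × Fin n → σ × Fin n → ℝ) (h' : τ × Fin n → τ × Fin n → ℝ) :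
    (σ × τ) × Fin n → (σ × τ) × Fin n → ℝ :=
  fun i j => h (i.1.1, i.2) (j.1.1, j.2) * h' (i.1.2, i.2) (j.1.2, j.2)

/-- Product of two vectors, along the last component. -/
def pairVec (y : σ × Fin n → ℝ) (y' : τ × Fin n → ℝ) : (σ × τ) × Fin n → ℝ :=
  fun i => y (i.1.1, i.2) * y' (i.1.2, i.2)

/-- Both runs read the same letters, so a product of two run sums is one run sum over pairs. This
makes second moments accessible to powers of a matrix. -/
lemma runSum_pair (h' : τ × Fin n → τ × Fin n → ℝ) (y' : τ × Fin n → ℝ) (k : ℕ) (q : σ) (q' : τ)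
    (w : ℕ → Fin n) :
    runSum (pairWeight h h') (pairVec y y') k (q, q') w =
      runSum h y k q w * runSum h' y' k q' w := by
  induction k generalizing q q' w with
  | zero => rfl
  | succ k ih =>
    simp only [runSum, Fintype.sum_prod_type, ih, Finset.sum_mul_sum]
    refine Finset.sum_congr rfl fun r _ => Finset.sum_congr rfl fun r' _ => ?_
    simp only [pairWeight]
    ring

namespace MarkovChain

variable (M : MarkovChain n)

/-- The matrix of the weights `h`, multiplied by the transition probabilities. -/
def weightMatrix (h : σ × Fin n → σ × Fin n → ℝ) : Matrix (σ × Fin n) (σ × Fin n) ℝ :=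
  fun i j => M.P i.2 j.2 * h i j

variable [DecidableEq σ]

/-- Averaging over the next state supplies the transition probability and the run sum supplies the
weight `h`, so the first-step decomposition is multiplication by the matrix. -/
lemma integral_runSum (k : ℕ) (q : σ) (s : Fin n) :
    ∫ w, runSum h y k q w ∂M.law s = ((M.weightMatrix h ^ k).mulVec y) (q, s) := by
  induction k generalizing q s with
  | zero =>
    rw [pow_zero, Matrix.one_mulVec]
    rw [integral_congr_ae (g := fun _ => y (q, s))]
    · simp
    · filter_upwards [M.ae_law_zero s] with w hw
      simp [runSum, hw]
  | succ k ih =>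
    obtain ⟨C, hC⟩ := exists_bound_runSum h y (k + 1)
    obtain ⟨C', hC'⟩ := exists_bound_runSum h y k
    rw [M.law_integral s (measurable_runSum h y _ q) (hC q), pow_succ', ← Matrix.mulVec_mulVec]
    simp only [Matrix.mulVec, dotProduct, Fintype.sum_prod_type]
    rw [Finset.sum_comm]
    refine Finset.sum_congr rfl fun t _ => ?_
    have : ∀ᵐ w ∂M.law t, runSum h y (k + 1) q (consWord s w) =
        ∑ q', h (q, s) (q', t) * runSum h y k q' w := by
      filter_upwards [M.ae_law_zero t] with w hw
      simp [runSum, hw]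
    rw [integral_congr_ae this, integral_finsetSum _ fun q' _ =>
      (integrable_of_bounded (measurable_runSum h y k q') (hC' q')).const_mul _, Finset.mul_sum]
    refine Finset.sum_congr rfl fun q' _ => ?_
    rw [integral_const_mul, ih]
    simp only [Matrix.mulVec, dotProduct, Fintype.sum_prod_type, weightMatrix]
    ring

end MarkovChain

end RunSum

/-! ### Power-bounded matrices -/

namespace Matrix

section PowerBounded

variable {κ : Type*} [Fintype κ] [DecidableEq κ]

/-- The bound does not depend on `k`; it is the constant in all Cesàro estimates below. -/
lemma abs_mulVec_pow_le {B : Matrix κ κ ℝ} (hB : ∀ k i j, |(B ^ k) i j| ≤ 1) (k : ℕ) (g : κ → ℝ)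
    (i : κ) : |(B ^ k).mulVec g i| ≤ ∑ j, |g j| := by
  refine (Finset.abs_sum_le_sum_abs _ _).trans (Finset.sum_le_sum fun j _ => ?_)
  rw [abs_mul]
  exact mul_le_of_le_one_left (abs_nonneg _) (hB k i j)

lemma eq_zero_of_forall_natCast_mul_le {x C : ℝ} (h : ∀ K : ℕ, K * x ≤ C) : x ≤ 0 := by
  by_contra hx
  push Not at hx
  obtain ⟨K, hK⟩ := exists_nat_gt (C / x)
  have := h K
  rw [div_lt_iff₀ hx] at hK
  linarith

/-- For a power-bounded matrix `B`, the space is the sum of the kernel and of the range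
of `1 - B`. -/
theorem exists_fixed_add_sub {B : Matrix κ κ ℝ} (hB : ∀ k i j, |(B ^ k) i j| ≤ 1) (b : κ → ℝ) :
    ∃ u g : κ → ℝ, B.mulVec u = u ∧ u + (g - B.mulVec g) = b := by
  let L : (κ → ℝ) →ₗ[ℝ] (κ → ℝ) := (1 - B).mulVecLin
  have hL : ∀ v, L v = v - B.mulVec v := fun v => by
    simp [L]
  -- A fixed vector of the form `w = g - B g` gives `B ^ k g = g - k w`, and boundedness in `k`
  -- forces `w = 0`.
  have hdis : Disjoint (LinearMap.ker L) (LinearMap.range L) := by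
    rw [Submodule.disjoint_def]
    rintro w hw ⟨g, rfl⟩
    set w := L g with hwdef
    have hfix : B.mulVec w = w := by
      have : L w = 0 := hw
      rw [hL] at this
      exact (sub_eq_zero.1 this).symm
    have hpow : ∀ k : ℕ, (B ^ k).mulVec g = g - (k : ℝ) • w := by
      intro k
      induction k with
      | zero => simp
      | succ k ih =>
        rw [pow_succ', ← Matrix.mulVec_mulVec, ih, Matrix.mulVec_sub, Matrix.mulVec_smul, hfix]
        have : B.mulVec g = g - w := by rw [hwdef, hL]; abel
        rw [this]
        push_cast
        rw [add_smul, one_smul]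
        abel
    have hbd : ∀ (k : ℕ) i, k * |w i| ≤ |g i| + ∑ j, |g j| := by
      intro k i
      have h1 := abs_mulVec_pow_le hB k g i
      rw [hpow] at h1
      simp only [Pi.sub_apply, Pi.smul_apply, smul_eq_mul] at h1
      have h2 : |(k : ℝ) * w i| ≤ |g i| + |g i - k * w i| := by
        have := abs_sub (g i) (g i - k * w i)
        simpa using this
      rw [abs_mul, Nat.abs_cast] at h2
      linarith
    funext i
    exact abs_eq_zero.1 (le_antisymm (eq_zero_of_forall_natCast_mul_le (hbd · i)) (abs_nonneg _))
  -- By rank–nullity the dimensions of kernel and range add up, so being disjoint they fill the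
  -- space.
  have htop := Submodule.eq_top_of_disjoint (LinearMap.ker L) (LinearMap.range L)
    (by rw [add_comm]; exact (LinearMap.finrank_range_add_finrank_ker L).ge) hdis
  have hb : b ∈ LinearMap.ker L ⊔ LinearMap.range L := htop ▸ Submodule.mem_top
  obtain ⟨u, hu, _, ⟨g, rfl⟩, hub⟩ := Submodule.mem_sup.1 hb
  refine ⟨u, g, ?_, ?_⟩
  · have : L u = 0 := hu
    rw [hL] at this
    exact (sub_eq_zero.1 this).symm
  · rw [← hL]; exact hub

lemma mulVec_pow_eq_self {B : Matrix κ κ ℝ} {u : κ → ℝ} (hu : B.mulVec u = u) (k : ℕ) :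
    (B ^ k).mulVec u = u := by
  induction k with
  | zero => simp
  | succ k ih => rw [pow_succ, ← Matrix.mulVec_mulVec, hu, ih]

/-- The part `g - B g` telescopes. Up to a bounded error the partial sums are `K u`, so `u` is the
limit of the averages, whichever `g` was chosen. -/
lemma sum_mulVec_pow {B : Matrix κ κ ℝ} {u g b : κ → ℝ} (hu : B.mulVec u = u)
    (hb : u + (g - B.mulVec g) = b) (K : ℕ) :
    ∑ k ∈ Finset.range K, (B ^ k).mulVec b = (K : ℝ) • u + g - (B ^ K).mulVec g := by
  induction K with
  | zero => simp
  | succ K ih =>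
    rw [Finset.sum_range_succ, ih, ← hb, Matrix.mulVec_add, Matrix.mulVec_sub,
      mulVec_pow_eq_self hu, Matrix.mulVec_mulVec, ← pow_succ]
    push_cast
    rw [add_smul, one_smul]
    abel

/-- A lower bound for all iterates passes to their averages, whose limit is `u`. -/
lemma le_of_fixed_add_sub {B : Matrix κ κ ℝ} (hB : ∀ k i j, |(B ^ k) i j| ≤ 1) {u g b : κ → ℝ}
    (hu : B.mulVec u = u) (hb : u + (g - B.mulVec g) = b) {i : κ} {c : ℝ}
    (hc : ∀ k, c ≤ (B ^ k).mulVec b i) : c ≤ u i := by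
  suffices h : ∀ K : ℕ, K * (c - u i) ≤ |g i| + ∑ j, |g j| by
    linarith [eq_zero_of_forall_natCast_mul_le h]
  intro K
  have h1 := congrFun (sum_mulVec_pow hu hb K) i
  rw [Finset.sum_apply] at h1
  have h2 : (K : ℝ) * c ≤ ∑ k ∈ Finset.range K, (B ^ k).mulVec b i := by
    have := Finset.card_nsmul_le_sum (Finset.range K) (fun k => (B ^ k).mulVec b i) c
      fun k _ => hc k
    simpa using this
  rw [h1] at h2
  simp only [Pi.sub_apply, Pi.add_apply, Pi.smul_apply, smul_eq_mul] at h2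
  have h3 := (abs_le.1 (abs_mulVec_pow_le hB K g i)).1
  have h4 := le_abs_self (g i)
  linarith

/-- A convergent sequence has the same Cesàro limit, and the averages of the iterates converge to
`u`. Only the tested sequence has to converge; the powers of `B` may be periodic. -/
lemma eq_of_tendsto_of_fixed_add_sub {B : Matrix κ κ ℝ} (hB : ∀ k i j, |(B ^ k) i j| ≤ 1)
    {u g b : κ → ℝ} (hu : B.mulVec u = u) (hb : u + (g - B.mulVec g) = b) {y : κ → ℝ} {a : ℝ}
    (ha : Tendsto (fun k => (B ^ k).mulVec b ⬝ᵥ y) atTop (nhds a)) : u ⬝ᵥ y = a := by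
  have h1 := ha.cesaro
  refine tendsto_nhds_unique ?_ h1
  have h2 : ∀ K : ℕ, ∑ k ∈ Finset.range K, (B ^ k).mulVec b ⬝ᵥ y =
      K * (u ⬝ᵥ y) + (g ⬝ᵥ y - (B ^ K).mulVec g ⬝ᵥ y) := by
    intro K
    rw [← sum_dotProduct, sum_mulVec_pow hu hb, sub_dotProduct,
      add_dotProduct, smul_dotProduct, smul_eq_mul]
    ring
  have h3 : ∀ K : ℕ, |g ⬝ᵥ y - (B ^ K).mulVec g ⬝ᵥ y| ≤
      |g ⬝ᵥ y| + ∑ i, (∑ j, |g j|) * |y i| := by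
    intro K
    refine (abs_sub _ _).trans (add_le_add le_rfl ?_)
    refine (Finset.abs_sum_le_sum_abs _ _).trans (Finset.sum_le_sum fun i _ => ?_)
    rw [abs_mul]
    exact mul_le_mul_of_nonneg_right (abs_mulVec_pow_le hB K g i) (abs_nonneg _)
  have h4 : Tendsto (fun K : ℕ => (K : ℝ)⁻¹ * (g ⬝ᵥ y - (B ^ K).mulVec g ⬝ᵥ y)) atTop (nhds 0) := by
    refine squeeze_zero_norm (a := fun K : ℕ => (K : ℝ)⁻¹ *
      (|g ⬝ᵥ y| + ∑ i, (∑ j, |g j|) * |y i|)) (fun K => ?_) ?_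
    · rw [Real.norm_eq_abs, abs_mul, abs_of_nonneg (inv_nonneg.2 (Nat.cast_nonneg K))]
      exact mul_le_mul_of_nonneg_left (h3 K) (inv_nonneg.2 (Nat.cast_nonneg K))
    · simpa using (tendsto_inv_atTop_nhds_zero_nat (𝕜 := ℝ)).mul_const
        (|g ⬝ᵥ y| + ∑ i, (∑ j, |g j|) * |y i|)
  have h5 : Tendsto (fun K : ℕ => u ⬝ᵥ y + (K : ℝ)⁻¹ * (g ⬝ᵥ y - (B ^ K).mulVec g ⬝ᵥ y)) atTop
      (nhds (u ⬝ᵥ y)) := by simpa using h4.const_add (u ⬝ᵥ y)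
  refine h5.congr' ?_
  filter_upwards [eventually_gt_atTop 0] with K hK
  rw [h2]
  field_simp

end PowerBounded

/-! ### Nonnegative matrices, seen as graphs -/

section Nonneg

variable {κ : Type*} [Fintype κ] [DecidableEq κ]

lemma pow_nonneg_apply {B : Matrix κ κ ℝ} (hB : ∀ i j, 0 ≤ B i j) (k : ℕ) (i j : κ) :
    0 ≤ (B ^ k) i j := by
  induction k generalizing i j with
  | zero => by_cases h : i = j <;> simp [h]
  | succ k ih =>
    rw [pow_succ, Matrix.mul_apply]
    exact Finset.sum_nonneg fun l _ => mul_nonneg (ih _ _) (hB _ _)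

lemma pow_le_pow_apply {B C : Matrix κ κ ℝ} (hC : ∀ i j, 0 ≤ C i j) (hCB : ∀ i j, C i j ≤ B i j)
    (k : ℕ) (i j : κ) : (C ^ k) i j ≤ (B ^ k) i j := by
  induction k generalizing i j with
  | zero => simp
  | succ k ih =>
    rw [pow_succ, pow_succ, Matrix.mul_apply, Matrix.mul_apply]
    exact Finset.sum_le_sum fun l _ => mul_le_mul (ih _ _) (hCB _ _) (hC _ _)
      ((pow_nonneg_apply hC _ _ _).trans (ih _ _))

lemma mulVec_le_mulVec {B : Matrix κ κ ℝ} (hB : ∀ i j, 0 ≤ B i j) {u v : κ → ℝ}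
    (h : ∀ i, u i ≤ v i) (i : κ) : B.mulVec u i ≤ B.mulVec v i :=
  Finset.sum_le_sum fun j _ => mul_le_mul_of_nonneg_left (h j) (hB i j)

/-- Restriction of a matrix to the rows and columns that satisfy a predicate. -/
noncomputable def mask (B : Matrix κ κ ℝ) (Z : κ → Prop) : Matrix κ κ ℝ :=
  open Classical in fun i j => if Z i ∧ Z j then B i j else 0

lemma mask_nonneg {B : Matrix κ κ ℝ} (hB : ∀ i j, 0 ≤ B i j) (Z : κ → Prop) (i j : κ) :
    0 ≤ B.mask Z i j := by
  unfold mask; split_ifs <;> simp [hB]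

lemma mask_le {B : Matrix κ κ ℝ} (hB : ∀ i j, 0 ≤ B i j) (Z : κ → Prop) (i j : κ) :
    B.mask Z i j ≤ B i j := by
  unfold mask; split_ifs <;> simp [hB]

lemma mask_pow_mulVec_of_not {B : Matrix κ κ ℝ} {Z : κ → Prop} {y : κ → ℝ}
    (hy : ∀ i, ¬ Z i → y i = 0) (k : ℕ) {i : κ} (hi : ¬ Z i) :
    ((B.mask Z) ^ k).mulVec y i = 0 := by
  cases k with
  | zero => simp [hy i hi]
  | succ k =>
    rw [pow_succ', ← Matrix.mulVec_mulVec]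
    exact Finset.sum_eq_zero fun j _ => by simp [mask, hi]

/-- If a set `Z` cannot be entered from the rest of the closed set `G`, then vectors that live
on `Z` are not affected by the restriction to `Z`. -/
lemma pow_mulVec_eq_mask {B : Matrix κ κ ℝ} {G Z : κ → Prop}
    (hG : ∀ i j, G i → B i j ≠ 0 → G j) (hZ : ∀ i j, G i → B i j ≠ 0 → Z j → Z i) {y : κ → ℝ}
    (hy : ∀ i, ¬ Z i → y i = 0) (k : ℕ) {i : κ} (hi : G i) :
    (B ^ k).mulVec y i = ((B.mask Z) ^ k).mulVec y i := by
  induction k generalizing i with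
  | zero => simp
  | succ k ih =>
    rw [pow_succ', pow_succ', ← Matrix.mulVec_mulVec, ← Matrix.mulVec_mulVec]
    refine Finset.sum_congr rfl fun j _ => ?_
    by_cases hB : B i j = 0
    · simp [hB, mask]
    rw [ih (hG i j hi hB)]
    by_cases hj : Z j
    · simp [mask, hj, hZ i j hi hB hj]
    · rw [mask_pow_mulVec_of_not hy k hj]
      simp

end Nonneg

/-! ### Reachability through a linear system -/

section Reach

variable {κ : Type*} [Fintype κ] [DecidableEq κ]

/-- `j` is reachable from `i` in the graph of the nonzero entries of `B`. -/
abbrev Reach {R : Type*} [Zero R] (B : Matrix κ κ R) : κ → κ → Prop :=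
  Relation.ReflTransGen fun i j => B i j ≠ 0

variable {B : Matrix κ κ ℝ} {a : ℝ}

/-- Row sums below `a` make `a - B` strictly diagonally dominant, hence invertible. -/
lemma exists_resolvent (hB : ∀ i j, 0 ≤ B i j) (ha : ∀ i, ∑ j, B i j < a) (b : κ → ℝ) :
    ∃ x : κ → ℝ, ∀ i, a * x i = ∑ k, B i k * x k + b i := by
  have hdet : (Matrix.diagonal (fun _ : κ => a) - B : Matrix κ κ ℝ).det ≠ 0 := by
    refine det_ne_zero_of_sum_row_lt_diag fun k => ?_
    have hk := Finset.add_sum_erase Finset.univ (fun j => B k j) (Finset.mem_univ k)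
    have h1 : ∑ j ∈ Finset.univ.erase k, ‖(Matrix.diagonal (fun _ : κ => a) - B : Matrix κ κ ℝ) k j‖ =
        ∑ j ∈ Finset.univ.erase k, B k j := by
      refine Finset.sum_congr rfl fun j hj => ?_
      rw [Matrix.sub_apply, Matrix.diagonal_apply_ne _ (Finset.ne_of_mem_erase hj).symm, zero_sub,
        norm_neg, Real.norm_of_nonneg (hB _ _)]
    rw [h1, Matrix.sub_apply, Matrix.diagonal_apply_eq]
    refine lt_of_lt_of_le ?_ (Real.le_norm_self _)
    linarith [ha k]
  have hu : IsUnit (Matrix.diagonal (fun _ => a) - B).det := isUnit_iff_ne_zero.2 hdet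
  refine ⟨(Matrix.diagonal (fun _ => a) - B)⁻¹.mulVec b, fun i => ?_⟩
  have := congrFun (congrArg (fun M => Matrix.mulVec M b) (Matrix.mul_nonsing_inv _ hu)) i
  simp only [← Matrix.mulVec_mulVec, Matrix.sub_mulVec, Pi.sub_apply, Matrix.one_mulVec,
    Matrix.mulVec_diagonal] at this
  have h2 : ∀ v, B.mulVec v i = ∑ k, B i k * v k := fun v => rfl
  rw [h2] at this
  linarith

/-- Minimum principle: at an index `i₀` of a minimal entry, `a` minus the row sum, times `x i₀`, is
at least `b i₀ ≥ 0`. -/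
lemma resolvent_nonneg (hB : ∀ i j, 0 ≤ B i j) (ha : ∀ i, ∑ j, B i j < a) {x b : κ → ℝ}
    (hb : ∀ i, 0 ≤ b i) (hx : ∀ i, a * x i = ∑ k, B i k * x k + b i) (i : κ) : 0 ≤ x i := by
  have : Nonempty κ := ⟨i⟩
  obtain ⟨i₀, h₀⟩ := Finite.exists_min x
  suffices 0 ≤ x i₀ from this.trans (h₀ i)
  by_contra hneg
  push Not at hneg
  have h1 : ∑ k, B i₀ k * x i₀ ≤ ∑ k, B i₀ k * x k :=
    Finset.sum_le_sum fun k _ => mul_le_mul_of_nonneg_left (h₀ k) (hB _ _)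
  rw [← Finset.sum_mul] at h1
  have := hx i₀
  have := hb i₀
  nlinarith [ha i₀]

/-- The solution of `a X = B X + 1`, for a large number `a`, is positive exactly at the pairs
of vertices that are connected by a path. -/
theorem resolvent_ne_zero_iff (hB : ∀ i j, 0 ≤ B i j) (ha : ∀ i, ∑ j, B i j < a) {X : κ → κ → ℝ}
    (hX : ∀ i j, a * X i j = ∑ k, B i k * X k j + if i = j then 1 else 0) (i j : κ) :
    X i j ≠ 0 ↔ Reach B i j := by
  have hnn : ∀ i j, 0 ≤ X i j := fun i j =>
    resolvent_nonneg hB ha (x := fun i => X i j) (b := fun i => if i = j then 1 else 0)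
      (fun i => by positivity) (fun i => hX i j) i
  have ha0 : ∀ i, 0 < a := fun i => (Finset.sum_nonneg fun j _ => hB i j).trans_lt (ha i)
  constructor
  · intro h
    by_contra hr
    have hcl : ∀ l k, ¬ Reach B l j → B l k ≠ 0 → ¬ Reach B k j :=
      fun l k hl hlk hk => hl (Relation.ReflTransGen.head hlk hk)
    -- Vertices that do not reach `j` have no edges to vertices that do, so on them `-X` solves the
    -- homogeneous system. Extended by zero, it solves a system with nonnegative right-hand side;
    -- hence `-X ≥ 0` there, and `X = 0`.
    let x : κ → ℝ := open Classical in fun l => if Reach B l j then 0 else - X l j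
    have hx := resolvent_nonneg hB ha (x := x)
      (b := fun l => open Classical in if Reach B l j then ∑ k, B l k * X k j *
        (if Reach B k j then 0 else 1) else 0)
      (fun l => by
        split_ifs
        · exact Finset.sum_nonneg fun k _ => mul_nonneg (mul_nonneg (hB _ _) (hnn _ _))
            (by positivity)
        · exact le_rfl)
      (fun l => by
        by_cases hl : Reach B l j
        · simp only [x, hl, if_true, mul_zero, ← Finset.sum_add_distrib]
          refine (Finset.sum_eq_zero fun k _ => ?_).symm
          split_ifs <;> ring
        · have hlj : l ≠ j := by rintro rfl; exact hl Relation.ReflTransGen.refl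
          have := hX l j
          simp only [x, hl, if_false, add_zero]
          rw [mul_neg, this, if_neg hlj, add_zero, ← Finset.sum_neg_distrib]
          refine Finset.sum_congr rfl fun k _ => ?_
          by_cases hB0 : B l k = 0
          · simp [hB0]
          · simp [hcl l k hl hB0]) i
    simp only [x, hr, if_false] at hx
    exact h (le_antisymm (by linarith) (hnn i j))
  · intro h
    induction h using Relation.ReflTransGen.head_induction_on with
    | refl =>
      intro h0
      have := hX j j
      rw [h0, mul_zero, if_pos rfl] at this
      have : 0 ≤ ∑ k, B j k * X k j := Finset.sum_nonneg fun k _ => mul_nonneg (hB _ _) (hnn _ _)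
      linarith
    | head h1 _ ih =>
      rename_i l k _
      intro h0
      have := hX l j
      rw [h0, mul_zero] at this
      have h3 : 0 < B l k * X k j :=
        mul_pos (lt_of_le_of_ne (hB _ _) h1.symm) (lt_of_le_of_ne (hnn _ _) ih.symm)
      have h4 := Finset.single_le_sum (f := fun k => B l k * X k j)
        (fun k _ => mul_nonneg (hB l k) (hnn k j)) (Finset.mem_univ k)
      have h5 : (0 : ℝ) ≤ if l = j then 1 else 0 := by positivity
      linarith

end Reach

end Matrix

/-! ### Product matrices and the fixed point equation of the acceptance probabilities -/

namespace Buchi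

variable {n m : ℕ} (M : MarkovChain n) (A : NFA (Fin n) (Fin m))

open Classical in
/-- Indicator of the transitions of the automaton. -/
noncomputable def stepWeight : Fin m × Fin n → Fin m × Fin n → ℝ :=
  fun i j => if j.1 ∈ A.step i.1 i.2 then 1 else 0

open Classical in
/-- Indicator of the initial states. -/
noncomputable def startWeight (q : Fin m) : ℝ := if q ∈ A.start then 1 else 0

/-- The matrix of the product of the chain and the automaton. -/
noncomputable def productMatrix : Matrix (Fin m × Fin n) (Fin m × Fin n) ℝ :=
  M.weightMatrix (stepWeight A)

/-- The matrix of the product of the chain and two copies of the automaton. -/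
noncomputable def pairMatrix : Matrix ((Fin m × Fin m) × Fin n) ((Fin m × Fin m) × Fin n) ℝ :=
  M.weightMatrix (pairWeight (stepWeight A) (stepWeight A))

/-- The probability that the trajectory started in `s` is accepted from the state `q`. -/
noncomputable def acceptProb (i : Fin m × Fin n) : ℝ := (M.law i.2).real (langFrom A i.1)

/-- Initial weights in the product of the chain and the automaton. -/
noncomputable def productStart (i : Fin m × Fin n) : ℝ := M.π i.2 * startWeight A i.1

/-- Initial weights in the product of the chain and two copies of the automaton. -/
noncomputable def pairStart (i : (Fin m × Fin m) × Fin n) : ℝ :=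
  M.π i.2 * (startWeight A i.1.1 * startWeight A i.1.2)

variable {M A}

lemma stepWeight_nonneg (i j : Fin m × Fin n) : 0 ≤ stepWeight A i j := by
  unfold stepWeight; split_ifs <;> simp

lemma startWeight_nonneg (q : Fin m) : 0 ≤ startWeight A q := by
  unfold startWeight; split_ifs <;> simp

lemma productMatrix_nonneg (i j : Fin m × Fin n) : 0 ≤ productMatrix M A i j :=
  mul_nonneg (by exact_mod_cast M.P_nonneg _ _) (stepWeight_nonneg _ _)

lemma pairMatrix_nonneg (i j : (Fin m × Fin m) × Fin n) : 0 ≤ pairMatrix M A i j :=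
  mul_nonneg (by exact_mod_cast M.P_nonneg _ _)
    (mul_nonneg (stepWeight_nonneg _ _) (stepWeight_nonneg _ _))

lemma mem_step_of_productMatrix_ne_zero {i j : Fin m × Fin n} (h : productMatrix M A i j ≠ 0) :
    j.1 ∈ A.step i.1 i.2 := by
  by_contra h'
  exact h (by simp [productMatrix, MarkovChain.weightMatrix, stepWeight, h'])

lemma acceptProb_nonneg (i : Fin m × Fin n) : 0 ≤ acceptProb M A i := measureReal_nonneg

lemma acceptProb_le_one (i : Fin m × Fin n) : acceptProb M A i ≤ 1 := measureReal_le_one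

lemma UnambFrom.of_productMatrix_ne_zero {i j : Fin m × Fin n} (hu : UnambFrom A i.1)
    (h : productMatrix M A i j ≠ 0) : UnambFrom A j.1 :=
  hu.step (mem_step_of_productMatrix_ne_zero h)

lemma indicator_langFrom_consWord {q : Fin m} (hu : UnambFrom A q) (s : Fin n) (w : ℕ → Fin n) :
    (langFrom A q).indicator (1 : (ℕ → Fin n) → ℝ) (consWord s w) =
      ∑ q', stepWeight A (q, s) (q', w 0) * (langFrom A q').indicator 1 w := by
  rw [indicator_langFrom hu]
  rfl

lemma abs_indicator_one_le (S : Set (ℕ → Fin n)) (w : ℕ → Fin n) :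
    |S.indicator (1 : (ℕ → Fin n) → ℝ) w| ≤ 1 := by
  by_cases h : w ∈ S <;> simp [h]

lemma measurable_indicator_langFrom {q : Fin m} (hu : UnambFrom A q) :
    Measurable ((langFrom A q).indicator (1 : (ℕ → Fin n) → ℝ)) :=
  measurable_one.indicator hu.measurableSet_langFrom

/-- Integration of a function of the first letters against the sums over runs, and against the
language, agree. -/
theorem integral_mul_runSum {G : Fin m × Fin n → Prop} (hG : ∀ i, G i → UnambFrom A i.1)
    (hGs : ∀ i j, G i → productMatrix M A i j ≠ 0 → G j) {x : Fin m × Fin n → ℝ}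
    (hx : ∀ i, G i → x i = acceptProb M A i) (k : ℕ) {f : (ℕ → Fin n) → ℝ} (hf : Measurable f)
    (hfb : ∃ C, ∀ w, |f w| ≤ C) (hfk : ∀ w w', (∀ i ≤ k, w i = w' i) → f w = f w')
    {q : Fin m} {s : Fin n} (hq : G (q, s)) :
    ∫ w, f w * runSum (stepWeight A) x k q w ∂M.law s =
      ∫ w, f w * (langFrom A q).indicator 1 w ∂M.law s := by
  obtain ⟨C, hC⟩ := hfb
  have hC0 : ∀ w, 0 ≤ C := fun w => (abs_nonneg _).trans (hC w)
  induction k generalizing f q s with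
  | zero =>
    have h1 : ∀ᵐ w ∂M.law s, f w * runSum (stepWeight A) x 0 q w =
        f (fun _ => s) * x (q, s) := by
      filter_upwards [M.ae_law_zero s] with w hw
      rw [runSum, hw, hfk w (fun _ => s) (by intro i hi; rw [Nat.le_zero.1 hi, hw])]
    have h2 : ∀ᵐ w ∂M.law s, f w * (langFrom A q).indicator (1 : (ℕ → Fin n) → ℝ) w =
        f (fun _ => s) * (langFrom A q).indicator 1 w := by
      filter_upwards [M.ae_law_zero s] with w hw
      rw [hfk w (fun _ => s) (by intro i hi; rw [Nat.le_zero.1 hi, hw])]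
    rw [integral_congr_ae h1, integral_congr_ae h2, integral_const_mul,
      integral_const_mul, integral_indicator_one (hG _ hq).measurableSet_langFrom, hx _ hq]
    simp [acceptProb]
  | succ k ih =>
    have hu := hG _ hq
    obtain ⟨D, hD⟩ := exists_bound_runSum (stepWeight A) x (k + 1)
    obtain ⟨D', hD'⟩ := exists_bound_runSum (stepWeight A) x k
    have hfs : ∀ t, Measurable fun w => f (consWord t w) := fun t => hf.comp (measurable_consWord t)
    change ∫ w, (f * runSum (stepWeight A) x (k + 1) q) w ∂M.law s =
      ∫ w, (f * (langFrom A q).indicator (1 : (ℕ → Fin n) → ℝ)) w ∂M.law s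
    rw [M.law_integral s (hf.mul (measurable_runSum (stepWeight A) x (k + 1) q)) (C := C * D)
        fun w => by
          rw [Pi.mul_apply, abs_mul]
          exact mul_le_mul (hC _) (hD _ _) (abs_nonneg _) (hC0 w),
      M.law_integral s (hf.mul (measurable_indicator_langFrom hu)) (C := C * 1) fun w => by
          rw [Pi.mul_apply, abs_mul]
          exact mul_le_mul (hC _) (abs_indicator_one_le _ _) (abs_nonneg _) (hC0 w)]
    refine Finset.sum_congr rfl fun t _ => ?_
    by_cases hP : M.P s t = 0
    · simp [hP]
    congr 1
    have h1 : ∀ᵐ w ∂M.law t, (f * runSum (stepWeight A) x (k + 1) q) (consWord s w) =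
        ∑ q', stepWeight A (q, s) (q', t) *
          (f (consWord s w) * runSum (stepWeight A) x k q' w) := by
      filter_upwards [M.ae_law_zero t] with w hw
      simp only [Pi.mul_apply, runSum, consWord_zero, consWord_succ, hw, tailWord_consWord,
        Finset.mul_sum]
      exact Finset.sum_congr rfl fun _ _ => by ring
    have h2 : ∀ᵐ w ∂M.law t,
        (f * (langFrom A q).indicator (1 : (ℕ → Fin n) → ℝ)) (consWord s w) =
        ∑ q', stepWeight A (q, s) (q', t) *
          (f (consWord s w) * (langFrom A q').indicator 1 w) := by
      filter_upwards [M.ae_law_zero t] with w hw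
      rw [Pi.mul_apply, indicator_langFrom_consWord hu, hw, Finset.mul_sum]
      exact Finset.sum_congr rfl fun _ _ => by ring
    -- Terms outside `G` have weight zero; for them neither measurability of the language nor the
    -- value of `x` is available.
    have key : ∀ q', stepWeight A (q, s) (q', t) ≠ 0 → G (q', t) := fun q' hne =>
      hGs _ _ hq (mul_ne_zero (by exact_mod_cast hP) hne)
    rw [integral_congr_ae h1, integral_congr_ae h2, integral_finsetSum, integral_finsetSum]
    · refine Finset.sum_congr rfl fun q' _ => ?_
      rw [integral_const_mul, integral_const_mul]
      by_cases hne : stepWeight A (q, s) (q', t) = 0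
      · simp [hne]
      congr 1
      -- The letter `s` is absorbed into the test function, which is why the induction carries a
      -- general `f`.
      refine ih (hfs s) (fun w w' h => hfk _ _ ?_) (key q' hne) (fun w => hC _)
      rintro (_ | i) hi
      · rfl
      · exact h i (by omega)
    · intro q' _
      by_cases hne : stepWeight A (q, s) (q', t) = 0
      · simp [hne]
      refine Integrable.const_mul (MarkovChain.integrable_of_bounded ((hfs s).mul
        (measurable_indicator_langFrom (hG _ (key q' hne)))) (C := C * 1) fun w => ?_) _
      rw [Pi.mul_apply, abs_mul]
      exact mul_le_mul (hC _) (abs_indicator_one_le _ _) (abs_nonneg _) (hC0 w)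
    · intro q' _
      refine Integrable.const_mul (MarkovChain.integrable_of_bounded ((hfs s).mul
        (measurable_runSum (stepWeight A) x k q')) (C := C * D') fun w => ?_) _
      rw [Pi.mul_apply, abs_mul]
      exact mul_le_mul (hC _) (hD' _ _) (abs_nonneg _) (hC0 w)

/-- The acceptance probabilities form a fixed point of the product matrix. -/
theorem acceptProb_eq_mulVec {i : Fin m × Fin n} (hu : UnambFrom A i.1) :
    acceptProb M A i = (productMatrix M A).mulVec (acceptProb M A) i := by
  -- One step with the constant test function is already the fixed point equation.
  have h := integral_mul_runSum (M := M) (A := A) (G := fun i => UnambFrom A i.1)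
    (x := acceptProb M A) (fun _ h => h) (fun i j hi hij => hi.of_productMatrix_ne_zero hij)
    (fun _ _ => rfl) 1 (f := fun _ => 1) measurable_const ⟨1, by simp⟩ (fun _ _ _ => rfl)
    (q := i.1) (s := i.2) hu
  simp only [one_mul] at h
  rw [MarkovChain.integral_runSum, integral_indicator_one hu.measurableSet_langFrom, pow_one] at h
  exact h.symm

/-! ### Boundedness of the powers -/

/-- The first `k` letters of `w`, followed by `z`. -/
def splice : ℕ → (ℕ → Fin n) → (ℕ → Fin n) → ℕ → Fin n
  | 0, _, z => z
  | k + 1, w, z => consWord (w 0) (splice k (tailWord w) z)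

/-- A nonzero sum means that some run over the first `k` letters leads from `q` to `r`, where an
accepting run on `z` takes over. -/
lemma splice_mem_langFrom {r : Fin m} {z : ℕ → Fin n} (hz : z ∈ langFrom A r) {t : Fin n} (k : ℕ)
    {q : Fin m} {w : ℕ → Fin n}
    (h : runSum (stepWeight A) (Pi.single (r, t) 1) k q w ≠ 0) : splice k w z ∈ langFrom A q := by
  induction k generalizing q w with
  | zero =>
    have : q = r := by
      by_contra hne
      exact h (Pi.single_eq_of_ne (fun e => hne (congrArg Prod.fst e)) _)
    rwa [this]
  | succ k ih =>
    obtain ⟨q', _, hq'⟩ := Finset.exists_ne_zero_of_sum_ne_zero h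
    have h1 := left_ne_zero_of_mul hq'
    refine mem_langFrom_iff.2 ⟨q', ?_, ih (right_ne_zero_of_mul hq')⟩
    by_contra hn
    exact h1 (by simp only [stepWeight, ite_eq_right_iff, one_ne_zero]; exact fun h => hn h)

/-- The sum counts the runs from `q` to `r` over the letters of `w`. Two of them, continued by the
same accepting run on `z`, would be two accepting runs on one word. Without an accepted `z`,
unambiguity would say nothing about these runs. -/
lemma runSum_single_le_one {r : Fin m} (hr : (langFrom A r).Nonempty) (t : Fin n) (k : ℕ)
    {q : Fin m} (hu : UnambFrom A q) (w : ℕ → Fin n) :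
    runSum (stepWeight A) (Pi.single (r, t) 1) k q w ≤ 1 := by
  obtain ⟨z, hz⟩ := hr
  induction k generalizing q w with
  | zero => simp only [runSum, Pi.single_apply]; split_ifs <;> simp
  | succ k ih =>
    have hstep : ∀ q', stepWeight A (q, w 0) (q', w 1) ≠ 0 → q' ∈ A.step q (w 0) := by
      intro q' h
      by_contra hn
      exact h (by simp only [stepWeight, ite_eq_right_iff, one_ne_zero]; exact fun h => hn h)
    by_cases h0 : ∃ q', stepWeight A (q, w 0) (q', w 1) *
        runSum (stepWeight A) (Pi.single (r, t) 1) k q' (tailWord w) ≠ 0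
    · obtain ⟨q₀, h₀⟩ := h0
      have h₀s := hstep _ (left_ne_zero_of_mul h₀)
      rw [runSum, Finset.sum_eq_single q₀]
      · have h1 : stepWeight A (q, w 0) (q₀, w 1) ≤ 1 := by
          unfold stepWeight; split_ifs <;> simp
        have h2 := ih (hu.step h₀s) (tailWord w)
        have h3 := runSum_nonneg (h := stepWeight A) (y := Pi.single (r, t) 1) stepWeight_nonneg
          (fun i => by rw [Pi.single_apply]; split_ifs <;> simp) k q₀ (tailWord w)
        nlinarith [stepWeight_nonneg (A := A) (q, w 0) (q₀, w 1)]
      · intro q' _ hne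
        by_contra h'
        exact hne (hu.eq_of_mem (w := splice (k + 1) w z) (hstep _ (left_ne_zero_of_mul h')) h₀s
          (splice_mem_langFrom hz k (right_ne_zero_of_mul h'))
          (splice_mem_langFrom hz k (right_ne_zero_of_mul h₀)))
      · simp
    · push Not at h0
      rw [runSum, Finset.sum_eq_zero fun q' _ => h0 q']
      exact zero_le_one

lemma runSum_single_nonneg (r : Fin m × Fin n) (k : ℕ) (q : Fin m) (w : ℕ → Fin n) :
    0 ≤ runSum (stepWeight A) (Pi.single r 1) k q w :=
  runSum_nonneg stepWeight_nonneg (fun i => by rw [Pi.single_apply]; split_ifs <;> simp) k q w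

lemma integral_le_one_of_le {μ : Measure (ℕ → Fin n)} [IsProbabilityMeasure μ]
    {f : (ℕ → Fin n) → ℝ} (h0 : ∀ w, 0 ≤ f w) (h1 : ∀ w, f w ≤ 1) : ∫ w, f w ∂μ ≤ 1 := by
  have := integral_mono_of_nonneg (μ := μ) (ae_of_all _ h0) (integrable_const 1) (ae_of_all _ h1)
  simpa using this

/-- The entry is the expected number of runs from `i` to `j` in `k` steps, and that number is at
most one for each word. -/
lemma productMatrix_pow_le_one {i j : Fin m × Fin n} (hi : UnambFrom A i.1)
    (hj : (langFrom A j.1).Nonempty) (k : ℕ) : (productMatrix M A ^ k) i j ≤ 1 := by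
  have h := M.integral_runSum (stepWeight A) (Pi.single j 1) k i.1 i.2
  rw [Matrix.mulVec_single_one] at h
  change _ = (productMatrix M A ^ k) i j at h
  rw [← h]
  exact integral_le_one_of_le (fun w => runSum_single_nonneg j k _ w)
    fun w => runSum_single_le_one hj j.2 k hi w

/-- The number of pairs of runs is a product of two numbers that are at most one. -/
lemma pairMatrix_pow_le_one {i j : (Fin m × Fin m) × Fin n} (hi : UnambFrom A i.1.1)
    (hi' : UnambFrom A i.1.2) (hj : (langFrom A j.1.1).Nonempty) (hj' : (langFrom A j.1.2).Nonempty)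
    (k : ℕ) : (pairMatrix M A ^ k) i j ≤ 1 := by
  have h := M.integral_runSum (pairWeight (stepWeight A) (stepWeight A)) (Pi.single j 1) k i.1 i.2
  rw [Matrix.mulVec_single_one] at h
  change _ = (pairMatrix M A ^ k) i j at h
  rw [← h]
  have e : (Pi.single j 1 : (Fin m × Fin m) × Fin n → ℝ) =
      pairVec (Pi.single (j.1.1, j.2) 1) (Pi.single (j.1.2, j.2) 1) := by
    funext x
    obtain ⟨⟨a, b⟩, c⟩ := x
    obtain ⟨⟨a', b'⟩, c'⟩ := j
    simp only [pairVec, Pi.single_apply, Prod.mk.injEq]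
    by_cases h1 : a = a' <;> by_cases h2 : b = b' <;> by_cases h3 : c = c' <;> simp [h1, h2, h3]
  rw [e]
  have e2 : ∀ w, runSum (pairWeight (stepWeight A) (stepWeight A))
      (pairVec (Pi.single (j.1.1, j.2) 1) (Pi.single (j.1.2, j.2) 1)) k i.1 w =
      runSum (stepWeight A) (Pi.single (j.1.1, j.2) 1) k i.1.1 w *
        runSum (stepWeight A) (Pi.single (j.1.2, j.2) 1) k i.1.2 w := fun w =>
    runSum_pair _ _ _ _ k i.1.1 i.1.2 w
  simp only [e2]
  refine integral_le_one_of_le (fun w => mul_nonneg (runSum_single_nonneg _ k _ w)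
    (runSum_single_nonneg _ k _ w)) fun w => mul_le_one₀ ?_ (runSum_single_nonneg _ k _ w) ?_
  · exact runSum_single_le_one hj _ k hi w
  · exact runSum_single_le_one hj' _ k hi' w

/-- A path that contributes to a positive power leaves `i` and enters `j` by edges of `C`, so the
bound for `B` is needed only for rows in `S` and columns in `T`. The zeroth power is the identity
and needs no bound. -/
lemma abs_pow_apply_le_one {κ : Type*} [Fintype κ] [DecidableEq κ] {B C : Matrix κ κ ℝ}
    {S T : κ → Prop} (hB : ∀ i j k, S i → T j → (B ^ k) i j ≤ 1) (hC : ∀ i j, 0 ≤ C i j)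
    (hCB : ∀ i j, C i j ≤ B i j) (hS : ∀ i j, C i j ≠ 0 → S i ∧ T j) (k : ℕ) (i j : κ) :
    |(C ^ k) i j| ≤ 1 := by
  rw [abs_of_nonneg (Matrix.pow_nonneg_apply hC k i j)]
  cases k with
  | zero => rw [pow_zero, Matrix.one_apply]; split_ifs <;> simp
  | succ k =>
    by_cases h : (C ^ (k + 1)) i j = 0
    · rw [h]; exact zero_le_one
    have h1 := h
    have h2 := h
    rw [pow_succ', Matrix.mul_apply] at h1
    rw [pow_succ, Matrix.mul_apply] at h2
    obtain ⟨l, _, hl⟩ := Finset.exists_ne_zero_of_sum_ne_zero h1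
    obtain ⟨l', _, hl'⟩ := Finset.exists_ne_zero_of_sum_ne_zero h2
    exact (Matrix.pow_le_pow_apply hC hCB _ _ _).trans
      (hB _ _ _ (hS _ _ (left_ne_zero_of_mul hl)).1 (hS _ _ (right_ne_zero_of_mul hl')).2)

end Buchi

namespace Buchi

variable {n m : ℕ} {M : MarkovChain n} {A : NFA (Fin n) (Fin m)}

/-! ### Convergence of the sums over runs -/

variable (A) in
/-- The sum over the runs from the initial states on a prefix of a word. -/
noncomputable def startRunSum (y : Fin m × Fin n → ℝ) (k : ℕ) (w : ℕ → Fin n) : ℝ :=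
  ∑ q, startWeight A q * runSum (stepWeight A) y k q w

lemma measurable_startRunSum (y : Fin m × Fin n → ℝ) (k : ℕ) : Measurable (startRunSum A y k) :=
  Finset.measurable_sum _ fun q _ => (measurable_runSum _ y k q).const_mul _

lemma startRunSum_congr (y : Fin m × Fin n → ℝ) (k : ℕ) {w w' : ℕ → Fin n}
    (h : ∀ i ≤ k, w i = w' i) : startRunSum A y k w = startRunSum A y k w' :=
  Finset.sum_congr rfl fun q _ => by rw [runSum_congr _ y k q h]

lemma exists_bound_startRunSum (y : Fin m × Fin n → ℝ) (k : ℕ) :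
    ∃ C, ∀ w, |startRunSum A y k w| ≤ C := by
  obtain ⟨C, hC⟩ := exists_bound_runSum (stepWeight A) y k
  refine ⟨∑ q, startWeight A q * C, fun w => ?_⟩
  refine (Finset.abs_sum_le_sum_abs _ _).trans (Finset.sum_le_sum fun q _ => ?_)
  rw [abs_mul, abs_of_nonneg (startWeight_nonneg q)]
  exact mul_le_mul_of_nonneg_left (hC q w) (startWeight_nonneg q)

lemma integral_startRunSum (y : Fin m × Fin n → ℝ) (k : ℕ) :
    ∫ w, startRunSum A y k w ∂M.trajectoryLaw =
      productStart M A ⬝ᵥ (productMatrix M A ^ k).mulVec y := by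
  obtain ⟨C, hC⟩ := exists_bound_startRunSum (A := A) y k
  rw [M.trajectoryLaw_integral (measurable_startRunSum y k) hC]
  simp only [dotProduct, Fintype.sum_prod_type]
  rw [Finset.sum_comm]
  refine Finset.sum_congr rfl fun s _ => ?_
  obtain ⟨D, hD⟩ := exists_bound_runSum (stepWeight A) y k
  simp only [startRunSum]
  rw [integral_finsetSum _ fun q _ => (MarkovChain.integrable_of_bounded
    (measurable_runSum _ y k q) (hD q)).const_mul _, Finset.mul_sum]
  refine Finset.sum_congr rfl fun q _ => ?_
  rw [integral_const_mul, MarkovChain.integral_runSum]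
  simp only [productStart, productMatrix]
  ring

/-- After `runSum_pair` this is a first-moment formula, for the product with two copies of the
automaton. -/
lemma integral_startRunSum_mul (x y : Fin m × Fin n → ℝ) (k : ℕ) :
    ∫ w, startRunSum A x k w * startRunSum A y k w ∂M.trajectoryLaw =
      pairStart M A ⬝ᵥ (pairMatrix M A ^ k).mulVec (pairVec x y) := by
  obtain ⟨C, hC⟩ := exists_bound_startRunSum (A := A) x k
  obtain ⟨C', hC'⟩ := exists_bound_startRunSum (A := A) y k
  rw [M.trajectoryLaw_integral (f := fun w => startRunSum A x k w * startRunSum A y k w)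
    (C := C * C') ((measurable_startRunSum x k).mul
    (measurable_startRunSum y k)) fun w => by
      rw [abs_mul]
      exact mul_le_mul (hC _) (hC' _) (abs_nonneg _) ((abs_nonneg _).trans (hC w))]
  simp only [dotProduct]
  rw [Fintype.sum_prod_type, Finset.sum_comm]
  refine Finset.sum_congr rfl fun s _ => ?_
  obtain ⟨D, hD⟩ := exists_bound_runSum (pairWeight (stepWeight A) (stepWeight A)) (pairVec x y) k
  have e : ∀ w, startRunSum A x k w * startRunSum A y k w =
      ∑ i : Fin m × Fin m, startWeight A i.1 * startWeight A i.2 *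
        runSum (pairWeight (stepWeight A) (stepWeight A)) (pairVec x y) k i w := by
    intro w
    rw [startRunSum, startRunSum, Finset.sum_mul_sum, Fintype.sum_prod_type]
    refine Finset.sum_congr rfl fun q _ => Finset.sum_congr rfl fun q' _ => ?_
    rw [runSum_pair]
    ring
  simp only [e]
  rw [integral_finsetSum _ fun q _ => (MarkovChain.integrable_of_bounded
    (measurable_runSum _ _ k q) (hD q)).const_mul _, Finset.mul_sum]
  refine Finset.sum_congr rfl fun q _ => ?_
  rw [integral_const_mul, MarkovChain.integral_runSum]
  simp only [pairStart, pairMatrix]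
  ring

/-- The languages of different initial states are disjoint by unambiguity. This reduces the problem
to identifying `acceptProb` among the fixed points, at least against the initial weights. -/
lemma trajectoryLaw_real_language (hA : IsUnambiguous A) :
    M.trajectoryLaw.real (language A) = productStart M A ⬝ᵥ acceptProb M A := by
  rw [← integral_indicator_one hA.measurableSet_language,
    M.trajectoryLaw_integral (measurable_one.indicator hA.measurableSet_language)
      (abs_indicator_one_le _)]
  simp only [dotProduct, Fintype.sum_prod_type]
  rw [Finset.sum_comm]
  refine Finset.sum_congr rfl fun s _ => ?_
  have e : ∀ w, (language A).indicator (1 : (ℕ → Fin n) → ℝ) w =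
      ∑ q, startWeight A q * (langFrom A q).indicator (1 : (ℕ → Fin n) → ℝ) w :=
    indicator_language hA
  simp only [e]
  have hm : ∀ q, startWeight A q ≠ 0 → UnambFrom A q := fun q h =>
    hA.unambFrom (by by_contra h'; exact h (by simp [startWeight, h']))
  rw [integral_finsetSum, Finset.mul_sum]
  · refine Finset.sum_congr rfl fun q _ => ?_
    rw [integral_const_mul]
    by_cases h : startWeight A q = 0
    · simp [productStart, h]
    · rw [integral_indicator_one (hm q h).measurableSet_langFrom, productStart, acceptProb]
      ring
  · intro q _
    by_cases h : startWeight A q = 0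
    · simp [h]
    · exact (MarkovChain.integrable_of_bounded (measurable_indicator_langFrom (hm q h))
        (abs_indicator_one_le _)).const_mul _

/-! ### Lévy's theorem for the sums over runs -/

section Levy

variable {G : Fin m × Fin n → Prop} {x : Fin m × Fin n → ℝ}

lemma integral_mul_startRunSum (hA : IsUnambiguous A) (hG : ∀ i, G i → UnambFrom A i.1)
    (hGs : ∀ i j, G i → productMatrix M A i j ≠ 0 → G j)
    (hG0 : ∀ q s, q ∈ A.start → G (q, s)) (hx : ∀ i, G i → x i = acceptProb M A i) (k : ℕ)
    {f : (ℕ → Fin n) → ℝ} (hf : Measurable f)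
    (hfb : ∃ C, ∀ w, |f w| ≤ C) (hfk : ∀ w w', (∀ i ≤ k, w i = w' i) → f w = f w') :
    ∫ w, f w * startRunSum A x k w ∂M.trajectoryLaw =
      ∫ w, f w * (language A).indicator 1 w ∂M.trajectoryLaw := by
  obtain ⟨C, hC⟩ := hfb
  have hC0 : ∀ w, 0 ≤ C := fun w => (abs_nonneg _).trans (hC w)
  obtain ⟨D, hD⟩ := exists_bound_startRunSum (A := A) x k
  obtain ⟨D', hD'⟩ := exists_bound_runSum (stepWeight A) x k
  rw [M.trajectoryLaw_integral (f := fun w => f w * startRunSum A x k w) (C := C * D) (hf.mul (measurable_startRunSum x k)) fun w => by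
      rw [abs_mul]
      exact mul_le_mul (hC _) (hD _) (abs_nonneg _) (hC0 w),
    M.trajectoryLaw_integral
      (f := fun w => f w * (language A).indicator (1 : (ℕ → Fin n) → ℝ) w) (C := C * 1)
      (hf.mul (measurable_one.indicator hA.measurableSet_language)) fun w => by
      rw [abs_mul]
      exact mul_le_mul (hC _) (abs_indicator_one_le _ _) (abs_nonneg _) (hC0 w)]
  refine Finset.sum_congr rfl fun s _ => ?_
  congr 1
  have e1 : ∀ w, f w * startRunSum A x k w =
      ∑ q, startWeight A q * (f w * runSum (stepWeight A) x k q w) := by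
    intro w
    rw [startRunSum, Finset.mul_sum]
    exact Finset.sum_congr rfl fun _ _ => by ring
  have e2 : ∀ w, f w * (language A).indicator (1 : (ℕ → Fin n) → ℝ) w =
      ∑ q, startWeight A q * (f w * (langFrom A q).indicator (1 : (ℕ → Fin n) → ℝ) w) := by
    intro w
    rw [indicator_language hA, Finset.mul_sum]
    refine Finset.sum_congr rfl fun _ _ => ?_
    simp only [startWeight]
    ring
  simp only [e1, e2]
  have hm : ∀ q, startWeight A q ≠ 0 → q ∈ A.start := fun q h => by
    by_contra h'; exact h (by simp [startWeight, h'])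
  rw [integral_finsetSum, integral_finsetSum]
  · refine Finset.sum_congr rfl fun q _ => ?_
    rw [integral_const_mul, integral_const_mul]
    by_cases h : startWeight A q = 0
    · simp [h]
    · rw [integral_mul_runSum hG hGs hx k hf ⟨C, hC⟩ hfk (hG0 q s (hm q h))]
  · intro q _
    by_cases h : startWeight A q = 0
    · simp [h]
    refine Integrable.const_mul (MarkovChain.integrable_of_bounded (C := C * 1) (hf.mul
        (measurable_indicator_langFrom (hA.unambFrom (hm q h)))) fun w => ?_) _
    rw [Pi.mul_apply, abs_mul]
    exact mul_le_mul (hC _) (abs_indicator_one_le _ _) (abs_nonneg _) (hC0 w)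
  · intro q _
    refine Integrable.const_mul (MarkovChain.integrable_of_bounded (C := C * D') (hf.mul
      (measurable_runSum (stepWeight A) x k q)) fun w => ?_) _
    rw [Pi.mul_apply, abs_mul]
    exact mul_le_mul (hC _) (hD' _ _) (abs_nonneg _) (hC0 w)

/-- The function factors through the finite type of prefixes, on which every function is measurable.
-/
lemma stronglyMeasurable_of_prefix (k : ℕ) {f : (ℕ → Fin n) → ℝ}
    (hfk : ∀ w w', (∀ i ≤ k, w i = w' i) → f w = f w') :
    StronglyMeasurable[Filtration.piLE (X := fun _ : ℕ => Fin n) k] f := by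
  have hfac : Function.FactorsThrough f (Preorder.frestrictLe (π := fun _ : ℕ => Fin n) k) :=
    fun w w' h => hfk w w' ((MarkovChain.frestrictLe_eq_iff k w' w).1 h)
  have e : f = Function.extend (Preorder.frestrictLe (π := fun _ : ℕ => Fin n) k) f 0 ∘
      Preorder.frestrictLe (π := fun _ : ℕ => Fin n) k := by
    funext w
    exact (hfac.extend_apply 0 w).symm
  rw [Filtration.piLE_eq_comap_frestrictLe, e]
  refine Measurable.stronglyMeasurable ?_
  exact Measurable.comp (measurable_of_countable _) (Measurable.of_comap_le le_rfl)

/-- Each coordinate is known at its own time, so the limit in Lévy's theorem is the indicator of the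
language itself. -/
lemma iSup_piLE : (⨆ k, Filtration.piLE (X := fun _ : ℕ => Fin n) k) =
    (MeasurableSpace.pi : MeasurableSpace (ℕ → Fin n)) := by
  refine le_antisymm (iSup_le fun k => Filtration.piLE.le k) ?_
  refine iSup_le fun i => ?_
  refine le_trans ?_ (le_iSup _ i)
  rw [Filtration.piLE_eq_comap_frestrictLe]
  have : (fun w : ℕ → Fin n => w i) = (fun y : Finset.Iic i → Fin n => y ⟨i, Finset.mem_Iic.2 le_rfl⟩) ∘
      Preorder.frestrictLe (π := fun _ : ℕ => Fin n) i := rfl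
  rw [this, ← MeasurableSpace.comap_comp]
  exact MeasurableSpace.comap_mono (measurable_pi_apply _).comap_le

/-- Given a prefix, acceptance means that one of the runs on it continues to an accepting run, and
by unambiguity only one does. So the conditional probability is the sum of the acceptance
probabilities at the ends of these runs; `integral_mul_startRunSum` tests this on prefix events. -/
theorem condExp_language (hA : IsUnambiguous A) (hG : ∀ i, G i → UnambFrom A i.1)
    (hGs : ∀ i j, G i → productMatrix M A i j ≠ 0 → G j)
    (hG0 : ∀ q s, q ∈ A.start → G (q, s)) (hx : ∀ i, G i → x i = acceptProb M A i) (k : ℕ) :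
    startRunSum A x k =ᵐ[M.trajectoryLaw]
      M.trajectoryLaw[(language A).indicator 1 | Filtration.piLE (X := fun _ : ℕ => Fin n) k] := by
  obtain ⟨D, hD⟩ := exists_bound_startRunSum (A := A) x k
  refine ae_eq_condExp_of_forall_setIntegral_eq (Filtration.piLE.le k)
    (MarkovChain.integrable_of_bounded (measurable_one.indicator hA.measurableSet_language)
      (abs_indicator_one_le _))
    (fun _ _ _ => (MarkovChain.integrable_of_bounded (measurable_startRunSum x k) hD).integrableOn)
    ?_ (stronglyMeasurable_of_prefix k fun w w' h => startRunSum_congr x k h).aestronglyMeasurable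
  intro S hS _
  have hS' : MeasurableSet S := Filtration.piLE.le k _ hS
  have hSk : ∀ w w', (∀ i ≤ k, w i = w' i) → (w ∈ S ↔ w' ∈ S) := by
    rw [Filtration.piLE_eq_comap_frestrictLe] at hS
    obtain ⟨T, -, rfl⟩ := hS
    intro w w' h
    rw [Set.mem_preimage, Set.mem_preimage, (MarkovChain.frestrictLe_eq_iff k w' w).2 h]
  have := integral_mul_startRunSum (M := M) hA hG hGs hG0 hx k
    (f := S.indicator 1) (measurable_one.indicator hS') ⟨1, abs_indicator_one_le _⟩
    (fun w w' h => by
      by_cases hw : w ∈ S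
      · simp [hw, (hSk w w' h).1 hw]
      · have hw' : w' ∉ S := fun h' => hw ((hSk w w' h).2 h')
        simp [hw, hw'])
  rw [← integral_indicator hS', ← integral_indicator hS']
  convert this using 2 <;> · funext w; by_cases hw : w ∈ S <;> simp [hw]

/-- If `|v| ≤ C x`, where `x` is the vector of the acceptance probabilities, then the sums of `v`
over the runs are asymptotically not affected by a multiplication with those of `x`. -/
theorem tendsto_integral_mul_sub (hA : IsUnambiguous A) (hG : ∀ i, G i → UnambFrom A i.1)
    (hGs : ∀ i j, G i → productMatrix M A i j ≠ 0 → G j)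
    (hG0 : ∀ q s, q ∈ A.start → G (q, s)) (hx : ∀ i, G i → x i = acceptProb M A i)
    (hx0 : ∀ i, 0 ≤ x i) {v : Fin m × Fin n → ℝ} {C : ℝ} (hv : ∀ i, |v i| ≤ C * x i) :
    Tendsto (fun k => ∫ w, startRunSum A x k w * startRunSum A v k w ∂M.trajectoryLaw -
      ∫ w, startRunSum A v k w ∂M.trajectoryLaw) atTop (nhds 0) := by
  set L : (ℕ → Fin n) → ℝ := (language A).indicator 1 with hL
  have hLi : Integrable L M.trajectoryLaw := MarkovChain.integrable_of_bounded
    (measurable_one.indicator hA.measurableSet_language) (abs_indicator_one_le _)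
  -- Lévy's upward theorem in `L¹`.
  have hlim := hLi.tendsto_eLpNorm_condExp (ℱ := Filtration.piLE (X := fun _ : ℕ => Fin n))
    (by rw [iSup_piLE]; exact (measurable_one.indicator hA.measurableSet_language).stronglyMeasurable)
  have hint : ∀ y k, Integrable (startRunSum A y k) M.trajectoryLaw := fun y k =>
    MarkovChain.integrable_of_bounded (measurable_startRunSum y k)
      (exists_bound_startRunSum y k).choose_spec
  have hae := fun k => condExp_language (M := M) hA hG hGs hG0 hx k
  have hlim2 : Tendsto (fun k => ∫ w, |startRunSum A x k w - L w| ∂M.trajectoryLaw) atTop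
      (nhds 0) := by
    have h2 := (ENNReal.tendsto_toReal ENNReal.zero_ne_top).comp hlim
    refine h2.congr fun k => ?_
    have h3 : eLpNorm (M.trajectoryLaw[L | Filtration.piLE (X := fun _ : ℕ => Fin n) k] - L) 1
        M.trajectoryLaw = eLpNorm (startRunSum A x k - L) 1 M.trajectoryLaw :=
      eLpNorm_congr_ae ((hae k).symm.sub (ae_eq_refl _))
    rw [Function.comp_apply, h3, eLpNorm_one_eq_lintegral_enorm,
      ← integral_norm_eq_lintegral_enorm ((hint x k).sub hLi).aestronglyMeasurable]
    rfl
  have hC : Tendsto (fun k => |C| * ∫ w, |startRunSum A x k w - L w| ∂M.trajectoryLaw) atTop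
      (nhds 0) := by simpa using hlim2.const_mul |C|
  refine squeeze_zero_norm (fun k => ?_) hC
  have hle1 : ∀ᵐ w ∂M.trajectoryLaw, startRunSum A x k w ≤ 1 := by
    have h1 : M.trajectoryLaw[L | Filtration.piLE (X := fun _ : ℕ => Fin n) k]
        ≤ᵐ[M.trajectoryLaw] M.trajectoryLaw[fun _ => (1 : ℝ) |
          Filtration.piLE (X := fun _ : ℕ => Fin n) k] :=
      condExp_mono hLi (integrable_const 1)
        (ae_of_all _ fun w => (le_abs_self _).trans (abs_indicator_one_le _ w))
    rw [condExp_const (Filtration.piLE.le k)] at h1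
    filter_upwards [h1, hae k] with w h1 h2
    rw [h2]; exact h1
  have hprod : Integrable (fun w => startRunSum A x k w * startRunSum A v k w)
      M.trajectoryLaw := by
    obtain ⟨D, hD⟩ := exists_bound_startRunSum (A := A) x k
    obtain ⟨D', hD'⟩ := exists_bound_startRunSum (A := A) v k
    refine MarkovChain.integrable_of_bounded (C := D * D')
      ((measurable_startRunSum x k).mul (measurable_startRunSum v k)) fun w => ?_
    rw [abs_mul]
    exact mul_le_mul (hD _) (hD' _) (abs_nonneg _) ((abs_nonneg _).trans (hD w))
  rw [← integral_sub hprod (hint v k), ← integral_const_mul]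
  refine norm_integral_le_of_norm_le (((hint x k).sub hLi).abs.const_mul |C|) ?_
  filter_upwards [hle1] with w hw
  have hX0 : 0 ≤ startRunSum A x k w := Finset.sum_nonneg fun q _ =>
    mul_nonneg (startWeight_nonneg q) (runSum_nonneg stepWeight_nonneg hx0 k q w)
  have hV : |startRunSum A v k w| ≤ |C| * startRunSum A x k w := by
    rw [startRunSum, startRunSum, Finset.mul_sum]
    refine (Finset.abs_sum_le_sum_abs _ _).trans (Finset.sum_le_sum fun q _ => ?_)
    rw [abs_mul, abs_of_nonneg (startWeight_nonneg q), ← mul_assoc, mul_comm |C|, mul_assoc]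
    refine mul_le_mul_of_nonneg_left ?_ (startWeight_nonneg q)
    rw [← runSum_smul]
    exact abs_runSum_le stepWeight_nonneg (fun i => (hv i).trans
      (mul_le_mul_of_nonneg_right (le_abs_self C) (hx0 i))) k q w
  -- With `X` and `V` for the two run sums, the difference is `-V (1 - X)`, of size at most `|C| X
  -- (1 - X)`. Since `0 ≤ X ≤ 1`, the product `X (1 - X)` is at most `|X - L|` for either value of
  -- `L`.
  have e : startRunSum A x k w * startRunSum A v k w - startRunSum A v k w =
      - (startRunSum A v k w * (1 - startRunSum A x k w)) := by ring
  rw [e, norm_neg, Real.norm_eq_abs, abs_mul, abs_of_nonneg (sub_nonneg.2 hw)]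
  refine (mul_le_mul_of_nonneg_right hV (sub_nonneg.2 hw)).trans ?_
  rw [mul_assoc]
  refine mul_le_mul_of_nonneg_left ?_ (abs_nonneg C)
  by_cases hmem : w ∈ language A
  · have : L w = 1 := by simp [hL, hmem]
    rw [this, abs_sub_comm, abs_of_nonneg (sub_nonneg.2 hw)]
    exact mul_le_of_le_one_left (sub_nonneg.2 hw) hw
  · have : L w = 0 := by simp [hL, hmem]
    rw [this, sub_zero, abs_of_nonneg hX0]
    exact mul_le_of_le_one_right hX0 (by linarith)

end Levy

end Buchi

/-! ### Paths and closed walks -/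

lemma exists_path_of_reflTransGen {κ : Type*} {r : κ → κ → Prop} {a b : κ}
    (h : Relation.ReflTransGen r a b) :
    ∃ (L : ℕ) (c : ℕ → κ), c 0 = a ∧ c L = b ∧ ∀ i < L, r (c i) (c (i + 1)) := by
  induction h using Relation.ReflTransGen.head_induction_on with
  | refl => exact ⟨0, fun _ => b, rfl, rfl, by simp⟩
  | head h1 _ ih =>
    rename_i a _ _
    obtain ⟨L, c, h0, hL, hc⟩ := ih
    refine ⟨L + 1, consWord a c, rfl, hL, ?_⟩
    rintro (_ | i) hi
    · simpa [h0] using h1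
    · exact hc i (by omega)

lemma exists_walk_of_cycle {κ : Type*} {r : κ → κ → Prop} {a b : κ} (hab : r a b)
    (hba : Relation.ReflTransGen r b a) :
    ∃ c : ℕ → κ, c 0 = a ∧ (∀ i, r (c i) (c (i + 1))) ∧ ∃ᶠ i in atTop, c i = a := by
  obtain ⟨L, c, h0, hL, hc⟩ := exists_path_of_reflTransGen hba
  have hd : ∀ i < L + 1, r (consWord a c i) (consWord a c (i + 1)) := by
    rintro (_ | i) hi
    · simpa [h0] using hab
    · exact hc i (by omega)
  -- The cycle of length `L + 1` is traversed periodically.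
  refine ⟨fun i => consWord a c (i % (L + 1)), rfl, fun i => ?_, ?_⟩
  · have hlt : i % (L + 1) < L + 1 := Nat.mod_lt i (Nat.succ_pos L)
    have h1 := hd _ hlt
    by_cases h2 : i % (L + 1) + 1 = L + 1
    · have h3 : (i + 1) % (L + 1) = 0 := by
        rw [Nat.add_mod, ← Nat.add_mod_mod, Nat.mod_mod]
        rcases Nat.eq_zero_or_pos L with rfl | hpos
        · omega
        · rw [Nat.mod_eq_of_lt (show 1 < L + 1 by omega), h2, Nat.mod_self]
      simp only [h3, consWord_zero]
      rw [h2] at h1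
      simpa [hL] using h1
    · have h3 : (i + 1) % (L + 1) = i % (L + 1) + 1 := by
        rw [Nat.add_mod]
        have : L ≠ 0 := by rintro rfl; omega
        rw [Nat.mod_eq_of_lt (show 1 < L + 1 by omega), Nat.mod_eq_of_lt (by omega)]
      simp only [h3]
      exact h1
  · refine frequently_atTop.2 fun x => ⟨(L + 1) * x, by nlinarith, ?_⟩
    simp

namespace Buchi

variable {n m : ℕ} {M : MarkovChain n} {A : NFA (Fin n) (Fin m)}

open Matrix (Reach)

lemma langFrom_nonempty_of_reach {i j : Fin m × Fin n} (h : Reach (productMatrix M A) i j)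
    (hj : (langFrom A j.1).Nonempty) : (langFrom A i.1).Nonempty := by
  induction h using Relation.ReflTransGen.head_induction_on with
  | refl => exact hj
  | head h1 _ ih =>
    rename_i a _ _
    obtain ⟨w, hw⟩ := ih
    exact ⟨consWord a.2 w, mem_langFrom_iff.2 ⟨_, mem_step_of_productMatrix_ne_zero h1, hw⟩⟩

lemma langFrom_nonempty_of_cycle {a b : Fin m × Fin n} (ha : a.1 ∈ A.accept)
    (hab : productMatrix M A a b ≠ 0) (hba : Reach (productMatrix M A) b a) :
    (langFrom A a.1).Nonempty := by
  obtain ⟨c, h0, hc, hf⟩ := exists_walk_of_cycle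
    (r := fun i j => productMatrix M A i j ≠ 0) hab hba
  refine ⟨fun i => (c i).2, fun i => (c i).1, by simp [h0],
    fun i => mem_step_of_productMatrix_ne_zero (hc i), hf.mono fun i hi => ?_⟩
  simpa [hi] using ha

/-- There is a path from `j` to `i` through an accepting state. -/
def ReturnsThroughAccept (M : MarkovChain n) (A : NFA (Fin n) (Fin m)) (i j : Fin m × Fin n) :
    Prop :=
  ∃ f : Fin m × Fin n, f.1 ∈ A.accept ∧ Reach (productMatrix M A) j f ∧
    Reach (productMatrix M A) f i

open Classical in
/-- The product matrix, restricted to the edges from `G` that lie on closed walks through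
accepting states. -/
noncomputable def loopMatrix (M : MarkovChain n) (A : NFA (Fin n) (Fin m))
    (G : Fin m × Fin n → Prop) : Matrix (Fin m × Fin n) (Fin m × Fin n) ℝ :=
  fun i j => if G i ∧ ReturnsThroughAccept M A i j then productMatrix M A i j else 0

section Loop

variable {G : Fin m × Fin n → Prop}

lemma loopMatrix_ne_zero {i j : Fin m × Fin n} : loopMatrix M A G i j ≠ 0 ↔
    G i ∧ ReturnsThroughAccept M A i j ∧ productMatrix M A i j ≠ 0 := by
  unfold loopMatrix
  split_ifs with h
  · simp [h]
  · simp only [ne_eq, not_true_eq_false, false_iff]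
    exact fun h' => h ⟨h'.1, h'.2.1⟩

lemma loopMatrix_nonneg (i j : Fin m × Fin n) : 0 ≤ loopMatrix M A G i j := by
  unfold loopMatrix; split_ifs <;> simp [productMatrix_nonneg]

lemma loopMatrix_le (i j : Fin m × Fin n) : loopMatrix M A G i j ≤ productMatrix M A i j := by
  unfold loopMatrix; split_ifs <;> simp [productMatrix_nonneg]

/-- The edge lies on a closed walk through an accepting state `f`, which `j` reaches; going round
forever spells an accepted word. So the bound for powers applies to the loop matrix. -/
lemma langFrom_nonempty_of_loopMatrix {i j : Fin m × Fin n} (h : loopMatrix M A G i j ≠ 0) :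
    (langFrom A j.1).Nonempty := by
  obtain ⟨-, ⟨f, hf, hjf, hfi⟩, hij⟩ := loopMatrix_ne_zero.1 h
  refine langFrom_nonempty_of_reach hjf ?_
  -- If `f = i`, the closed walk begins with the edge itself, otherwise with the first edge of the
  -- path from `f` to `i`.
  rcases Relation.ReflTransGen.cases_head hfi with rfl | ⟨b, hfb, hbi⟩
  · exact langFrom_nonempty_of_cycle hf hij hjf
  · exact langFrom_nonempty_of_cycle hf hfb (hbi.trans (Relation.ReflTransGen.head hij hjf))

lemma abs_loopMatrix_pow_le_one (hG : ∀ i, G i → UnambFrom A i.1) (k : ℕ) (i j : Fin m × Fin n) :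
    |(loopMatrix M A G ^ k) i j| ≤ 1 :=
  abs_pow_apply_le_one (B := productMatrix M A) (S := fun i => UnambFrom A i.1)
    (T := fun j => (langFrom A j.1).Nonempty)
    (fun _ _ k hi hj => productMatrix_pow_le_one hi hj k) loopMatrix_nonneg loopMatrix_le
    (fun _ _ h => ⟨hG _ (loopMatrix_ne_zero.1 h).1, langFrom_nonempty_of_loopMatrix h⟩) k i j

/-! ### Union bounds -/

/-- The union bound needs only the outer measure, so it can be used for sets given by the existence
of a run, without proving them measurable. -/
lemma law_real_le_sum {σ : Type} [Fintype σ] {h : σ × Fin n → σ × Fin n → ℝ}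
    (hh : ∀ i j, 0 ≤ h i j) (V : Set (ℕ → Fin n)) (V' : σ → Set (ℕ → Fin n)) (q : σ) (s : Fin n)
    (hV : ∀ w, consWord s w ∈ V → ∃ q', 1 ≤ h (q, s) (q', w 0) ∧ w ∈ V' q') :
    (M.law s).real V ≤ ∑ j, M.weightMatrix h (q, s) j * (M.law j.2).real (V' j.1) := by
  rw [M.law_real, Fintype.sum_prod_type, Finset.sum_comm]
  refine Finset.sum_le_sum fun t _ => ?_
  have hP : (0 : ℝ) ≤ M.P s t := by exact_mod_cast M.P_nonneg s t
  simp only [MarkovChain.weightMatrix, mul_assoc]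
  rw [← Finset.mul_sum]
  refine mul_le_mul_of_nonneg_left ?_ hP
  classical
  have h1 : (M.law t).real (consWord s ⁻¹' V) ≤
      (M.law t).real (⋃ q' ∈ Finset.univ.filter fun q' => 1 ≤ h (q, s) (q', t), V' q') := by
    refine ENNReal.toReal_mono (measure_ne_top _ _) (measure_mono_ae ?_)
    filter_upwards [M.ae_law_zero t] with w hw hwV
    obtain ⟨q', h1, h2⟩ := hV w hwV
    rw [hw] at h1
    exact Set.mem_biUnion (by simpa using h1) h2
  refine h1.trans ((measureReal_biUnion_finset_le _ _).trans ?_)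
  refine (Finset.sum_le_sum fun q' hq' => ?_).trans
    (Finset.sum_le_univ_sum_of_nonneg (f := fun q' => h (q, s) (q', t) * (M.law t).real (V' q'))
      fun q' => mul_nonneg (hh _ _) measureReal_nonneg)
  exact le_mul_of_one_le_left measureReal_nonneg (Finset.mem_filter.1 hq').2

/-- Words with an accepting run from `q` that is in an accepting state at time `k`. -/
def langVisiting (A : NFA (Fin n) (Fin m)) (k : ℕ) (q : Fin m) : Set (ℕ → Fin n) :=
  {w | ∃ ρ, AcceptingFrom A q w ρ ∧ ρ k ∈ A.accept}

lemma one_le_stepWeight {i j : Fin m × Fin n} (h : j.1 ∈ A.step i.1 i.2) :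
    1 ≤ stepWeight A i j := by
  simp [stepWeight, h]

lemma law_real_langVisiting_succ_le (k : ℕ) (i : Fin m × Fin n) :
    (M.law i.2).real (langVisiting A (k + 1) i.1) ≤
      ∑ j, productMatrix M A i j * (M.law j.2).real (langVisiting A k j.1) := by
  refine law_real_le_sum stepWeight_nonneg _ (langVisiting A k) i.1 i.2 ?_
  rintro w ⟨ρ, hρ, hk⟩
  have h0 := hρ.2.1 0
  rw [hρ.1] at h0
  exact ⟨ρ 1, one_le_stepWeight h0, tailWord ρ, hρ.tail, hk⟩

lemma langVisiting_subset (k : ℕ) (q : Fin m) : langVisiting A k q ⊆ langFrom A q :=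
  fun _ ⟨ρ, h, _⟩ => ⟨ρ, h⟩

/-- States with positive acceptance probability reach accepting states, through such states. -/
theorem exists_reach_accept {i : Fin m × Fin n} (hi : 0 < acceptProb M A i) :
    ∃ f : Fin m × Fin n, f.1 ∈ A.accept ∧ Relation.ReflTransGen
      (fun a b => productMatrix M A a b ≠ 0 ∧ 0 < acceptProb M A b) i f := by
  by_contra hno
  push Not at hno
  -- Words accepted by a run that is in an accepting state at time `k` are null: steps into states
  -- of acceptance probability zero contribute nothing, and all other steps stay among the states
  -- that are supposed to contain no accepting one.
  have hzero : ∀ k (j : Fin m × Fin n), (0 < acceptProb M A j → Relation.ReflTransGen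
      (fun a b => productMatrix M A a b ≠ 0 ∧ 0 < acceptProb M A b) i j) →
      (M.law j.2).real (langVisiting A k j.1) = 0 := by
    intro k
    induction k with
    | zero =>
      intro j hj
      by_cases hp : 0 < acceptProb M A j
      · have hna : j.1 ∉ A.accept := fun h => hno j h (hj hp)
        have : langVisiting A 0 j.1 = ∅ := by
          ext w
          simp only [langVisiting, Set.mem_ofPred_eq, Set.mem_empty_iff_false, iff_false]
          rintro ⟨ρ, hρ, h0⟩
          rw [hρ.1] at h0
          exact hna h0
        rw [this]; simp
      · refine le_antisymm ((measureReal_mono (langVisiting_subset 0 j.1)).trans ?_)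
          measureReal_nonneg
        exact not_lt.1 hp
    | succ k ih =>
      intro j hj
      by_cases hp : 0 < acceptProb M A j
      · refine le_antisymm ((law_real_langVisiting_succ_le k j).trans ?_) measureReal_nonneg
        refine (Finset.sum_eq_zero fun l _ => ?_).le
        by_cases hB : productMatrix M A j l = 0
        · simp [hB]
        · rw [ih l fun hl => (hj hp).tail ⟨hB, hl⟩, mul_zero]
      · refine le_antisymm ((measureReal_mono (langVisiting_subset _ j.1)).trans ?_)
          measureReal_nonneg
        exact not_lt.1 hp
  have hsub : langFrom A i.1 ⊆ ⋃ k, langVisiting A k i.1 := by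
    rintro w ⟨ρ, hρ⟩
    obtain ⟨k, hk⟩ := hρ.2.2.exists
    exact Set.mem_iUnion.2 ⟨k, ρ, hρ, hk⟩
  have h0 : M.law i.2 (⋃ k, langVisiting A k i.1) = 0 :=
    measure_iUnion_null fun k =>
      (measureReal_eq_zero_iff).1 (hzero k i fun _ => Relation.ReflTransGen.refl)
  have : acceptProb M A i = 0 := by
    rw [acceptProb, measureReal_eq_zero_iff]
    exact measure_mono_null hsub h0
  exact hi.ne' this

/-- From a state of positive acceptance probability one reaches the support of each fixed point
of the loop matrix that dominates the averages of the powers. -/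
theorem exists_reach_support (hG : ∀ i, G i → UnambFrom A i.1)
    (hGs : ∀ i j, G i → productMatrix M A i j ≠ 0 → G j) {u g : Fin m × Fin n → ℝ}
    (hu : (loopMatrix M A G).mulVec u = u)
    (hug : u + (g - (loopMatrix M A G).mulVec g) = fun _ => 1) {i : Fin m × Fin n} (hi : G i)
    (hp : 0 < acceptProb M A i) : ∃ j, Reach (productMatrix M A) i j ∧ 0 < u j := by
  classical
  let r : Fin m × Fin n → Fin m × Fin n → Prop :=
    fun a b => productMatrix M A a b ≠ 0 ∧ 0 < acceptProb M A b
  -- A state `j` with the fewest descendants in the graph `r` lies in a bottom component: all its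
  -- descendants lead back to it.
  let c : Fin m × Fin n → ℕ := fun a => (Finset.univ.filter fun b => Relation.ReflTransGen r a b).card
  obtain ⟨j, hij, hmin⟩ := Finset.exists_min_image
    (Finset.univ.filter fun b => Relation.ReflTransGen r i b) c
    ⟨i, by simp [Relation.ReflTransGen.refl]⟩
  replace hij : Relation.ReflTransGen r i j := by simpa using hij
  have hback : ∀ a, Relation.ReflTransGen r j a → Relation.ReflTransGen r a j := by
    intro a hja
    have hsub : (Finset.univ.filter fun b => Relation.ReflTransGen r a b) ⊆
        Finset.univ.filter fun b => Relation.ReflTransGen r j b := by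
      intro b hb
      simp only [Finset.mem_filter, Finset.mem_univ, true_and] at hb ⊢
      exact hja.trans hb
    have heq := Finset.eq_of_subset_of_card_le hsub (hmin a (by simpa using hij.trans hja))
    have : j ∈ Finset.univ.filter fun b => Relation.ReflTransGen r a b := by
      rw [heq]; simp [Relation.ReflTransGen.refl]
    simpa using this
  have hr : ∀ {a b}, Relation.ReflTransGen r a b → Reach (productMatrix M A) a b :=
    fun h => Relation.ReflTransGen.mono (fun _ _ h => h.1) _ _ h
  have hpos : ∀ {a b}, Relation.ReflTransGen r a b → G a → 0 < acceptProb M A a →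
      G b ∧ 0 < acceptProb M A b := by
    intro a b h ha hpa
    induction h with
    | refl => exact ⟨ha, hpa⟩
    | tail _ h2 ih => exact ⟨hGs _ _ ih.1 h2.1, h2.2⟩
  have hj := hpos hij hi hp
  refine ⟨j, hr hij, ?_⟩
  -- Within the component of `j`, every edge into a positive state lies on a closed walk through an
  -- accepting state, by `exists_reach_accept`. Hence no such edge is lost in the loop matrix, and
  -- the acceptance probabilities cut off outside are a subsolution.
  let v : Fin m × Fin n → ℝ := fun a => if Relation.ReflTransGen r j a then acceptProb M A a else 0
  have hv1 : ∀ a, v a ≤ 1 := fun a => by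
    simp only [v]; split_ifs
    · exact acceptProb_le_one a
    · exact zero_le_one
  have hv0 : ∀ a, 0 ≤ v a := fun a => by
    simp only [v]; split_ifs
    · exact acceptProb_nonneg a
    · exact le_rfl
  have hstep : ∀ a, v a ≤ (loopMatrix M A G).mulVec v a := by
    intro a
    by_cases ha : Relation.ReflTransGen r j a
    · have hGa := hpos ha hj.1 hj.2
      simp only [v, ha, if_true]
      rw [acceptProb_eq_mulVec (hG _ hGa.1)]
      refine Finset.sum_le_sum fun b _ => ?_
      change productMatrix M A a b * acceptProb M A b ≤ loopMatrix M A G a b * v b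
      by_cases hB : productMatrix M A a b = 0
      · rw [hB, zero_mul]
        exact mul_nonneg (loopMatrix_nonneg _ _) (hv0 b)
      by_cases hb : 0 < acceptProb M A b
      · have hjb : Relation.ReflTransGen r j b := ha.tail ⟨hB, hb⟩
        obtain ⟨f, hf, hbf⟩ := exists_reach_accept hb
        have hfa : Relation.ReflTransGen r f a := (hback f (hjb.trans hbf)).trans ha
        have : loopMatrix M A G a b = productMatrix M A a b := by
          rw [loopMatrix, if_pos ⟨hGa.1, f, hf, hr hbf, hr hfa⟩]
        have hvb : v b = acceptProb M A b := if_pos hjb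
        rw [this, hvb]
      · have : acceptProb M A b = 0 := le_antisymm (not_lt.1 hb) (acceptProb_nonneg b)
        rw [this, mul_zero]
        exact mul_nonneg (loopMatrix_nonneg _ _) (hv0 b)
    · simp only [v, ha, if_false]
      exact Finset.sum_nonneg fun b _ => mul_nonneg (loopMatrix_nonneg _ _) (hv0 b)
  -- As `v ≤ 1`, iterating the subsolution inequality gives a lower bound for all iterates of `1`,
  -- which passes to the average `u`.
  have hpow : ∀ k a, v a ≤ ((loopMatrix M A G) ^ k).mulVec (fun _ => 1) a := by
    intro k
    induction k with
    | zero => intro a; simpa using hv1 a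
    | succ k ih =>
      intro a
      rw [pow_succ', ← Matrix.mulVec_mulVec]
      exact (hstep a).trans (Matrix.mulVec_le_mulVec loopMatrix_nonneg ih a)
  have := Matrix.le_of_fixed_add_sub (abs_loopMatrix_pow_le_one hG) hu hug (hpow · j)
  refine lt_of_lt_of_le ?_ this
  simp only [v, Relation.ReflTransGen.refl, if_true]
  exact hj.2

end Loop

end Buchi

namespace Buchi

open Matrix (Reach)

variable {n m : ℕ} {M : MarkovChain n} {A : NFA (Fin n) (Fin m)} {G : Fin m × Fin n → Prop}

/-! ### Runs along closed walks through accepting states -/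

lemma reach_of_productMatrix_ne_zero {i j : Fin m × Fin n} (h : productMatrix M A i j ≠ 0) :
    Reach (productMatrix M A) i j :=
  Relation.ReflTransGen.single h

section

variable (hGs : ∀ i j, G i → productMatrix M A i j ≠ 0 → G j)
include hGs

lemma closed_of_reach {i j : Fin m × Fin n} (hi : G i) (h : Reach (productMatrix M A) i j) :
    G j := by
  induction h with
  | refl => exact hi
  | tail _ h2 ih => exact hGs _ _ ih h2

/-- All edges of a path from `j` back to `i` are edges of the loop matrix. -/
lemma reach_loopMatrix {i j : Fin m × Fin n} (hij : loopMatrix M A G i j ≠ 0)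
    {a b : Fin m × Fin n} (hja : Reach (productMatrix M A) j a)
    (hab : Reach (productMatrix M A) a b) (hbi : Reach (productMatrix M A) b i) :
    Reach (loopMatrix M A G) a b := by
  obtain ⟨hGi, ⟨f, hf, hjf, hfi⟩, hB⟩ := loopMatrix_ne_zero.1 hij
  induction hab using Relation.ReflTransGen.head_induction_on with
  | refl => exact Relation.ReflTransGen.refl
  | head h1 h2 ih =>
    rename_i a c
    have hedge := reach_of_productMatrix_ne_zero hB
    have hGa : G a := closed_of_reach hGs hGi (hedge.trans hja)
    refine Relation.ReflTransGen.head ?_ (ih (hja.trans (reach_of_productMatrix_ne_zero h1)))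
    refine loopMatrix_ne_zero.2 ⟨hGa, ⟨f, hf, ?_, ?_⟩, h1⟩
    · exact h2.trans (hbi.trans (hedge.trans hjf))
    · exact hfi.trans (hedge.trans hja)

lemma loopMatrix_reach_back {i j : Fin m × Fin n} (hij : loopMatrix M A G i j ≠ 0) :
    Reach (loopMatrix M A G) j i := by
  obtain ⟨_, ⟨f, _, hjf, hfi⟩, _⟩ := loopMatrix_ne_zero.1 hij
  exact reach_loopMatrix hGs hij .refl (hjf.trans hfi) .refl

lemma loopMatrix_reach_accept {i j : Fin m × Fin n} (hij : loopMatrix M A G i j ≠ 0) :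
    ∃ f : Fin m × Fin n, f.1 ∈ A.accept ∧ Reach (loopMatrix M A G) j f := by
  obtain ⟨_, ⟨f, hf, hjf, hfi⟩, _⟩ := loopMatrix_ne_zero.1 hij
  exact ⟨f, hf, reach_loopMatrix hGs hij .refl hjf hfi⟩

variable {u : Fin m × Fin n → ℝ} (hu : (loopMatrix M A G).mulVec u = u) (hu0 : ∀ i, 0 ≤ u i)
include hu hu0

omit hGs in
lemma fixed_pos_of_reach {i j : Fin m × Fin n} (h : Reach (loopMatrix M A G) i j) (hj : 0 < u j) :
    0 < u i := by
  induction h using Relation.ReflTransGen.head_induction_on with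
  | refl => exact hj
  | head h1 _ ih =>
    rename_i a c _
    rw [← hu]
    refine lt_of_lt_of_le (mul_pos (lt_of_le_of_ne (loopMatrix_nonneg a c) (Ne.symm h1)) ih) ?_
    exact Finset.single_le_sum (f := fun c => loopMatrix M A G a c * u c)
      (fun c _ => mul_nonneg (loopMatrix_nonneg _ _) (hu0 c)) (Finset.mem_univ c)

/-- Positivity spreads backwards along edges, and each edge of the loop matrix has a way back inside
it. So these edges never leave the support of `u`. -/
lemma fixed_pos_of_edge {i j : Fin m × Fin n} (hi : 0 < u i) (hij : loopMatrix M A G i j ≠ 0) :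
    0 < u j :=
  fixed_pos_of_reach hu hu0 (loopMatrix_reach_back hGs hij) hi

omit hGs hu0 in
lemma exists_edge_of_fixed_pos {i : Fin m × Fin n} (hi : 0 < u i) :
    ∃ j, loopMatrix M A G i j ≠ 0 := by
  rw [← hu] at hi
  obtain ⟨j, _, hj⟩ := Finset.exists_ne_zero_of_sum_ne_zero hi.ne'
  exact ⟨j, left_ne_zero_of_mul hj⟩

lemma exists_reach_accept_of_fixed_pos {i : Fin m × Fin n} (hi : 0 < u i) :
    ∃ f : Fin m × Fin n, f.1 ∈ A.accept ∧ Reach (loopMatrix M A G) i f := by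
  obtain ⟨j, hij⟩ := exists_edge_of_fixed_pos hu hi
  obtain ⟨f, hf, hjf⟩ := loopMatrix_reach_accept hGs hij
  exact ⟨f, hf, hjf.head hij⟩

/-- A subsolution of the equations of the loop matrix without the rows of the accepting states
vanishes. -/
lemma eq_zero_of_le_avoiding {z : Fin m × Fin n → ℝ} (hz0 : ∀ i, 0 ≤ z i)
    (hz : ∀ i, 0 < u i → z i ≤ (loopMatrix M A G).mulVec z i)
    (hza : ∀ i, i.1 ∈ A.accept → z i = 0) (hzu : ∀ i, u i = 0 → z i = 0) : ∀ i, z i = 0 := by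
  by_contra hne
  push Not at hne
  obtain ⟨i₁, hi₁⟩ := hne
  have hupos : ∀ i, z i ≠ 0 → 0 < u i := fun i h => lt_of_le_of_ne (hu0 i) fun e => h (hzu i e.symm)
  have : Nonempty (Fin m × Fin n) := ⟨i₁⟩
  -- Maximum principle for the ratio `z / u`; where `u` vanishes, so does `z`, and division by zero
  -- gives the harmless value `0`.
  obtain ⟨i₀, hmax⟩ := Finite.exists_max fun i => z i / u i
  set c := z i₀ / u i₀ with hc
  have hc0 : 0 < c := lt_of_lt_of_le
    (div_pos (lt_of_le_of_ne (hz0 i₁) (Ne.symm hi₁)) (hupos _ hi₁)) (hmax i₁)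
  have hle : ∀ i, z i ≤ c * u i := by
    intro i
    rcases (hu0 i).eq_or_lt with h | h
    · rw [hzu i h.symm, ← h, mul_zero]
    · exact (div_le_iff₀ h).1 (hmax i)
  have hi₀ : 0 < u i₀ := by
    refine lt_of_le_of_ne (hu0 _) fun h => hc0.ne' ?_
    rw [hc, ← h, div_zero]
  -- Where the maximal ratio is attained, it is attained at all successors too, because `z ≤ c u`
  -- and `u` is a fixed point.
  have hstep : ∀ i j, z i = c * u i → 0 < u i → loopMatrix M A G i j ≠ 0 → z j = c * u j := by
    intro i j hi hui hij
    by_contra hj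
    have hlt : z j < c * u j := lt_of_le_of_ne (hle j) hj
    have h1 : (loopMatrix M A G).mulVec z i < (loopMatrix M A G).mulVec (fun j => c * u j) i :=
      Finset.sum_lt_sum (fun l _ => mul_le_mul_of_nonneg_left (hle l) (loopMatrix_nonneg _ _))
        ⟨j, Finset.mem_univ j, mul_lt_mul_of_pos_left hlt
          (lt_of_le_of_ne (loopMatrix_nonneg _ _) (Ne.symm hij))⟩
    have h2 : (loopMatrix M A G).mulVec (fun j => c * u j) i = c * u i := by
      have := congrFun (Matrix.mulVec_smul (loopMatrix M A G) c u) i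
      rw [hu] at this
      exact this
    linarith [hz i hui]
  -- The positive ratio `c` would be carried along to an accepting state, where `z` vanishes.
  obtain ⟨f, hf, hreach⟩ := exists_reach_accept_of_fixed_pos hGs hu hu0 hi₀
  have hall : ∀ b, Reach (loopMatrix M A G) i₀ b → z b = c * u b ∧ 0 < u b := by
    intro b hb
    induction hb with
    | refl => exact ⟨by rw [hc]; field_simp, hi₀⟩
    | tail _ h2 ih =>
      exact ⟨hstep _ _ ih.1 ih.2 h2, fixed_pos_of_edge hGs hu hu0 ih.2 h2⟩
  have hfin := hall f hreach
  have := mul_pos hc0 hfin.2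
  rw [← hfin.1, hza f hf] at this
  exact lt_irrefl _ this

end

/-- `ρ` is an infinite run on `w` from `q` along the edges of the loop matrix. -/
def LoopRun (M : MarkovChain n) (A : NFA (Fin n) (Fin m)) (G : Fin m × Fin n → Prop) (q : Fin m)
    (w : ℕ → Fin n) (ρ : ℕ → Fin m) : Prop :=
  ρ 0 = q ∧ ∀ i, loopMatrix M A G (ρ i, w i) (ρ (i + 1), w (i + 1)) ≠ 0

/-- There is a run of length `k` along the edges of the loop matrix. -/
def HasLoopPath (M : MarkovChain n) (A : NFA (Fin n) (Fin m)) (G : Fin m × Fin n → Prop) :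
    ℕ → Fin m → (ℕ → Fin n) → Prop
  | 0, _, _ => True
  | k + 1, q, w => ∃ q', loopMatrix M A G (q, w 0) (q', w 1) ≠ 0 ∧ HasLoopPath M A G k q' (tailWord w)

lemma LoopRun.tail {q : Fin m} {w : ℕ → Fin n} {ρ : ℕ → Fin m} (h : LoopRun M A G q w ρ) :
    LoopRun M A G (ρ 1) (tailWord w) (tailWord ρ) :=
  ⟨rfl, fun i => h.2 (i + 1)⟩

lemma HasLoopPath.of_succ {k : ℕ} {q : Fin m} {w : ℕ → Fin n}
    (h : HasLoopPath M A G (k + 1) q w) : HasLoopPath M A G k q w := by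
  induction k generalizing q w with
  | zero => trivial
  | succ k ih =>
    obtain ⟨q', h1, h2⟩ := h
    exact ⟨q', h1, ih h2⟩

lemma HasLoopPath.of_le {k l : ℕ} (hkl : k ≤ l) {q : Fin m} {w : ℕ → Fin n}
    (h : HasLoopPath M A G l q w) : HasLoopPath M A G k q w := by
  induction hkl with
  | refl => exact h
  | step _ ih => exact ih h.of_succ

/-- There are finitely many candidates; if each failed at some length, no path longer than all these
lengths could exist. -/
lemma exists_next_of_forall_hasLoopPath {q : Fin m} {w : ℕ → Fin n}
    (h : ∀ k, HasLoopPath M A G k q w) :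
    ∃ q', loopMatrix M A G (q, w 0) (q', w 1) ≠ 0 ∧ ∀ k, HasLoopPath M A G k q' (tailWord w) := by
  by_contra hno
  push Not at hno
  have : ∀ q', ∃ k, loopMatrix M A G (q, w 0) (q', w 1) ≠ 0 →
      ¬ HasLoopPath M A G k q' (tailWord w) := by
    intro q'
    by_cases hq' : loopMatrix M A G (q, w 0) (q', w 1) ≠ 0
    · obtain ⟨k, hk⟩ := hno q' hq'
      exact ⟨k, fun _ => hk⟩
    · exact ⟨0, fun h => absurd h hq'⟩
  choose f hf using this
  obtain ⟨q', h1, h2⟩ := h (Finset.univ.sup f + 1)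
  exact hf q' h1 (h2.of_le (Finset.le_sup (Finset.mem_univ q')))

/-- König's lemma for the finitely branching tree of loop paths over `w`. -/
theorem exists_loopRun {q : Fin m} {w : ℕ → Fin n} (h : ∀ k, HasLoopPath M A G k q w) :
    ∃ ρ, LoopRun M A G q w ρ := by
  classical
  have hnext : ∀ (i : ℕ) (q : {q : Fin m // ∀ k, HasLoopPath M A G k q (fun j => w (i + j))}),
      ∃ q' : {q' : Fin m // ∀ k, HasLoopPath M A G k q' (fun j => w (i + 1 + j))},
        loopMatrix M A G (q.1, w i) (q'.1, w (i + 1)) ≠ 0 := by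
    rintro i ⟨q, hq⟩
    obtain ⟨q', h1, h2⟩ := exists_next_of_forall_hasLoopPath hq
    refine ⟨⟨q', fun k => ?_⟩, h1⟩
    convert h2 k using 2 with j
    rw [tailWord_apply]
    congr 1
    omega
  choose next hnext using hnext
  let ρ : (i : ℕ) → {q : Fin m // ∀ k, HasLoopPath M A G k q (fun j => w (i + j))} :=
    fun i => Nat.rec ⟨q, by simpa using h⟩ (fun i q => next i q) i
  exact ⟨fun i => (ρ i).1, rfl, fun i => hnext i (ρ i)⟩

open Classical in
/-- Indicator of the edges of the loop matrix. -/
noncomputable def loopWeight (M : MarkovChain n) (A : NFA (Fin n) (Fin m))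
    (G : Fin m × Fin n → Prop) : Fin m × Fin n → Fin m × Fin n → ℝ :=
  fun i j => if loopMatrix M A G i j ≠ 0 then 1 else 0

lemma loopWeight_nonneg (i j : Fin m × Fin n) : 0 ≤ loopWeight M A G i j := by
  unfold loopWeight; split_ifs <;> simp

lemma loopWeight_le (i j : Fin m × Fin n) : loopWeight M A G i j ≤ stepWeight A i j := by
  unfold loopWeight
  split_ifs with h
  · exact one_le_stepWeight (mem_step_of_productMatrix_ne_zero (loopMatrix_ne_zero.1 h).2.2)
  · exact stepWeight_nonneg _ _

lemma weightMatrix_loopWeight : M.weightMatrix (loopWeight M A G) = loopMatrix M A G := by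
  funext i j
  by_cases h : loopMatrix M A G i j ≠ 0
  · have h' := loopMatrix_ne_zero.1 h
    have h2 : j.1 ∈ A.step i.1 i.2 := mem_step_of_productMatrix_ne_zero h'.2.2
    rw [MarkovChain.weightMatrix, loopWeight, if_pos h, loopMatrix, if_pos ⟨h'.1, h'.2.1⟩,
      productMatrix, MarkovChain.weightMatrix, stepWeight, if_pos h2]
  · rw [MarkovChain.weightMatrix, loopWeight, if_neg h]
    push Not at h
    rw [h, mul_zero]

lemma law_real_le_sum_loopMatrix (V : Set (ℕ → Fin n)) (V' : Fin m → Set (ℕ → Fin n))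
    (i : Fin m × Fin n) (hV : ∀ w, consWord i.2 w ∈ V →
      ∃ q', loopMatrix M A G i (q', w 0) ≠ 0 ∧ w ∈ V' q') :
    (M.law i.2).real V ≤ ∑ j, loopMatrix M A G i j * (M.law j.2).real (V' j.1) := by
  rw [← weightMatrix_loopWeight]
  refine law_real_le_sum loopWeight_nonneg V V' i.1 i.2 fun w hw => ?_
  obtain ⟨q', h1, h2⟩ := hV w hw
  refine ⟨q', ?_, h2⟩
  rw [loopWeight, if_pos h1]

lemma hasLoopPath_of_runSum_ne_zero {y : Fin m × Fin n → ℝ} {k : ℕ} {q : Fin m} {w : ℕ → Fin n}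
    (h : runSum (loopWeight M A G) y k q w ≠ 0) : HasLoopPath M A G k q w := by
  induction k generalizing q w with
  | zero => trivial
  | succ k ih =>
    obtain ⟨q', _, hq'⟩ := Finset.exists_ne_zero_of_sum_ne_zero h
    refine ⟨q', ?_, ih (right_ne_zero_of_mul hq')⟩
    by_contra hn
    exact left_ne_zero_of_mul hq' (if_neg (by simpa using hn))

lemma measurableSet_hasLoopPath (k : ℕ) (q : Fin m) :
    MeasurableSet {w | HasLoopPath M A G k q w} := by
  induction k generalizing q with
  | zero => simp [HasLoopPath]
  | succ k ih =>
    have : {w | HasLoopPath M A G (k + 1) q w} = ⋃ q', {w : ℕ → Fin n |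
        loopMatrix M A G (q, w 0) (q', w 1) ≠ 0} ∩ tailWord ⁻¹' {w | HasLoopPath M A G k q' w} := by
      ext w; simp [HasLoopPath]
    rw [this]
    refine MeasurableSet.iUnion fun q' => MeasurableSet.inter ?_ ((ih q').preimage measurable_tailWord)
    exact ((measurable_pi_apply (X := fun _ => Fin n) 0).prodMk (measurable_pi_apply 1))
      (Set.toFinite {y : Fin n × Fin n | loopMatrix M A G (q, y.1) (q', y.2) ≠ 0}).measurableSet

lemma runSum_mono_weight {σ : Type} [Fintype σ] {h h' : σ × Fin n → σ × Fin n → ℝ}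
    {y : σ × Fin n → ℝ} (hh : ∀ i j, 0 ≤ h i j) (hle : ∀ i j, h i j ≤ h' i j) (hy : ∀ i, 0 ≤ y i)
    (k : ℕ) (q : σ) (w : ℕ → Fin n) : runSum h y k q w ≤ runSum h' y k q w := by
  induction k generalizing q w with
  | zero => exact le_rfl
  | succ k ih =>
    exact Finset.sum_le_sum fun q' _ => mul_le_mul (hle _ _) (ih _ _)
      (runSum_nonneg hh hy _ _ _) ((hh _ _).trans (hle _ _))

/-! ### Positive acceptance probability on the support of a fixed point -/

section

variable (hG : ∀ i, G i → UnambFrom A i.1) (hGs : ∀ i j, G i → productMatrix M A i j ≠ 0 → G j)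
  {u : Fin m × Fin n → ℝ} (hu : (loopMatrix M A G).mulVec u = u) (hu0 : ∀ i, 0 ≤ u i)
include hG hGs hu hu0

omit hG in
lemma langFrom_nonempty_of_fixed_pos {i : Fin m × Fin n} (hi : 0 < u i) :
    (langFrom A i.1).Nonempty := by
  obtain ⟨j, hij⟩ := exists_edge_of_fixed_pos hu hi
  have hji := loopMatrix_reach_back hGs hij
  have hb : Reach (productMatrix M A) i j :=
    reach_of_productMatrix_ne_zero (loopMatrix_ne_zero.1 hij).2.2
  exact langFrom_nonempty_of_reach hb (langFrom_nonempty_of_loopMatrix hij)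

omit hG hu0 in
lemma pos_imp_mem {i : Fin m × Fin n} (hi : 0 < u i) : G i := by
  obtain ⟨j, hij⟩ := exists_edge_of_fixed_pos hu hi
  exact (loopMatrix_ne_zero.1 hij).1

/-- Loop paths are runs of the automaton, and at most one of them ends at any given state of
positive weight, since such states have nonempty language. -/
lemma runSum_loopWeight_le {q : Fin m} (hq : UnambFrom A q) (k : ℕ) (w : ℕ → Fin n) :
    runSum (loopWeight M A G) u k q w ≤ ∑ i, u i := by
  refine (runSum_mono_weight loopWeight_nonneg loopWeight_le hu0 k q w).trans ?_
  have e : u = fun i => ∑ a, u a * (Pi.single a 1 : Fin m × Fin n → ℝ) i := by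
    funext i
    simp [Pi.single_apply]
  conv_lhs => rw [e]
  rw [runSum_sum]
  refine Finset.sum_le_sum fun a _ => ?_
  rw [runSum_smul]
  rcases (hu0 a).eq_or_lt with h | h
  · rw [← h, zero_mul]
  · exact mul_le_of_le_one_right h.le
      (runSum_single_le_one (langFrom_nonempty_of_fixed_pos hGs hu hu0 h) a.2 k hq w)

/-- `u i` is the expectation of the run sum of `u`, which is at most `∑ i, u i` and vanishes if
there is no loop path of length `k`. The constant is independent of `k`, so it survives the limit.
-/
lemma exists_le_law_real_hasLoopPath {i : Fin m × Fin n} (hi : 0 < u i) :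
    ∃ c > 0, ∀ k, c ≤ (M.law i.2).real {w | HasLoopPath M A G k i.1 w} := by
  have hS : 0 < ∑ i, u i := Finset.sum_pos' (fun i _ => hu0 i) ⟨i, Finset.mem_univ i, hi⟩
  refine ⟨u i / ∑ i, u i, div_pos hi hS, fun k => ?_⟩
  rw [div_le_iff₀ hS]
  have h1 := M.integral_runSum (loopWeight M A G) u k i.1 i.2
  rw [weightMatrix_loopWeight, Matrix.mulVec_pow_eq_self hu] at h1
  change _ = u i at h1
  rw [← h1, mul_comm, ← integral_indicator_one (measurableSet_hasLoopPath k i.1),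
    ← integral_const_mul]
  have hbd := runSum_loopWeight_le hG hGs hu hu0 (hG i (pos_imp_mem hGs hu hi)) k
  have hnn := runSum_nonneg (loopWeight_nonneg (M := M) (A := A) (G := G)) hu0 k i.1
  refine integral_mono (MarkovChain.integrable_of_bounded (measurable_runSum _ _ _ _)
    (C := ∑ i, u i) fun w => by rw [abs_of_nonneg (hnn w)]; exact hbd w)
    ((MarkovChain.integrable_of_bounded (measurable_one.indicator
      (measurableSet_hasLoopPath k i.1)) (abs_indicator_one_le _)).const_mul _) fun w => ?_
  by_cases hw : HasLoopPath M A G k i.1 w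
  · simpa [hw] using hbd w
  · have : runSum (loopWeight M A G) u k i.1 w = 0 := by
      by_contra h
      exact hw (hasLoopPath_of_runSum_ne_zero h)
    simp [hw, this]

-- For `k = 0` these probabilities, set to zero off the support of `u`, are a subsolution that
-- vanishes at accepting states, so `eq_zero_of_le_avoiding` applies. Larger `k` reduce to this by
-- the union bound, one step at a time.
omit hG in
lemma law_real_avoiding_eq_zero (k : ℕ) {i : Fin m × Fin n} (hi : 0 < u i) :
    (M.law i.2).real {w | ∃ ρ, LoopRun M A G i.1 w ρ ∧ ∀ l ≥ k, ρ l ∉ A.accept} = 0 := by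
  classical
  induction k generalizing i with
  | zero =>
    let V : Fin m → Set (ℕ → Fin n) :=
      fun q => {w | ∃ ρ, LoopRun M A G q w ρ ∧ ∀ l ≥ 0, ρ l ∉ A.accept}
    have hz := eq_zero_of_le_avoiding hGs hu hu0
      (z := fun i => if u i = 0 then 0 else (M.law i.2).real (V i.1))
      (fun i => by split_ifs; exacts [le_rfl, measureReal_nonneg])
      (fun i hi => by
        rw [if_neg hi.ne']
        refine (law_real_le_sum_loopMatrix (M := M) (A := A) (G := G) (V i.1) V i ?_).trans
          (Finset.sum_le_sum fun j _ => ?_)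
        · rintro w ⟨ρ, hρ, hacc⟩
          refine ⟨ρ 1, ?_, tailWord ρ, hρ.tail, fun l _ => hacc (l + 1) (Nat.zero_le _)⟩
          have := hρ.2 0
          rw [hρ.1] at this
          exact this
        · change loopMatrix M A G i j * (M.law j.2).real (V j.1) ≤ loopMatrix M A G i j *
            (if u j = 0 then 0 else (M.law j.2).real (V j.1))
          by_cases hB : loopMatrix M A G i j = 0
          · simp [hB]
          · rw [if_neg (fixed_pos_of_edge hGs hu hu0 hi hB).ne'])
      (fun i ha => by
        have : V i.1 = ∅ := by
          ext w
          simp only [V, Set.mem_ofPred_eq, Set.mem_empty_iff_false, iff_false]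
          rintro ⟨ρ, hρ, hacc⟩
          have := hacc 0 le_rfl
          rw [hρ.1] at this
          exact this ha
        simp [this])
      (fun i hi => if_pos hi) i
    simpa [hi.ne', V] using hz
  | succ k ih =>
    refine le_antisymm ((law_real_le_sum_loopMatrix (M := M) (A := A) (G := G) _
      (fun q => {w | ∃ ρ, LoopRun M A G q w ρ ∧ ∀ l ≥ k, ρ l ∉ A.accept}) i ?_).trans
      (Finset.sum_eq_zero fun j _ => ?_).le) measureReal_nonneg
    · rintro w ⟨ρ, hρ, hacc⟩
      refine ⟨ρ 1, ?_, tailWord ρ, hρ.tail, fun l hl => hacc (l + 1) (by omega)⟩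
      have := hρ.2 0
      rw [hρ.1] at this
      exact this
    · by_cases hB : loopMatrix M A G i j = 0
      · simp [hB]
      · rw [ih (fixed_pos_of_edge hGs hu hu0 hi hB), mul_zero]

/-- The acceptance probability is positive on the support of a nonnegative fixed point of the
loop matrix. -/
theorem acceptProb_pos_of_fixed_pos {i : Fin m × Fin n} (hi : 0 < u i) :
    0 < acceptProb M A i := by
  obtain ⟨c, hc, hle⟩ := exists_le_law_real_hasLoopPath hG hGs hu hu0 hi
  refine lt_of_lt_of_le hc ?_
  have hanti : Antitone fun k => {w | HasLoopPath M A G k i.1 w} :=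
    fun k l hkl w hw => HasLoopPath.of_le hkl hw
  -- Continuity from above carries the uniform bound over to the event that there are loop paths of
  -- all lengths.
  have hlim := tendsto_measure_iInter_atTop (μ := M.law i.2)
    (fun k => (measurableSet_hasLoopPath (M := M) (A := A) (G := G) k i.1).nullMeasurableSet) hanti
    ⟨0, measure_ne_top _ _⟩
  have hlim' := (ENNReal.tendsto_toReal (measure_ne_top (M.law i.2) _)).comp hlim
  have h1 : c ≤ (M.law i.2).real (⋂ k, {w | HasLoopPath M A G k i.1 w}) :=
    ge_of_tendsto' hlim' hle
  refine h1.trans ?_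
  -- On this event there is an infinite loop run; either it is accepting, or it avoids the accepting
  -- states from some time on, which is a null event.
  have hsub : (⋂ k, {w | HasLoopPath M A G k i.1 w}) ⊆ langFrom A i.1 ∪
      ⋃ k, {w | ∃ ρ, LoopRun M A G i.1 w ρ ∧ ∀ l ≥ k, ρ l ∉ A.accept} := by
    intro w hw
    obtain ⟨ρ, hρ⟩ := exists_loopRun fun k => Set.mem_iInter.1 hw k
    by_cases hf : ∃ᶠ l in atTop, ρ l ∈ A.accept
    · exact Or.inl ⟨ρ, hρ.1, fun l => mem_step_of_productMatrix_ne_zero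
        (loopMatrix_ne_zero.1 (hρ.2 l)).2.2, hf⟩
    · rw [not_frequently, eventually_atTop] at hf
      obtain ⟨k, hk⟩ := hf
      exact Or.inr (Set.mem_iUnion.2 ⟨k, ρ, hρ, hk⟩)
  have h0 : M.law i.2 (⋃ k, {w | ∃ ρ, LoopRun M A G i.1 w ρ ∧ ∀ l ≥ k, ρ l ∉ A.accept}) = 0 :=
    measure_iUnion_null fun k =>
      (measureReal_eq_zero_iff).1 (law_real_avoiding_eq_zero hGs hu hu0 k hi)
  refine (measureReal_mono hsub).trans ((measureReal_union_le _ _).trans ?_)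
  rw [measureReal_def (M.law i.2) (⋃ k, _), h0]
  simp [acceptProb]

/-- Characterization of the states of positive acceptance probability. -/
theorem acceptProb_pos_iff {g : Fin m × Fin n → ℝ}
    (hug : u + (g - (loopMatrix M A G).mulVec g) = fun _ => 1) {i : Fin m × Fin n} (hi : G i) :
    0 < acceptProb M A i ↔ ∃ j, Reach (productMatrix M A) i j ∧ 0 < u j := by
  refine ⟨exists_reach_support hG hGs hu hug hi, ?_⟩
  rintro ⟨j, hij, hj⟩
  have hp := acceptProb_pos_of_fixed_pos hG hGs hu hu0 hj
  clear hj
  induction hij using Relation.ReflTransGen.head_induction_on with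
  | refl => exact hp
  | head h1 _ ih =>
    rename_i a b _
    rw [acceptProb_eq_mulVec (hG _ hi)]
    refine lt_of_lt_of_le (mul_pos (lt_of_le_of_ne (productMatrix_nonneg a b) (Ne.symm h1))
      (ih (hGs _ _ hi h1))) ?_
    exact Finset.single_le_sum (f := fun c => productMatrix M A a c * acceptProb M A c)
      (fun c _ => mul_nonneg (productMatrix_nonneg _ _) (acceptProb_nonneg c)) (Finset.mem_univ b)

end

end Buchi

namespace Buchi

open Matrix (Reach)

variable {n m : ℕ}

/-! ### The linear systems -/

/-- The state `i` of the product is reachable from an initial state of the automaton. -/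
def Reachable (M : MarkovChain n) (A : NFA (Fin n) (Fin m)) (i : Fin m × Fin n) : Prop :=
  ∃ i₀ : Fin m × Fin n, i₀.1 ∈ A.start ∧ Reach (productMatrix M A) i₀ i

/-- The state `i` of the product is reachable, and reaches the support of `u`. -/
def Live (M : MarkovChain n) (A : NFA (Fin n) (Fin m)) (u : Fin m × Fin n → ℝ)
    (i : Fin m × Fin n) : Prop :=
  Reachable M A i ∧ ∃ j, Reach (productMatrix M A) i j ∧ u j ≠ 0

/-- Both components of a pair are live. -/
def PairLive (M : MarkovChain n) (A : NFA (Fin n) (Fin m)) (u : Fin m × Fin n → ℝ)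
    (i : (Fin m × Fin m) × Fin n) : Prop :=
  Live M A u (i.1.1, i.2) ∧ Live M A u (i.1.2, i.2)

/-- The matrix of the bilinear form with weights `c`. -/
def formMatrix (c : (Fin m × Fin m) × Fin n → ℝ) : Matrix (Fin m × Fin n) (Fin m × Fin n) ℝ :=
  fun i j => if i.2 = j.2 then c ((i.1, j.1), i.2) else 0

lemma dotProduct_formMatrix (c : (Fin m × Fin m) × Fin n → ℝ) (x y : Fin m × Fin n → ℝ) :
    x ⬝ᵥ (formMatrix c).mulVec y = c ⬝ᵥ pairVec x y := by
  simp only [dotProduct, Matrix.mulVec, Fintype.sum_prod_type, formMatrix, pairVec, Finset.mul_sum]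
  refine Finset.sum_congr rfl fun q _ => ?_
  rw [Finset.sum_comm]
  refine Finset.sum_congr rfl fun q' _ => ?_
  refine Finset.sum_congr rfl fun s _ => ?_
  rw [Finset.sum_eq_single s]
  · rw [if_pos rfl]; ring
  · intro t _ hts
    rw [if_neg hts.symm]; ring
  · simp

variable {M : MarkovChain n} {A : NFA (Fin n) (Fin m)}

lemma Reachable.step {i j : Fin m × Fin n} (hi : Reachable M A i) (h : productMatrix M A i j ≠ 0) :
    Reachable M A j := by
  obtain ⟨i₀, h0, h1⟩ := hi
  exact ⟨i₀, h0, h1.tail h⟩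

lemma reachable_of_start {i : Fin m × Fin n} (h : i.1 ∈ A.start) : Reachable M A i :=
  ⟨i, h, .refl⟩

lemma Reachable.unambFrom (hA : IsUnambiguous A) {i : Fin m × Fin n} (hi : Reachable M A i) :
    UnambFrom A i.1 := by
  obtain ⟨i₀, h0, h1⟩ := hi
  induction h1 with
  | refl => exact hA.unambFrom h0
  | tail _ h2 ih => exact ih.of_productMatrix_ne_zero h2

/-- Read contrapositively: from a reachable state that is not live no edge leads to a live one. This
is what allows masking by `Matrix.pow_mulVec_eq_mask`. -/
lemma Live.of_edge {u : Fin m × Fin n → ℝ} {i j : Fin m × Fin n} (hi : Reachable M A i)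
    (h : productMatrix M A i j ≠ 0) (hj : Live M A u j) : Live M A u i := by
  obtain ⟨-, l, hl, hul⟩ := hj
  exact ⟨hi, l, hl.head h, hul⟩

lemma productMatrix_ne_zero_of_pair {i j : (Fin m × Fin m) × Fin n}
    (h : pairMatrix M A i j ≠ 0) : productMatrix M A (i.1.1, i.2) (j.1.1, j.2) ≠ 0 ∧
      productMatrix M A (i.1.2, i.2) (j.1.2, j.2) ≠ 0 := by
  have h1 := left_ne_zero_of_mul h
  have h2 := right_ne_zero_of_mul h
  exact ⟨mul_ne_zero h1 (left_ne_zero_of_mul h2), mul_ne_zero h1 (right_ne_zero_of_mul h2)⟩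

lemma start_of_productStart_ne_zero {i : Fin m × Fin n} (h : productStart M A i ≠ 0) :
    i.1 ∈ A.start := by
  by_contra hn
  exact right_ne_zero_of_mul h (by simp [startWeight, hn])

lemma start_of_pairStart_ne_zero {i : (Fin m × Fin m) × Fin n} (h : pairStart M A i ≠ 0) :
    i.1.1 ∈ A.start ∧ i.1.2 ∈ A.start := by
  have h2 := right_ne_zero_of_mul h
  constructor
  · by_contra hn
    exact left_ne_zero_of_mul h2 (by simp [startWeight, hn])
  · by_contra hn
    exact right_ne_zero_of_mul h2 (by simp [startWeight, hn])

/-- The solutions of the equations for the projection of `1` to the fixed points of the loop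
matrix. -/
structure IsLoopSolution (M : MarkovChain n) (A : NFA (Fin n) (Fin m))
    (u g : Fin m × Fin n → ℝ) : Prop where
  fixed : (loopMatrix M A (Reachable M A)).mulVec u = u
  add : u + (g - (loopMatrix M A (Reachable M A)).mulVec g) = fun _ => 1

theorem exists_isLoopSolution (M : MarkovChain n) (hA : IsUnambiguous A) :
    ∃ u g, IsLoopSolution M A u g := by
  obtain ⟨u, g, h1, h2⟩ := Matrix.exists_fixed_add_sub
    (abs_loopMatrix_pow_le_one (M := M) fun i hi => Reachable.unambFrom hA hi) fun _ => 1
  exact ⟨u, g, h1, h2⟩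

/-- The matrix of the live part of the product. -/
noncomputable def liveMatrix (M : MarkovChain n) (A : NFA (Fin n) (Fin m))
    (u : Fin m × Fin n → ℝ) : Matrix (Fin m × Fin n) (Fin m × Fin n) ℝ :=
  (productMatrix M A).mask (Live M A u)

/-- The matrix of the live part of the product with two copies of the automaton. -/
noncomputable def pairLiveMatrix (M : MarkovChain n) (A : NFA (Fin n) (Fin m))
    (u : Fin m × Fin n → ℝ) :
    Matrix ((Fin m × Fin m) × Fin n) ((Fin m × Fin m) × Fin n) ℝ :=
  (pairMatrix M A).mask (PairLive M A u)

/-- The equations for the projection of the initial weights to the left fixed points of the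
matrix of pairs. -/
structure IsPairSolution (M : MarkovChain n) (A : NFA (Fin n) (Fin m)) (u : Fin m × Fin n → ℝ)
    (c g : (Fin m × Fin m) × Fin n → ℝ) : Prop where
  fixed : (pairLiveMatrix M A u).transpose.mulVec c = c
  add : c + (g - (pairLiveMatrix M A u).transpose.mulVec g) = pairStart M A

/-- The equations for the acceptance probabilities. -/
structure IsAcceptSolution (M : MarkovChain n) (A : NFA (Fin n) (Fin m)) (u : Fin m × Fin n → ℝ)
    (c : (Fin m × Fin m) × Fin n → ℝ) (v g : Fin m × Fin n → ℝ) : Prop where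
  fixed : (liveMatrix M A u).mulVec v = v
  add : (formMatrix c).mulVec v + (g - (liveMatrix M A u).transpose.mulVec g) = productStart M A

/-! ### Solvability of the systems, and the value of an arbitrary solution -/

section

variable {u g : Fin m × Fin n → ℝ} (hA : IsUnambiguous A) (hu : IsLoopSolution M A u g)
include hA hu

/-- `u` is a Cesàro limit of nonnegative vectors. -/
lemma IsLoopSolution.nonneg (i : Fin m × Fin n) : 0 ≤ u i := by
  refine Matrix.le_of_fixed_add_sub
    (abs_loopMatrix_pow_le_one (M := M) fun i hi => Reachable.unambFrom hA hi) hu.fixed hu.add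
    fun k => Finset.sum_nonneg fun j _ => ?_
  simpa using Matrix.pow_nonneg_apply loopMatrix_nonneg k i j

/-- This holds for any solution `u` of the system, so positivity of a probability becomes a question
about a graph and a computed vector. -/
lemma acceptProb_pos_iff_live {i : Fin m × Fin n} (hi : Reachable M A i) :
    0 < acceptProb M A i ↔ Live M A u i := by
  rw [acceptProb_pos_iff (fun i hi => Reachable.unambFrom hA hi) (fun i j => Reachable.step)
    hu.fixed (hu.nonneg hA) hu.add hi]
  constructor
  · rintro ⟨j, h1, h2⟩
    exact ⟨hi, j, h1, h2.ne'⟩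
  · rintro ⟨-, j, h1, h2⟩
    exact ⟨j, h1, lt_of_le_of_ne (hu.nonneg hA j) (Ne.symm h2)⟩

lemma langFrom_nonempty_of_live {i : Fin m × Fin n} (hi : Live M A u i) :
    (langFrom A i.1).Nonempty := by
  by_contra hne
  rw [Set.not_nonempty_iff_eq_empty] at hne
  have := (acceptProb_pos_iff_live hA hu hi.1).2 hi
  simp [acceptProb, hne] at this

/-- Live states are reachable, hence unambiguous, and have nonempty language: the two hypotheses of
the bound for powers. -/
lemma abs_liveMatrix_pow_le_one (k : ℕ) (i j : Fin m × Fin n) :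
    |(liveMatrix M A u ^ k) i j| ≤ 1 := by
  refine abs_pow_apply_le_one (B := productMatrix M A) (S := fun i => UnambFrom A i.1)
    (T := fun j => (langFrom A j.1).Nonempty)
    (fun _ _ k hi hj => productMatrix_pow_le_one hi hj k)
    (Matrix.mask_nonneg productMatrix_nonneg _) (Matrix.mask_le productMatrix_nonneg _)
    (fun i j h => ?_) k i j
  have : Live M A u i ∧ Live M A u j := by
    by_contra hn
    exact h (by simp [Matrix.mask, hn])
  exact ⟨Reachable.unambFrom hA this.1.1, langFrom_nonempty_of_live hA hu this.2⟩

lemma abs_pairLiveMatrix_pow_le_one (k : ℕ) (i j : (Fin m × Fin m) × Fin n) :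
    |(pairLiveMatrix M A u ^ k) i j| ≤ 1 := by
  refine abs_pow_apply_le_one (B := pairMatrix M A)
    (S := fun i => UnambFrom A i.1.1 ∧ UnambFrom A i.1.2)
    (T := fun j => (langFrom A j.1.1).Nonempty ∧ (langFrom A j.1.2).Nonempty)
    (fun _ _ k hi hj => pairMatrix_pow_le_one hi.1 hi.2 hj.1 hj.2 k)
    (Matrix.mask_nonneg pairMatrix_nonneg _) (Matrix.mask_le pairMatrix_nonneg _)
    (fun i j h => ?_) k i j
  have : PairLive M A u i ∧ PairLive M A u j := by
    by_contra hn
    exact h (by simp [Matrix.mask, hn])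
  exact ⟨⟨Reachable.unambFrom hA this.1.1.1, Reachable.unambFrom hA this.1.2.1⟩,
    langFrom_nonempty_of_live hA hu this.2.1, langFrom_nonempty_of_live hA hu this.2.2⟩

lemma abs_transpose_pow_le_one {κ : Type*} [Fintype κ] [DecidableEq κ] {B : Matrix κ κ ℝ}
    (hB : ∀ k i j, |(B ^ k) i j| ≤ 1) (k : ℕ) (i j : κ) : |(B.transpose ^ k) i j| ≤ 1 := by
  rw [← Matrix.transpose_pow]
  exact hB k j i

theorem exists_isPairSolution : ∃ c g, IsPairSolution M A u c g := by
  obtain ⟨c, g, h1, h2⟩ := Matrix.exists_fixed_add_sub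
    (abs_transpose_pow_le_one hA hu (abs_pairLiveMatrix_pow_le_one hA hu)) (pairStart M A)
  exact ⟨c, g, h1, h2⟩

omit hA hu in
lemma eq_zero_of_not_live {v : Fin m × Fin n → ℝ} (hv : (liveMatrix M A u).mulVec v = v)
    {i : Fin m × Fin n} (hi : ¬ Live M A u i) : v i = 0 := by
  rw [← hv]
  exact Finset.sum_eq_zero fun j _ => by simp [liveMatrix, Matrix.mask, hi]

open Classical in
/-- The acceptance probabilities of the live states. -/
noncomputable def liveProb (M : MarkovChain n) (A : NFA (Fin n) (Fin m)) (u : Fin m × Fin n → ℝ)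
    (i : Fin m × Fin n) : ℝ := if Live M A u i then acceptProb M A i else 0

lemma liveProb_eq {i : Fin m × Fin n} (hi : Reachable M A i) :
    liveProb M A u i = acceptProb M A i := by
  unfold liveProb
  split_ifs with h
  · rfl
  · rw [← acceptProb_pos_iff_live hA hu hi] at h
    exact le_antisymm (acceptProb_nonneg i) (not_lt.1 h)

omit hA hu in
lemma liveProb_nonneg (i : Fin m × Fin n) : 0 ≤ liveProb M A u i := by
  unfold liveProb; split_ifs; exacts [acceptProb_nonneg i, le_rfl]

lemma liveProb_fixed : (liveMatrix M A u).mulVec (liveProb M A u) = liveProb M A u := by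
  funext i
  by_cases hi : Live M A u i
  · rw [liveProb_eq hA hu hi.1, acceptProb_eq_mulVec (Reachable.unambFrom hA hi.1)]
    refine Finset.sum_congr rfl fun j _ => ?_
    change liveMatrix M A u i j * liveProb M A u j = productMatrix M A i j * acceptProb M A j
    by_cases hB : productMatrix M A i j = 0
    · simp [liveMatrix, Matrix.mask, hB]
    rw [← liveProb_eq hA hu (hi.1.step hB)]
    by_cases hj : Live M A u j
    · simp [liveMatrix, Matrix.mask, hi, hj]
    · simp [liveProb, hj]
  · have : liveProb M A u i = 0 := if_neg hi
    rw [this]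
    exact Finset.sum_eq_zero fun j _ => by simp [liveMatrix, Matrix.mask, hi]

/-- Fixed points vanish off the live states, and on these the acceptance probability is positive;
finiteness gives the constant. The domination is what ties the run sums of `v` to the language in
`tendsto_integral_mul_sub`. -/
lemma exists_abs_le_liveProb {v : Fin m × Fin n → ℝ} (hv : (liveMatrix M A u).mulVec v = v) :
    ∃ C, ∀ i, |v i| ≤ C * liveProb M A u i := by
  refine ⟨∑ j, |v j| / liveProb M A u j, fun i => ?_⟩
  by_cases hi : Live M A u i
  · have hpos : 0 < liveProb M A u i := by
      rw [liveProb_eq hA hu hi.1]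
      exact (acceptProb_pos_iff_live hA hu hi.1).2 hi
    rw [← div_le_iff₀ hpos]
    exact Finset.single_le_sum (f := fun j => |v j| / liveProb M A u j)
      (fun j _ => div_nonneg (abs_nonneg _) (liveProb_nonneg j)) (Finset.mem_univ i)
  · simp [eq_zero_of_not_live hv hi, liveProb, hi]

lemma trajectoryLaw_real_language_eq :
    M.trajectoryLaw.real (language A) = productStart M A ⬝ᵥ liveProb M A u := by
  rw [trajectoryLaw_real_language hA]
  refine Finset.sum_congr rfl fun i _ => ?_
  by_cases h : productStart M A i = 0
  · rw [h, zero_mul, zero_mul]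
  · rw [liveProb_eq hA hu (reachable_of_start (start_of_productStart_ne_zero h))]

-- On reachable states the full product matrix acts on `v` like its live part, which fixes `v`. So
-- the expected run sums of `v` are constant in `k`.
omit hA hu in
lemma productStart_dotProduct_pow {v : Fin m × Fin n → ℝ}
    (hv : (liveMatrix M A u).mulVec v = v) (k : ℕ) :
    productStart M A ⬝ᵥ (productMatrix M A ^ k).mulVec v = productStart M A ⬝ᵥ v := by
  refine Finset.sum_congr rfl fun i _ => ?_
  by_cases h : productStart M A i = 0
  · rw [h, zero_mul, zero_mul]
  · rw [Matrix.pow_mulVec_eq_mask (G := Reachable M A) (Z := Live M A u)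
      (fun i j => Reachable.step) (fun i j hi hij hj => hj.of_edge hi hij)
      (fun i hi => eq_zero_of_not_live hv hi) k
      (reachable_of_start (start_of_productStart_ne_zero h))]
    have := congrFun (Matrix.mulVec_pow_eq_self hv k) i
    exact congrArg _ this

-- The same masking for pairs; transposition then moves the powers to the initial weights, whose
-- Cesàro limit does not depend on `x` and `y`.
omit hA hu in
lemma pairStart_dotProduct_pow {x y : Fin m × Fin n → ℝ} (hx : ∀ i, ¬ Live M A u i → x i = 0)
    (hy : ∀ i, ¬ Live M A u i → y i = 0) (k : ℕ) :
    pairStart M A ⬝ᵥ (pairMatrix M A ^ k).mulVec (pairVec x y) =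
      ((pairLiveMatrix M A u).transpose ^ k).mulVec (pairStart M A) ⬝ᵥ pairVec x y := by
  rw [← Matrix.transpose_pow, Matrix.mulVec_transpose, ← Matrix.dotProduct_mulVec]
  refine Finset.sum_congr rfl fun i _ => ?_
  by_cases h : pairStart M A i = 0
  · rw [h, zero_mul, zero_mul]
  · have hs := start_of_pairStart_ne_zero h
    rw [Matrix.pow_mulVec_eq_mask
      (G := fun i : (Fin m × Fin m) × Fin n => Reachable M A (i.1.1, i.2) ∧
        Reachable M A (i.1.2, i.2)) (Z := PairLive M A u)
      (fun i j hi hij => ⟨hi.1.step (productMatrix_ne_zero_of_pair hij).1,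
        hi.2.step (productMatrix_ne_zero_of_pair hij).2⟩)
      (fun i j hi hij hj => ⟨hj.1.of_edge hi.1 (productMatrix_ne_zero_of_pair hij).1,
        hj.2.of_edge hi.2 (productMatrix_ne_zero_of_pair hij).2⟩)
      (fun i hi => ?_) k ⟨reachable_of_start hs.1, reachable_of_start hs.2⟩]
    · rfl
    · by_cases h1 : Live M A u (i.1.1, i.2)
      · rw [pairVec, hy _ fun h2 => hi ⟨h1, h2⟩, mul_zero]
      · rw [pairVec, hx _ h1, zero_mul]

variable {c g₂ : (Fin m × Fin m) × Fin n → ℝ} (hc : IsPairSolution M A u c g₂)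
include hc

/-- By Lévy's theorem, the expected product of the run sums of `liveProb` and `v` tends to the
product of the initial weights with `v`. These expectations are iterates of the transposed pair
matrix on `pairStart`, tested against a fixed vector, and `c` is the Cesàro limit of the iterates.
Both orders are recorded, as symmetry of `c` is not required: one serves solvability, the other the
value. -/
lemma dotProduct_pairVec {v : Fin m × Fin n → ℝ} (hv : (liveMatrix M A u).mulVec v = v) :
    c ⬝ᵥ pairVec (liveProb M A u) v = productStart M A ⬝ᵥ v ∧
      c ⬝ᵥ pairVec v (liveProb M A u) = productStart M A ⬝ᵥ v := by
  obtain ⟨C, hC⟩ := exists_abs_le_liveProb hA hu hv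
  have hlim := tendsto_integral_mul_sub (M := M) (G := Reachable M A) (x := liveProb M A u) hA
    (fun i hi => Reachable.unambFrom hA hi) (fun i j => Reachable.step)
    (fun q s h => reachable_of_start h) (fun i hi => liveProb_eq hA hu hi) liveProb_nonneg hC
  have hlim2 : Tendsto (fun k => ∫ w, startRunSum A (liveProb M A u) k w * startRunSum A v k w
      ∂M.trajectoryLaw) atTop (nhds (productStart M A ⬝ᵥ v)) := by
    have := hlim.add_const (productStart M A ⬝ᵥ v)
    rw [zero_add] at this
    refine this.congr fun k => ?_
    rw [integral_startRunSum v k, productStart_dotProduct_pow hv]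
    ring
  have hx0 : ∀ i, ¬ Live M A u i → liveProb M A u i = 0 := fun i hi => if_neg hi
  have hv0 : ∀ i, ¬ Live M A u i → v i = 0 := fun i hi => eq_zero_of_not_live hv hi
  have hbd := abs_transpose_pow_le_one hA hu (abs_pairLiveMatrix_pow_le_one hA hu)
  constructor
  · refine Matrix.eq_of_tendsto_of_fixed_add_sub hbd hc.fixed hc.add (hlim2.congr fun k => ?_)
    rw [integral_startRunSum_mul, pairStart_dotProduct_pow hx0 hv0]
  · refine Matrix.eq_of_tendsto_of_fixed_add_sub hbd hc.fixed hc.add (hlim2.congr fun k => ?_)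
    simp only [mul_comm (startRunSum A (liveProb M A u) k _)]
    rw [integral_startRunSum_mul, pairStart_dotProduct_pow hv0 hx0]

-- Fixed points of `B` are orthogonal to the range of `1 - Bᵀ`, so the auxiliary unknown `g`
-- disappears on pairing.
omit hA hu hc in
lemma dotProduct_sub_transpose {κ : Type*} [Fintype κ] {B : Matrix κ κ ℝ} {v : κ → ℝ}
    (hv : B.mulVec v = v) (g : κ → ℝ) : v ⬝ᵥ (g - B.transpose.mulVec g) = 0 := by
  rw [dotProduct_sub, Matrix.mulVec_transpose, dotProduct_comm v (Matrix.vecMul g B),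
    ← Matrix.dotProduct_mulVec, hv, dotProduct_comm, sub_self]

/-- The acceptance probabilities are a solution: by `dotProduct_pairVec` their residual is
orthogonal to all fixed points of the live matrix, hence in the range of `1 - Bᵀ`. -/
theorem exists_isAcceptSolution : ∃ v g, IsAcceptSolution M A u c v g := by
  set x := liveProb M A u with hx
  have hbd := abs_liveMatrix_pow_le_one hA hu
  obtain ⟨w, g, h1, h2⟩ := Matrix.exists_fixed_add_sub (abs_transpose_pow_le_one hA hu hbd)
    (productStart M A - (formMatrix c).mulVec x)
  -- The fixed part `w` of the residual is orthogonal to the fixed points of the live matrix by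
  -- `dotProduct_pairVec`, and to the range of `1 - B` because `Bᵀ` fixes `w`. Together these span
  -- the space.
  have hw : w = 0 := by
    refine dotProduct_eq_zero w fun y => ?_
    obtain ⟨v, h, hv, rfl⟩ := Matrix.exists_fixed_add_sub hbd y
    rw [dotProduct_add]
    have e1 : w ⬝ᵥ v = 0 := by
      have h3 : v ⬝ᵥ (productStart M A - (formMatrix c).mulVec x) = 0 := by
        rw [dotProduct_sub, dotProduct_formMatrix, (dotProduct_pairVec hA hu hc hv).2,
          dotProduct_comm, sub_self]
      rw [← h2, dotProduct_add, dotProduct_sub_transpose hv, add_zero] at h3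
      rw [dotProduct_comm, h3]
    have e2 := dotProduct_sub_transpose (B := (liveMatrix M A u).transpose) h1 h
    rw [Matrix.transpose_transpose] at e2
    rw [e1, e2, add_zero]
  refine ⟨x, g, liveProb_fixed hA hu, ?_⟩
  rw [hw, zero_add] at h2
  rw [h2]
  abel

/-- Each solution of the linear systems yields the probability of the language. -/
theorem IsAcceptSolution.trajectoryLaw_real_language {v g₃ : Fin m × Fin n → ℝ}
    (hv : IsAcceptSolution M A u c v g₃) :
    M.trajectoryLaw.real (language A) = productStart M A ⬝ᵥ v := by
  -- Paired with the true acceptance probabilities, the right side is the wanted number, the range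
  -- term vanishes, and the form returns the initial weights against `v`.
  have h := congrArg (fun y => liveProb M A u ⬝ᵥ y) hv.add
  simp only [dotProduct_add] at h
  rw [dotProduct_formMatrix, (dotProduct_pairVec hA hu hc hv.fixed).1,
    dotProduct_sub_transpose (liveProb_fixed hA hu), add_zero] at h
  rw [trajectoryLaw_real_language_eq hA hu, h, dotProduct_comm]

end

end Buchi

/-! ### Integral pivoting -/

namespace Matrix

section Tableau

variable {ρ γ : Type*} [Fintype ρ] [DecidableEq ρ]

/-- The matrix whose `i`-th column is the column `piv i` of `M`, or a unit vector if there is none. -/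
def basisMatrix (M : Matrix ρ γ ℤ) (piv : ρ → Option γ) : Matrix ρ ρ ℤ :=
  of fun k i => (piv i).elim (if k = i then 1 else 0) fun q => M k q

/-- The tableau `W` is obtained from `M` by pivoting in the rows `S` and the columns `N`. -/
structure IsTableau (M : Matrix ρ γ ℤ) (N : Set γ) (S : Set ρ) (piv : ρ → Option γ) (d : ℤ)
    (W : Matrix ρ γ ℤ) : Prop where
  det_eq : (basisMatrix M piv).det = d
  ne_zero : d ≠ 0
  mul_eq : basisMatrix M piv * W = d • M
  eq_none : ∀ i, i ∉ S → piv i = none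
  eq_zero : ∀ i ∈ S, piv i = none → ∀ j ∈ N, W i j = 0
  mem : ∀ i q, piv i = some q → q ∈ N

variable {M W : Matrix ρ γ ℤ} {N : Set γ} {S : Set ρ} {piv : ρ → Option γ} {d : ℤ}

theorem isTableau_self (M : Matrix ρ γ ℤ) (N : Set γ) : IsTableau M N ∅ (fun _ => none) 1 M := by
  have h : basisMatrix M (fun _ => none) = 1 := by
    ext i j; simp [basisMatrix, Matrix.one_apply]
  exact ⟨by simp [h], one_ne_zero, by simp [h], fun _ _ => rfl, by simp, by simp⟩

theorem basisMatrix_update (M : Matrix ρ γ ℤ) (piv : ρ → Option γ) (p : ρ) (q : γ) :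
    basisMatrix M (Function.update piv p (some q)) =
      (basisMatrix M piv).updateCol p fun k => M k q := by
  ext k i
  by_cases h : i = p
  · subst h; simp [basisMatrix]
  · simp [basisMatrix, h]

namespace IsTableau

theorem eq_adjugate (h : IsTableau M N S piv d W) : W = (basisMatrix M piv).adjugate * M := by
  have h1 : (basisMatrix M piv).adjugate * (basisMatrix M piv * W) = d • W := by
    rw [← Matrix.mul_assoc, adjugate_mul, h.det_eq, smul_mul, Matrix.one_mul]
  rw [h.mul_eq, Matrix.mul_smul] at h1
  ext i j
  have := congrFun (congrFun h1 i) j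
  simp only [smul_apply, smul_eq_mul] at this
  exact (mul_left_cancel₀ h.ne_zero this).symm

/-- Cramer's rule. However many pivots were made, each entry is a determinant of columns of `M` and
unit vectors, so lengths do not accumulate. -/
theorem apply_eq_det (h : IsTableau M N S piv d W) (i : ρ) (j : γ) :
    W i j = ((basisMatrix M piv).updateCol i fun k => M k j).det := by
  conv_lhs => rw [h.eq_adjugate]
  rw [← cramer_apply, cramer_eq_adjugate_mulVec]
  rfl

/-- A row that vanishes on the candidate columns needs no pivot; its basis column remains a unit
vector. -/
theorem insert_of_eq_zero (h : IsTableau M N S piv d W) {p : ρ} (hp : ∀ j ∈ N, W p j = 0) :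
    IsTableau M N (insert p S) piv d W where
  __ := h
  eq_none i hi := h.eq_none i fun h' => hi (Set.mem_insert_of_mem _ h')
  eq_zero i hi hn j hj := by
    rcases hi with rfl | hi
    · exact hp j hj
    · exact h.eq_zero i hi hn j hj

/-- The tableau after pivoting in row `p` and column `q`. -/
def _root_.Matrix.pivotStep (W : Matrix ρ γ ℤ) (d : ℤ) (p : ρ) (q : γ) : Matrix ρ γ ℤ :=
  of fun i j => if i = p then W p j else (W p q * W i j - W i q * W p j) / d

/-- Before division, the eliminated matrix equals `d` times the adjugate of the new basis times `M`.
So division by the old `d` is exact and the new tableau is again integral. -/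
theorem pivot (h : IsTableau M N S piv d W) {p : ρ} (hp : p ∉ S) {q : γ} (hq : q ∈ N)
    (hpq : W p q ≠ 0) :
    IsTableau M N (insert p S) (Function.update piv p (some q)) (W p q) (W.pivotStep d p q) := by
  set B := basisMatrix M piv with hB
  set B' := basisMatrix M (Function.update piv p (some q)) with hB'
  have hB'' : B' = B.updateCol p fun k => M k q := basisMatrix_update M piv p q
  have hdet : B'.det = W p q := by rw [hB'', h.apply_eq_det]
  -- The matrix before division; row `p` is multiplied by `d` so that all rows carry this factor.
  set U : Matrix ρ γ ℤ := of fun i j => if i = p then d * W p j else W p q * W i j - W i q * W p j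
  have hU : ∀ i j, U i j = W p q * W i j - (W i q - if i = p then d else 0) * W p j := by
    intro i j
    by_cases hi : i = p
    · subst hi; simp only [U, of_apply, if_true]; ring
    · simp [U, hi]
  have hBW : ∀ k j, ∑ i, B k i * W i j = d * M k j := fun k j => by
    simpa [Matrix.mul_apply] using congrFun (congrFun h.mul_eq k) j
  have hBU : B' * U = (d * W p q) • M := by
    ext k j
    have e1 : ∀ i, B' k i = B k i + if i = p then M k q - B k p else 0 := by
      intro i
      rw [hB'']
      by_cases hi : i = p
      · subst hi; simp
      · simp [hi]
    rw [Matrix.mul_apply, smul_apply, smul_eq_mul]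
    have e2 : ∑ i, B' k i * U i j = ∑ i, B k i * U i j + (M k q - B k p) * U p j := by
      simp [e1, add_mul, Finset.sum_add_distrib]
    have e3 : ∑ i, B k i * U i j = W p q * (∑ i, B k i * W i j) -
        (∑ i, B k i * W i q) * W p j + B k p * d * W p j := by
      simp only [hU, Finset.mul_sum, Finset.sum_mul]
      rw [← Finset.sum_sub_distrib]
      have : B k p * d * W p j = ∑ i, if i = p then B k i * d * W p j else 0 := by simp
      rw [this, ← Finset.sum_add_distrib]
      refine Finset.sum_congr rfl fun i _ => ?_
      split_ifs <;> ring
    rw [e2, e3, hBW, hBW, hU p j, if_pos rfl]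
    ring
  have hadj : U = d • (B'.adjugate * M) := by
    have h1 : B'.adjugate * (B' * U) = W p q • U := by
      rw [← Matrix.mul_assoc, adjugate_mul, hdet, smul_mul, Matrix.one_mul]
    rw [hBU, Matrix.mul_smul] at h1
    ext i j
    have := congrFun (congrFun h1 i) j
    simp only [smul_apply, smul_eq_mul] at this ⊢
    exact mul_left_cancel₀ hpq (by rw [← this]; ring)
  have hW' : W.pivotStep d p q = B'.adjugate * M := by
    ext i j
    have hUij := congrFun (congrFun hadj i) j
    rw [smul_apply, smul_eq_mul] at hUij
    by_cases hi : i = p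
    · simp only [pivotStep, of_apply, hi, if_true]
      simp only [U, of_apply, hi, if_true] at hUij
      exact mul_left_cancel₀ h.ne_zero hUij
    · simp only [pivotStep, of_apply, hi, if_false]
      simp only [U, of_apply, hi, if_false] at hUij
      rw [hUij, Int.mul_ediv_cancel_left _ h.ne_zero]
  refine ⟨hdet, hpq, ?_, ?_, ?_, ?_⟩
  · rw [hW', ← Matrix.mul_assoc, ← hB', mul_adjugate, hdet, smul_mul, Matrix.one_mul]
  · intro i hi
    have : i ≠ p := fun h' => hi (h' ▸ Set.mem_insert _ _)
    rw [Function.update_of_ne this]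
    exact h.eq_none i fun h' => hi (Set.mem_insert_of_mem _ h')
  · intro i hi hn j hj
    have hip : i ≠ p := by rintro rfl; simp at hn
    rw [Function.update_of_ne hip] at hn
    have hS : i ∈ S := hi.resolve_left hip
    simp [pivotStep, hip, h.eq_zero i hS hn j hj, h.eq_zero i hS hn q hq]
  · intro i q' hi
    by_cases hip : i = p
    · subst hip; simp at hi; exact hi ▸ hq
    · rw [Function.update_of_ne hip] at hi
      exact h.mem i q' hi

/-- The Leibniz bound for the determinant in `apply_eq_det`; the unit columns are the reason for `1
≤ X`. -/
theorem abs_apply_le (h : IsTableau M N S piv d W) {X : ℤ} (hX : 1 ≤ X)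
    (hM : ∀ i, ∀ j ∈ N, |M i j| ≤ X) {j : γ} (hj : ∀ i, |M i j| ≤ X) (i : ρ) :
    |W i j| ≤ (Fintype.card ρ).factorial * X ^ Fintype.card ρ := by
  rw [h.apply_eq_det]
  have := det_le (A := (basisMatrix M piv).updateCol i fun k => M k j)
    (abv := (AbsoluteValue.abs : AbsoluteValue ℤ ℤ)) (x := X) ?_
  · simpa using this
  · intro k l
    rw [AbsoluteValue.abs_apply]
    by_cases hl : l = i
    · subst hl; simpa using hj k
    · rw [updateCol_ne hl, basisMatrix, of_apply]
      rcases hp : piv l with _ | q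
      · simp only [Option.elim_none]; split_ifs <;> simp <;> omega
      · exact hM k q (h.mem l q hp)

theorem abs_le (h : IsTableau M N S piv d W) {X : ℤ} (hX : 1 ≤ X)
    (hM : ∀ i, ∀ j ∈ N, |M i j| ≤ X) :
    |d| ≤ (Fintype.card ρ).factorial * X ^ Fintype.card ρ := by
  rw [← h.det_eq]
  have := det_le (A := basisMatrix M piv)
    (abv := (AbsoluteValue.abs : AbsoluteValue ℤ ℤ)) (x := X) ?_
  · simpa using this
  · intro k l
    rw [AbsoluteValue.abs_apply, basisMatrix, of_apply]
    rcases hp : piv l with _ | q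
    · simp only [Option.elim_none]; split_ifs <;> simp <;> omega
    · exact hM k q (h.mem l q hp)

/-- A tableau in which all rows are processed gives a solution of the linear system with right-hand
side the column `t`, if there is one. -/
theorem sum_mul_eq [DecidableEq γ] (h : IsTableau M N Set.univ piv d W) (J : Finset γ)
    (hJ : ∀ j, j ∈ J ↔ j ∈ N) (t : γ) (x : γ → ℝ) (hx : ∀ i, ∑ j ∈ J, (M i j : ℝ) * x j = M i t)
    (i : ρ) :
    ∑ j ∈ J, M i j * ∑ k, (if piv k = some j then W k t else 0) = d * M i t := by
  set B := basisMatrix M piv with hB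
  have hBW : ∀ k j, ∑ i, B k i * W i j = d * M k j := fun k j => by
    simpa [Matrix.mul_apply] using congrFun (congrFun h.mul_eq k) j
  have hinj : Function.Injective (B.map (Int.cast : ℤ → ℝ)).mulVec := by
    rw [Matrix.mulVec_injective_iff_isUnit, isUnit_iff_isUnit_det, isUnit_iff_ne_zero]
    have : (B.map (Int.cast : ℤ → ℝ)).det = ((B.det : ℤ) : ℝ) :=
      (Int.cast_det B).symm
    rw [this, hB, h.det_eq]
    exact_mod_cast h.ne_zero
  -- The basis matrix is invertible, so a real solution also solves the reduced system. It serves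
  -- only to show consistency: rows without pivot vanish on `N`, hence in column `t`.
  have hWt : (fun k => ∑ j ∈ J, (W k j : ℝ) * x j) = fun k => (W k t : ℝ) := by
    apply hinj
    funext k
    have hBW' : ∀ k j, ∑ i, (B k i : ℝ) * W i j = d * M k j := fun k j => by
      exact_mod_cast hBW k j
    change ∑ i, (B k i : ℝ) * (∑ j ∈ J, (W i j : ℝ) * x j) = ∑ i, (B k i : ℝ) * (W i t : ℝ)
    rw [hBW', ← hx k, Finset.mul_sum]
    simp only [Finset.mul_sum]
    rw [Finset.sum_comm]
    refine Finset.sum_congr rfl fun j _ => ?_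
    rw [← mul_assoc, ← hBW' k j, Finset.sum_mul]
    exact Finset.sum_congr rfl fun _ _ => by ring
  have hzero : ∀ k, piv k = none → W k t = 0 := by
    intro k hk
    have : ∑ j ∈ J, (W k j : ℝ) * x j = W k t := congrFun hWt k
    rw [Finset.sum_eq_zero fun j hj => by
      rw [h.eq_zero k trivial hk j ((hJ j).1 hj)]; simp] at this
    exact_mod_cast this.symm
  rw [← hBW i t]
  simp only [Finset.mul_sum]
  rw [Finset.sum_comm]
  refine Finset.sum_congr rfl fun k _ => ?_
  rcases hk : piv k with _ | q
  · simp [hzero k hk]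
  · have hq := (hJ q).2 (h.mem k q hk)
    simp [hB, basisMatrix, hk, hq]

end IsTableau

end Tableau

end Matrix

/-! ### Costs of programs -/

namespace RAM

theorem one_le_len (x : ℤ) : 1 ≤ len x := Nat.le_add_left _ _

theorem len_le_iff {x : ℤ} {L : ℕ} : len x ≤ L + 1 ↔ x.natAbs < 2 ^ L := by
  rw [len, Nat.add_le_add_iff_right, Nat.size_le]

theorem natAbs_lt_two_pow_len (x : ℤ) : x.natAbs < 2 ^ (len x - 1) := by
  simpa [len] using Nat.lt_size_self x.natAbs

theorem len_mono {x y : ℤ} (h : x.natAbs ≤ y.natAbs) : len x ≤ len y :=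
  Nat.add_le_add_right (Nat.size_le_size h) 1

theorem len_add_le_succ {x y : ℤ} {L : ℕ} (hx : len x ≤ L) (hy : len y ≤ L) :
    len (x + y) ≤ L + 1 := by
  rcases L with _ | L
  · exact absurd hx (by have := one_le_len x; omega)
  · rw [len_le_iff] at hx hy ⊢
    have := Int.natAbs_add_le x y
    rw [pow_succ]; omega

theorem len_add_le (x y : ℤ) : len (x + y) ≤ len x + len y := by
  have hx := one_le_len x
  have hy := one_le_len y
  rcases le_total (len x) (len y) with h | h
  · exact (len_add_le_succ h le_rfl).trans (by omega)
  · exact (len_add_le_succ le_rfl h).trans (by omega)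

theorem len_neg (x : ℤ) : len (-x) = len x := by simp [len]

theorem len_mul_le (x y : ℤ) : len (x * y) ≤ len x + len y := by
  have hx := natAbs_lt_two_pow_len x
  have hy := natAbs_lt_two_pow_len y
  have h1 := one_le_len x
  have h2 := one_le_len y
  obtain ⟨a, ha⟩ : ∃ a, len x = a + 1 := ⟨_, (Nat.sub_add_cancel h1).symm⟩
  obtain ⟨b, hb⟩ : ∃ b, len y = b + 1 := ⟨_, (Nat.sub_add_cancel h2).symm⟩
  rw [ha] at hx; rw [hb] at hy
  have : len (x * y) ≤ (a + b) + 1 := by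
    rw [len_le_iff, Int.natAbs_mul, pow_add]
    exact Nat.mul_lt_mul'' (by simpa using hx) (by simpa using hy)
  omega

theorem Op.len_eval_le (o : Op) (x y : ℤ) : len (o.eval x y) ≤ len x + len y := by
  cases o
  · exact len_add_le x y
  · rw [Op.eval, sub_eq_add_neg, ← len_neg y]; exact len_add_le x (-y)
  · exact len_mul_le x y
  · exact (len_mono (Int.natAbs_ediv_le_natAbs x y)).trans (Nat.le_add_right _ _)

theorem len_natCast_mono {a b : ℕ} (h : a ≤ b) : len (a : ℤ) ≤ len (b : ℤ) :=
  len_mono (by simpa using h)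

/-- All registers and all cells hold integers of length at most `L`. -/
def State.Bdd (L : ℕ) (s : State) : Prop :=
  (∀ r, len (s.reg r) ≤ L) ∧ ∀ a i, len (s.arr a i) ≤ L

theorem State.Bdd.one_le {L : ℕ} {s : State} (h : s.Bdd L) : 1 ≤ L :=
  (one_le_len _).trans (h.1 0)

theorem State.Bdd.mono {L L' : ℕ} {s : State} (h : s.Bdd L) (hL : L ≤ L') : s.Bdd L' :=
  ⟨fun r => (h.1 r).trans hL, fun a i => (h.2 a i).trans hL⟩

theorem State.Bdd.setReg {L : ℕ} {s : State} (h : s.Bdd L) {r : ℕ} {x : ℤ} (hx : len x ≤ L) :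
    (s.setReg r x).Bdd L := by
  refine ⟨fun r' => ?_, h.2⟩
  by_cases hr : r' = r
  · subst hr; simpa [State.setReg] using hx
  · simpa [State.setReg, hr] using h.1 r'

theorem State.Bdd.setArr {L : ℕ} {s : State} (h : s.Bdd L) {a k : ℕ} {x : ℤ} (hx : len x ≤ L) :
    (s.setArr a k x).Bdd L := by
  refine ⟨h.1, fun b i => ?_⟩
  by_cases hb : b = a
  · subst hb
    by_cases hi : i = k
    · subst hi; simpa [State.setArr] using hx
    · simpa [State.setArr, hi] using h.2 b i
  · simpa [State.setArr, hb] using h.2 b i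

@[simp] theorem State.setReg_reg_self (s : State) (r : ℕ) (x : ℤ) : (s.setReg r x).reg r = x := by
  simp [State.setReg]

theorem State.setReg_reg_of_ne (s : State) {r r' : ℕ} (h : r' ≠ r) (x : ℤ) :
    (s.setReg r x).reg r' = s.reg r' := by
  simp [State.setReg, h]

@[simp] theorem State.setReg_arr (s : State) (r : ℕ) (x : ℤ) : (s.setReg r x).arr = s.arr := rfl

@[simp] theorem State.setArr_reg (s : State) (a k : ℕ) (x : ℤ) : (s.setArr a k x).reg = s.reg := rfl

/-- The length of the value of `e` is at most `e.lenFactor` times that of the memory contents. -/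
def Expr.lenFactor : Expr → ℕ
  | .const c => len c
  | .reg _ => 1
  | .get _ _ => 1
  | .op _ e f => e.lenFactor + f.lenFactor

/-- The cost of `e` is at most `e.costFactor` times the squared length of the memory contents. -/
def Expr.costFactor : Expr → ℕ
  | .const c => len c
  | .reg _ => 1
  | .get _ i => i.costFactor + i.lenFactor + 1
  | .op _ e f => e.costFactor + f.costFactor + e.lenFactor * f.lenFactor

theorem Expr.len_eval_le {s : State} {L : ℕ} (h : s.Bdd L) (e : Expr) :
    len (e.eval s) ≤ e.lenFactor * L := by
  have hL := h.one_le
  induction e with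
  | const c => exact Nat.le_mul_of_pos_right _ hL
  | reg r => simpa [Expr.eval, Expr.lenFactor] using h.1 r
  | get a i => simpa [Expr.eval, Expr.lenFactor] using h.2 a _
  | op o e f he hf =>
    exact (o.len_eval_le _ _).trans (by rw [Expr.lenFactor, add_mul]; exact add_le_add he hf)

theorem Expr.cost_le {s : State} {L : ℕ} (h : s.Bdd L) (e : Expr) :
    e.cost s ≤ e.costFactor * L ^ 2 := by
  have hL := h.one_le
  have hL2 : L ≤ L ^ 2 := Nat.le_self_pow two_ne_zero L
  induction e with
  | const c => exact Nat.le_mul_of_pos_right _ (pow_pos hL _)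
  | reg r => simpa [Expr.cost, Expr.costFactor] using (h.1 r).trans hL2
  | get a i hi =>
    have h1 := (i.len_eval_le h).trans (Nat.mul_le_mul_left i.lenFactor hL2)
    have h2 := (h.2 a (i.eval s).toNat).trans hL2
    simp only [Expr.cost, Expr.costFactor, add_mul, one_mul]
    omega
  | op o e f he hf =>
    have h1 := Nat.mul_le_mul (e.len_eval_le h) (f.len_eval_le h)
    have h2 : e.lenFactor * L * (f.lenFactor * L) = e.lenFactor * f.lenFactor * L ^ 2 := by ring
    simp only [Expr.cost, Expr.costFactor, add_mul]
    omega

/-- Execute `c` for the values `0, …, k - 1` of register `r`, where register `K` holds `k`. -/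
def Program.iter (r K : ℕ) (c : Program) : Program :=
  .seq (.assign r (.const 0)) (.loop (.op .sub (.reg K) (.reg r))
    (.seq c (.assign r (.op .add (.reg r) (.const 1)))))

/-- The invariant has to bound all lengths by one `L` for all passes. A bound that grew in each pass
could become exponential. -/
theorem exec_iter {r K k T L : ℕ} {c : Program} {I : ℕ → State → Prop} {s : State}
    (hI : ∀ i s, I i s → s.reg K = k ∧ s.reg r = i ∧ s.Bdd L) (h0 : I 0 (s.setReg r 0))
    (hc : ∀ i < k, ∀ s, I i s → ∃ s' t, Exec c s s' t ∧ t ≤ T ∧ s'.Bdd L ∧ s'.reg r = i ∧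
      I (i + 1) (s'.setReg r (i + 1 : ℕ))) :
    ∃ s' t, Exec (.iter r K c) s s' t ∧ t ≤ (k + 1) * (T + 20 * L ^ 2) ∧ I k s' := by
  have hL : 1 ≤ L := (hI _ _ h0).2.2.one_le
  have hL2 : L ≤ L ^ 2 := Nat.le_self_pow two_ne_zero L
  have htest : ∀ i s, I i s →
      Expr.cost s (.op .sub (.reg K) (.reg r)) ≤ 3 * L ^ 2 ∧
      Expr.eval s (.op .sub (.reg K) (.reg r)) = (k : ℤ) - i := by
    intro i s hs
    obtain ⟨h1, h2, h3⟩ := hI i s hs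
    refine ⟨by simpa [Expr.costFactor, Expr.lenFactor] using Expr.cost_le h3 (.op .sub (.reg K) (.reg r)), ?_⟩
    simp [Expr.eval, Op.eval, h1, h2]
  have key : ∀ n i s, i + n = k → I i s → ∃ s' t,
      Exec (.loop (.op .sub (.reg K) (.reg r))
        (.seq c (.assign r (.op .add (.reg r) (.const 1))))) s s' t ∧
      t ≤ n * (T + 20 * L ^ 2) + 4 * L ^ 2 ∧ I k s' := by
    intro n
    induction n with
    | zero =>
      intro i s hi hs
      obtain ⟨h1, h2⟩ := htest i s hs
      have : i = k := by omega
      refine ⟨s, _, Exec.loop_false (by rw [h2]; omega), ?_, this ▸ hs⟩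
      have := Nat.one_le_pow 2 L hL
      omega
    | succ n ih =>
      intro i s hi hs
      obtain ⟨h1, h2⟩ := htest i s hs
      obtain ⟨s', t, he, ht, hb, hr, hI'⟩ := hc i (by omega) s hs
      obtain ⟨s'', t', he', ht', hI''⟩ := ih (i + 1) _ (by omega) hI'
      have hcost : Expr.cost s' (.op .add (.reg r) (.const 1)) ≤ 5 * L ^ 2 := by
        simpa [Expr.costFactor, Expr.lenFactor, len] using
          Expr.cost_le hb (.op .add (.reg r) (.const 1))
      have hval : Expr.eval s' (.op .add (.reg r) (.const 1)) = ((i + 1 : ℕ) : ℤ) := by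
        simp [Expr.eval, Op.eval, hr]
      refine ⟨s'', _, Exec.loop_true (by rw [h2]; omega)
        (Exec.seq he (Exec.assign r _ s')) (by rw [hval]; exact he'), ?_, hI''⟩
      have := Nat.one_le_pow 2 L hL
      rw [add_mul, one_mul]
      omega
  obtain ⟨s', t, he, ht, hs'⟩ := key k 0 _ (by omega) h0
  refine ⟨s', _, Exec.seq (Exec.assign r (.const 0) s) he, ?_, hs'⟩
  have := Nat.one_le_pow 2 L hL
  have h2 : Expr.cost s (.const 0) = 1 := by simp [Expr.cost, len]
  rw [h2, add_mul, one_mul]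
  omega

/-- Start with the value of `e₀` in register `2`, and replace it by the value of `e` for the values
`0, …, k - 1` of register `1`, where register `J` holds `k`. -/
def Program.fold (J : ℕ) (e₀ e : Expr) : Program :=
  .seq (.assign 2 e₀) (.iter 1 J (.assign 2 e))

/-- The successive values of register `2` in `Program.fold J e₀ e`. -/
def foldVal (s : State) (e₀ e : Expr) : ℕ → ℤ
  | 0 => e₀.eval s
  | j + 1 => e.eval ((s.setReg 1 j).setReg 2 (foldVal s e₀ e j))

theorem State.setReg_comm (s : State) {r r' : ℕ} (h : r ≠ r') (x y : ℤ) :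
    (s.setReg r x).setReg r' y = (s.setReg r' y).setReg r x := by
  simp [State.setReg, Function.update_comm h.symm]

theorem State.setReg_setReg (s : State) (r : ℕ) (x y : ℤ) :
    (s.setReg r x).setReg r y = s.setReg r y := by
  simp [State.setReg]

theorem exec_fold {J k L : ℕ} {e₀ e : Expr} {s : State} (hJ : 3 ≤ J) (hk : s.reg J = k)
    (hs : s.Bdd L) (hv : ∀ j ≤ k, len (foldVal s e₀ e j) ≤ L) :
    ∃ t, Exec (.fold J e₀ e) s ((s.setReg 1 k).setReg 2 (foldVal s e₀ e k)) t ∧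
      t ≤ (k + 1) * ((e₀.costFactor + e.costFactor + 22) * L ^ 2) := by
  have hL : 1 ≤ L := hs.one_le
  have hb : ∀ j ≤ k, ((s.setReg 1 j).setReg 2 (foldVal s e₀ e j)).Bdd L := fun j hj =>
    (hs.setReg ((len_natCast_mono hj).trans (hk ▸ hs.1 J))).setReg (hv j hj)
  have key := exec_iter (r := 1) (K := J) (k := k) (L := L)
    (T := (e.costFactor + 1) * L ^ 2) (c := .assign 2 e) (s := s.setReg 2 (e₀.eval s))
    (I := fun i s' => i ≤ k ∧ s' = (s.setReg 1 i).setReg 2 (foldVal s e₀ e i)) ?_ ?_ ?_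
  · obtain ⟨s', t, he, ht, hle, rfl⟩ := key
    refine ⟨_, Exec.seq (Exec.assign 2 e₀ s) he, ?_⟩
    have h1 := Expr.cost_le hs e₀
    have h2 := Nat.one_le_pow 2 L hL
    have h3 : e₀.cost s + 1 ≤ (k + 1) * ((e₀.costFactor + 1) * L ^ 2) := by
      refine le_trans ?_ (Nat.le_mul_of_pos_left _ (Nat.succ_pos k))
      rw [add_mul]; omega
    calc _ ≤ (k + 1) * ((e₀.costFactor + 1) * L ^ 2) +
          (k + 1) * ((e.costFactor + 1) * L ^ 2 + 20 * L ^ 2) := add_le_add h3 ht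
      _ = _ := by ring
  · rintro i s' ⟨hi, rfl⟩
    refine ⟨?_, ?_, hb i hi⟩
    · rw [State.setReg_reg_of_ne _ (by omega), State.setReg_reg_of_ne _ (by omega), hk]
    · rw [State.setReg_reg_of_ne _ (by omega), State.setReg_reg_self]
  · exact ⟨Nat.zero_le _, by rw [State.setReg_comm _ (by decide)]; rfl⟩
  · rintro i hi s' ⟨_, rfl⟩
    refine ⟨_, _, Exec.assign 2 e _, ?_, ?_, ?_, ?_⟩
    · have h1 := Expr.cost_le (hb i hi.le) e
      have h2 := Nat.one_le_pow 2 L hL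
      rw [add_mul]; omega
    · exact (hb i hi.le).setReg (hv (i + 1) hi)
    · rw [State.setReg_reg_of_ne _ (by omega), State.setReg_reg_of_ne _ (by omega),
        State.setReg_reg_self]
    · refine ⟨hi, ?_⟩
      rw [State.setReg_setReg]
      rw [State.setReg_comm _ (by decide : (2:ℕ) ≠ 1), State.setReg_setReg]
      rfl

/-- The expression reads neither array `a` nor register `2`. -/
def Expr.avoids (a : ℕ) : Expr → Bool
  | .const _ => true
  | .reg r => r != 2
  | .get b i => b != a && i.avoids a
  | .op _ e f => e.avoids a && f.avoids a

/-- While a table is filled, the accumulator and the target array change; the summands must not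
depend on them. -/
theorem Expr.eval_congr {a : ℕ} {e : Expr} (he : e.avoids a = true) {s s' : State}
    (hr : ∀ r, r ≠ 2 → s'.reg r = s.reg r) (ha : ∀ b, b ≠ a → s'.arr b = s.arr b) :
    e.eval s' = e.eval s := by
  induction e with
  | const c => rfl
  | reg r => exact hr r (by simpa [Expr.avoids] using he)
  | get b i hi =>
    simp only [Expr.avoids, Bool.and_eq_true, bne_iff_ne, ne_eq] at he
    simp only [Expr.eval, hi he.2, ha b he.1]
  | op o e f h1 h2 =>
    simp only [Expr.avoids, Bool.and_eq_true] at he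
    simp only [Expr.eval, h1 he.1, h2 he.2]

/-- Store in the cells `i` of array `a`, for all `i` below the value of register `K`, the sum of the
values of `e`, with `i` in register `0`, for all values below that of register `J` of
register `1`. -/
def Program.tab (a K J : ℕ) (e : Expr) : Program :=
  .iter 0 K (.seq (.fold J (.const 0) (.op .add (.reg 2) e)) (.put a (.reg 0) (.reg 2)))

/-- The value of the expression `e` if registers `0` and `1` hold `i` and `j`. -/
def Expr.at (e : Expr) (s : State) (i j : ℕ) : ℤ :=
  e.eval ((s.setReg 0 i).setReg 1 j)

/-- The effect of `Program.tab a K J e` on memory. -/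
structure TabSpec (a : ℕ) (e : Expr) (k l : ℕ) (s s' : State) : Prop where
  reg : ∀ r, 3 ≤ r → s'.reg r = s.reg r
  arr : ∀ b, b ≠ a → s'.arr b = s.arr b
  apply : ∀ i < k, s'.arr a i = ∑ j ∈ Finset.range l, e.at s i j
  apply_of_le : ∀ i, k ≤ i → s'.arr a i = s.arr a i

/-- Each addition lengthens the partial sum by at most one symbol, so the sum of `l` terms exceeds
the length of the terms by about `l`. -/
theorem exec_tab {a K J k l L : ℕ} {e : Expr} {s : State} (hK : 3 ≤ K) (hJ : 3 ≤ J)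
    (he : e.avoids a = true) (hk : s.reg K = k) (hl : s.reg J = l) (hs : s.Bdd L) :
    ∃ s' t, Exec (.tab a K J e) s s' t ∧
      t ≤ (k + 1) * ((l + 1) * ((e.costFactor + e.lenFactor + 60) * (L + e.lenFactor * L + l + 1) ^ 2)) ∧
      s'.Bdd (L + e.lenFactor * L + l + 1) ∧ TabSpec a e k l s s' := by
  set L' := L + e.lenFactor * L + l + 1 with hL'
  have hLL' : L ≤ L' := by omega
  have hf : ∀ i < k, ∀ j < l, len (e.at s i j) ≤ e.lenFactor * L := fun i hi j hj =>
    Expr.len_eval_le ((hs.setReg ((len_natCast_mono hi.le).trans (hk ▸ hs.1 K))).setReg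
      ((len_natCast_mono hj.le).trans (hl ▸ hs.1 J))) e
  have hsum : ∀ i < k, ∀ j ≤ l, len (∑ j ∈ Finset.range j, e.at s i j) ≤ e.lenFactor * L + j + 1 := by
    intro i hi j
    induction j with
    | zero => intro _; simp [len]
    | succ j ih =>
      intro hj
      rw [Finset.sum_range_succ]
      exact (len_add_le_succ (ih (by omega)) ((hf i hi j hj).trans (by omega))).trans (by omega)
  set C := (l + 1) * (((Expr.const 0).costFactor + (Expr.op .add (.reg 2) e).costFactor + 22) * L' ^ 2)
    with hC
  have key := exec_iter (r := 0) (K := K) (k := k) (L := L')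
    (T := C + 3 * L' ^ 2)
    (c := .seq (.fold J (.const 0) (.op .add (.reg 2) e)) (.put a (.reg 0) (.reg 2))) (s := s)
    (I := fun i s' => (∀ r, 3 ≤ r → s'.reg r = s.reg r) ∧ (∀ b, b ≠ a → s'.arr b = s.arr b) ∧
      (∀ x < i, s'.arr a x = ∑ j ∈ Finset.range l, e.at s x j) ∧
      (∀ x, i ≤ x → s'.arr a x = s.arr a x) ∧ s'.reg 0 = i ∧ s'.Bdd L' ∧ i ≤ k)
      ?_ ?_ ?_
  · obtain ⟨s', t, hex, ht, ⟨h1, h2, h3, h3', -, hbd, -⟩⟩ := key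
    refine ⟨s', t, hex, ht.trans ?_, hbd, h1, h2, h3, h3'⟩
    refine Nat.mul_le_mul_left _ ?_
    have h4 : 23 * L' ^ 2 ≤ (l + 1) * (23 * L' ^ 2) := Nat.le_mul_of_pos_left _ (Nat.succ_pos l)
    calc C + 3 * L' ^ 2 + 20 * L' ^ 2 ≤ C + (l + 1) * (23 * L' ^ 2) := by omega
      _ = (l + 1) * ((e.costFactor + e.lenFactor + 47) * L' ^ 2) := by
        rw [hC]; simp only [Expr.costFactor, Expr.lenFactor, len]; simp; ring
      _ ≤ _ := by gcongr; omega
  · rintro i s' ⟨h1, h2, h3, h3', h4, h5, h6⟩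
    exact ⟨by rw [h1 K hK, hk], h4, h5⟩
  · refine ⟨fun r hr => State.setReg_reg_of_ne _ (by omega) _, fun b _ => rfl, by simp, fun _ _ => rfl, by simp,
      (hs.mono hLL').setReg ?_, Nat.zero_le _⟩
    simp [len]; omega
  · rintro i hi s' ⟨h1, h2, h3, h3', h4, h5, h6⟩
    have hat : ∀ j x, e.eval ((s'.setReg 1 (j : ℕ)).setReg 2 x) = e.at s i j := by
      intro j x
      refine Expr.eval_congr he (fun r hr => ?_) fun b hb => h2 b hb
      rw [State.setReg_reg_of_ne _ hr]
      rcases Nat.lt_or_ge r 3 with h | h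
      · interval_cases r
        · simp [State.setReg, h4]
        · simp
        · omega
      · simp only [State.setReg_reg_of_ne _ (show r ≠ 1 by omega),
          State.setReg_reg_of_ne _ (show r ≠ 0 by omega), h1 r h]
    have hv : ∀ j, foldVal s' (.const 0) (.op .add (.reg 2) e) j =
        ∑ j ∈ Finset.range j, e.at s i j := by
      intro j
      induction j with
      | zero => simp [foldVal, Expr.eval]
      | succ j ih =>
        rw [foldVal, Finset.sum_range_succ, Expr.eval, Op.eval, hat, ih]
        simp [Expr.eval]
    obtain ⟨t, hex, ht⟩ := exec_fold (J := J) (k := l) (L := L') (e₀ := .const 0)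
      (e := .op .add (.reg 2) e) (s := s') hJ (by rw [h1 J hJ, hl]) h5
      (fun j hj => by rw [hv]; exact (hsum i hi j hj).trans (by omega))
    set s'' := (s'.setReg 1 l).setReg 2 (foldVal s' (.const 0) (.op .add (.reg 2) e) l) with hs''
    have hlen : len (foldVal s' (.const 0) (.op .add (.reg 2) e) l) ≤ L' := by
      rw [hv]; exact (hsum i hi l le_rfl).trans (by omega)
    have hb'' : s''.Bdd L' :=
      (h5.setReg ((hl ▸ hs.1 J).trans hLL')).setReg hlen
    have h0 : s''.reg 0 = i := by
      rw [hs'', State.setReg_reg_of_ne _ (by decide), State.setReg_reg_of_ne _ (by decide), h4]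
    have h2' : s''.reg 2 = ∑ j ∈ Finset.range l, e.at s i j := by
      rw [hs'', State.setReg_reg_self, hv]
    refine ⟨_, _, Exec.seq hex (Exec.put a (.reg 0) (.reg 2) s''), ?_, ?_, ?_, ?_⟩
    · have := hb''.1 0
      have := hb''.1 2
      have := Nat.le_self_pow two_ne_zero L'
      have := hb''.one_le
      simp only [Expr.cost]
      omega
    · refine hb''.setArr ?_
      simp only [Expr.eval]; exact hb''.1 2
    · simpa using h0
    · refine ⟨fun r hr => ?_, fun b hb => ?_, fun x hx => ?_, fun x hx => ?_, by simp, ?_, hi⟩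
      · simp only [State.setReg_reg_of_ne _ (show r ≠ 0 by omega), State.setArr_reg, hs'',
          State.setReg_reg_of_ne _ (show r ≠ 1 by omega),
          State.setReg_reg_of_ne _ (show r ≠ 2 by omega), h1 r hr]
      · simp only [State.setReg_arr, State.setArr, Function.update_of_ne hb, hs'', h2 b hb]
      · simp only [State.setReg_arr, State.setArr, Expr.eval, h0, Function.update_self, h2',
          Int.toNat_natCast]
        by_cases hxi : x = i
        · subst hxi; simp
        · rw [Function.update_of_ne hxi]
          exact h3 x (by omega)
      · simp only [State.setReg_arr, State.setArr, Expr.eval, h0, Function.update_self,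
          Int.toNat_natCast]
        rw [Function.update_of_ne (by omega)]
        exact h3' x (by omega)
      · refine State.Bdd.setReg (hb''.setArr ?_) ?_
        · simp only [Expr.eval]; exact hb''.1 2
        · exact ((len_natCast_mono hi).trans (hk ▸ hs.1 K)).trans hLL'

end RAM

/-! ### Programs with polynomially bounded costs -/

namespace RAM

section Runs

variable {Ω : Type*} (sz : Ω → ℕ)

/-- The function `f` of the instance is bounded by a polynomial in the size of the instance. -/
def PolyBdd (f : Ω → ℕ) : Prop :=
  ∃ p : Polynomial ℕ, ∀ ω, f ω ≤ p.eval (sz ω)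

variable {sz}

namespace PolyBdd

variable {f g : Ω → ℕ}

theorem mono (hg : PolyBdd sz g) (h : ∀ ω, f ω ≤ g ω) : PolyBdd sz f :=
  let ⟨p, hp⟩ := hg
  ⟨p, fun ω => (h ω).trans (hp ω)⟩

theorem const (c : ℕ) : PolyBdd sz fun _ => c :=
  ⟨Polynomial.C c, fun ω => by simp⟩

theorem size : PolyBdd sz sz :=
  ⟨Polynomial.X, fun ω => by simp⟩

theorem add (hf : PolyBdd sz f) (hg : PolyBdd sz g) : PolyBdd sz fun ω => f ω + g ω :=
  let ⟨p, hp⟩ := hf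
  let ⟨q, hq⟩ := hg
  ⟨p + q, fun ω => by rw [Polynomial.eval_add]; exact add_le_add (hp ω) (hq ω)⟩

theorem mul (hf : PolyBdd sz f) (hg : PolyBdd sz g) : PolyBdd sz fun ω => f ω * g ω :=
  let ⟨p, hp⟩ := hf
  let ⟨q, hq⟩ := hg
  ⟨p * q, fun ω => by rw [Polynomial.eval_mul]; exact Nat.mul_le_mul (hp ω) (hq ω)⟩

theorem pow (hf : PolyBdd sz f) (k : ℕ) : PolyBdd sz fun ω => f ω ^ k := by
  induction k with
  | zero => simpa using const 1
  | succ k ih => simpa only [pow_succ] using ih.mul hf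

theorem comp {Ω' : Type*} (hf : PolyBdd sz f) (g : Ω' → Ω) :
    PolyBdd (fun x => sz (g x)) fun x => f (g x) :=
  let ⟨p, hp⟩ := hf
  ⟨p, fun x => hp (g x)⟩

end PolyBdd

variable (sz) in
/-- Started in memory with `P`, the program `c` halts in memory with `Q`; if the lengths of the
integers in memory are polynomially bounded, then so are the cost and the lengths at the end. -/
def Runs (P : Ω → State → Prop) (c : Program) (Q : Ω → State → Prop) : Prop :=
  ∀ L : Ω → ℕ, PolyBdd sz L → ∃ T : Ω → ℕ, PolyBdd sz T ∧ ∀ ω s, P ω s → s.Bdd (L ω) →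
    ∃ s' t, Exec c s s' t ∧ t ≤ T ω ∧ s'.Bdd (T ω) ∧ Q ω s'

namespace Runs

variable {P Q R : Ω → State → Prop} {c d : Program}

theorem conseq {P' Q' : Ω → State → Prop} (h : Runs sz P c Q) (hP : ∀ ω s, P' ω s → P ω s)
    (hQ : ∀ ω s, Q ω s → Q' ω s) : Runs sz P' c Q' := by
  intro L hL
  obtain ⟨T, hT, h⟩ := h L hL
  refine ⟨T, hT, fun ω s hs hb => ?_⟩
  obtain ⟨s', t, h1, h2, h3, h4⟩ := h ω s (hP ω s hs) hb
  exact ⟨s', t, h1, h2, h3, hQ ω s' h4⟩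

/-- The length bound at the end of `c` becomes the one at the start of `d`; for this reason `Runs`
quantifies over all polynomially bounded `L`. -/
theorem seq (hc : Runs sz P c Q) (hd : Runs sz Q d R) : Runs sz P (.seq c d) R := by
  intro L hL
  obtain ⟨T, hT, hc⟩ := hc L hL
  obtain ⟨T', hT', hd⟩ := hd T hT
  refine ⟨_, hT.add hT', fun ω s hs hb => ?_⟩
  obtain ⟨s', t, h1, h2, h3, h4⟩ := hc ω s hs hb
  obtain ⟨s'', t', h1', h2', h3', h4'⟩ := hd ω s' h4 h3
  exact ⟨s'', _, Exec.seq h1 h1', add_le_add h2 h2', h3'.mono (Nat.le_add_left _ _), h4'⟩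

theorem assign (P : Ω → State → Prop) (r : ℕ) (e : Expr) :
    Runs sz P (.assign r e) fun ω s' => ∃ s, P ω s ∧ s' = s.setReg r (e.eval s) := by
  intro L hL
  refine ⟨_, (((PolyBdd.const e.costFactor).mul (hL.pow 2)).add (PolyBdd.const 1)).add
    (((PolyBdd.const e.lenFactor).mul hL).add hL), fun ω s hs hb => ?_⟩
  refine ⟨_, _, Exec.assign r e s, ?_, ?_, s, hs, rfl⟩
  · have := e.cost_le hb; omega
  · exact (hb.mono (by omega)).setReg ((e.len_eval_le hb).trans (by omega))

theorem put (P : Ω → State → Prop) (a : ℕ) (i e : Expr) :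
    Runs sz P (.put a i e) fun ω s' =>
      ∃ s, P ω s ∧ s' = s.setArr a (i.eval s).toNat (e.eval s) := by
  intro L hL
  refine ⟨_, ((((PolyBdd.const i.costFactor).mul (hL.pow 2)).add
    ((PolyBdd.const e.costFactor).mul (hL.pow 2))).add (PolyBdd.const 1)).add
    (((PolyBdd.const e.lenFactor).mul hL).add hL), fun ω s hs hb => ?_⟩
  refine ⟨_, _, Exec.put a i e s, ?_, ?_, s, hs, rfl⟩
  · have := e.cost_le hb; have := i.cost_le hb; omega
  · exact (hb.mono (by omega)).setArr ((e.len_eval_le hb).trans (by omega))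

theorem cond {e : Expr} (hc : Runs sz (fun ω s => P ω s ∧ 0 < e.eval s) c Q)
    (hd : Runs sz (fun ω s => P ω s ∧ ¬ 0 < e.eval s) d Q) : Runs sz P (.cond e c d) Q := by
  intro L hL
  obtain ⟨T, hT, hc⟩ := hc L hL
  obtain ⟨T', hT', hd⟩ := hd L hL
  refine ⟨_, (((PolyBdd.const e.costFactor).mul (hL.pow 2)).add (PolyBdd.const 1)).add
    (hT.add hT'), fun ω s hs hb => ?_⟩
  have he := e.cost_le hb
  by_cases h : 0 < e.eval s
  · obtain ⟨s', t, h1, h2, h3, h4⟩ := hc ω s ⟨hs, h⟩ hb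
    exact ⟨s', _, Exec.cond_true h h1, by omega, h3.mono (by omega), h4⟩
  · obtain ⟨s', t, h1, h2, h3, h4⟩ := hd ω s ⟨hs, h⟩ hb
    exact ⟨s', _, Exec.cond_false h h1, by omega, h3.mono (by omega), h4⟩

theorem fold {J : ℕ} {e₀ e : Expr} {k : Ω → ℕ} (hJ : 3 ≤ J) (hk : ∀ ω s, P ω s → s.reg J = k ω)
    (hk' : PolyBdd sz k)
    (hv : ∀ L : Ω → ℕ, PolyBdd sz L → ∃ B : Ω → ℕ, PolyBdd sz B ∧ ∀ ω s, P ω s → s.Bdd (L ω) →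
      ∀ j ≤ k ω, len (foldVal s e₀ e j) ≤ B ω) :
    Runs sz P (.fold J e₀ e) fun ω s' =>
      ∃ s, P ω s ∧ s' = (s.setReg 1 (k ω)).setReg 2 (foldVal s e₀ e (k ω)) := by
  intro L hL
  obtain ⟨B, hB, hv⟩ := hv L hL
  have hLB := hL.add hB
  refine ⟨_, ((hk'.add (PolyBdd.const 1)).mul ((PolyBdd.const
    (e₀.costFactor + e.costFactor + 22)).mul (hLB.pow 2))).add hLB, fun ω s hs hb => ?_⟩
  have hb' : s.Bdd (L ω + B ω) := hb.mono (Nat.le_add_right _ _)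
  have hv' : ∀ j ≤ k ω, len (foldVal s e₀ e j) ≤ L ω + B ω := fun j hj =>
    (hv ω s hs hb j hj).trans (Nat.le_add_left _ _)
  obtain ⟨t, h1, h2⟩ := exec_fold hJ (hk ω s hs) hb' hv'
  refine ⟨_, t, h1, h2.trans (Nat.le_add_right _ _), ?_, s, hs, rfl⟩
  refine State.Bdd.mono ?_ (Nat.le_add_left _ _)
  exact (hb'.setReg ((hk ω s hs) ▸ hb'.1 J)).setReg (hv' _ le_rfl)

theorem tab {a K J : ℕ} {e : Expr} {k l : Ω → ℕ} (hK : 3 ≤ K) (hJ : 3 ≤ J)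
    (he : e.avoids a = true) (hk : ∀ ω s, P ω s → s.reg K = k ω)
    (hl : ∀ ω s, P ω s → s.reg J = l ω) (hk' : PolyBdd sz k) (hl' : PolyBdd sz l) :
    Runs sz P (.tab a K J e) fun ω s' => ∃ s, P ω s ∧ TabSpec a e (k ω) (l ω) s s' := by
  intro L hL
  have hL' := ((hL.add ((PolyBdd.const e.lenFactor).mul hL)).add hl').add (PolyBdd.const 1)
  refine ⟨_, ((hk'.add (PolyBdd.const 1)).mul ((hl'.add (PolyBdd.const 1)).mul ((PolyBdd.const
    (e.costFactor + e.lenFactor + 60)).mul (hL'.pow 2)))).add hL', fun ω s hs hb => ?_⟩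
  obtain ⟨s', t, h1, h2, h3, h4⟩ := exec_tab hK hJ he (hk ω s hs) (hl ω s hs) hb
  exact ⟨s', t, h1, h2.trans (Nat.le_add_right _ _), h3.mono (Nat.le_add_left _ _), s, hs, h4⟩

/-- In the invariant `I ω s₀ i s`, the memory before the loop is `s₀`, and `s` is that before the
pass with number `i`. -/
theorem iter {r K : ℕ} {k : Ω → ℕ} (hk : PolyBdd sz k)
    (h : ∀ L : Ω → ℕ, PolyBdd sz L → ∃ L' : Ω → ℕ, PolyBdd sz L' ∧
      ∃ I : Ω → State → ℕ → State → Prop,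
        (∀ ω s, P ω s → s.Bdd (L ω) → I ω s 0 (s.setReg r 0)) ∧
        (∀ ω s₀ i s, I ω s₀ i s → s.reg K = k ω ∧ s.reg r = i ∧ s.Bdd (L' ω)) ∧
        Runs (fun x : Ω × State × ℕ × State => sz x.1)
          (fun x s => x.2.2.1 < k x.1 ∧ I x.1 x.2.1 x.2.2.1 s ∧ s = x.2.2.2) c
          (fun x s' => s'.reg r = x.2.2.1 ∧
            I x.1 x.2.1 (x.2.2.1 + 1) (s'.setReg r (x.2.2.1 + 1 : ℕ))) ∧
        ∀ ω s₀ s, P ω s₀ → I ω s₀ (k ω) s → Q ω s) :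
    Runs sz P (.iter r K c) Q := by
  intro L hL
  obtain ⟨L', hL', I, h0, hI, hc, hQ⟩ := h L hL
  -- The body runs on instances enlarged by the memory and the number of the pass, but their size is
  -- that of `ω`. So one polynomial bounds all passes.
  obtain ⟨T, ⟨p, hp⟩, hc⟩ := hc _ (hL'.comp Prod.fst)
  have hp' : PolyBdd sz fun ω => p.eval (sz ω) := ⟨p, fun _ => le_rfl⟩
  have hB := hL'.add hp'
  refine ⟨_, ((hk.add (PolyBdd.const 1)).mul (hp'.add
    ((PolyBdd.const 20).mul (hB.pow 2)))).add hL', fun ω s hs hb => ?_⟩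
  obtain ⟨s', t, h1, h2, h3⟩ := exec_iter (r := r) (K := K) (k := k ω) (T := p.eval (sz ω))
    (L := L' ω + p.eval (sz ω)) (c := c) (I := I ω s) (s := s)
    (fun i s' hs' => ⟨(hI ω s i s' hs').1, (hI ω s i s' hs').2.1,
      (hI ω s i s' hs').2.2.mono (Nat.le_add_right _ _)⟩) (h0 ω s hs hb) fun i hi s' hs' => by
      obtain ⟨s'', t, h1, h2, h3, h4, h5⟩ := hc (ω, s, i, s') s' ⟨hi, hs', rfl⟩
        (hI ω s i s' hs').2.2
      exact ⟨s'', t, h1, h2.trans (hp _), h3.mono ((hp _).trans (Nat.le_add_left _ _)), h4, h5⟩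
  exact ⟨s', t, h1, h2.trans (Nat.le_add_right _ _),
    (hI ω s _ s' h3).2.2.mono (Nat.le_add_left _ _), hQ ω s s' hs h3⟩

end Runs

end Runs

end RAM

/-! ### A program that solves linear systems -/

namespace RAM

instance : Add Expr := ⟨.op .add⟩
instance : Sub Expr := ⟨.op .sub⟩
instance : Mul Expr := ⟨.op .mul⟩
instance : Div Expr := ⟨.op .div⟩

namespace Expr

variable (s : State) (e f : Expr)

@[simp] theorem eval_add : (e + f).eval s = e.eval s + f.eval s := rfl
@[simp] theorem eval_sub : (e - f).eval s = e.eval s - f.eval s := rfl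
@[simp] theorem eval_mul : (e * f).eval s = e.eval s * f.eval s := rfl
@[simp] theorem eval_div : (e / f).eval s = e.eval s / f.eval s := rfl
@[simp] theorem eval_const (c : ℤ) : (const c).eval s = c := rfl
@[simp] theorem eval_reg (r : ℕ) : (reg r).eval s = s.reg r := rfl
@[simp] theorem eval_get (a : ℕ) : (get a e).eval s = s.arr a (e.eval s).toNat := rfl

/-- The value is `1` if `e` is zero, and `0` otherwise. -/
def isZero (e : Expr) : Expr := const 1 / (const 1 + e * e)

/-- The value is `0` if `e` is zero, and `1` otherwise. -/
def nonzero (e : Expr) : Expr := const 1 - e.isZero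

/-- The remainder of a division. -/
def mod (e f : Expr) : Expr := e - e / f * f

-- The division rounds down, and `1 + x * x ≥ 2` for a nonzero integer `x`.
@[simp] theorem eval_isZero : e.isZero.eval s = if e.eval s = 0 then 1 else 0 := by
  simp only [isZero, eval_div, eval_add, eval_mul, eval_const]
  split_ifs with h
  · simp [h]
  · have : 0 < e.eval s * e.eval s := mul_self_pos.2 h
    exact Int.ediv_eq_zero_of_lt (by norm_num) (by omega)

@[simp] theorem eval_nonzero : e.nonzero.eval s = if e.eval s = 0 then 0 else 1 := by
  simp only [nonzero, eval_sub, eval_const, eval_isZero]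
  split_ifs <;> simp

@[simp] theorem eval_mod : (e.mod f).eval s = e.eval s % f.eval s := by
  simp only [mod, eval_sub, eval_mul, eval_div]
  rw [Int.emod_def, mul_comm]

end Expr

namespace Solver

open RAM.Expr

/-- The entries of the augmented matrix. -/
def augmentExpr : Expr :=
  isZero ((reg 0).mod (reg 7) - reg 20) * get 21 (reg 0 / reg 7) +
    nonzero ((reg 0).mod (reg 7) - reg 20) * get 20 (reg 0 / reg 7 * reg 20 + (reg 0).mod (reg 7))

/-- The search for a nonzero entry in the row given by register `3`. -/
def searchExpr : Expr :=
  reg 2 + nonzero (get 23 (reg 3 * reg 7 + reg 1)) * (reg 1 - reg 2)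

/-- The entries of the tableau after pivoting. -/
def pivotExpr : Expr :=
  isZero (reg 0 / reg 7 - reg 3) * get 23 (reg 0) +
    nonzero (reg 0 / reg 7 - reg 3) *
      ((get 23 (reg 3 * reg 7 + reg 5) * get 23 (reg 0) -
        get 23 (reg 0 / reg 7 * reg 7 + reg 5) * get 23 (reg 3 * reg 7 + (reg 0).mod (reg 7))) /
          reg 4)

/-- Pivot in the row and column given by registers `3` and `5`. -/
def pivotProgram : Program :=
  .seq (.tab 24 8 9 pivotExpr)
    (.seq (.tab 23 8 9 (get 24 (reg 0))) (.assign 4 (get 23 (reg 3 * reg 7 + reg 5))))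

/-- Treat the row given by register `3`. -/
def rowProgram : Program :=
  .seq (.seq (.fold 20 (const (-1)) searchExpr)
      (.seq (.assign 5 (reg 2)) (.put 25 (reg 3) (reg 5))))
    (.seq (.cond (reg 5 + const 1) pivotProgram (.assign 5 (const 0)))
      (.seq (.assign 0 (const 0)) (.seq (.assign 1 (const 0)) (.seq (.assign 2 (const 0))
        (.assign 5 (const 0))))))

/-- The memory holds a matrix of size `N` in array `20` and a right-hand side in array `21`; this is
the augmented matrix. -/
def augmented (N : ℕ) (s : State) : Matrix (Fin N) ℕ ℤ :=
  Matrix.of fun i j => if j < N then s.arr 20 (i * N + j) else s.arr 21 i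

/-- The memory before the first row is treated. -/
structure Ready (N : ℕ) (s : State) : Prop where
  reg4 : s.reg 4 = 1
  reg7 : s.reg 7 = (N + 1 : ℕ)
  reg8 : s.reg 8 = (N * (N + 1) : ℕ)
  reg9 : s.reg 9 = (1 : ℕ)
  reg20 : s.reg 20 = N
  arr : ∀ (i : Fin N) (j : ℕ), j ≤ N → s.arr 23 (i * (N + 1) + j) = augmented N s i j

/-- The memory `s` before row `p` is treated, where `s₀` is that before the first row. -/
structure Invariant (N L : ℕ) (s₀ : State) (p : ℕ) (s : State) : Prop where
  ready : Ready N s₀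
  bdd₀ : s₀.Bdd L
  bdd : s.Bdd (L + N * N + L * N + 3)
  reg3 : s.reg 3 = p
  reg : ∀ r, 6 ≤ r → s.reg r = s₀.reg r
  arr : ∀ b, b ≠ 23 → b ≠ 24 → b ≠ 25 → s.arr b = s₀.arr b
  tableau : ∃ (piv : Fin N → Option ℕ) (W : Matrix (Fin N) ℕ ℤ),
    (augmented N s₀).IsTableau {j | j < N} {i | i.val < p} piv (s.reg 4) W ∧
    (∀ (i : Fin N) (j : ℕ), j ≤ N → s.arr 23 (i * (N + 1) + j) = W i j) ∧
    ∀ i : Fin N, i.val < p → s.arr 25 i = (piv i).elim (-1) Nat.cast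

/-- By `N! ≤ N ^ N ≤ 2 ^ (N * N)`, the determinant bound is at most `2 ^ (N * N + L * N)`. -/
theorem len_le_of_abs_le {N L : ℕ} {x : ℤ} (h : |x| ≤ (N.factorial : ℤ) * (2 ^ L) ^ N) :
    len x ≤ L + N * N + L * N + 3 := by
  have h1 : x.natAbs ≤ N.factorial * (2 ^ L) ^ N := by
    zify; exact h
  have h2 : N.factorial ≤ 2 ^ (N * N) := calc
    N.factorial ≤ N ^ N := N.factorial_le_pow
    _ ≤ (2 ^ N) ^ N := Nat.pow_le_pow_left Nat.lt_two_pow_self.le N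
    _ = 2 ^ (N * N) := by rw [pow_mul]
  have h3 : x.natAbs ≤ 2 ^ (N * N + L * N) := by
    rw [pow_add, pow_mul 2 L N]; exact h1.trans (Nat.mul_le_mul_right _ h2)
  have h4 : len x ≤ (N * N + L * N + 1) + 1 := by
    rw [len_le_iff, pow_succ]
    have : 0 < 2 ^ (N * N + L * N) := by positivity
    omega
  omega

theorem abs_augmented_le {N L : ℕ} {s : State} (h : s.Bdd L) (i : Fin N) (j : ℕ) :
    |augmented N s i j| ≤ (2 ^ L : ℤ) := by
  have : ∀ x : ℤ, len x ≤ L → |x| ≤ (2 ^ L : ℤ) := by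
    intro x hx
    have h1 := natAbs_lt_two_pow_len x
    have h2 : 2 ^ (len x - 1) ≤ 2 ^ L := Nat.pow_le_pow_right (by norm_num) (by omega)
    zify at h1 h2
    exact (h1.trans_le h2).le
  simp only [augmented, Matrix.of_apply]
  split_ifs
  · exact this _ (h.2 _ _)
  · exact this _ (h.2 _ _)

theorem len_tableau_le {N L : ℕ} {s : State} (h : s.Bdd L) {p : ℕ} {piv : Fin N → Option ℕ} {d : ℤ}
    {W : Matrix (Fin N) ℕ ℤ}
    (hW : (augmented N s).IsTableau {j | j < N} {i | i.val < p} piv d W) :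
    len d ≤ L + N * N + L * N + 3 ∧ ∀ i j, len (W i j) ≤ L + N * N + L * N + 3 := by
  have hX : (1 : ℤ) ≤ 2 ^ L := by exact_mod_cast Nat.one_le_two_pow
  have hM := fun i j => abs_augmented_le h (N := N) i j
  refine ⟨len_le_of_abs_le ?_, fun i j => len_le_of_abs_le ?_⟩
  · simpa using hW.abs_le hX fun i j _ => hM i j
  · simpa using hW.abs_apply_le hX (fun i j _ => hM i j) (fun i => hM i j) i

theorem exists_index {N x : ℕ} (hx : x < N * (N + 1)) :
    ∃ (i : Fin N) (j : ℕ), j ≤ N ∧ x = i * (N + 1) + j := by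
  refine ⟨⟨x / (N + 1), Nat.div_lt_of_lt_mul (by rwa [mul_comm] at hx)⟩, x % (N + 1), ?_, ?_⟩
  · exact Nat.lt_succ_iff.1 (Nat.mod_lt _ (Nat.succ_pos N))
  · rw [mul_comm]; exact (Nat.div_add_mod _ _).symm

theorem index_lt {N j : ℕ} (i : Fin N) (hj : j ≤ N) : i * (N + 1) + j < N * (N + 1) := by
  have := i.isLt
  calc i * (N + 1) + j < (i + 1) * (N + 1) := by rw [add_mul]; omega
    _ ≤ N * (N + 1) := Nat.mul_le_mul_right _ this

theorem index_div {N j : ℕ} (i : ℕ) (hj : j ≤ N) :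
    ((i * (N + 1) + j : ℕ) : ℤ) / ((N + 1 : ℕ) : ℤ) = i := by
  rw [← Int.natCast_ediv]
  congr 1
  rw [mul_comm, Nat.mul_add_div (Nat.succ_pos N), Nat.div_eq_of_lt (by omega), add_zero]

theorem index_mod {N j : ℕ} (i : ℕ) (hj : j ≤ N) :
    ((i * (N + 1) + j : ℕ) : ℤ) % ((N + 1 : ℕ) : ℤ) = j := by
  rw [← Int.natCast_emod]
  congr 1
  rw [mul_comm, Nat.mul_add_mod, Nat.mod_eq_of_lt (by omega)]

theorem toNat_index (i j k : ℕ) : ((i : ℤ) * (k : ℤ) + j).toNat = i * k + j := by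
  rw [← Nat.cast_mul, ← Nat.cast_add, Int.toNat_natCast]

/-- The result of the search in a row. -/
theorem foldVal_search {N L p : ℕ} {s₀ s : State} (h : Invariant N L s₀ p s) {j : ℕ} (hj : j ≤ N) :
    (foldVal s (const (-1)) searchExpr j = -1 ∧ ∀ k < j, s.arr 23 (p * (N + 1) + k) = 0) ∨
      ∃ q < j, foldVal s (const (-1)) searchExpr j = q ∧ s.arr 23 (p * (N + 1) + q) ≠ 0 := by
  have h7 : s.reg 7 = (N + 1 : ℕ) := (h.reg 7 (by norm_num)).trans h.ready.reg7
  induction j with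
  | zero => left; simp [foldVal]
  | succ j ih =>
    -- A nonzero entry overrides the earlier result, so the last nonzero column wins; `-1` means
    -- that none was found.
    have hstep : foldVal s (const (-1)) searchExpr (j + 1) =
        if s.arr 23 (p * (N + 1) + j) = 0 then foldVal s (const (-1)) searchExpr j else j := by
      rw [foldVal]
      simp only [searchExpr, eval_add, eval_reg, State.setReg_reg_self, eval_mul, eval_nonzero,
        eval_get, State.setReg_arr, eval_sub, State.setReg_reg_of_ne _ (show 3 ≠ 2 by decide),
        State.setReg_reg_of_ne _ (show 3 ≠ 1 by decide),
        State.setReg_reg_of_ne _ (show 7 ≠ 2 by decide),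
        State.setReg_reg_of_ne _ (show 7 ≠ 1 by decide),
        State.setReg_reg_of_ne _ (show 1 ≠ 2 by decide), h.reg3, h7, toNat_index]
      split_ifs <;> ring
    rw [hstep]
    by_cases hz : s.arr 23 (p * (N + 1) + j) = 0
    · simp only [hz, if_true]
      rcases ih (by omega) with ⟨h1, h2⟩ | ⟨q, h1, h2, h3⟩
      · refine Or.inl ⟨h1, fun k hk => ?_⟩
        rcases Nat.lt_succ_iff_lt_or_eq.1 hk with hk | rfl
        · exact h2 k hk
        · exact hz
      · exact Or.inr ⟨q, by omega, h2, h3⟩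
    · simp only [hz, if_false]
      exact Or.inr ⟨j, by omega, rfl, hz⟩

theorem insert_row {N p : ℕ} (hp : p < N) :
    insert (⟨p, hp⟩ : Fin N) {i : Fin N | i.val < p} = {i | i.val < p + 1} := by
  ext i
  simp only [Set.mem_insert_iff, Set.mem_ofPred_eq, Fin.ext_iff]
  omega

/-- The memory `s'` after row `p` is treated, up to temporary registers, where `s` is that before. -/
structure Treated (N : ℕ) (s₀ : State) (p : ℕ) (s s' : State) : Prop where
  reg3 : s'.reg 3 = p
  reg : ∀ r, 6 ≤ r → s'.reg r = s.reg r
  arr : ∀ b, b ≠ 23 → b ≠ 24 → b ≠ 25 → s'.arr b = s.arr b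
  tableau : ∃ (piv : Fin N → Option ℕ) (W : Matrix (Fin N) ℕ ℤ),
    (augmented N s₀).IsTableau {j | j < N} {i | i.val < p + 1} piv (s'.reg 4) W ∧
    (∀ (i : Fin N) (j : ℕ), j ≤ N → s'.arr 23 (i * (N + 1) + j) = W i j) ∧
    ∀ i : Fin N, i.val < p + 1 → s'.arr 25 i = (piv i).elim (-1) Nat.cast
  arr23 : ∀ x, N * (N + 1) ≤ x → s'.arr 23 x = s.arr 23 x
  arr24 : ∀ x, s'.arr 24 x = s.arr 24 x ∨ x < N * (N + 1) ∧ s'.arr 24 x = s'.arr 23 x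
  arr25 : ∀ x, x ≠ p → s'.arr 25 x = s.arr 25 x

/-- The lengths after a row are not derived from those before it: the entries are determinants built
from the matrix in `s₀`, which gives one bound for all rows. The temporary registers are cleared so
that they obey it too. -/
theorem Treated.invariant {N L p : ℕ} {s₀ s s' : State} (ht : Treated N s₀ p s s')
    (h : Invariant N L s₀ p s) (hp : p < N)
    (hreg0 : s'.reg 0 = 0 ∧ s'.reg 1 = 0 ∧ s'.reg 2 = 0 ∧ s'.reg 5 = 0) :
    Invariant N L s₀ (p + 1) (s'.setReg 3 (p + 1 : ℕ)) := by
  obtain ⟨hreg3, hreg, harr, ⟨piv, W, hT, h23, h25⟩, h23', h24, h25'⟩ := ht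
  obtain ⟨hd, hWb⟩ := len_tableau_le h.bdd₀ hT
  have hN : len (N : ℤ) ≤ L := by rw [← h.ready.reg20]; exact h.bdd₀.1 20
  have hpN : ∀ q : ℕ, q ≤ N → len (q : ℤ) ≤ L + N * N + L * N + 3 := fun q hq =>
    ((len_natCast_mono hq).trans hN).trans (by omega)
  have h0 : len 0 ≤ L + N * N + L * N + 3 := by simpa using hpN 0 (Nat.zero_le _)
  have hb23 : ∀ x, len (s'.arr 23 x) ≤ L + N * N + L * N + 3 := by
    intro x
    rcases Nat.lt_or_ge x (N * (N + 1)) with hx | hx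
    · obtain ⟨i, j, hj, rfl⟩ := exists_index hx
      rw [h23 i j hj]; exact hWb i j
    · rw [h23' x hx]; exact h.bdd.2 23 x
  refine ⟨h.ready, h.bdd₀, State.Bdd.setReg ⟨fun r => ?_, fun b x => ?_⟩ (hpN _ hp),
    by simp, fun r hr => ?_, fun b h1 h2 h3 => ?_, piv, W, ?_, ?_, ?_⟩
  · rcases Nat.lt_or_ge r 6 with hr | hr
    · interval_cases r
      · rw [hreg0.1]; exact h0
      · rw [hreg0.2.1]; exact h0
      · rw [hreg0.2.2.1]; exact h0
      · rw [hreg3]; exact hpN p hp.le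
      · exact hd
      · rw [hreg0.2.2.2]; exact h0
    · rw [hreg r hr]; exact h.bdd.1 r
  · by_cases hb1 : b = 23
    · subst hb1; exact hb23 x
    by_cases hb2 : b = 24
    · subst hb2
      rcases h24 x with h' | ⟨-, h'⟩
      · rw [h']; exact h.bdd.2 24 x
      · rw [h']; exact hb23 x
    by_cases hb3 : b = 25
    · subst hb3
      by_cases hx : x = p
      · have := h25 ⟨p, hp⟩ (Nat.lt_succ_self p)
        rw [hx, show s'.arr 25 p = _ from this]
        rcases hpv : piv ⟨p, hp⟩ with _ | q
        · simp only [Option.elim_none, len]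
          have : ((-1 : ℤ).natAbs.size) = 1 := by decide
          omega
        · exact hpN q (le_of_lt (hT.mem _ _ hpv))
      · rw [h25' x hx]; exact h.bdd.2 25 x
    rw [harr b hb1 hb2 hb3]; exact h.bdd.2 b x
  · rw [State.setReg_reg_of_ne _ (by omega), hreg r hr, h.reg r hr]
  · rw [State.setReg_arr, harr b h1 h2 h3, h.arr b h1 h2 h3]
  · rwa [State.setReg_reg_of_ne _ (by decide)]
  · exact h23
  · exact h25

/-- The memory `s'` after the search in row `p`, where `s` is that before. -/
structure Searched (N L : ℕ) (s₀ : State) (p : ℕ) (s s' : State) : Prop where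
  inv : Invariant N L s₀ p s
  lt : p < N
  reg : ∀ r, 3 ≤ r → r ≠ 5 → s'.reg r = s.reg r
  arr : ∀ b, b ≠ 25 → s'.arr b = s.arr b
  arr25 : s'.arr 25 p = s'.reg 5
  arr25_of_ne : ∀ x, x ≠ p → s'.arr 25 x = s.arr 25 x
  search : (s'.reg 5 = -1 ∧ ∀ k < N, s.arr 23 (p * (N + 1) + k) = 0) ∨
      ∃ q < N, s'.reg 5 = q ∧ s.arr 23 (p * (N + 1) + q) ≠ 0

/-- A search without result means a row that is zero on the columns of the matrix; it is kept
without a pivot, and `-1` stands for `none`. -/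
theorem treated_of_not_pos {N L p : ℕ} {s₀ s s' : State} (h : Searched N L s₀ p s s')
    (hn : ¬ 0 < (reg 5 + const 1).eval s') : Treated N s₀ p s (s'.setReg 5 0) := by
  obtain ⟨piv, W, hT, h23, h25⟩ := h.inv.tableau
  rcases h.search with ⟨h5, hz⟩ | ⟨q, hq, h5, -⟩
  · have hnone : piv ⟨p, h.lt⟩ = none := hT.eq_none _ (by simp)
    refine ⟨?_, fun r hr => ?_, fun b _ _ hb => h.arr b hb, ⟨piv, W, ?_, ?_, ?_⟩, ?_, ?_, ?_⟩
    · rw [State.setReg_reg_of_ne _ (by decide), h.reg 3 le_rfl (by decide), h.inv.reg3]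
    · rw [State.setReg_reg_of_ne _ (by omega), h.reg r (by omega) (by omega)]
    · rw [State.setReg_reg_of_ne _ (by decide), h.reg 4 (by decide) (by decide), ← insert_row h.lt]
      refine hT.insert_of_eq_zero fun j hj => ?_
      rw [← h23 ⟨p, h.lt⟩ j (le_of_lt hj)]
      exact hz j hj
    · intro i j hj
      rw [State.setReg_arr, h.arr 23 (by decide), h23 i j hj]
    · intro i hi
      by_cases hip : i.val = p
      · have : i = ⟨p, h.lt⟩ := Fin.ext hip
        subst this
        rw [State.setReg_arr, h.arr25, h5, hnone]
        rfl
      · rw [State.setReg_arr, h.arr25_of_ne _ hip, h25 i (by omega)]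
    · intro x _
      rw [State.setReg_arr, h.arr 23 (by decide)]
    · intro x
      rw [State.setReg_arr, h.arr 24 (by decide)]
      exact Or.inl rfl
    · exact h.arr25_of_ne
  · simp only [eval_add, eval_reg, eval_const, h5] at hn
    omega

/-- The new entries go to array `24` and are then copied back, because the formula needs the old
pivot row and column throughout. -/
theorem treated_of_pos {N L p : ℕ} {s₀ s s₁ s₂ s₃ : State} (h : Searched N L s₀ p s s₁)
    (hpos : 0 < (reg 5 + const 1).eval s₁) (h12 : TabSpec 24 pivotExpr (N * (N + 1)) 1 s₁ s₂)
    (h23 : TabSpec 23 (get 24 (reg 0)) (N * (N + 1)) 1 s₂ s₃) :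
    Treated N s₀ p s (s₃.setReg 4 ((get 23 (reg 3 * reg 7 + reg 5)).eval s₃)) := by
  obtain ⟨piv, W, hT, hW, h25⟩ := h.inv.tableau
  rcases h.search with ⟨h5, -⟩ | ⟨q, hq, h5, hne⟩
  · simp only [eval_add, eval_reg, eval_const, h5] at hpos
    omega
  have hr : ∀ r, 3 ≤ r → s₃.reg r = s₁.reg r := fun r hr => (h23.reg r hr).trans (h12.reg r hr)
  have h3 : s₁.reg 3 = p := (h.reg 3 le_rfl (by decide)).trans h.inv.reg3
  have h7 : s₁.reg 7 = (N + 1 : ℕ) :=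
    (h.reg 7 (by decide) (by decide)).trans ((h.inv.reg 7 (by norm_num)).trans h.inv.ready.reg7)
  have h4 : s₁.reg 4 = s.reg 4 := h.reg 4 (by decide) (by decide)
  have hW1 : ∀ (i : Fin N) (j : ℕ), j ≤ N → s₁.arr 23 (i * (N + 1) + j) = W i j := fun i j hj => by
    rw [h.arr 23 (by decide), hW i j hj]
  have hWp : ∀ j ≤ N, s₁.arr 23 (p * (N + 1) + j) = W ⟨p, h.lt⟩ j := fun j hj =>
    hW1 ⟨p, h.lt⟩ j hj
  have h24' : ∀ x < N * (N + 1), s₃.arr 23 x = s₂.arr 24 x := by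
    intro x hx
    rw [h23.apply x hx]
    simp [Expr.at, State.setReg_reg_of_ne]
  have hnew : ∀ (i : Fin N) (j : ℕ), j ≤ N →
      s₂.arr 24 (i * (N + 1) + j) = W.pivotStep (s.reg 4) ⟨p, h.lt⟩ q i j := by
    intro i j hj
    rw [h12.apply _ (index_lt i hj), Finset.sum_range_one]
    have e0 : ∀ r, 3 ≤ r → ((s₁.setReg 0 (i * (N + 1) + j : ℕ)).setReg 1 (0 : ℕ)).reg r = s₁.reg r :=
      fun r hr => by
        rw [State.setReg_reg_of_ne _ (by omega), State.setReg_reg_of_ne _ (by omega)]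
    have e1 : ((s₁.setReg 0 (i * (N + 1) + j : ℕ)).setReg 1 (0 : ℕ)).reg 0 =
        (i * (N + 1) + j : ℕ) := by
      rw [State.setReg_reg_of_ne _ (by decide), State.setReg_reg_self]
    simp only [Expr.at, pivotExpr, eval_add, eval_mul, eval_isZero, eval_nonzero, eval_sub,
      eval_div, eval_get, eval_mod, eval_reg, e1, e0 _ (show 3 ≤ 3 by decide),
      e0 _ (show 3 ≤ 7 by decide), e0 _ (show 3 ≤ 5 by decide), e0 _ (show 3 ≤ 4 by decide),
      h3, h7, h5, h4, State.setReg_arr, index_div _ hj, index_mod _ hj, toNat_index,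
      Int.toNat_natCast, hW1 i j hj, hWp j hj, hWp q hq.le, hW1 i q hq.le, Matrix.pivotStep,
      Matrix.of_apply]
    by_cases hip : i.val = p
    · have : i = ⟨p, h.lt⟩ := Fin.ext hip
      simp [this]
    · have : i ≠ ⟨p, h.lt⟩ := fun h' => hip (by rw [h'])
      have h' : (i.val : ℤ) - p ≠ 0 := by omega
      simp [h', this]
  have hpq : W ⟨p, h.lt⟩ q ≠ 0 := by
    rw [← hW _ q hq.le]; exact hne
  have hd : (get 23 (reg 3 * reg 7 + reg 5)).eval s₃ = W ⟨p, h.lt⟩ q := by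
    simp only [eval_get, eval_add, eval_mul, eval_reg, hr _ (show 3 ≤ 3 by decide),
      hr _ (show 3 ≤ 7 by decide), hr _ (show 3 ≤ 5 by decide), h3, h5, h7, toNat_index]
    have h' := index_lt ⟨p, h.lt⟩ hq.le
    have h'' := hnew ⟨p, h.lt⟩ q hq.le
    simp only at h' h''
    rw [h24' _ h', h'']
    simp [Matrix.pivotStep]
  have harr25 : s₃.arr 25 = s₁.arr 25 := by rw [h23.arr 25 (by decide), h12.arr 25 (by decide)]
  rw [hd]
  refine ⟨?_, fun r hr' => ?_, fun b h1 h2 h3 => ?_, ⟨Function.update piv ⟨p, h.lt⟩ (some q),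
    W.pivotStep (s.reg 4) ⟨p, h.lt⟩ q, ?_, ?_, ?_⟩, ?_, ?_, ?_⟩
  · rw [State.setReg_reg_of_ne _ (by decide), hr 3 le_rfl, h3]
  · rw [State.setReg_reg_of_ne _ (by omega), hr r (by omega), h.reg r (by omega) (by omega)]
  · rw [State.setReg_arr, h23.arr b h1, h12.arr b h2, h.arr b h3]
  · rw [State.setReg_reg_self, ← insert_row h.lt]
    exact hT.pivot (by simp) hq hpq
  · intro i j hj
    rw [State.setReg_arr, h24' _ (index_lt i hj), hnew i j hj]
  · intro i hi
    rw [State.setReg_arr, harr25]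
    by_cases hip : i.val = p
    · have : i = ⟨p, h.lt⟩ := Fin.ext hip
      subst this
      rw [h.arr25, h5, Function.update_self]
      rfl
    · have : i ≠ ⟨p, h.lt⟩ := fun h' => hip (by rw [h'])
      rw [h.arr25_of_ne _ hip, h25 i (by omega), Function.update_of_ne this]
  · intro x hx
    rw [State.setReg_arr, h23.apply_of_le x hx, h12.arr 23 (by decide), h.arr 23 (by decide)]
  · intro x
    rw [State.setReg_arr, h23.arr 24 (by decide)]
    rcases Nat.lt_or_ge x (N * (N + 1)) with hx | hx
    · exact Or.inr ⟨hx, (h24' x hx).symm⟩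
    · exact Or.inl (by rw [h12.apply_of_le x hx, h.arr 24 (by decide)])
  · intro x hx
    rw [State.setReg_arr, harr25, h.arr25_of_ne x hx]

section

variable {Ω : Type*} {sz : Ω → ℕ}

theorem runs_pivotProgram {N L p : Ω → ℕ} {s₀ s : Ω → State} (hN : PolyBdd sz N) :
    Runs sz (fun ω s' => Searched (N ω) (L ω) (s₀ ω) (p ω) (s ω) s' ∧
        0 < (reg 5 + const 1).eval s') pivotProgram
      (fun ω s' => (p ω < N ω ∧ Invariant (N ω) (L ω) (s₀ ω) (p ω) (s ω)) ∧
        Treated (N ω) (s₀ ω) (p ω) (s ω) s') := by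
  have h8 : ∀ ω s', Searched (N ω) (L ω) (s₀ ω) (p ω) (s ω) s' →
      s'.reg 8 = (N ω * (N ω + 1) : ℕ) := fun ω s' h =>
    (h.reg 8 (by decide) (by decide)).trans ((h.inv.reg 8 (by norm_num)).trans h.inv.ready.reg8)
  have h9 : ∀ ω s', Searched (N ω) (L ω) (s₀ ω) (p ω) (s ω) s' → s'.reg 9 = (1 : ℕ) := fun ω s' h =>
    (h.reg 9 (by decide) (by decide)).trans ((h.inv.reg 9 (by norm_num)).trans h.inv.ready.reg9)
  have hN' : PolyBdd sz fun ω => N ω * (N ω + 1) := hN.mul (hN.add (.const 1))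
  refine Runs.conseq ((Runs.tab (k := fun ω => N ω * (N ω + 1)) (l := fun _ => 1) (by decide)
    (by decide) rfl (fun ω s' h => h8 ω s' h.1) (fun ω s' h => h9 ω s' h.1) hN' (.const 1)).seq
    ((Runs.tab (k := fun ω => N ω * (N ω + 1)) (l := fun _ => 1) (by decide) (by decide) rfl
      ?_ ?_ hN' (.const 1)).seq (Runs.assign _ _ _))) (fun _ _ h => h) ?_
  · rintro ω s₂ ⟨s₁, ⟨h, hpos⟩, h12⟩
    rw [h12.reg 8 (by decide), h8 ω s₁ h]
  · rintro ω s₂ ⟨s₁, ⟨h, hpos⟩, h12⟩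
    rw [h12.reg 9 (by decide), h9 ω s₁ h]
  · rintro ω _ ⟨s₃, ⟨s₂, ⟨s₁, ⟨h, hpos⟩, h12⟩, h23⟩, rfl⟩
    exact ⟨⟨h.lt, h.inv⟩, treated_of_pos h hpos h12 h23⟩

theorem runs_rowProgram {N L p : Ω → ℕ} {s₀ s : Ω → State} (hN : PolyBdd sz N) :
    Runs sz (fun ω s' => p ω < N ω ∧ Invariant (N ω) (L ω) (s₀ ω) (p ω) s' ∧ s' = s ω) rowProgram
      (fun ω s' => s'.reg 3 = p ω ∧
        Invariant (N ω) (L ω) (s₀ ω) (p ω + 1) (s'.setReg 3 (p ω + 1 : ℕ))) := by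
  have h20 : ∀ ω s', Invariant (N ω) (L ω) (s₀ ω) (p ω) s' → s'.reg 20 = N ω := fun ω s' h =>
    (h.reg 20 (by norm_num)).trans h.ready.reg20
  have hsearch : Runs sz (fun ω s' => p ω < N ω ∧ Invariant (N ω) (L ω) (s₀ ω) (p ω) s' ∧ s' = s ω)
      (.seq (.fold 20 (const (-1)) searchExpr) (.seq (.assign 5 (reg 2)) (.put 25 (reg 3) (reg 5))))
      (fun ω s' => Searched (N ω) (L ω) (s₀ ω) (p ω) (s ω) s') := by
    refine Runs.conseq ((Runs.fold (k := N) (by decide) (fun ω s' h => h20 ω s' h.2.1) hN ?_).seq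
      ((Runs.assign _ _ _).seq (Runs.put _ _ _ _))) (fun _ _ h => h) ?_
    · intro L' hL'
      refine ⟨_, hL'.add (.const 2), ?_⟩
      rintro ω s' ⟨hp, h, rfl⟩ hb j hj
      rcases foldVal_search h hj with ⟨h1, -⟩ | ⟨q, hq, h1, -⟩
      · rw [h1]
        have : len (-1) = 2 := by decide
        omega
      · rw [h1]
        have := len_natCast_mono (hq.le.trans hj)
        have := hb.1 20
        rw [h20 ω _ h] at this
        omega
    · rintro ω _ ⟨_, ⟨_, ⟨s', ⟨hp, h, rfl⟩, rfl⟩, rfl⟩, rfl⟩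
      have h3 := h.reg3
      simp only [eval_reg, State.setReg_reg_self, State.setReg_reg_of_ne _ (show 3 ≠ 5 by decide),
        State.setReg_reg_of_ne _ (show 3 ≠ 2 by decide),
        State.setReg_reg_of_ne _ (show 3 ≠ 1 by decide), h3, Int.toNat_natCast]
      refine ⟨h, hp, fun r hr hr5 => ?_, fun b hb => ?_, ?_, fun x hx => ?_, ?_⟩
      · rw [State.setArr_reg, State.setReg_reg_of_ne _ hr5, State.setReg_reg_of_ne _ (by omega),
          State.setReg_reg_of_ne _ (by omega)]
      · simp [State.setArr, hb]
      · simp [State.setArr]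
      · simp [State.setArr, hx]
      · simpa using foldVal_search h le_rfl
  have hcond : Runs sz (fun ω s' => Searched (N ω) (L ω) (s₀ ω) (p ω) (s ω) s')
      (.cond (reg 5 + const 1) pivotProgram (.assign 5 (const 0)))
      (fun ω s' => (p ω < N ω ∧ Invariant (N ω) (L ω) (s₀ ω) (p ω) (s ω)) ∧
        Treated (N ω) (s₀ ω) (p ω) (s ω) s') := by
    refine Runs.cond (runs_pivotProgram hN) (Runs.conseq (Runs.assign _ _ _) (fun _ _ h => h) ?_)
    rintro ω _ ⟨s', ⟨h, hn⟩, rfl⟩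
    exact ⟨⟨h.lt, h.inv⟩, treated_of_not_pos h hn⟩
  refine Runs.conseq (hsearch.seq (hcond.seq ((Runs.assign _ _ _).seq ((Runs.assign _ _ _).seq
    ((Runs.assign _ _ _).seq (Runs.assign _ _ _)))))) (fun _ _ h => h) ?_
  rintro ω _ ⟨_, ⟨_, ⟨_, ⟨s', ⟨⟨hp, h⟩, ht⟩, rfl⟩, rfl⟩, rfl⟩, rfl⟩
  set s'' := (((s'.setReg 0 0).setReg 1 0).setReg 2 0).setReg 5 0 with hs''
  have hne : ∀ r, r = 3 ∨ r = 4 ∨ 6 ≤ r → s''.reg r = s'.reg r := fun r hr => by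
    rw [hs'', State.setReg_reg_of_ne _ (by omega), State.setReg_reg_of_ne _ (by omega),
      State.setReg_reg_of_ne _ (by omega), State.setReg_reg_of_ne _ (by omega)]
  have ht' : Treated (N ω) (s₀ ω) (p ω) (s ω) s'' := by
    refine ⟨(hne 3 (by omega)).trans ht.reg3, fun r hr => (hne r (by omega)).trans (ht.reg r hr),
      ht.arr, ?_, ht.arr23, ht.arr24, ht.arr25⟩
    rw [hne 4 (by omega)]
    exact ht.tableau
  exact ⟨ht'.reg3, ht'.invariant h hp ⟨rfl, rfl, rfl, rfl⟩⟩

end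

end Solver

end RAM

/-! ### Assembly of the linear solver -/

namespace RAM

namespace Solver

open RAM.Expr

/-- Prepare the registers and the augmented matrix. -/
def setupProgram : Program :=
  .seq (.assign 7 (reg 20 + const 1)) (.seq (.assign 8 (reg 20 * reg 7)) (.seq (.assign 9 (const 1))
    (.seq (.assign 4 (const 1)) (.tab 23 8 9 augmentExpr))))

/-- The entries of the solution, multiplied by the determinant. -/
def outputExpr : Expr :=
  isZero (get 25 (reg 1) - reg 0) * get 23 (reg 1 * reg 7 + reg 20)

/-- Solve a linear system whose size is in register `20`, with matrix in array `20` and right-hand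
side in array `21`. A common denominator of the solution is left in register `4`, the numerators in
array `22`. -/
def program : Program :=
  .seq setupProgram (.seq (.iter 3 20 rowProgram) (.tab 22 20 20 outputExpr))

/-- The effect of `Solver.program` on memory. -/
structure Spec (N : ℕ) (s s' : State) : Prop where
  reg : ∀ r, 10 ≤ r → s'.reg r = s.reg r
  arr : ∀ b < 22, s'.arr b = s.arr b
  ne_zero : s'.reg 4 ≠ 0
  solution : ∀ x : ℕ → ℝ, (∀ i < N, ∑ j ∈ Finset.range N, (s.arr 20 (i * N + j) : ℝ) * x j =
      s.arr 21 i) →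
    ∀ i < N, ∑ j ∈ Finset.range N, s.arr 20 (i * N + j) * s'.arr 22 j = s'.reg 4 * s.arr 21 i

theorem ready_of_tabSpec {N : ℕ} {s s' : State} (h20 : s.reg 20 = N) (h4 : s.reg 4 = 1)
    (h7 : s.reg 7 = (N + 1 : ℕ)) (h8 : s.reg 8 = (N * (N + 1) : ℕ)) (h9 : s.reg 9 = (1 : ℕ))
    (h : TabSpec 23 augmentExpr (N * (N + 1)) 1 s s') : Ready N s' := by
  refine ⟨?_, ?_, ?_, ?_, ?_, fun i j hj => ?_⟩
  · rw [h.reg 4 (by decide), h4]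
  · rw [h.reg 7 (by decide), h7]
  · rw [h.reg 8 (by decide), h8]
  · rw [h.reg 9 (by decide), h9]
  · rw [h.reg 20 (by decide), h20]
  · rw [h.apply _ (index_lt i hj), Finset.sum_range_one]
    have e0 : ∀ r, 3 ≤ r → ((s.setReg 0 (i * (N + 1) + j : ℕ)).setReg 1 (0 : ℕ)).reg r = s.reg r :=
      fun r hr => by
        rw [State.setReg_reg_of_ne _ (by omega), State.setReg_reg_of_ne _ (by omega)]
    have e1 : ((s.setReg 0 (i * (N + 1) + j : ℕ)).setReg 1 (0 : ℕ)).reg 0 =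
        (i * (N + 1) + j : ℕ) := by
      rw [State.setReg_reg_of_ne _ (by decide), State.setReg_reg_self]
    simp only [Expr.at, augmentExpr, eval_add, eval_mul, eval_isZero, eval_nonzero, eval_sub,
      eval_div, eval_get, eval_mod, eval_reg, e1, e0 _ (show 3 ≤ 7 by decide),
      e0 _ (show 3 ≤ 20 by decide), h7, h20, State.setReg_arr, index_div _ hj, index_mod _ hj,
      toNat_index, Int.toNat_natCast, augmented, Matrix.of_apply, h.arr 20 (by decide),
      h.arr 21 (by decide)]
    by_cases hjN : j < N
    · have h' : (j : ℤ) - N ≠ 0 := by omega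
      simp [hjN, h']
    · have : j = N := by omega
      simp [this]

/-- The unknown with number `j` is read from column `N` in the row that pivots in `j`, and is `0` if
no row does. The last pivot is the common denominator. -/
theorem spec_of_invariant {N L : ℕ} {s s₀ s₁ s₂ : State} (hreg : ∀ r, 10 ≤ r → s₀.reg r = s.reg r)
    (harr : ∀ b < 22, s₀.arr b = s.arr b) (h : Invariant N L s₀ N s₁)
    (h12 : TabSpec 22 outputExpr N N s₁ s₂) : Spec N s s₂ := by
  obtain ⟨piv, W, hT, h23, h25⟩ := h.tableau
  have hall : {i : Fin N | i.val < N} = Set.univ := by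
    ext i; simp
  rw [hall] at hT
  have h4 : s₂.reg 4 = s₁.reg 4 := h12.reg 4 (by decide)
  refine ⟨fun r hr => ?_, fun b hb => ?_, ?_, fun x hx i hi => ?_⟩
  · rw [h12.reg r (by omega), h.reg r (by omega), hreg r hr]
  · rw [h12.arr b (by omega), h.arr b (by omega) (by omega) (by omega), harr b hb]
  · rw [h4]; exact hT.ne_zero
  · have hA : ∀ (i : Fin N), ∀ j ∈ Finset.range N,
        augmented N s₀ i j = s.arr 20 (i * N + j) := fun i j hj => by
      simp [augmented, Finset.mem_range.1 hj, harr 20 (by decide)]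
    have hb : ∀ i : Fin N, augmented N s₀ i N = s.arr 21 i := fun i => by
      simp [augmented, harr 21 (by decide)]
    have key := hT.sum_mul_eq (Finset.range N) (fun j => by simp) N x
      (fun i => by
        rw [hb, ← hx i i.isLt]
        exact Finset.sum_congr rfl fun j hj => by rw [hA i j hj]) ⟨i, hi⟩
    rw [hb, ← h4] at key
    rw [← key]
    refine Finset.sum_congr rfl fun j hj => ?_
    rw [hA _ j hj]
    congr 1
    rw [h12.apply j (Finset.mem_range.1 hj), ← Fin.sum_univ_eq_sum_range
      (fun k => outputExpr.at s₁ j k) N]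
    refine Finset.sum_congr rfl fun k _ => ?_
    have e0 : ∀ r, 3 ≤ r → ((s₁.setReg 0 (j : ℕ)).setReg 1 (k : ℕ)).reg r = s₁.reg r :=
      fun r hr => by
        rw [State.setReg_reg_of_ne _ (by omega), State.setReg_reg_of_ne _ (by omega)]
    have e1 : ((s₁.setReg 0 (j : ℕ)).setReg 1 (k : ℕ)).reg 0 = j := by
      rw [State.setReg_reg_of_ne _ (by decide), State.setReg_reg_self]
    have h7 : s₁.reg 7 = (N + 1 : ℕ) := (h.reg 7 (by decide)).trans h.ready.reg7
    have h20 : s₁.reg 20 = N := (h.reg 20 (by decide)).trans h.ready.reg20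
    simp only [Expr.at, outputExpr, eval_mul, eval_isZero, eval_sub, eval_get, eval_reg, e1,
      State.setReg_reg_self, e0 _ (show 3 ≤ 7 by decide), e0 _ (show 3 ≤ 20 by decide), h7, h20,
      State.setReg_arr, eval_add, toNat_index, Int.toNat_natCast, h23 k N le_rfl, h25 k k.isLt]
    rcases hk : piv k with _ | q
    · have : ¬ (-1 - (j : ℤ) = 0) := by omega
      simp [this]
    · simp [sub_eq_zero]

variable {Ω : Type*} {sz : Ω → ℕ}

theorem runs_program {P : Ω → State → Prop} {N : Ω → ℕ} (hN : PolyBdd sz N)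
    (h20 : ∀ ω s, P ω s → s.reg 20 = N ω) :
    Runs sz P program fun ω s' => ∃ s, P ω s ∧ Spec (N ω) s s' := by
  have hsetup : Runs sz P setupProgram fun ω s₀ => Ready (N ω) s₀ ∧ ∃ s, P ω s ∧
      (∀ r, 10 ≤ r → s₀.reg r = s.reg r) ∧ ∀ b < 22, s₀.arr b = s.arr b := by
    refine Runs.conseq ((Runs.assign _ _ _).seq ((Runs.assign _ _ _).seq ((Runs.assign _ _ _).seq
      ((Runs.assign _ _ _).seq (Runs.tab (k := fun ω => N ω * (N ω + 1)) (l := fun _ => 1)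
      (by decide) (by decide) rfl ?_ ?_ (hN.mul (hN.add (.const 1))) (.const 1))))))
      (fun _ _ h => h) ?_
    · rintro ω _ ⟨_, ⟨_, ⟨_, ⟨s, hs, rfl⟩, rfl⟩, rfl⟩, rfl⟩
      simp [State.setReg_reg_of_ne, h20 ω s hs]
    · rintro ω _ ⟨_, ⟨_, ⟨_, ⟨s, hs, rfl⟩, rfl⟩, rfl⟩, rfl⟩
      simp [State.setReg_reg_of_ne]
    · rintro ω s' ⟨_, ⟨_, ⟨_, ⟨_, ⟨s, hs, rfl⟩, rfl⟩, rfl⟩, rfl⟩, h⟩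
      refine ⟨ready_of_tabSpec ?_ ?_ ?_ ?_ ?_ h, s, hs, fun r hr => ?_, fun b hb => ?_⟩
      · simp [State.setReg_reg_of_ne, h20 ω s hs]
      · simp
      · simp [State.setReg_reg_of_ne, h20 ω s hs]
      · simp [State.setReg_reg_of_ne, h20 ω s hs]
      · simp [State.setReg_reg_of_ne]
      · rw [h.reg r (by omega), State.setReg_reg_of_ne _ (by omega),
          State.setReg_reg_of_ne _ (by omega), State.setReg_reg_of_ne _ (by omega),
          State.setReg_reg_of_ne _ (by omega)]
      · rw [h.arr b (by omega)]; rfl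
  refine hsetup.seq (Runs.seq (Q := fun ω s₁ => ∃ s L s₀, P ω s ∧
    (∀ r, 10 ≤ r → s₀.reg r = s.reg r) ∧ (∀ b < 22, s₀.arr b = s.arr b) ∧
    Invariant (N ω) L s₀ (N ω) s₁) (Runs.iter hN fun L hL => ?_) ?_)
  · have hL' : PolyBdd sz fun ω => L ω + N ω * N ω + L ω * N ω + 3 :=
      ((hL.add (hN.mul hN)).add (hL.mul hN)).add (.const 3)
    refine ⟨_, hL', fun ω s₀ p s => Invariant (N ω) (L ω) s₀ p s, ?_, ?_, ?_, ?_⟩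
    · rintro ω s ⟨hs, -⟩ hb
      refine ⟨hs, hb, (hb.mono (by omega)).setReg (by simp [len]), by simp,
        fun r hr => State.setReg_reg_of_ne _ (by omega) _, fun _ _ _ _ => rfl,
        fun _ => none, augmented (N ω) s, ?_, hs.arr, fun _ h => absurd h (Nat.not_lt_zero _)⟩
      rw [State.setReg_reg_of_ne _ (by decide), hs.reg4]
      simpa using Matrix.isTableau_self (augmented (N ω) s) {j | j < N ω}
    · intro ω s₀ p s h
      exact ⟨(h.reg 20 (by decide)).trans h.ready.reg20, h.reg3, h.bdd⟩
    · exact runs_rowProgram (N := fun x : Ω × State × ℕ × State => N x.1) (L := fun x => L x.1)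
        (p := fun x => x.2.2.1) (s₀ := fun x => x.2.1) (s := fun x => x.2.2.2) (hN.comp Prod.fst)
    · rintro ω s₀ s₁ ⟨-, s, hs, hr, ha⟩ h
      exact ⟨s, L ω, s₀, hs, hr, ha, h⟩
  · have h20' : ∀ ω s₁, (∃ s L s₀, P ω s ∧ (∀ r, 10 ≤ r → s₀.reg r = s.reg r) ∧
        (∀ b < 22, s₀.arr b = s.arr b) ∧ Invariant (N ω) L s₀ (N ω) s₁) → s₁.reg 20 = N ω := by
      rintro ω s₁ ⟨s, L, s₀, hs, hr, ha, h⟩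
      exact (h.reg 20 (by decide)).trans h.ready.reg20
    refine Runs.conseq (Runs.tab (by decide) (by decide) rfl h20' h20' hN hN) (fun _ _ h => h) ?_
    rintro ω s₂ ⟨s₁, ⟨s, L, s₀, hs, hr, ha, h⟩, h12⟩
    exact ⟨s, hs, spec_of_invariant hr ha h h12⟩

end Solver

end RAM

/-! ### Arrays indexed by finite types -/

/-- A finite type with a numbering of its elements. -/
class Idx (ι : Type) extends Fintype ι where
  card : ℕ
  code : ι ≃ Fin card

namespace Idx

instance (n : ℕ) : Idx (Fin n) := ⟨n, Equiv.refl _⟩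

instance (ι κ : Type) [Idx ι] [Idx κ] : Idx (ι × κ) :=
  ⟨card ι * card κ, (code.prodCongr code).trans finProdFinEquiv⟩

/-- The number of an element. -/
def num {ι : Type} [Idx ι] (x : ι) : ℕ := (code x).val

variable {ι κ : Type} [Idx ι] [Idx κ]

theorem num_lt (x : ι) : num x < card ι := (code x).isLt

theorem num_injective : Function.Injective (num : ι → ℕ) := fun _ _ h =>
  code.injective (Fin.ext h)

theorem card_prod : card (ι × κ) = card ι * card κ := rfl

theorem card_fin (n : ℕ) : card (Fin n) = n := rfl

theorem num_fin {n : ℕ} (x : Fin n) : num x = x.val := rfl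

theorem num_prod (x : ι × κ) : num x = num x.1 * card κ + num x.2 := by
  change (finProdFinEquiv (code x.1, code x.2)).val = _
  simp [finProdFinEquiv, num]
  ring

theorem num_mk (x : ι) (y : κ) : num (x, y) = num x * card κ + num y := num_prod (x, y)

theorem card_pos (x : ι) : 0 < card ι := (Nat.zero_le _).trans_lt (num_lt x)

theorem num_ediv (x : ι × κ) : (num x : ℤ) / (card κ : ℤ) = num x.1 := by
  rw [num_prod, ← Int.natCast_ediv]
  congr 1
  rw [mul_comm, Nat.mul_add_div (card_pos x.2), Nat.div_eq_of_lt (num_lt x.2), add_zero]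

theorem num_emod (x : ι × κ) : (num x : ℤ) % (card κ : ℤ) = num x.2 := by
  rw [num_prod, ← Int.natCast_emod]
  congr 1
  rw [mul_comm, Nat.mul_add_mod, Nat.mod_eq_of_lt (num_lt x.2)]

theorem toNat_num_mul_add (x : ι) (y : κ) :
    ((num x : ℤ) * (card κ : ℤ) + (num y : ℤ)).toNat = num (x, y) := by
  rw [num_mk]; exact RAM.Solver.toNat_index _ _ _

theorem exists_num_eq {k : ℕ} (h : k < card ι) : ∃ x : ι, num x = k :=
  ⟨code.symm ⟨k, h⟩, by simp [num]⟩

theorem sum_range_card {β : Type*} [AddCommMonoid β] (f : ℕ → β) :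
    ∑ k ∈ Finset.range (card ι), f k = ∑ x : ι, f (num x) := by
  rw [← Fin.sum_univ_eq_sum_range f]
  exact (code.sum_comp fun k : Fin (card ι) => f k).symm

end Idx

namespace RAM

open Idx RAM.Expr

variable {ι κ : Type} [Idx ι] [Idx κ]

/-- Array `a` holds the values of `f`. -/
def State.Holds (s : State) (a : ℕ) (f : ι → ℤ) : Prop :=
  ∀ x, s.arr a (num x) = f x

theorem State.Holds.congr {s s' : State} {a : ℕ} {f : ι → ℤ} (h : s.Holds a f)
    (h' : s'.arr a = s.arr a) : s'.Holds a f := fun x => by rw [h', h x]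

/-- The memory with `i` and `j` in registers `0` and `1`. -/
def State.cursor (s : State) (i j : ℕ) : State := (s.setReg 0 i).setReg 1 j

@[simp] theorem State.cursor_arr (s : State) (i j : ℕ) : (s.cursor i j).arr = s.arr := rfl

@[simp] theorem State.cursor_reg_zero (s : State) (i j : ℕ) : (s.cursor i j).reg 0 = i := by
  simp [State.cursor, State.setReg]

@[simp] theorem State.cursor_reg_one (s : State) (i j : ℕ) : (s.cursor i j).reg 1 = j := by
  simp [State.cursor]

theorem State.cursor_reg (s : State) (i j : ℕ) {r : ℕ} (hr : 2 ≤ r) :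
    (s.cursor i j).reg r = s.reg r := by
  rw [State.cursor, State.setReg_reg_of_ne _ (by omega), State.setReg_reg_of_ne _ (by omega)]

theorem TabSpec.holds {a : ℕ} {e : Expr} {s s' : State} (h : TabSpec a e (card ι) (card κ) s s')
    {g : ι → κ → ℤ} (hg : ∀ x y, e.eval (s.cursor (num x) (num y)) = g x y) :
    s'.Holds a fun x => ∑ y, g x y := by
  intro x
  rw [h.apply _ (num_lt x), sum_range_card]
  exact Finset.sum_congr rfl fun y _ => hg x y

theorem TabSpec.holds_one {a : ℕ} {e : Expr} {s s' : State} (h : TabSpec a e (card ι) 1 s s')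
    {g : ι → ℤ} (hg : ∀ x, e.eval (s.cursor (num x) 0) = g x) : s'.Holds a g := by
  intro x
  rw [h.apply _ (num_lt x), Finset.sum_range_one]
  exact hg x

/-- The linear system solved by `Solver.program`, in typed form. -/
theorem Solver.Spec.exists_holds {s s' : State} (h : Solver.Spec (card ι) s s') {X : ι → ι → ℤ}
    {b : ι → ℤ} (hX : s.Holds 20 fun x : ι × ι => X x.1 x.2) (hb : s.Holds 21 b)
    (hx : ∃ x : ι → ℝ, ∀ i, ∑ j, (X i j : ℝ) * x j = b i) :
    ∃ y : ι → ℤ, s'.Holds 22 y ∧ ∀ i, ∑ j, X i j * y j = s'.reg 4 * b i := by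
  obtain ⟨x, hx⟩ := hx
  refine ⟨fun i => s'.arr 22 (num i), fun _ => rfl, fun i => ?_⟩
  have hX' : ∀ i j : ι, s.arr 20 (num i * card ι + num j) = X i j := fun i j => by
    rw [← num_mk]; exact hX (i, j)
  have key := h.solution (fun k => if hk : k < card ι then x (code.symm ⟨k, hk⟩) else 0) ?_
    (num i) (num_lt i)
  · rw [sum_range_card, hb] at key
    simpa only [hX'] using key
  · intro k hk
    obtain ⟨i, rfl⟩ := exists_num_eq hk
    rw [sum_range_card, hb, ← hx]
    refine Finset.sum_congr rfl fun j _ => ?_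
    rw [hX', dif_pos (num_lt j)]
    simp [num]

/-! ### Block systems -/

namespace Block

/-- The entries of the block matrix. -/
def matrixExpr : Expr :=
  (const 1 - reg 0 / reg 20 / reg 26) * ((const 1 - (reg 0).mod (reg 20) / reg 26) *
      get 16 ((reg 0 / reg 20).mod (reg 26) * reg 26 + ((reg 0).mod (reg 20)).mod (reg 26))) +
    reg 0 / reg 20 / reg 26 * ((const 1 - (reg 0).mod (reg 20) / reg 26) *
      get 17 ((reg 0 / reg 20).mod (reg 26) * reg 26 + ((reg 0).mod (reg 20)).mod (reg 26)) +
      (reg 0).mod (reg 20) / reg 26 *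
      get 18 ((reg 0 / reg 20).mod (reg 26) * reg 26 + ((reg 0).mod (reg 20)).mod (reg 26)))

/-- The right-hand side of the block system. -/
def rhsExpr : Expr := reg 0 / reg 26 * get 19 ((reg 0).mod (reg 26))

/-- Solve `X y = 0`, `Y y + V g = b`, where arrays `16` to `19` hold `X`, `Y`, `V`, `b`, and register
`26` the size of these matrices. -/
def program : Program :=
  .seq (.assign 20 (const 2 * reg 26)) (.seq (.assign 21 (reg 20 * reg 20))
    (.seq (.assign 22 (const 1)) (.seq (.tab 20 21 22 matrixExpr) (.seq (.tab 21 20 22 rhsExpr)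
      Solver.program))))

/-- The effect of `Block.program` on memory. -/
structure Spec (ι : Type) [Idx ι] (s s' : State) : Prop where
  reg : ∀ r, 26 ≤ r → s'.reg r = s.reg r
  arr : ∀ b < 20, s'.arr b = s.arr b
  ne_zero : s'.reg 4 ≠ 0
  solution : ∀ (X Y V : ι → ι → ℤ) (b : ι → ℤ), s.Holds 16 (fun x : ι × ι => X x.1 x.2) →
    s.Holds 17 (fun x : ι × ι => Y x.1 x.2) → s.Holds 18 (fun x : ι × ι => V x.1 x.2) →
    s.Holds 19 b →
    (∃ v g : ι → ℝ, (∀ i, ∑ j, (X i j : ℝ) * v j = 0) ∧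
      ∀ i, ∑ j, (Y i j : ℝ) * v j + ∑ j, (V i j : ℝ) * g j = b i) →
    ∃ y g : ι → ℤ, s'.Holds 22 y ∧ (∀ i, ∑ j, X i j * y j = 0) ∧
      ∀ i, ∑ j, Y i j * y j + ∑ j, V i j * g j = s'.reg 4 * b i

/-- The block matrix with blocks `X`, `0`, `Y`, `V`. -/
def blockMatrix (X Y V : ι → ι → ℤ) (i j : Fin 2 × ι) : ℤ :=
  if i.1 = 0 then if j.1 = 0 then X i.2 j.2 else 0
  else if j.1 = 0 then Y i.2 j.2 else V i.2 j.2

/-- The pair of unknown vectors is indexed by `Fin 2 × ι`: rows of block `0` carry the homogeneous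
equations, rows of block `1` the others. -/
theorem spec_of_solverSpec {s s₁ s₂ s₃ s₄ : State} (hr : ∀ r, 26 ≤ r → s₁.reg r = s.reg r)
    (ha : s₁.arr = s.arr) (h26 : s.reg 26 = card ι) (h20 : s₁.reg 20 = card (Fin 2 × ι))
    (h12 : TabSpec 20 matrixExpr (card ((Fin 2 × ι) × (Fin 2 × ι))) 1 s₁ s₂)
    (h23 : TabSpec 21 rhsExpr (card (Fin 2 × ι)) 1 s₂ s₃)
    (h34 : Solver.Spec (card (Fin 2 × ι)) s₃ s₄) : Spec ι s s₄ := by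
  have h26₁ : s₁.reg 26 = card ι := (hr 26 le_rfl).trans h26
  refine ⟨fun r h => ?_, fun b hb => ?_, h34.ne_zero, fun X Y V b hX hY hV hb hsol => ?_⟩
  · rw [h34.reg r (by omega), h23.reg r (by omega), h12.reg r (by omega), hr r h]
  · rw [h34.arr b (by omega), h23.arr b (by omega), h12.arr b (by omega), ha]
  have hX' : s₃.Holds 20 fun x : (Fin 2 × ι) × (Fin 2 × ι) => blockMatrix X Y V x.1 x.2 := by
    refine State.Holds.congr (h12.holds_one fun x => ?_) (h23.arr 20 (by decide))
    simp only [matrixExpr, eval_add, eval_mul, eval_sub, eval_div, eval_mod, eval_reg, eval_const,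
      eval_get, State.cursor_reg_zero, State.cursor_reg _ _ _ (show 2 ≤ 20 by decide),
      State.cursor_reg _ _ _ (show 2 ≤ 26 by decide), h26₁, h20, num_ediv, num_emod,
      toNat_num_mul_add, State.cursor_arr, ha, hX _, hY _, hV _, blockMatrix]
    obtain ⟨⟨b, i⟩, ⟨c, j⟩⟩ := x
    fin_cases b <;> fin_cases c <;> simp [num_fin]
  have hb' : s₃.Holds 21 fun x : Fin 2 × ι => if x.1 = 0 then 0 else b x.2 := by
    refine h23.holds_one fun x => ?_
    have : s₂.reg 26 = card ι := (h12.reg 26 (by decide)).trans h26₁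
    simp only [rhsExpr, eval_mul, eval_div, eval_mod, eval_reg,
      eval_get, State.cursor_reg_zero,
      State.cursor_reg _ _ _ (show 2 ≤ 26 by decide), this, num_ediv, num_emod,
      State.cursor_arr, h12.arr 19 (by decide), ha, Int.toNat_natCast, hb _]
    obtain ⟨c, i⟩ := x
    fin_cases c <;> simp [num_fin]
  obtain ⟨v, g, h1, h2⟩ := hsol
  obtain ⟨y, hy, hy'⟩ := h34.exists_holds hX' hb'
    ⟨fun x => if x.1 = 0 then v x.2 else g x.2, fun ⟨c, i⟩ => by
      rw [Fintype.sum_prod_type]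
      fin_cases c
      · simpa [blockMatrix] using h1 i
      · simpa [blockMatrix] using h2 i⟩
  refine ⟨fun i => y (0, i), fun i => y (1, i), fun i => ?_, fun i => ?_, fun i => ?_⟩
  · change s₄.arr 22 (num i) = y (0, i)
    rw [← hy, num_mk]; simp [num_fin]
  · have := hy' (0, i)
    rw [Fintype.sum_prod_type] at this
    simpa [blockMatrix] using this
  · have := hy' (1, i)
    rw [Fintype.sum_prod_type] at this
    simpa [blockMatrix] using this

variable {Ω : Type*} {sz : Ω → ℕ}

theorem runs_program {P : Ω → State → Prop} (ι : Ω → Type) [∀ ω, Idx (ι ω)]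
    (hN : PolyBdd sz fun ω => card (ι ω)) (h26 : ∀ ω s, P ω s → s.reg 26 = card (ι ω)) :
    Runs sz P program fun ω s' => ∃ s, P ω s ∧ Spec (ι ω) s s' := by
  have hN2 : PolyBdd sz fun ω => card (Fin 2 × ι ω) := (PolyBdd.const 2).mul hN
  have hN4 : PolyBdd sz fun ω => card ((Fin 2 × ι ω) × (Fin 2 × ι ω)) := hN2.mul hN2
  refine Runs.conseq ((Runs.assign _ _ _).seq ((Runs.assign _ _ _).seq ((Runs.assign _ _ _).seq
    ((Runs.tab (k := fun ω => card ((Fin 2 × ι ω) × (Fin 2 × ι ω))) (l := fun _ => 1) (by decide)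
      (by decide) rfl ?_ ?_ hN4 (.const 1)).seq
    ((Runs.tab (k := fun ω => card (Fin 2 × ι ω)) (l := fun _ => 1) (by decide) (by decide) rfl
      ?_ ?_ hN2 (.const 1)).seq
    (Solver.runs_program hN2 ?_)))))) (fun _ _ h => h) ?_
  · rintro ω _ ⟨_, ⟨_, ⟨s, hs, rfl⟩, rfl⟩, rfl⟩
    simp [State.setReg_reg_of_ne, h26 ω s hs, card_prod, card_fin]
  · rintro ω _ ⟨_, ⟨_, ⟨s, hs, rfl⟩, rfl⟩, rfl⟩
    simp
  · rintro ω s₂ ⟨_, ⟨_, ⟨_, ⟨s, hs, rfl⟩, rfl⟩, rfl⟩, h12⟩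
    rw [h12.reg 20 (by decide)]
    simp [State.setReg_reg_of_ne, h26 ω s hs, card_prod, card_fin]
  · rintro ω s₂ ⟨_, ⟨_, ⟨_, ⟨s, hs, rfl⟩, rfl⟩, rfl⟩, h12⟩
    rw [h12.reg 22 (by decide)]
    simp
  · rintro ω s₃ ⟨s₂, ⟨_, ⟨_, ⟨_, ⟨s, hs, rfl⟩, rfl⟩, rfl⟩, h12⟩, h23⟩
    rw [h23.reg 20 (by decide), h12.reg 20 (by decide)]
    simp [State.setReg_reg_of_ne, h26 ω s hs, card_prod, card_fin]
  · rintro ω s₄ ⟨s₃, ⟨s₂, ⟨_, ⟨_, ⟨_, ⟨s, hs, rfl⟩, rfl⟩, rfl⟩, h12⟩, h23⟩, h34⟩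
    refine ⟨s, hs, spec_of_solverSpec (fun r hr => ?_) ?_ (h26 ω s hs) ?_ h12 h23 h34⟩
    · rw [State.setReg_reg_of_ne _ (by omega), State.setReg_reg_of_ne _ (by omega),
        State.setReg_reg_of_ne _ (by omega)]
    · rfl
    · simp [State.setReg_reg_of_ne, h26 ω s hs, card_prod, card_fin]

end Block

end RAM

/-! ### Reading the input -/

theorem List.length_flatMap_of_forall {α β : Type*} (l : List α) {f : α → List β} {k : ℕ}
    (hf : ∀ x, (f x).length = k) : (l.flatMap f).length = l.length * k := by
  simp [List.length_flatMap, hf]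

theorem List.getD_flatMap_of_forall {α β : Type*} (l : List α) {f : α → List β} {k : ℕ}
    (hf : ∀ x, (f x).length = k) (d : β) (i : ℕ) (hi : i < l.length) {j : ℕ} (hj : j < k) :
    (l.flatMap f).getD (i * k + j) d = (f l[i]).getD j d := by
  induction l generalizing i with
  | nil => simp at hi
  | cons x l ih =>
    rw [List.flatMap_cons]
    rcases i with _ | i
    · rw [List.getD_append _ _ _ _ (by rw [hf]; omega)]
      simp
    · rw [List.getD_append_right _ _ _ _ (by rw [hf, add_mul]; omega), hf,
        show (i + 1) * k + j - k = i * k + j by rw [add_mul]; omega,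
        ih i (by simpa using hi)]
      simp

theorem List.getD_flatMap_finRange {β : Type*} {n : ℕ} {f : Fin n → List β} {k : ℕ}
    (hf : ∀ x, (f x).length = k) (d : β) (i : Fin n) {j : ℕ} (hj : j < k) :
    ((List.finRange n).flatMap f).getD (i * k + j) d = (f i).getD j d := by
  rw [List.getD_flatMap_of_forall _ hf d i (by simp) hj]
  simp

open Classical in
/-- A truth value as an integer. -/
noncomputable def boolInt (p : Prop) : ℤ := if p then 1 else 0

theorem length_encodeProp (p : Prop) : (encodeProp p).length = 1 := by
  unfold encodeProp; split_ifs <;> rfl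

theorem getD_encodeProp (p : Prop) : (encodeProp p).getD 0 0 = boolInt p := by
  unfold encodeProp boolInt; split_ifs <;> rfl

theorem length_encodeRat (q : ℚ) : (encodeRat q).length = 2 := rfl

namespace MarkovChain

variable {n : ℕ} (M : MarkovChain n)

theorem length_encode : M.encode.length = 1 + 2 * n + 2 * (n * n) := by
  simp only [encode, List.cons_append, List.length_cons, List.length_append,
    List.length_flatMap_of_forall _ (fun _ => List.length_flatMap_of_forall _
      (fun _ => length_encodeRat _)), List.length_flatMap_of_forall _ (fun _ => length_encodeRat _),
    List.length_finRange]
  ring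

theorem getD_encode_initial (l : List ℤ) (s : Fin n) {j : ℕ} (hj : j < 2) :
    (M.encode ++ l).getD (1 + 2 * s + j) 0 = (encodeRat (M.π s)).getD j 0 := by
  have h := s.isLt
  rw [List.getD_append _ _ _ _ (by rw [M.length_encode]; omega), encode,
    List.getD_append _ _ _ _ (by
      simp only [List.length_cons, List.length_flatMap_of_forall _ (fun _ => length_encodeRat _),
        List.length_finRange]; omega),
    show 1 + 2 * s.val + j = (s * 2 + j) + 1 by ring, List.getD_cons_succ,
    List.getD_flatMap_finRange (fun _ => length_encodeRat _) _ _ hj]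

theorem getD_encode_transition (l : List ℤ) (s t : Fin n) {j : ℕ} (hj : j < 2) :
    (M.encode ++ l).getD (1 + 2 * n + 2 * (s * n + t) + j) 0 = (encodeRat (M.P s t)).getD j 0 := by
  have hs := s.isLt
  have ht := t.isLt
  have h1 : s * n + t < n * n := calc
    s * n + t < (s + 1) * n := by rw [add_mul]; omega
    _ ≤ n * n := Nat.mul_le_mul_right _ hs
  have h2 : ((n : ℤ) :: (List.finRange n).flatMap fun s => encodeRat (M.π s)).length = 1 + 2 * n := by
    simp only [List.length_cons, List.length_flatMap_of_forall _ (fun _ => length_encodeRat _),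
        List.length_finRange]; ring
  rw [List.getD_append _ _ _ _ (by rw [M.length_encode]; omega), encode,
    List.getD_append_right _ _ _ _ (by rw [h2]; omega), h2,
    show 1 + 2 * n + 2 * (s * n + t) + j - (1 + 2 * n) = s * (n * 2) + (t * 2 + j) by
      have : s.val * (n * 2) = 2 * (s * n) := by ring
      omega,
    List.getD_flatMap_finRange (fun s => (List.length_flatMap_of_forall _
      fun _ => length_encodeRat _).trans (by rw [List.length_finRange])) _ _ (by omega),
    List.getD_flatMap_finRange (fun _ => length_encodeRat _) _ _ hj]

end MarkovChain

namespace Buchi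

variable {n m : ℕ} (M : MarkovChain n) (A : NFA (Fin n) (Fin m))

theorem getD_encode (j : ℕ) :
    (M.encode ++ encode A).getD (1 + 2 * n + 2 * (n * n) + j) 0 = (encode A).getD j 0 := by
  rw [List.getD_append_right _ _ _ _ (by rw [M.length_encode]; omega), M.length_encode,
    Nat.add_sub_cancel_left]

theorem length_start :
    ((List.finRange m).flatMap fun q => encodeProp (q ∈ A.start)).length = m := by
  rw [List.length_flatMap_of_forall _ (fun _ => length_encodeProp _), List.length_finRange, mul_one]

theorem length_accept :
    ((List.finRange m).flatMap fun q => encodeProp (q ∈ A.accept)).length = m := by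
  rw [List.length_flatMap_of_forall _ (fun _ => length_encodeProp _), List.length_finRange, mul_one]

theorem getD_encode_start (q : Fin m) :
    (encode A).getD (2 + q) 0 = boolInt (q ∈ A.start) := by
  have h := q.isLt
  rw [encode, List.append_assoc, List.append_assoc, List.getD_append_right _ _ _ _ (by simp),
    List.getD_append _ _ _ _ (by rw [length_start]; simp),
    ← getD_encodeProp, ← List.getD_flatMap_finRange (fun q => length_encodeProp (q ∈ A.start)) _ q
      Nat.one_pos]
  simp

theorem getD_encode_accept (q : Fin m) :
    (encode A).getD (2 + m + q) 0 = boolInt (q ∈ A.accept) := by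
  have h := q.isLt
  rw [encode, List.append_assoc, List.append_assoc, List.getD_append_right _ _ _ _ (by simp; omega),
    List.getD_append_right _ _ _ _ (by rw [length_start]; simp; omega), length_start,
    List.getD_append _ _ _ _ (by rw [length_accept]; simp; omega),
    ← getD_encodeProp, ← List.getD_flatMap_finRange (fun q => length_encodeProp (q ∈ A.accept)) _ q
      Nat.one_pos]
  congr 1
  simp; omega

theorem getD_encode_step (q : Fin m) (a : Fin n) (q' : Fin m) :
    (encode A).getD (2 + 2 * m + ((q * n + a) * m + q')) 0 = boolInt (q' ∈ A.step q a) := by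
  have hq := q.isLt
  have ha := a.isLt
  have hq' := q'.isLt
  have h1 : a * m + q' < n * m := calc
    a * m + q' < (a + 1) * m := by rw [add_mul]; omega
    _ ≤ n * m := Nat.mul_le_mul_right _ ha
  have e1 : ∀ q a, ((List.finRange m).flatMap fun q' => encodeProp (q' ∈ A.step q a)).length = m :=
    fun q a => by
      rw [List.length_flatMap_of_forall _ (fun _ => length_encodeProp _), List.length_finRange,
        mul_one]
  have e2 : ∀ q, ((List.finRange n).flatMap fun a =>
      (List.finRange m).flatMap fun q' => encodeProp (q' ∈ A.step q a)).length = n * m :=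
    fun q => by rw [List.length_flatMap_of_forall _ (e1 q), List.length_finRange]
  have h2 : 2 + 2 * m + ((q.val * n + a) * m + q') =
      q * (n * m) + (a * m + (q' * 1 + 0)) + 2 + m + m := by ring
  rw [encode, List.append_assoc, List.append_assoc, h2,
    List.getD_append_right _ _ _ _ (by simp; omega),
    List.getD_append_right _ _ _ _ (by rw [length_start]; simp; omega), length_start,
    List.getD_append_right _ _ _ _ (by rw [length_accept]; simp; omega), length_accept]
  have h3 : ∀ x : ℕ, x + 2 + m + m - [(n : ℤ), (m : ℤ)].length - m - m = x := fun x => by simp; omega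
  rw [h3, List.getD_flatMap_finRange e2 _ q (by omega), List.getD_flatMap_finRange (e1 q) _ a
    (by omega), List.getD_flatMap_finRange (fun _ => length_encodeProp _) _ q' Nat.one_pos,
    getD_encodeProp]

theorem length_encode_ge : 2 + 2 * m ≤ (encode A).length := by
  rw [encode, List.append_assoc, List.append_assoc, List.length_append, List.length_append,
    List.length_append, length_start, length_accept]
  simp only [List.length_cons, List.length_nil]
  omega

end Buchi

namespace RAM

theorem length_le_inputLength (l : List ℤ) : l.length ≤ inputLength l := by
  induction l with
  | nil => simp [inputLength]
  | cons x l ih =>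
    have := one_le_len x
    simp only [inputLength, List.map_cons, List.sum_cons, List.length_cons] at ih ⊢
    omega

theorem len_getD_le (l : List ℤ) (i : ℕ) : len (l.getD i 0) ≤ inputLength l + 1 := by
  induction l generalizing i with
  | nil => simp [len]
  | cons x l ih =>
    have e : inputLength (x :: l) = len x + inputLength l := by simp [inputLength]
    rcases i with _ | i
    · rw [e, List.getD_cons_zero]; omega
    · rw [e, List.getD_cons_succ]; exact (ih i).trans (by omega)

theorem inputLength_append (l l' : List ℤ) :
    inputLength (l ++ l') = inputLength l + inputLength l' := by
  simp [inputLength]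

theorem start_bdd (l : List ℤ) : (start l).Bdd (inputLength l + 1) := by
  refine ⟨fun r => by simp [start, len], fun a i => ?_⟩
  simp only [start]
  split_ifs
  · exact len_getD_le l i
  · simp [len]

end RAM

/-! ### The common data of all stages of the algorithm -/

namespace Buchi

open RAM RAM.Expr Idx

/-- An instance of the problem. -/
structure Instance where
  n : ℕ
  m : ℕ
  chain : MarkovChain n
  aut : NFA (Fin n) (Fin m)
  unambiguous : IsUnambiguous aut

namespace Instance

variable (ω : Instance)

/-- The length of the representation of an instance. -/
noncomputable def size : ℕ := inputLength ω.chain.encode + inputLength (encode ω.aut)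

/-- The memory at the start. -/
noncomputable def startState : State := RAM.start (ω.chain.encode ++ encode ω.aut)

/-- The states of the product of chain and automaton. -/
abbrev Pos : Type := Fin ω.m × Fin ω.n

/-- The states of the product of the chain and two copies of the automaton. -/
abbrev Pair : Type := (Fin ω.m × Fin ω.m) × Fin ω.n

/-- A common denominator of the probabilities. -/
def denom : ℤ := (∏ s, ((ω.chain.π s).den : ℤ)) * ∏ x : Fin ω.n × Fin ω.n, ((ω.chain.P x.1 x.2).den : ℤ)

/-- The initial distribution multiplied by the common denominator. -/
def initialInt (s : Fin ω.n) : ℤ := (ω.chain.π s).num * (ω.denom / (ω.chain.π s).den)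

/-- The transition matrix multiplied by the common denominator. -/
def transitionInt (x : Fin ω.n × Fin ω.n) : ℤ :=
  (ω.chain.P x.1 x.2).num * (ω.denom / (ω.chain.P x.1 x.2).den)

/-- The matrix of the product multiplied by the common denominator. -/
noncomputable def productInt (i j : ω.Pos) : ℤ :=
  ω.transitionInt (i.2, j.2) * boolInt (j.1 ∈ ω.aut.step i.1 i.2)

theorem denom_pos : 0 < ω.denom :=
  mul_pos (Finset.prod_pos fun _ _ => by exact_mod_cast Rat.den_pos _)
    (Finset.prod_pos fun _ _ => by exact_mod_cast Rat.den_pos _)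

theorem cast_num_mul_ediv {q : ℚ} {D : ℤ} (h : (q.den : ℤ) ∣ D) :
    ((q.num * (D / q.den) : ℤ) : ℝ) = D * (q : ℝ) := by
  obtain ⟨k, rfl⟩ := h
  have hd : (q.den : ℤ) ≠ 0 := by exact_mod_cast q.den_ne_zero
  rw [Int.mul_ediv_cancel_left _ hd]
  have hq : (q : ℝ) * q.den = q.num := by exact_mod_cast Rat.mul_den_eq_num q
  push_cast
  rw [← hq]; ring

theorem cast_initialInt (s : Fin ω.n) : (ω.initialInt s : ℝ) = ω.denom * ω.chain.π s :=
  cast_num_mul_ediv ((Finset.dvd_prod_of_mem (fun s => ((ω.chain.π s).den : ℤ))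
    (Finset.mem_univ s)).mul_right _)

theorem cast_transitionInt (x : Fin ω.n × Fin ω.n) :
    (ω.transitionInt x : ℝ) = ω.denom * ω.chain.P x.1 x.2 :=
  cast_num_mul_ediv ((Finset.dvd_prod_of_mem
    (fun x : Fin ω.n × Fin ω.n => ((ω.chain.P x.1 x.2).den : ℤ)) (Finset.mem_univ x)).mul_left _)

theorem cast_boolInt (p : Prop) [Decidable p] : (boolInt p : ℝ) = if p then 1 else 0 := by
  unfold boolInt; split_ifs <;> simp

theorem cast_productInt (i j : ω.Pos) :
    (ω.productInt i j : ℝ) = ω.denom * productMatrix ω.chain ω.aut i j := by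
  classical
  rw [productInt, Int.cast_mul, cast_transitionInt, cast_boolInt, productMatrix,
    MarkovChain.weightMatrix, stepWeight]
  rw [mul_assoc]

/-- The common data in memory. -/
structure Base (s : State) : Prop where
  r30 : s.reg 30 = card (Fin ω.n)
  r31 : s.reg 31 = card (Fin ω.m)
  r32 : s.reg 32 = card ω.Pos
  r33 : s.reg 33 = card (ω.Pos × ω.Pos)
  r34 : s.reg 34 = card ω.Pair
  r37 : s.reg 37 = card ((ω.Pos × ω.Pos) × (ω.Pos × ω.Pos))
  r38 : s.reg 38 = card (ω.Pair × ω.Pair)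
  r39 : s.reg 39 = (1 : ℕ)
  r40 : s.reg 40 = ω.denom
  a2 : s.Holds 2 ω.initialInt
  a1 : s.Holds 1 ω.transitionInt
  a3 : s.Holds 3 fun q : Fin ω.m => boolInt (q ∈ ω.aut.start)
  a4 : s.Holds 4 fun q : Fin ω.m => boolInt (q ∈ ω.aut.accept)
  a5 : s.Holds 5 fun x : ω.Pos × ω.Pos => ω.productInt x.1 x.2

variable {ω} in
theorem Base.congr {s s' : State} (h : ω.Base s) (hr : ∀ r, 30 ≤ r → s'.reg r = s.reg r)
    (ha : ∀ b, b < 6 → s'.arr b = s.arr b) : ω.Base s' where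
  r30 := (hr 30 (by decide)).trans h.r30
  r31 := (hr 31 (by decide)).trans h.r31
  r32 := (hr 32 (by decide)).trans h.r32
  r33 := (hr 33 (by decide)).trans h.r33
  r34 := (hr 34 (by decide)).trans h.r34
  r37 := (hr 37 (by decide)).trans h.r37
  r38 := (hr 38 (by decide)).trans h.r38
  r39 := (hr 39 (by decide)).trans h.r39
  r40 := (hr 40 (by decide)).trans h.r40
  a1 := h.a1.congr (ha 1 (by decide))
  a2 := h.a2.congr (ha 2 (by decide))
  a3 := h.a3.congr (ha 3 (by decide))
  a4 := h.a4.congr (ha 4 (by decide))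
  a5 := h.a5.congr (ha 5 (by decide))

/-- The numerators of the transition matrix, multiplied by the denominator. -/
def transitionExpr : Expr :=
  get 0 (const 1 + const 2 * reg 30 + const 2 * reg 0 + const 0) *
    (reg 40 / get 0 (const 1 + const 2 * reg 30 + const 2 * reg 0 + const 1))

/-- The numerators of the initial distribution, multiplied by the denominator. -/
def initialExpr : Expr :=
  get 0 (const 1 + const 2 * reg 0 + const 0) * (reg 40 / get 0 (const 1 + const 2 * reg 0 + const 1))

/-- The entries of the product matrix. -/
def productExpr : Expr :=
  get 1 ((reg 0 / reg 32).mod (reg 30) * reg 30 + ((reg 0).mod (reg 32)).mod (reg 30)) *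
    get 0 (reg 41 + (const 2 + const 2 * reg 31 +
      (reg 0 / reg 32 * reg 31 + (reg 0).mod (reg 32) / reg 30)))

/-- Compute the registers of the common data, except the denominator. -/
def sizeProgram : Program :=
  .seq (.assign 30 (get 0 (const 0)))
  (.seq (.assign 41 (const 1 + const 2 * reg 30 + const 2 * (reg 30 * reg 30)))
  (.seq (.assign 31 (get 0 (reg 41 + const 1)))
  (.seq (.assign 39 (const 1))
  (.seq (.assign 32 (reg 31 * reg 30))
  (.seq (.assign 33 (reg 32 * reg 32))
  (.seq (.assign 34 (reg 31 * reg 31 * reg 30))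
  (.seq (.assign 35 (reg 30 * reg 30))
  (.seq (.assign 36 (reg 30 + reg 35))
  (.seq (.assign 37 (reg 33 * reg 33))
  (.assign 38 (reg 34 * reg 34)))))))))))

/-- Compute the common data. -/
def baseProgram : Program :=
  .seq sizeProgram
  (.seq (.seq (.fold 36 (const 1) (reg 2 * get 0 (const 2 + const 2 * reg 1))) (.assign 40 (reg 2)))
  (.seq (.tab 1 35 39 transitionExpr)
  (.seq (.tab 2 30 39 initialExpr)
  (.seq (.tab 3 31 39 (get 0 (reg 41 + (const 2 + reg 0))))
  (.seq (.tab 4 31 39 (get 0 (reg 41 + (const 2 + reg 31 + reg 0))))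
  (.tab 5 33 39 productExpr))))))

/-- The registers after `sizeProgram`. -/
structure Sizes (s : State) : Prop where
  r30 : s.reg 30 = card (Fin ω.n)
  r31 : s.reg 31 = card (Fin ω.m)
  r32 : s.reg 32 = card ω.Pos
  r33 : s.reg 33 = card (ω.Pos × ω.Pos)
  r34 : s.reg 34 = card ω.Pair
  r35 : s.reg 35 = card (Fin ω.n × Fin ω.n)
  r36 : s.reg 36 = (ω.n + ω.n * ω.n : ℕ)
  r37 : s.reg 37 = card ((ω.Pos × ω.Pos) × (ω.Pos × ω.Pos))
  r38 : s.reg 38 = card (ω.Pair × ω.Pair)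
  r39 : s.reg 39 = (1 : ℕ)
  r41 : s.reg 41 = (1 + 2 * ω.n + 2 * (ω.n * ω.n) : ℕ)
  arr : s.arr 0 = ω.startState.arr 0

variable {ω} in
theorem Sizes.congr {s s' : State} (h : ω.Sizes s)
    (hr : ∀ r, 30 ≤ r → r ≠ 40 → s'.reg r = s.reg r) (ha : s'.arr 0 = s.arr 0) : ω.Sizes s' where
  r30 := (hr 30 (by decide) (by decide)).trans h.r30
  r31 := (hr 31 (by decide) (by decide)).trans h.r31
  r32 := (hr 32 (by decide) (by decide)).trans h.r32
  r33 := (hr 33 (by decide) (by decide)).trans h.r33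
  r34 := (hr 34 (by decide) (by decide)).trans h.r34
  r35 := (hr 35 (by decide) (by decide)).trans h.r35
  r36 := (hr 36 (by decide) (by decide)).trans h.r36
  r37 := (hr 37 (by decide) (by decide)).trans h.r37
  r38 := (hr 38 (by decide) (by decide)).trans h.r38
  r39 := (hr 39 (by decide) (by decide)).trans h.r39
  r41 := (hr 41 (by decide) (by decide)).trans h.r41
  arr := ha.trans h.arr

theorem startState_arr_zero (i : ℕ) :
    ω.startState.arr 0 i = (ω.chain.encode ++ encode ω.aut).getD i 0 := rfl

theorem runs_sizeProgram :
    Runs size (fun ω s => s = ω.startState) sizeProgram fun ω s => ω.Sizes s := by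
  refine Runs.conseq ((Runs.assign _ _ _).seq ((Runs.assign _ _ _).seq ((Runs.assign _ _ _).seq
    ((Runs.assign _ _ _).seq ((Runs.assign _ _ _).seq ((Runs.assign _ _ _).seq
    ((Runs.assign _ _ _).seq ((Runs.assign _ _ _).seq ((Runs.assign _ _ _).seq
    ((Runs.assign _ _ _).seq (Runs.assign _ _ _))))))))))) (fun _ _ h => h) ?_
  rintro ω _ ⟨_, ⟨_, ⟨_, ⟨_, ⟨_, ⟨_, ⟨_, ⟨_, ⟨_, ⟨_, ⟨_, rfl, rfl⟩, rfl⟩, rfl⟩, rfl⟩, rfl⟩, rfl⟩,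
    rfl⟩, rfl⟩, rfl⟩, rfl⟩, rfl⟩
  have h0 : ω.startState.arr 0 0 = ω.n := rfl
  have h1 : ω.startState.arr 0 (1 + 2 * ω.n + 2 * (ω.n * ω.n) + 1) = ω.m := by
    rw [startState_arr_zero, getD_encode]; rfl
  have h2 : (1 + 2 * (ω.n : ℤ) + 2 * ((ω.n : ℤ) * ω.n) + 1).toNat =
      1 + 2 * ω.n + 2 * (ω.n * ω.n) + 1 := by
    rw [← Int.toNat_natCast (1 + 2 * ω.n + 2 * (ω.n * ω.n) + 1)]; congr 1
  constructor <;> simp [State.setReg_reg_of_ne, h0, h2, h1, card_prod, card_fin]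

theorem polyBdd_n : PolyBdd size fun ω => ω.n := by
  refine PolyBdd.size.mono fun ω => ?_
  have h1 := length_le_inputLength ω.chain.encode
  rw [ω.chain.length_encode] at h1
  unfold size; omega

theorem polyBdd_m : PolyBdd size fun ω => ω.m := by
  refine PolyBdd.size.mono fun ω => ?_
  have h1 := length_le_inputLength (encode ω.aut)
  have h2 := length_encode_ge ω.aut
  unfold size; omega

theorem polyBdd_pos : PolyBdd size fun ω => card ω.Pos := polyBdd_m.mul polyBdd_n

theorem polyBdd_pair : PolyBdd size fun ω => card ω.Pair :=
  (polyBdd_m.mul polyBdd_m).mul polyBdd_n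

theorem startState_initial (s : Fin ω.n) {j : ℕ} (hj : j < 2) :
    ω.startState.arr 0 (1 + 2 * s + j) = (encodeRat (ω.chain.π s)).getD j 0 := by
  rw [startState_arr_zero, MarkovChain.getD_encode_initial _ _ _ hj]

theorem startState_transition (x : Fin ω.n × Fin ω.n) {j : ℕ} (hj : j < 2) :
    ω.startState.arr 0 (1 + 2 * ω.n + 2 * num x + j) =
      (encodeRat (ω.chain.P x.1 x.2)).getD j 0 := by
  rw [startState_arr_zero, num_prod]
  exact MarkovChain.getD_encode_transition _ _ _ _ hj

theorem prod_range_denominators :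
    ∏ j ∈ Finset.range (ω.n + ω.n * ω.n), ω.startState.arr 0 (2 + 2 * j) = ω.denom := by
  rw [Finset.prod_range_add, denom]
  congr 1
  · rw [← Fin.prod_univ_eq_prod_range]
    refine Finset.prod_congr rfl fun s _ => ?_
    rw [show 2 + 2 * s.val = 1 + 2 * s + 1 by ring, ω.startState_initial s (by decide)]
    rfl
  · rw [← Fin.prod_univ_eq_prod_range (fun x => ω.startState.arr 0 (2 + 2 * (ω.n + x))) (ω.n * ω.n)]
    refine (Equiv.prod_comp (code : Fin ω.n × Fin ω.n ≃ Fin (ω.n * ω.n)) _).symm.trans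
      (Finset.prod_congr rfl fun x _ => ?_)
    have h := ω.startState_transition x (j := 1) (by decide)
    rw [show 1 + 2 * ω.n + 2 * num x + 1 = 2 + 2 * (ω.n + num x) by ring] at h
    exact h

theorem foldVal_denom {s : State} (h : ω.Sizes s) (k : ℕ) :
    foldVal s (const 1) (reg 2 * get 0 (const 2 + const 2 * reg 1)) k =
      ∏ j ∈ Finset.range k, ω.startState.arr 0 (2 + 2 * j) := by
  induction k with
  | zero => simp [foldVal]
  | succ k ih =>
    have e : (2 + 2 * (k : ℤ)).toNat = 2 + 2 * k := by omega
    simp [foldVal, ih, Finset.prod_range_succ, State.setReg_reg_of_ne, h.arr, e]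

theorem runs_denom : Runs size (fun ω s => ω.Sizes s)
    (.seq (.fold 36 (const 1) (reg 2 * get 0 (const 2 + const 2 * reg 1))) (.assign 40 (reg 2)))
    fun ω s => ω.Sizes s ∧ s.reg 40 = ω.denom := by
  have hk : PolyBdd size fun ω => ω.n + ω.n * ω.n := polyBdd_n.add (polyBdd_n.mul polyBdd_n)
  refine Runs.conseq ((Runs.fold (k := fun ω => ω.n + ω.n * ω.n) (by decide)
    (fun ω s h => h.r36) hk ?_).seq (Runs.assign _ _ _)) (fun _ _ h => h) ?_
  · intro L hL
    refine ⟨_, (hk.mul hL).add (.const 2), fun ω s h hb j hj => ?_⟩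
    rw [ω.foldVal_denom h]
    -- Lengths add under multiplication, so the common denominator has polynomial length although
    -- its value may be exponential.
    have : len (∏ i ∈ Finset.range j, ω.startState.arr 0 (2 + 2 * i)) ≤ j * L ω + 2 := by
      clear hj
      induction j with
      | zero => simp [len]
      | succ j ih =>
        rw [Finset.prod_range_succ, add_mul, one_mul]
        refine (len_mul_le _ _).trans ?_
        have h' := hb.2 0 (2 + 2 * j)
        rw [h.arr] at h'
        omega
    exact this.trans (Nat.add_le_add_right (Nat.mul_le_mul_right _ hj) _)
  · rintro ω _ ⟨_, ⟨s, h, rfl⟩, rfl⟩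
    refine ⟨h.congr (fun r hr hr' => ?_) rfl, ?_⟩
    · rw [State.setReg_reg_of_ne _ hr', State.setReg_reg_of_ne _ (by omega),
        State.setReg_reg_of_ne _ (by omega)]
    · simp only [State.setReg_reg_self, eval_reg]
      rw [ω.foldVal_denom h, ω.prod_range_denominators]

variable {ω} in
theorem sizes_of_tabSpec {s s' : State} {a k l : ℕ} {e : Expr} (ha : a ≠ 0)
    (h : ω.Sizes s ∧ s.reg 40 = ω.denom) (ht : TabSpec a e k l s s') :
    ω.Sizes s' ∧ s'.reg 40 = ω.denom :=
  ⟨h.1.congr (fun r hr _ => ht.reg r (by omega)) (ht.arr 0 ha.symm), (ht.reg 40 (by decide)).trans h.2⟩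

theorem runs_baseProgram :
    Runs size (fun ω s => s = ω.startState) baseProgram fun ω s => ω.Base s := by
  have h1 := polyBdd_n.mul polyBdd_n
  have h33 : PolyBdd size fun ω => card (ω.Pos × ω.Pos) := polyBdd_pos.mul polyBdd_pos
  have hone : PolyBdd size fun _ => 1 := .const 1
  have key : Runs size (fun ω s => ω.Sizes s ∧ s.reg 40 = ω.denom)
      (.seq (.tab 1 35 39 transitionExpr)
      (.seq (.tab 2 30 39 initialExpr)
      (.seq (.tab 3 31 39 (get 0 (reg 41 + (const 2 + reg 0))))
      (.seq (.tab 4 31 39 (get 0 (reg 41 + (const 2 + reg 31 + reg 0))))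
      (.tab 5 33 39 productExpr))))) fun ω s => ω.Base s := by
    refine Runs.conseq ((Runs.tab (k := fun ω => card (Fin ω.n × Fin ω.n)) (by decide) (by decide)
      rfl (fun ω s h => h.1.r35) (fun ω s h => h.1.r39) h1 hone).seq
      ((Runs.tab (k := fun ω => card (Fin ω.n)) (l := fun _ => 1) (by decide) (by decide)
      rfl ?_ ?_ polyBdd_n hone).seq
      ((Runs.tab (k := fun ω => card (Fin ω.m)) (l := fun _ => 1) (by decide) (by decide)
      rfl ?_ ?_ polyBdd_m hone).seq
      ((Runs.tab (k := fun ω => card (Fin ω.m)) (l := fun _ => 1) (by decide) (by decide)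
      rfl ?_ ?_ polyBdd_m hone).seq
      (Runs.tab (k := fun ω => card (ω.Pos × ω.Pos)) (l := fun _ => 1) (by decide) (by decide)
      rfl ?_ ?_ h33 hone))))) (fun _ _ h => h) ?_
    · rintro ω s₁ ⟨s₀, h, t₁⟩
      exact (sizes_of_tabSpec (by decide) h t₁).1.r30
    · rintro ω s₁ ⟨s₀, h, t₁⟩
      exact (sizes_of_tabSpec (by decide) h t₁).1.r39
    · rintro ω s₂ ⟨s₁, ⟨s₀, h, t₁⟩, t₂⟩
      exact (sizes_of_tabSpec (by decide) (sizes_of_tabSpec (by decide) h t₁) t₂).1.r31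
    · rintro ω s₂ ⟨s₁, ⟨s₀, h, t₁⟩, t₂⟩
      exact (sizes_of_tabSpec (by decide) (sizes_of_tabSpec (by decide) h t₁) t₂).1.r39
    · rintro ω s₃ ⟨s₂, ⟨s₁, ⟨s₀, h, t₁⟩, t₂⟩, t₃⟩
      exact (sizes_of_tabSpec (by decide) (sizes_of_tabSpec (by decide)
        (sizes_of_tabSpec (by decide) h t₁) t₂) t₃).1.r31
    · rintro ω s₃ ⟨s₂, ⟨s₁, ⟨s₀, h, t₁⟩, t₂⟩, t₃⟩
      exact (sizes_of_tabSpec (by decide) (sizes_of_tabSpec (by decide)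
        (sizes_of_tabSpec (by decide) h t₁) t₂) t₃).1.r39
    · rintro ω s₄ ⟨s₃, ⟨s₂, ⟨s₁, ⟨s₀, h, t₁⟩, t₂⟩, t₃⟩, t₄⟩
      exact (sizes_of_tabSpec (by decide) (sizes_of_tabSpec (by decide) (sizes_of_tabSpec (by decide)
        (sizes_of_tabSpec (by decide) h t₁) t₂) t₃) t₄).1.r33
    · rintro ω s₄ ⟨s₃, ⟨s₂, ⟨s₁, ⟨s₀, h, t₁⟩, t₂⟩, t₃⟩, t₄⟩
      exact (sizes_of_tabSpec (by decide) (sizes_of_tabSpec (by decide) (sizes_of_tabSpec (by decide)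
        (sizes_of_tabSpec (by decide) h t₁) t₂) t₃) t₄).1.r39
    · rintro ω s₅ ⟨s₄, ⟨s₃, ⟨s₂, ⟨s₁, ⟨s₀, h₀, t₁⟩, t₂⟩, t₃⟩, t₄⟩, t₅⟩
      have h₁ := sizes_of_tabSpec (by decide) h₀ t₁
      have h₂ := sizes_of_tabSpec (by decide) h₁ t₂
      have h₃ := sizes_of_tabSpec (by decide) h₂ t₃
      have h₄ := sizes_of_tabSpec (by decide) h₃ t₄
      have h₅ := sizes_of_tabSpec (by decide) h₄ t₅
      have a1 : s₁.Holds 1 ω.transitionInt := by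
        refine t₁.holds_one fun x => ?_
        have e : ∀ j : ℕ, (1 + 2 * (card (Fin ω.n) : ℤ) + 2 * (num x : ℤ) + (j : ℤ)).toNat =
            1 + 2 * ω.n + 2 * num x + j := fun j => by
          rw [card_fin, ← Int.toNat_natCast (1 + 2 * ω.n + 2 * num x + j)]; congr 1
        have e0 := e 0
        have e1 := e 1
        rw [Nat.cast_zero] at e0
        rw [Nat.cast_one] at e1
        simp only [transitionExpr, eval_mul, eval_get, eval_add, eval_const, eval_reg, eval_div,
          State.cursor_reg_zero, State.cursor_reg _ _ _ (show 2 ≤ 30 by decide),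
          State.cursor_reg _ _ _ (show 2 ≤ 40 by decide), h₀.1.r30, h₀.2, State.cursor_arr, h₀.1.arr,
          e0, e1, ω.startState_transition x (show 0 < 2 by decide),
          ω.startState_transition x (show 1 < 2 by decide)]
        rfl
      have a2 : s₂.Holds 2 ω.initialInt := by
        refine t₂.holds_one fun x => ?_
        have e : ∀ j : ℕ, (1 + 2 * (num x : ℤ) + (j : ℤ)).toNat = 1 + 2 * x + j := fun j => by
          rw [← Int.toNat_natCast (1 + 2 * x + j)]; congr 1
        have e0 := e 0
        have e1 := e 1
        rw [Nat.cast_zero] at e0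
        rw [Nat.cast_one] at e1
        simp only [initialExpr, eval_mul, eval_get, eval_add, eval_const, eval_reg, eval_div,
          State.cursor_reg_zero,
          State.cursor_reg _ _ _ (show 2 ≤ 40 by decide), h₁.2, State.cursor_arr, h₁.1.arr,
          e0, e1, ω.startState_initial x (show 0 < 2 by decide),
          ω.startState_initial x (show 1 < 2 by decide)]
        rfl
      have a3 : s₃.Holds 3 fun q : Fin ω.m => boolInt (q ∈ ω.aut.start) := by
        refine t₃.holds_one fun q => ?_
        have e : (((1 + 2 * ω.n + 2 * (ω.n * ω.n) : ℕ) : ℤ) + (2 + (num q : ℤ))).toNat =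
            1 + 2 * ω.n + 2 * (ω.n * ω.n) + (2 + q) := by
          rw [← Int.toNat_natCast (1 + 2 * ω.n + 2 * (ω.n * ω.n) + (2 + q))]; congr 1
        simp only [eval_get, eval_add, eval_const, eval_reg,
          State.cursor_reg_zero, State.cursor_reg _ _ _ (show 2 ≤ 41 by decide), h₂.1.r41,
          State.cursor_arr, h₂.1.arr, e, startState_arr_zero, getD_encode, getD_encode_start]
      have a4 : s₄.Holds 4 fun q : Fin ω.m => boolInt (q ∈ ω.aut.accept) := by
        refine t₄.holds_one fun q => ?_
        have e : (((1 + 2 * ω.n + 2 * (ω.n * ω.n) : ℕ) : ℤ) + (2 + (card (Fin ω.m) : ℤ) +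
            (num q : ℤ))).toNat = 1 + 2 * ω.n + 2 * (ω.n * ω.n) + (2 + ω.m + q) := by
          rw [card_fin, ← Int.toNat_natCast (1 + 2 * ω.n + 2 * (ω.n * ω.n) + (2 + ω.m + q))]; congr 1
        simp only [eval_get, eval_add, eval_const, eval_reg,
          State.cursor_reg_zero, State.cursor_reg _ _ _ (show 2 ≤ 41 by decide),
          State.cursor_reg _ _ _ (show 2 ≤ 31 by decide), h₃.1.r41, h₃.1.r31,
          State.cursor_arr, h₃.1.arr, e, startState_arr_zero, getD_encode, getD_encode_accept]
      have a1' : s₄.Holds 1 ω.transitionInt :=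
        ((a1.congr (t₂.arr 1 (by decide))).congr (t₃.arr 1 (by decide))).congr (t₄.arr 1 (by decide))
      have a5 : s₅.Holds 5 fun x : ω.Pos × ω.Pos => ω.productInt x.1 x.2 := by
        refine t₅.holds_one fun x => ?_
        have e : (((1 + 2 * ω.n + 2 * (ω.n * ω.n) : ℕ) : ℤ) + (2 + 2 * (card (Fin ω.m) : ℤ) +
            ((num x.1 : ℤ) * (card (Fin ω.m) : ℤ) + (num x.2.1 : ℤ)))).toNat =
            1 + 2 * ω.n + 2 * (ω.n * ω.n) + (2 + 2 * ω.m +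
              ((x.1.1 * ω.n + x.1.2) * ω.m + x.2.1)) := by
          rw [card_fin, ← Int.toNat_natCast (1 + 2 * ω.n + 2 * (ω.n * ω.n) + (2 + 2 * ω.m +
              ((x.1.1 * ω.n + x.1.2) * ω.m + x.2.1))), num_prod x.1]
          congr 1
        simp only [productExpr, eval_mul, eval_get, eval_add, eval_const, eval_reg, eval_div,
          eval_mod, State.cursor_reg_zero, State.cursor_reg _ _ _ (show 2 ≤ 41 by decide),
          State.cursor_reg _ _ _ (show 2 ≤ 30 by decide),
          State.cursor_reg _ _ _ (show 2 ≤ 32 by decide),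
          State.cursor_reg _ _ _ (show 2 ≤ 31 by decide), h₄.1.r41, h₄.1.r31, h₄.1.r30, h₄.1.r32,
          num_ediv, num_emod, toNat_num_mul_add, State.cursor_arr, a1' _, e, h₄.1.arr,
          startState_arr_zero, getD_encode, getD_encode_step]
        rfl
      exact ⟨h₅.1.r30, h₅.1.r31, h₅.1.r32, h₅.1.r33, h₅.1.r34, h₅.1.r37, h₅.1.r38, h₅.1.r39, h₅.2,
        ((a2.congr (t₃.arr 2 (by decide))).congr (t₄.arr 2 (by decide))).congr (t₅.arr 2 (by decide)),
        a1'.congr (t₅.arr 1 (by decide)),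
        (a3.congr (t₄.arr 3 (by decide))).congr (t₅.arr 3 (by decide)),
        a4.congr (t₅.arr 4 (by decide)), a5⟩
  exact runs_sizeProgram.seq (runs_denom.seq key)

end Instance

end Buchi

namespace Buchi

open RAM RAM.Expr Idx

open Matrix (Reach)

theorem ite_num_sub {ι : Type} [Idx ι] [DecidableEq ι] (x y : ι) :
    (if (num x : ℤ) - num y = 0 then (1 : ℤ) else 0) = if x = y then 1 else 0 := by
  have : (num x : ℤ) - num y = 0 ↔ x = y := by
    rw [sub_eq_zero, Nat.cast_inj, num_injective.eq_iff]
  simp [this]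

theorem boolInt_eq (p : Prop) [Decidable p] : boolInt p = if p then 1 else 0 := by
  unfold boolInt; split_ifs <;> rfl

theorem boolInt_mul (p q : Prop) : boolInt p * boolInt q = boolInt (p ∧ q) := by
  classical
  simp only [boolInt_eq]; split_ifs <;> simp_all

theorem ite_eq_boolInt (x : ℤ) : (if x = 0 then (0 : ℤ) else 1) = boolInt (x ≠ 0) := by
  rw [boolInt_eq]; split_ifs <;> simp_all

theorem sum_boolInt_ne_zero {ι : Type*} [Fintype ι] (p : ι → Prop) :
    ∑ x, boolInt (p x) ≠ 0 ↔ ∃ x, p x := by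
  classical
  have h : ∀ x ∈ Finset.univ, 0 ≤ boolInt (p x) := fun x _ => by rw [boolInt_eq]; split_ifs <;> simp
  rw [ne_eq, Finset.sum_eq_zero_iff_of_nonneg h]
  simp [boolInt_eq]

namespace Instance

variable {ω : Instance}

theorem Base.tab {s s' : State} (h : ω.Base s) {a k l : ℕ} {e : Expr} (ha : 6 ≤ a)
    (t : TabSpec a e k l s s') : ω.Base s' :=
  h.congr (fun r hr => t.reg r (by omega)) fun b hb => t.arr b (by omega)

/-- Tables with numbers from `6` on do not touch the common data, so the stages can be chained. -/
theorem runs_tab {P : Instance → State → Prop} (hP : ∀ ω s, P ω s → ω.Base s) {a K J : ℕ} {e : Expr}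
    {k l : Instance → ℕ} (hk : ∀ ω s, Base ω s → s.reg K = k ω)
    (hl : ∀ ω s, Base ω s → s.reg J = l ω) (hk' : PolyBdd size k) (hl' : PolyBdd size l)
    (ha : 6 ≤ a := by decide) (hK : 3 ≤ K := by decide) (hJ : 3 ≤ J := by decide)
    (he : e.avoids a = true := by rfl) :
    Runs size P (.tab a K J e) fun ω s' =>
      ω.Base s' ∧ ∃ s, P ω s ∧ TabSpec a e (k ω) (l ω) s s' :=
  Runs.conseq (Runs.tab hK hJ he (fun ω s h => hk ω s (hP ω s h)) (fun ω s h => hl ω s (hP ω s h))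
    hk' hl') (fun _ _ h => h) fun ω _ ⟨s, h, t⟩ => ⟨(hP ω s h).tab ha t, s, h, t⟩

theorem runs_assign {P : Instance → State → Prop} (hP : ∀ ω s, P ω s → ω.Base s) {r : ℕ} (e : Expr)
    (hr : r < 30 ∨ 41 < r := by decide) :
    Runs size P (.assign r e) fun ω s' =>
      ω.Base s' ∧ ∃ s, P ω s ∧ s' = s.setReg r (e.eval s) := by
  refine Runs.conseq (Runs.assign _ _ _) (fun _ _ h => h) ?_
  rintro ω _ ⟨s, h, rfl⟩
  have hb := hP ω s h
  refine ⟨?_, s, h, rfl⟩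
  have hne : ∀ r', 30 ≤ r' → r' ≤ 41 → (s.setReg r (e.eval s)).reg r' = s.reg r' := fun r' _ _ =>
    State.setReg_reg_of_ne _ (by omega) _
  exact ⟨(hne 30 (by decide) (by decide)).trans hb.r30, (hne 31 (by decide) (by decide)).trans hb.r31,
    (hne 32 (by decide) (by decide)).trans hb.r32, (hne 33 (by decide) (by decide)).trans hb.r33,
    (hne 34 (by decide) (by decide)).trans hb.r34, (hne 37 (by decide) (by decide)).trans hb.r37,
    (hne 38 (by decide) (by decide)).trans hb.r38, (hne 39 (by decide) (by decide)).trans hb.r39,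
    (hne 40 (by decide) (by decide)).trans hb.r40, hb.a2, hb.a1, hb.a3, hb.a4, hb.a5⟩

theorem runs_block {P : Instance → State → Prop} (hP : ∀ ω s, P ω s → ω.Base s) {K : ℕ}
    (ι : Instance → Type) [∀ ω, Idx (ι ω)] (hK : ∀ ω s, Base ω s → s.reg K = card (ι ω))
    (hN : PolyBdd size fun ω => card (ι ω)) :
    Runs size P (.seq (.assign 26 (reg K)) Block.program) fun ω s' =>
      ω.Base s' ∧ ∃ s, P ω s ∧ Block.Spec (ι ω) (s.setReg 26 (s.reg K)) s' := by
  refine Runs.conseq ((runs_assign hP (reg K)).seq (Block.runs_program ι hN ?_))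
    (fun _ _ h => h) ?_
  · rintro ω _ ⟨-, s, h, rfl⟩
    rw [State.setReg_reg_self]; exact hK ω s (hP ω s h)
  · rintro ω s' ⟨_, ⟨hb, s, h, rfl⟩, h'⟩
    exact ⟨hb.congr (fun r hr => h'.reg r (by omega)) fun b hb => h'.arr b (by omega), s, h, h'⟩

theorem polyBdd_pos_sq : PolyBdd size fun ω => card (ω.Pos × ω.Pos) := polyBdd_pos.mul polyBdd_pos

theorem polyBdd_pair_sq : PolyBdd size fun ω => card (ω.Pair × ω.Pair) :=
  polyBdd_pair.mul polyBdd_pair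

/-! ### Reachability -/

theorem reach_productInt : Reach (Matrix.of fun i j => (ω.productInt i j : ℝ)) =
    Reach (productMatrix ω.chain ω.aut) := by
  unfold Matrix.Reach
  congr 1
  funext i j
  have : (ω.denom : ℝ) ≠ 0 := by exact_mod_cast ω.denom_pos.ne'
  simp [cast_productInt, this]

/-- Each of the `m` automaton states receives at most the whole row of the chain, whose scaled sum
is `denom`. The number on the right serves as `a` in the resolvent. -/
theorem sum_productInt_lt (i : ω.Pos) :
    ∑ j, (ω.productInt i j : ℝ) < (ω.m : ℝ) * ω.denom + 1 := by
  have h : ∀ j : ω.Pos, (ω.productInt i j : ℝ) ≤ ω.denom * ω.chain.P i.2 j.2 := fun j => by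
    have hD : (0 : ℝ) < ω.denom := by exact_mod_cast ω.denom_pos
    have hP : (0 : ℝ) ≤ ω.chain.P i.2 j.2 := by exact_mod_cast ω.chain.P_nonneg _ _
    rw [productInt, Int.cast_mul, cast_transitionInt]
    classical
    rw [boolInt_eq]
    split_ifs
    · simp
    · simp only [Int.cast_zero, mul_zero]; positivity
  have hsum : ∑ t, (ω.chain.P i.2 t : ℝ) = 1 := by exact_mod_cast ω.chain.P_sum i.2
  have h2 : ∑ j : ω.Pos, (ω.denom : ℝ) * ω.chain.P i.2 j.2 = ω.m * ω.denom := by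
    rw [Fintype.sum_prod_type]
    simp [← Finset.mul_sum, hsum]
  linarith [Finset.sum_le_sum fun j (_ : j ∈ Finset.univ) => h j]

/-- The matrix of the linear system for reachability. -/
noncomputable def reachMatrix (ω : Instance) (x y : ω.Pos × ω.Pos) : ℤ :=
  (if x.2 = y.2 then 1 else 0) *
    (((ω.m : ℤ) * ω.denom + 1) * (if x.1 = y.1 then 1 else 0) - ω.productInt x.1 y.1)

/-- One large system for the whole resolvent: the second index is a mere parameter, so the columns
decouple. -/
theorem sum_reachMatrix_mul (X : ω.Pos × ω.Pos → ℝ) (x : ω.Pos × ω.Pos) :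
    ∑ y, (ω.reachMatrix x y : ℝ) * X y =
      ((ω.m : ℝ) * ω.denom + 1) * X x - ∑ k, (ω.productInt x.1 k : ℝ) * X (k, x.2) := by
  have h1 : ∀ k, ∑ l, (ω.reachMatrix x (k, l) : ℝ) * X (k, l) =
      (((ω.m : ℝ) * ω.denom + 1) * (if x.1 = k then 1 else 0) - ω.productInt x.1 k) * X (k, x.2) := by
    intro k
    rw [Finset.sum_eq_single x.2]
    · simp [reachMatrix]
    · intro l _ hl
      simp [reachMatrix, hl.symm]
    · simp
  rw [Fintype.sum_prod_type]
  simp only [h1, sub_mul, Finset.sum_sub_distrib]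
  simp

theorem exists_reachMatrix_solution : ∃ X : ω.Pos × ω.Pos → ℝ, ∀ x,
    ∑ y, (ω.reachMatrix x y : ℝ) * X y = ((if x.1 = x.2 then 1 else 0 : ℤ) : ℝ) := by
  have h := fun j : ω.Pos => Matrix.exists_resolvent
    (B := Matrix.of fun i j => (ω.productInt i j : ℝ)) (a := (ω.m : ℝ) * ω.denom + 1)
    (fun i j => by
      rw [Matrix.of_apply, cast_productInt]
      exact mul_nonneg (by exact_mod_cast ω.denom_pos.le) (productMatrix_nonneg _ _))
    sum_productInt_lt fun i => if i = j then 1 else 0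
  choose X hX using h
  refine ⟨fun x => X x.2 x.1, fun x => ?_⟩
  rw [sum_reachMatrix_mul, hX x.2 x.1]
  simp

/-- Division by `d`, whatever its sign, gives a solution of the resolvent equations, and the support
of any solution is the reachability relation. -/
theorem ne_zero_iff_reach {y : ω.Pos × ω.Pos → ℤ} {d : ℤ} (hd : d ≠ 0)
    (hy : ∀ x, ∑ z, ω.reachMatrix x z * y z = d * if x.1 = x.2 then 1 else 0) (x : ω.Pos × ω.Pos) :
    y x ≠ 0 ↔ Reach (productMatrix ω.chain ω.aut) x.1 x.2 := by
  have hd' : (d : ℝ) ≠ 0 := by exact_mod_cast hd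
  rw [← reach_productInt, ← Matrix.resolvent_ne_zero_iff
    (B := Matrix.of fun i j => (ω.productInt i j : ℝ)) (a := (ω.m : ℝ) * ω.denom + 1)
    (X := Matrix.of fun i j => (y (i, j) : ℝ) / d)
    (fun i j => by
      rw [Matrix.of_apply, cast_productInt]
      exact mul_nonneg (by exact_mod_cast ω.denom_pos.le) (productMatrix_nonneg _ _))
    sum_productInt_lt]
  · simp [hd]
  · intro i j
    have h1 : ∑ z, (ω.reachMatrix (i, j) z : ℝ) * (y z : ℝ) = d * if i = j then 1 else 0 := by
      exact_mod_cast hy (i, j)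
    rw [sum_reachMatrix_mul] at h1
    simp only [Matrix.of_apply]
    simp only [mul_div_assoc', ← Finset.sum_div]
    rw [div_add' _ _ _ hd', div_left_inj' hd', mul_comm _ (d : ℝ), ← h1]
    ring

/-- The entries of the linear system for reachability. -/
def reachMatrixExpr : Expr :=
  isZero ((reg 0 / reg 33).mod (reg 32) - ((reg 0).mod (reg 33)).mod (reg 32)) *
    ((reg 31 * reg 40 + const 1) * isZero (reg 0 / reg 33 / reg 32 - (reg 0).mod (reg 33) / reg 32) -
      get 5 (reg 0 / reg 33 / reg 32 * reg 32 + (reg 0).mod (reg 33) / reg 32))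

/-- Compute the reachability relation of the product. -/
def reachProgram : Program :=
  .seq (.assign 20 (reg 33)) (.seq (.tab 20 37 39 reachMatrixExpr)
    (.seq (.tab 21 33 39 (isZero (reg 0 / reg 32 - (reg 0).mod (reg 32))))
      (.seq Solver.program (.tab 6 33 39 (nonzero (get 22 (reg 0)))))))

/-- The data in memory after the computation of reachability. -/
def AfterReach (ω : Instance) (s : State) : Prop :=
  ω.Base s ∧ s.Holds 6 fun x : ω.Pos × ω.Pos =>
    boolInt (Reach (productMatrix ω.chain ω.aut) x.1 x.2)

theorem runs_reachProgram : Runs size (fun ω s => ω.Base s) reachProgram AfterReach := by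
  have h4 : PolyBdd size fun ω => card ((ω.Pos × ω.Pos) × (ω.Pos × ω.Pos)) :=
    polyBdd_pos_sq.mul polyBdd_pos_sq
  have hone : PolyBdd size fun _ => 1 := .const 1
  refine Runs.conseq ((runs_assign (fun _ _ h => h) (reg 33)).seq
    ((runs_tab (k := fun ω => card ((ω.Pos × ω.Pos) × (ω.Pos × ω.Pos))) (l := fun _ => 1)
      (fun _ _ h => h.1) (fun _ _ h => h.r37) (fun _ _ h => h.r39) h4 hone).seq
    ((runs_tab (k := fun ω => card (ω.Pos × ω.Pos)) (l := fun _ => 1)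
      (fun _ _ h => h.1) (fun _ _ h => h.r33) (fun _ _ h => h.r39) polyBdd_pos_sq hone).seq
    ((Solver.runs_program polyBdd_pos_sq ?_).seq
    (runs_tab (k := fun ω => card (ω.Pos × ω.Pos)) (l := fun _ => 1)
      ?_ (fun _ _ h => h.r33) (fun _ _ h => h.r39) polyBdd_pos_sq hone)))))
    (fun _ _ h => h) ?_
  · rintro ω s₃ ⟨h₃, s₂, ⟨h₂, _, ⟨h₁, s₀, h₀, rfl⟩, t₂⟩, t₃⟩
    rw [t₃.reg 20 (by decide), t₂.reg 20 (by decide), State.setReg_reg_self]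
    exact h₀.r33
  · rintro ω s₄ ⟨s₃, ⟨h₃, -⟩, hs⟩
    exact h₃.congr (fun r hr => hs.reg r (by omega)) fun b hb => hs.arr b (by omega)
  · rintro ω s₅ ⟨h₅, s₄, ⟨s₃, ⟨h₃, s₂, ⟨h₂, s₁, ⟨h₁, s₀, h₀, h01⟩, t₂⟩, t₃⟩, hs⟩, t₅⟩
    refine ⟨h₅, ?_⟩
    have hX : s₃.Holds 20 fun x : (ω.Pos × ω.Pos) × (ω.Pos × ω.Pos) => ω.reachMatrix x.1 x.2 := by
      refine State.Holds.congr (t₂.holds_one fun x => ?_) (t₃.arr 20 (by decide))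
      simp only [reachMatrixExpr, eval_mul, eval_isZero, eval_sub, eval_mod, eval_div, eval_reg,
        eval_add, eval_const, eval_get, State.cursor_reg_zero,
        State.cursor_reg _ _ _ (show 2 ≤ 33 by decide), State.cursor_reg _ _ _ (show 2 ≤ 32 by decide),
        State.cursor_reg _ _ _ (show 2 ≤ 31 by decide), State.cursor_reg _ _ _ (show 2 ≤ 40 by decide),
        h₁.r33, h₁.r32, h₁.r31, h₁.r40, num_ediv, num_emod, State.cursor_arr, toNat_num_mul_add,
        h₁.a5 _, ite_num_sub, reachMatrix, card_fin]
    have hb : s₃.Holds 21 fun x : ω.Pos × ω.Pos => if x.1 = x.2 then 1 else 0 := by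
      refine t₃.holds_one fun x => ?_
      simp only [eval_isZero, eval_sub, eval_mod, eval_div, eval_reg, State.cursor_reg_zero,
        State.cursor_reg _ _ _ (show 2 ≤ 32 by decide), h₂.r32, num_ediv, num_emod, ite_num_sub]
    obtain ⟨y, hy, hy'⟩ := hs.exists_holds hX hb exists_reachMatrix_solution
    refine t₅.holds_one fun x => ?_
    simp only [eval_nonzero, eval_get, eval_reg, State.cursor_reg_zero, State.cursor_arr,
      Int.toNat_natCast, hy x, ite_eq_boolInt, ne_zero_iff_reach hs.ne_zero hy']

end Instance

end Buchi

namespace Buchi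

open RAM RAM.Expr Idx

open Matrix (Reach)

/-! ### Fixed point systems as integral block systems -/

section FixedPoints

variable {ι : Type} [Idx ι] [DecidableEq ι]

/-- The matrix `D - N`. -/
def shiftInt (D : ℤ) (N : ι → ι → ℤ) (i j : ι) : ℤ := D * (if i = j then 1 else 0) - N i j

theorem sum_shiftInt_mul {D : ℤ} {N : ι → ι → ℤ} {L : Matrix ι ι ℝ}
    (hN : ∀ i j, (N i j : ℝ) = D * L i j) (v : ι → ℝ) (i : ι) :
    ∑ j, (shiftInt D N i j : ℝ) * v j = D * (v i - L.mulVec v i) := by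
  simp only [shiftInt, Int.cast_sub, Int.cast_mul, hN, sub_mul, Finset.sum_sub_distrib,
    Matrix.mulVec, dotProduct, mul_sub, Finset.mul_sum]
  congr 1
  · simp
  · exact Finset.sum_congr rfl fun j _ => by ring

/-- `Block.program` computes a fixed point of `L`, if it is given an integral multiple of the
system. -/
theorem exists_fixed_of_blockSpec {s s' : State} (h : Block.Spec ι s s') {D e : ℤ} (hD : D ≠ 0)
    (he : e ≠ 0) {N N' Y : ι → ι → ℤ} {b : ι → ℤ} {L L' Y₀ : Matrix ι ι ℝ} {b₀ : ι → ℝ}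
    (hX : s.Holds 16 fun x : ι × ι => shiftInt D N x.1 x.2)
    (hY : s.Holds 17 fun x : ι × ι => Y x.1 x.2)
    (hV : s.Holds 18 fun x : ι × ι => shiftInt D N' x.1 x.2) (hb : s.Holds 19 b)
    (hN : ∀ i j, (N i j : ℝ) = D * L i j) (hN' : ∀ i j, (N' i j : ℝ) = D * L' i j)
    (hY₀ : ∀ i j, (Y i j : ℝ) = e * Y₀ i j) (hb₀ : ∀ i, (b i : ℝ) = e * b₀ i)
    (hsol : ∃ v g, L.mulVec v = v ∧ Y₀.mulVec v + (g - L'.mulVec g) = b₀) :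
    ∃ y : ι → ℤ, s'.Holds 22 y ∧ ∃ v g, (∀ i, v i = (y i : ℝ) / s'.reg 4) ∧ L.mulVec v = v ∧
      Y₀.mulVec v + (g - L'.mulVec g) = b₀ := by
  have hD' : (D : ℝ) ≠ 0 := by exact_mod_cast hD
  have he' : (e : ℝ) ≠ 0 := by exact_mod_cast he
  have hd' : (s'.reg 4 : ℝ) ≠ 0 := by exact_mod_cast h.ne_zero
  have hYv : ∀ v i, ∑ j, (Y i j : ℝ) * v j = e * Y₀.mulVec v i := fun v i => by
    simp only [hY₀, Matrix.mulVec, dotProduct, Finset.mul_sum, mul_assoc]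
  obtain ⟨y, g, hy, h1, h2⟩ := h.solution _ _ _ _ hX hY hV hb (by
    obtain ⟨v, g, h1, h2⟩ := hsol
    -- The terms of the second equation are scaled by `e` and by `D`; the discrepancy is absorbed
    -- into the auxiliary unknown `g`.
    refine ⟨v, ((e : ℝ) / D) • g, fun i => ?_, fun i => ?_⟩
    · rw [sum_shiftInt_mul hN, h1]; simp
    · have := congrFun h2 i
      simp only [Pi.add_apply, Pi.sub_apply] at this
      rw [sum_shiftInt_mul hN', hYv, Matrix.mulVec_smul, hb₀, ← this]
      simp only [Pi.smul_apply, smul_eq_mul]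
      field_simp)
  refine ⟨y, hy, ((s'.reg 4 : ℝ)⁻¹) • fun i => (y i : ℝ),
    ((D : ℝ) / (e * s'.reg 4)) • fun i => (g i : ℝ), fun i => ?_, ?_, ?_⟩
  · simp only [Pi.smul_apply, smul_eq_mul]; field_simp
  · have h1' : ∀ i, ∑ j, (shiftInt D N i j : ℝ) * (y j : ℝ) = 0 := fun i => by exact_mod_cast h1 i
    rw [Matrix.mulVec_smul]
    congr 1
    ext i
    have := h1' i
    rw [sum_shiftInt_mul hN, mul_eq_zero, or_iff_right hD'] at this
    linarith
  · have h2' : ∀ i, ∑ j, (Y i j : ℝ) * (y j : ℝ) + ∑ j, (shiftInt D N' i j : ℝ) * (g j : ℝ) =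
        s'.reg 4 * b i := fun i => by exact_mod_cast h2 i
    ext i
    have := h2' i
    rw [sum_shiftInt_mul hN', hYv, hb₀] at this
    simp only [Pi.add_apply, Pi.sub_apply, Matrix.mulVec_smul, Pi.smul_apply, smul_eq_mul]
    field_simp
    linear_combination this

end FixedPoints

namespace Instance

variable {ω : Instance}

/-! ### The closed walks through accepting states -/

/-- The matrix of the edges on closed walks through accepting states, multiplied by the common
denominator. -/
noncomputable def loopInt (ω : Instance) (i j : ω.Pos) : ℤ :=
  ω.productInt i j * boolInt (Reachable ω.chain ω.aut i ∧ ReturnsThroughAccept ω.chain ω.aut i j)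

theorem cast_loopInt (i j : ω.Pos) : (ω.loopInt i j : ℝ) =
    ω.denom * loopMatrix ω.chain ω.aut (Reachable ω.chain ω.aut) i j := by
  classical
  rw [loopInt, Int.cast_mul, cast_productInt, cast_boolInt, loopMatrix]
  split_ifs <;> simp

/-- Compute the matrix of the edges on closed walks through accepting states. -/
def edgesProgram : Program :=
  .seq (.tab 7 32 32 (get 3 (reg 1 / reg 30) * get 6 (reg 1 * reg 32 + reg 0)))
  (.seq (.tab 8 33 32 (get 4 (reg 1 / reg 30) *
    (get 6 (reg 0 / reg 32 * reg 32 + reg 1) * get 6 (reg 1 * reg 32 + (reg 0).mod (reg 32)))))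
  (.tab 9 33 39 (get 5 (reg 0) * (nonzero (get 7 (reg 0 / reg 32)) *
    nonzero (get 8 ((reg 0).mod (reg 32) * reg 32 + reg 0 / reg 32))))))

/-- The data in memory after `edgesProgram`. -/
structure AfterEdges (ω : Instance) (s : State) : Prop where
  base : ω.Base s
  reach : s.Holds 6 fun x : ω.Pos × ω.Pos => boolInt (Reach (productMatrix ω.chain ω.aut) x.1 x.2)
  reachable : ∃ f : ω.Pos → ℤ, s.Holds 7 f ∧ ∀ i, f i ≠ 0 ↔ Reachable ω.chain ω.aut i
  loop : s.Holds 9 fun x : ω.Pos × ω.Pos => ω.loopInt x.1 x.2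

theorem runs_edgesProgram : Runs size AfterReach edgesProgram AfterEdges := by
  have hone : PolyBdd size fun _ => 1 := .const 1
  refine Runs.conseq ((runs_tab (k := fun ω => card ω.Pos) (l := fun ω => card ω.Pos)
      (fun _ _ h => h.1) (fun _ _ h => h.r32) (fun _ _ h => h.r32) polyBdd_pos polyBdd_pos).seq
    ((runs_tab (k := fun ω => card (ω.Pos × ω.Pos)) (l := fun ω => card ω.Pos)
      (fun _ _ h => h.1) (fun _ _ h => h.r33) (fun _ _ h => h.r32) polyBdd_pos_sq polyBdd_pos).seq
    (runs_tab (k := fun ω => card (ω.Pos × ω.Pos)) (l := fun _ => 1)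
      (fun _ _ h => h.1) (fun _ _ h => h.r33) (fun _ _ h => h.r39) polyBdd_pos_sq hone)))
    (fun _ _ h => h) ?_
  rintro ω s₃ ⟨h₃, s₂, ⟨h₂, s₁, ⟨h₁, s₀, ⟨h₀, a6⟩, t₁⟩, t₂⟩, t₃⟩
  -- Sums of truth values count witnesses; later only whether they vanish is used.
  have a7 := t₁.holds (ι := ω.Pos) (κ := ω.Pos) (g := fun i i₀ => boolInt (i₀.1 ∈ ω.aut.start ∧
      Reach (productMatrix ω.chain ω.aut) i₀ i)) fun i i₀ => by
    simp only [eval_mul, eval_get, eval_div, eval_reg, eval_add, State.cursor_reg_zero,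
      State.cursor_reg_one, State.cursor_reg _ _ _ (show 2 ≤ 30 by decide),
      State.cursor_reg _ _ _ (show 2 ≤ 32 by decide), h₀.r30, h₀.r32, num_ediv, State.cursor_arr,
      toNat_num_mul_add, Int.toNat_natCast, h₀.a3 _, a6 _, boolInt_mul]
  have a6' := a6.congr (t₁.arr 6 (by decide))
  have a8 := t₂.holds (ι := ω.Pos × ω.Pos) (κ := ω.Pos) (g := fun x f =>
      boolInt (f.1 ∈ ω.aut.accept ∧ Reach (productMatrix ω.chain ω.aut) x.1 f ∧
        Reach (productMatrix ω.chain ω.aut) f x.2)) fun x f => by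
    simp only [eval_mul, eval_get, eval_div, eval_mod, eval_reg, eval_add, State.cursor_reg_zero,
      State.cursor_reg_one, State.cursor_reg _ _ _ (show 2 ≤ 30 by decide),
      State.cursor_reg _ _ _ (show 2 ≤ 32 by decide), h₁.r30, h₁.r32, num_ediv, num_emod,
      State.cursor_arr, toNat_num_mul_add, Int.toNat_natCast, h₁.a4 _, a6' _, boolInt_mul]
  have a7' := a7.congr (t₂.arr 7 (by decide))
  refine ⟨h₃, (a6'.congr (t₂.arr 6 (by decide))).congr (t₃.arr 6 (by decide)),
    ⟨_, a7'.congr (t₃.arr 7 (by decide)), fun i => sum_boolInt_ne_zero _⟩, ?_⟩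
  refine t₃.holds_one fun x => ?_
  simp only [eval_mul, eval_get, eval_div, eval_mod, eval_reg, eval_add, eval_nonzero,
    State.cursor_reg_zero, State.cursor_reg _ _ _ (show 2 ≤ 32 by decide), h₂.r32, num_ediv,
    num_emod, State.cursor_arr, toNat_num_mul_add, Int.toNat_natCast, h₂.a5 _, a7' _, a8 _,
    ite_eq_boolInt, sum_boolInt_ne_zero, boolInt_mul, loopInt]
  rfl

/-! ### The live states -/

/-- The matrix of the live part of the product, multiplied by the common denominator. -/
noncomputable def liveInt (ω : Instance) (u : ω.Pos → ℝ) (i j : ω.Pos) : ℤ :=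
  ω.productInt i j * (boolInt (Live ω.chain ω.aut u i) * boolInt (Live ω.chain ω.aut u j))

theorem cast_liveInt (u : ω.Pos → ℝ) (i j : ω.Pos) : (ω.liveInt u i j : ℝ) =
    ω.denom * liveMatrix ω.chain ω.aut u i j := by
  classical
  rw [liveInt, boolInt_mul, Int.cast_mul, cast_productInt, cast_boolInt, liveMatrix, Matrix.mask]
  split_ifs <;> simp

/-- Compute the live states. -/
def liveProgram : Program :=
  .seq (.tab 16 33 39 (reg 40 * isZero (reg 0 / reg 32 - (reg 0).mod (reg 32)) - get 9 (reg 0)))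
  (.seq (.tab 18 33 39 (get 16 (reg 0)))
  (.seq (.tab 17 33 39 (isZero (reg 0 / reg 32 - (reg 0).mod (reg 32))))
  (.seq (.tab 19 32 39 (const 1))
  (.seq (.seq (.assign 26 (reg 32)) Block.program)
  (.seq (.tab 10 32 32 (get 6 (reg 0 * reg 32 + reg 1) * nonzero (get 22 (reg 1))))
  (.seq (.tab 13 32 39 (nonzero (get 7 (reg 0)) * nonzero (get 10 (reg 0))))
  (.tab 11 33 39 (get 5 (reg 0) *
    (get 13 (reg 0 / reg 32) * get 13 ((reg 0).mod (reg 32)))))))))))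

/-- The data in memory after `liveProgram`. -/
def AfterLive (ω : Instance) (s : State) : Prop :=
  ω.Base s ∧ ∃ u g, IsLoopSolution ω.chain ω.aut u g ∧
    s.Holds 11 fun x : ω.Pos × ω.Pos => ω.liveInt u x.1 x.2

theorem runs_liveProgram : Runs size AfterEdges liveProgram AfterLive := by
  have hone : PolyBdd size fun _ => 1 := .const 1
  refine Runs.conseq ((runs_tab (k := fun ω => card (ω.Pos × ω.Pos)) (l := fun _ => 1)
      (fun _ _ h => h.1) (fun _ _ h => h.r33) (fun _ _ h => h.r39) polyBdd_pos_sq hone).seq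
    ((runs_tab (k := fun ω => card (ω.Pos × ω.Pos)) (l := fun _ => 1)
      (fun _ _ h => h.1) (fun _ _ h => h.r33) (fun _ _ h => h.r39) polyBdd_pos_sq hone).seq
    ((runs_tab (k := fun ω => card (ω.Pos × ω.Pos)) (l := fun _ => 1)
      (fun _ _ h => h.1) (fun _ _ h => h.r33) (fun _ _ h => h.r39) polyBdd_pos_sq hone).seq
    ((runs_tab (k := fun ω => card ω.Pos) (l := fun _ => 1)
      (fun _ _ h => h.1) (fun _ _ h => h.r32) (fun _ _ h => h.r39) polyBdd_pos hone).seq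
    ((runs_block (fun _ _ h => h.1) (fun ω => ω.Pos) (fun _ _ h => h.r32) polyBdd_pos).seq
    ((runs_tab (k := fun ω => card ω.Pos) (l := fun ω => card ω.Pos)
      (fun _ _ h => h.1) (fun _ _ h => h.r32) (fun _ _ h => h.r32) polyBdd_pos polyBdd_pos).seq
    ((runs_tab (k := fun ω => card ω.Pos) (l := fun _ => 1)
      (fun _ _ h => h.1) (fun _ _ h => h.r32) (fun _ _ h => h.r39) polyBdd_pos hone).seq
    (runs_tab (k := fun ω => card (ω.Pos × ω.Pos)) (l := fun _ => 1)
      (fun _ _ h => h.1) (fun _ _ h => h.r33) (fun _ _ h => h.r39) polyBdd_pos_sq hone))))))))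
    (fun _ _ h => h) ?_
  rintro ω s₈ ⟨h₈, s₇, ⟨h₇, s₆, ⟨h₆, s₅, ⟨h₅, s₄, ⟨h₄, s₃, ⟨h₃, s₂, ⟨h₂, s₁, ⟨h₁, s₀,
    ⟨h₀, a6, ⟨f, a7, hf⟩, a9⟩, t₁⟩, t₂⟩, t₃⟩, t₄⟩, t₅⟩, t₆⟩, t₇⟩, t₈⟩
  have a16 := t₁.holds_one (ι := ω.Pos × ω.Pos)
      (g := fun x => shiftInt ω.denom ω.loopInt x.1 x.2) fun x => by
    simp only [eval_sub, eval_mul, eval_isZero, eval_get, eval_div, eval_mod, eval_reg,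
      State.cursor_reg_zero, State.cursor_reg _ _ _ (show 2 ≤ 40 by decide),
      State.cursor_reg _ _ _ (show 2 ≤ 32 by decide), h₀.r32, h₀.r40, num_ediv, num_emod,
      State.cursor_arr, Int.toNat_natCast, a9 _, ite_num_sub, shiftInt]
  have a18 := t₂.holds_one (ι := ω.Pos × ω.Pos)
      (g := fun x => shiftInt ω.denom ω.loopInt x.1 x.2) fun x => by
    simp only [eval_get, eval_reg, State.cursor_reg_zero, State.cursor_arr, Int.toNat_natCast, a16 _]
  have a17 := t₃.holds_one (ι := ω.Pos × ω.Pos)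
      (g := fun x => if x.1 = x.2 then 1 else 0) fun x => by
    simp only [eval_sub, eval_isZero, eval_div, eval_mod, eval_reg,
      State.cursor_reg_zero, State.cursor_reg _ _ _ (show 2 ≤ 32 by decide), h₂.r32, num_ediv,
      num_emod, ite_num_sub]
  have a19 := t₄.holds_one (ι := ω.Pos) (g := fun _ => 1) fun x => rfl
  -- With the identity as `Y` and the same matrix for `v` and `g`, the block system is that of
  -- `IsLoopSolution`.
  obtain ⟨y, hy, u, g, hyu, hu, hug⟩ := exists_fixed_of_blockSpec t₅ ω.denom_pos.ne' one_ne_zero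
    (Y := fun i j => if i = j then 1 else 0) (Y₀ := 1) (b₀ := fun _ => 1)
    (((a16.congr (t₂.arr 16 (by decide))).congr (t₃.arr 16 (by decide))).congr (t₄.arr 16 (by decide)))
    (a17.congr (t₄.arr 17 (by decide)))
    ((a18.congr (t₃.arr 18 (by decide))).congr (t₄.arr 18 (by decide))) a19
    cast_loopInt cast_loopInt (fun i j => by simp [Matrix.one_apply]) (fun i => by simp) (by
      obtain ⟨u, g, h⟩ := exists_isLoopSolution ω.chain ω.unambiguous
      exact ⟨u, g, h.fixed, by rw [Matrix.one_mulVec]; exact h.add⟩)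
  rw [Matrix.one_mulVec] at hug
  have hyu' : ∀ i, y i ≠ 0 ↔ u i ≠ 0 := fun i => by
    rw [hyu i]; simp [t₅.ne_zero]
  have hcongr : ∀ a, a < 16 → s₅.arr a = s₀.arr a := fun a ha => by
    rw [t₅.arr a (by omega), State.setReg_arr, t₄.arr a (by omega), t₃.arr a (by omega),
      t₂.arr a (by omega), t₁.arr a (by omega)]
  have a6' := a6.congr (hcongr 6 (by decide))
  have a7' := (a7.congr (hcongr 7 (by decide))).congr (t₆.arr 7 (by decide))
  have a10 := t₆.holds (ι := ω.Pos) (κ := ω.Pos) (g := fun i j =>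
      boolInt (Reach (productMatrix ω.chain ω.aut) i j ∧ u j ≠ 0)) fun i j => by
    simp only [eval_mul, eval_get, eval_reg, eval_add, eval_nonzero, State.cursor_reg_zero,
      State.cursor_reg_one, State.cursor_reg _ _ _ (show 2 ≤ 32 by decide), h₅.r32,
      State.cursor_arr, toNat_num_mul_add, Int.toNat_natCast, a6' _, hy _, ite_eq_boolInt, hyu',
      boolInt_mul]
  have a13 := t₇.holds_one (ι := ω.Pos) (g := fun i => boolInt (Live ω.chain ω.aut u i)) fun i => by
    simp only [eval_mul, eval_get, eval_reg, eval_nonzero, State.cursor_reg_zero,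
      State.cursor_arr, Int.toNat_natCast, a7' _, a10 _, ite_eq_boolInt, hf, sum_boolInt_ne_zero,
      boolInt_mul]
    rfl
  refine ⟨h₈, u, g, ⟨hu, hug⟩, t₈.holds_one fun x => ?_⟩
  simp only [eval_mul, eval_get, eval_div, eval_mod, eval_reg, State.cursor_reg_zero,
    State.cursor_reg _ _ _ (show 2 ≤ 32 by decide), h₇.r32, num_ediv, num_emod, State.cursor_arr,
    Int.toNat_natCast, h₇.a5 _, a13 _, liveInt]

end Instance

end Buchi

namespace Buchi

open RAM RAM.Expr Idx

theorem num_mul_add {ι κ : Type} [Idx ι] [Idx κ] (x : ι) (y : κ) :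
    (num x : ℤ) * (card κ : ℤ) + (num y : ℤ) = (num (x, y) : ℤ) := by
  rw [num_mk]; push_cast; ring

namespace Instance

variable {ω : Instance}

/-! ### The weights of pairs -/

/-- The matrix of the live pairs, multiplied by the common denominator. -/
noncomputable def pairInt (ω : Instance) (u : ω.Pos → ℝ) (i j : ω.Pair) : ℤ :=
  ω.liveInt u (i.1.1, i.2) (j.1.1, j.2) * boolInt (ω.liveInt u (i.1.2, i.2) (j.1.2, j.2) ≠ 0)

/-- Both copies move with one step of the chain, so the transition probability, and with it the
denominator, may occur only once. The second factor contributes its support alone. -/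
theorem cast_pairInt (u : ω.Pos → ℝ) (i j : ω.Pair) : (ω.pairInt u i j : ℝ) =
    ω.denom * pairLiveMatrix ω.chain ω.aut u i j := by
  classical
  have hD : (ω.denom : ℝ) ≠ 0 := by exact_mod_cast ω.denom_pos.ne'
  have h0 : ω.liveInt u (i.1.2, i.2) (j.1.2, j.2) ≠ 0 ↔
      liveMatrix ω.chain ω.aut u (i.1.2, i.2) (j.1.2, j.2) ≠ 0 := by
    rw [← Int.cast_ne_zero (α := ℝ), cast_liveInt]; simp [hD]
  rw [pairInt, Int.cast_mul, cast_liveInt, cast_boolInt, mul_assoc]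
  simp only [h0]
  congr 1
  simp only [liveMatrix, pairLiveMatrix, Matrix.mask, PairLive, productMatrix, pairMatrix,
    MarkovChain.weightMatrix, pairWeight]
  by_cases hP : (ω.chain.P i.2 j.2 : ℝ) = 0
  · simp [hP]
  · by_cases h1 : Live ω.chain ω.aut u (i.1.1, i.2) <;>
    by_cases h2 : Live ω.chain ω.aut u (i.1.2, i.2) <;>
    by_cases h3 : Live ω.chain ω.aut u (j.1.1, j.2) <;>
    by_cases h4 : Live ω.chain ω.aut u (j.1.2, j.2) <;>
    by_cases h5 : j.1.2 ∈ ω.aut.step i.1.2 i.2 <;>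
    simp [hP, h1, h2, h3, h4, h5, stepWeight]

/-- The entries of the matrix for the weights of pairs. -/
def pairExpr : Expr :=
  reg 40 * isZero (reg 0 / reg 34 - (reg 0).mod (reg 34)) -
    get 11 ((((reg 0).mod (reg 34) / reg 30 / reg 31) * reg 30 +
        ((reg 0).mod (reg 34)).mod (reg 30)) * reg 32 +
      ((reg 0 / reg 34 / reg 30 / reg 31) * reg 30 + (reg 0 / reg 34).mod (reg 30))) *
    nonzero (get 11 ((((reg 0).mod (reg 34) / reg 30).mod (reg 31) * reg 30 +
        ((reg 0).mod (reg 34)).mod (reg 30)) * reg 32 +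
      ((reg 0 / reg 34 / reg 30).mod (reg 31) * reg 30 + (reg 0 / reg 34).mod (reg 30))))

/-- Compute the weights of pairs. -/
def pairProgram : Program :=
  .seq (.tab 16 38 39 pairExpr)
  (.seq (.tab 18 38 39 (get 16 (reg 0)))
  (.seq (.tab 17 38 39 (isZero (reg 0 / reg 34 - (reg 0).mod (reg 34))))
  (.seq (.tab 19 34 39 (get 2 ((reg 0).mod (reg 30)) *
    (get 3 (reg 0 / reg 30 / reg 31) * get 3 ((reg 0 / reg 30).mod (reg 31)))))
  (.seq (.seq (.assign 26 (reg 34)) Block.program)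
  (.seq (.tab 12 34 39 (get 22 (reg 0))) (.assign 42 (reg 4)))))))

/-- The data in memory after `pairProgram`. -/
def AfterPair (ω : Instance) (s : State) : Prop :=
  ω.Base s ∧ ∃ u g c h, IsLoopSolution ω.chain ω.aut u g ∧ IsPairSolution ω.chain ω.aut u c h ∧
    (s.Holds 11 fun x : ω.Pos × ω.Pos => ω.liveInt u x.1 x.2) ∧ s.reg 42 ≠ 0 ∧
    ∃ y : ω.Pair → ℤ, s.Holds 12 y ∧ ∀ i, (y i : ℝ) = s.reg 42 * ω.denom * c i

theorem runs_pairProgram : Runs size AfterLive pairProgram AfterPair := by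
  have hone : PolyBdd size fun _ => 1 := .const 1
  refine Runs.conseq ((runs_tab (k := fun ω => card (ω.Pair × ω.Pair)) (l := fun _ => 1)
      (fun _ _ h => h.1) (fun _ _ h => h.r38) (fun _ _ h => h.r39) polyBdd_pair_sq hone).seq
    ((runs_tab (k := fun ω => card (ω.Pair × ω.Pair)) (l := fun _ => 1)
      (fun _ _ h => h.1) (fun _ _ h => h.r38) (fun _ _ h => h.r39) polyBdd_pair_sq hone).seq
    ((runs_tab (k := fun ω => card (ω.Pair × ω.Pair)) (l := fun _ => 1)
      (fun _ _ h => h.1) (fun _ _ h => h.r38) (fun _ _ h => h.r39) polyBdd_pair_sq hone).seq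
    ((runs_tab (k := fun ω => card ω.Pair) (l := fun _ => 1)
      (fun _ _ h => h.1) (fun _ _ h => h.r34) (fun _ _ h => h.r39) polyBdd_pair hone).seq
    ((runs_block (fun _ _ h => h.1) (fun ω => ω.Pair) (fun _ _ h => h.r34) polyBdd_pair).seq
    ((runs_tab (k := fun ω => card ω.Pair) (l := fun _ => 1)
      (fun _ _ h => h.1) (fun _ _ h => h.r34) (fun _ _ h => h.r39) polyBdd_pair hone).seq
    (runs_assign (fun _ _ h => h.1) (reg 4))))))))
    (fun _ _ h => h) ?_
  rintro ω s₇ ⟨h₇, s₆, ⟨h₆, s₅, ⟨h₅, s₄, ⟨h₄, s₃, ⟨h₃, s₂, ⟨h₂, s₁, ⟨h₁, s₀,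
    ⟨h₀, u, g, hu, a11⟩, t₁⟩, t₂⟩, t₃⟩, t₄⟩, t₅⟩, t₆⟩, rfl⟩
  -- The indices are exchanged, because left fixed points are wanted.
  have a16 := t₁.holds_one (ι := ω.Pair × ω.Pair)
      (g := fun x => shiftInt ω.denom (fun i j => ω.pairInt u j i) x.1 x.2) fun x => by
    simp only [pairExpr, eval_sub, eval_add, eval_mul, eval_isZero, eval_nonzero, eval_get, eval_div,
      eval_mod, eval_reg,
      State.cursor_reg_zero, State.cursor_reg _ _ _ (show 2 ≤ 40 by decide),
      State.cursor_reg _ _ _ (show 2 ≤ 30 by decide), State.cursor_reg _ _ _ (show 2 ≤ 31 by decide),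
      State.cursor_reg _ _ _ (show 2 ≤ 32 by decide), State.cursor_reg _ _ _ (show 2 ≤ 34 by decide),
      h₀.r30, h₀.r31, h₀.r32, h₀.r34, h₀.r40, num_ediv, num_emod, num_mul_add,
      State.cursor_arr, Int.toNat_natCast, a11 _, ite_num_sub, ite_eq_boolInt, shiftInt, pairInt]
  have a18 := t₂.holds_one (ι := ω.Pair × ω.Pair)
      (g := fun x => shiftInt ω.denom (fun i j => ω.pairInt u j i) x.1 x.2) fun x => by
    simp only [eval_get, eval_reg, State.cursor_reg_zero, State.cursor_arr, Int.toNat_natCast, a16 _]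
  have a17 := t₃.holds_one (ι := ω.Pair × ω.Pair)
      (g := fun x => if x.1 = x.2 then 1 else 0) fun x => by
    simp only [eval_sub, eval_isZero, eval_div, eval_mod, eval_reg,
      State.cursor_reg_zero, State.cursor_reg _ _ _ (show 2 ≤ 34 by decide), h₂.r34, num_ediv,
      num_emod, ite_num_sub]
  have a19 := t₄.holds_one (ι := ω.Pair) (g := fun i => ω.initialInt i.2 *
      (boolInt (i.1.1 ∈ ω.aut.start) * boolInt (i.1.2 ∈ ω.aut.start))) fun i => by
    simp only [eval_mul, eval_get, eval_div, eval_mod, eval_reg, State.cursor_reg_zero,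
      State.cursor_reg _ _ _ (show 2 ≤ 30 by decide), State.cursor_reg _ _ _ (show 2 ≤ 31 by decide),
      h₃.r30, h₃.r31, num_ediv, num_emod, State.cursor_arr, Int.toNat_natCast, h₃.a2 _, h₃.a3 _]
  have hD : (ω.denom : ℝ) ≠ 0 := by exact_mod_cast ω.denom_pos.ne'
  -- The right-hand side becomes integral after scaling by `denom`, so the solution is `denom` times
  -- the wanted projection.
  obtain ⟨y, hy, v, h, hyv, hv, hvh⟩ := exists_fixed_of_blockSpec t₅ ω.denom_pos.ne' one_ne_zero
    (Y := fun i j => if i = j then 1 else 0) (Y₀ := 1)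
    (b₀ := (ω.denom : ℝ) • pairStart ω.chain ω.aut)
    (L := (pairLiveMatrix ω.chain ω.aut u).transpose)
    (L' := (pairLiveMatrix ω.chain ω.aut u).transpose)
    (((a16.congr (t₂.arr 16 (by decide))).congr (t₃.arr 16 (by decide))).congr (t₄.arr 16 (by decide)))
    (a17.congr (t₄.arr 17 (by decide)))
    ((a18.congr (t₃.arr 18 (by decide))).congr (t₄.arr 18 (by decide))) a19
    (fun i j => cast_pairInt u j i) (fun i j => cast_pairInt u j i)
    (fun i j => by simp [Matrix.one_apply]) (fun i => by
      classical
      simp only [Int.cast_mul, cast_initialInt, cast_boolInt, Pi.smul_apply, pairStart, startWeight,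
        smul_eq_mul, Int.cast_one, one_mul]
      ring) (by
      obtain ⟨c, h, hc⟩ := exists_isPairSolution ω.unambiguous hu
      refine ⟨(ω.denom : ℝ) • c, (ω.denom : ℝ) • h, ?_, ?_⟩
      · rw [Matrix.mulVec_smul, hc.fixed]
      · rw [Matrix.one_mulVec, Matrix.mulVec_smul, ← hc.add, smul_add, smul_sub])
  rw [Matrix.one_mulVec] at hvh
  have hne : s₅.reg 4 ≠ 0 := t₅.ne_zero
  have h4 : s₆.reg 4 = s₅.reg 4 := t₆.reg 4 (by decide)
  have hd : (s₅.reg 4 : ℝ) ≠ 0 := by exact_mod_cast hne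
  have a12 := t₆.holds_one (ι := ω.Pair) (g := y) fun i => by
    simp only [eval_get, eval_reg, State.cursor_reg_zero, State.cursor_arr, Int.toNat_natCast, hy _]
  have a11' : s₆.Holds 11 fun x : ω.Pos × ω.Pos => ω.liveInt u x.1 x.2 := by
    refine a11.congr ?_
    rw [t₆.arr 11 (by decide), t₅.arr 11 (by decide), State.setReg_arr, t₄.arr 11 (by decide),
      t₃.arr 11 (by decide), t₂.arr 11 (by decide), t₁.arr 11 (by decide)]
  refine ⟨h₇, u, g, (ω.denom : ℝ)⁻¹ • v, (ω.denom : ℝ)⁻¹ • h, hu, ⟨?_, ?_⟩, a11', ?_, y, a12,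
    fun i => ?_⟩
  · rw [Matrix.mulVec_smul, hv]
  · rw [Matrix.mulVec_smul, ← smul_sub, ← smul_add, hvh, smul_smul, inv_mul_cancel₀ hD, one_smul]
  · rw [State.setReg_reg_self, eval_reg, h4]; exact hne
  · rw [State.setReg_reg_self, eval_reg, h4]
    simp only [Pi.smul_apply, smul_eq_mul, hyv]
    field_simp

/-! ### The probability of acceptance -/

/-- Compute the probability of acceptance. -/
def acceptProgram : Program :=
  .seq (.tab 16 33 39 (reg 40 * isZero (reg 0 / reg 32 - (reg 0).mod (reg 32)) - get 11 (reg 0)))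
  (.seq (.tab 18 33 39 (reg 40 * isZero (reg 0 / reg 32 - (reg 0).mod (reg 32)) -
    get 11 ((reg 0).mod (reg 32) * reg 32 + reg 0 / reg 32)))
  (.seq (.tab 17 33 39 (isZero ((reg 0 / reg 32).mod (reg 30) - ((reg 0).mod (reg 32)).mod (reg 30)) *
    get 12 ((reg 0 / reg 32 / reg 30 * reg 31 + (reg 0).mod (reg 32) / reg 30) * reg 30 +
      (reg 0 / reg 32).mod (reg 30))))
  (.seq (.tab 19 32 39 (reg 42 * (get 2 ((reg 0).mod (reg 30)) * get 3 (reg 0 / reg 30))))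
  (.seq (.seq (.assign 26 (reg 32)) Block.program)
  (.seq (.tab 27 39 32 (get 2 ((reg 1).mod (reg 30)) * get 3 (reg 1 / reg 30) * get 22 (reg 1)))
  (.seq (.assign 0 (get 27 (const 0) * reg 4)) (.assign 1 (reg 40 * (reg 4 * reg 4)))))))))

/-- The result of the computation. -/
def Result (ω : Instance) (s : State) : Prop :=
  0 < s.reg 1 ∧
    ω.chain.trajectoryLaw.real (language ω.aut) = (s.reg 0 : ℝ) / (s.reg 1 : ℝ)

theorem runs_acceptProgram : Runs size AfterPair acceptProgram Result := by
  have hone : PolyBdd size fun _ => 1 := .const 1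
  refine Runs.conseq ((runs_tab (k := fun ω => card (ω.Pos × ω.Pos)) (l := fun _ => 1)
      (fun _ _ h => h.1) (fun _ _ h => h.r33) (fun _ _ h => h.r39) polyBdd_pos_sq hone).seq
    ((runs_tab (k := fun ω => card (ω.Pos × ω.Pos)) (l := fun _ => 1)
      (fun _ _ h => h.1) (fun _ _ h => h.r33) (fun _ _ h => h.r39) polyBdd_pos_sq hone).seq
    ((runs_tab (k := fun ω => card (ω.Pos × ω.Pos)) (l := fun _ => 1)
      (fun _ _ h => h.1) (fun _ _ h => h.r33) (fun _ _ h => h.r39) polyBdd_pos_sq hone).seq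
    ((runs_tab (k := fun ω => card ω.Pos) (l := fun _ => 1)
      (fun _ _ h => h.1) (fun _ _ h => h.r32) (fun _ _ h => h.r39) polyBdd_pos hone).seq
    ((runs_block (fun _ _ h => h.1) (fun ω => ω.Pos) (fun _ _ h => h.r32) polyBdd_pos).seq
    ((runs_tab (k := fun _ => 1) (l := fun ω => card ω.Pos)
      (fun _ _ h => h.1) (fun _ _ h => h.r39) (fun _ _ h => h.r32) hone polyBdd_pos).seq
    ((runs_assign (fun _ _ h => h.1) (get 27 (const 0) * reg 4)).seq
    (runs_assign (fun _ _ h => h.1) (reg 40 * (reg 4 * reg 4))))))))))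
    (fun _ _ h => h) ?_
  rintro ω _ ⟨-, _, ⟨-, s₆, ⟨h₆, s₅, ⟨h₅, s₄, ⟨h₄, s₃, ⟨h₃, s₂, ⟨h₂, s₁, ⟨h₁, s₀,
    ⟨h₀, u, g, c, g₂, hu, hc, a11, hne, y₂, a12, hy₂⟩, t₁⟩, t₂⟩, t₃⟩, t₄⟩, t₅⟩, t₆⟩, rfl⟩, rfl⟩
  have a16 := t₁.holds_one (ι := ω.Pos × ω.Pos)
      (g := fun x => shiftInt ω.denom (ω.liveInt u) x.1 x.2) fun x => by
    simp only [eval_sub, eval_mul, eval_isZero, eval_get, eval_div, eval_mod, eval_reg,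
      State.cursor_reg_zero, State.cursor_reg _ _ _ (show 2 ≤ 40 by decide),
      State.cursor_reg _ _ _ (show 2 ≤ 32 by decide), h₀.r32, h₀.r40, num_ediv, num_emod,
      State.cursor_arr, Int.toNat_natCast, a11 _, ite_num_sub, shiftInt]
  have a11₁ := a11.congr (t₁.arr 11 (by decide))
  have a18 := t₂.holds_one (ι := ω.Pos × ω.Pos)
      (g := fun x => shiftInt ω.denom (fun i j => ω.liveInt u j i) x.1 x.2) fun x => by
    simp only [eval_sub, eval_add, eval_mul, eval_isZero, eval_get, eval_div, eval_mod, eval_reg,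
      State.cursor_reg_zero, State.cursor_reg _ _ _ (show 2 ≤ 40 by decide),
      State.cursor_reg _ _ _ (show 2 ≤ 32 by decide), h₁.r32, h₁.r40, num_ediv, num_emod,
      State.cursor_arr, num_mul_add, Int.toNat_natCast, a11₁ _, ite_num_sub, shiftInt]
  have a12₂ := (a12.congr (t₁.arr 12 (by decide))).congr (t₂.arr 12 (by decide))
  have a17 := t₃.holds_one (ι := ω.Pos × ω.Pos)
      (g := fun x => (if x.1.2 = x.2.2 then 1 else 0) * y₂ ((x.1.1, x.2.1), x.1.2)) fun x => by
    simp only [eval_sub, eval_add, eval_mul, eval_isZero, eval_get, eval_div, eval_mod, eval_reg,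
      State.cursor_reg_zero, State.cursor_reg _ _ _ (show 2 ≤ 30 by decide),
      State.cursor_reg _ _ _ (show 2 ≤ 31 by decide),
      State.cursor_reg _ _ _ (show 2 ≤ 32 by decide), h₂.r30, h₂.r31, h₂.r32, num_ediv, num_emod,
      State.cursor_arr, num_mul_add, Int.toNat_natCast, a12₂ _, ite_num_sub]
  have h42 : s₃.reg 42 = s₀.reg 42 := by
    rw [t₃.reg 42 (by decide), t₂.reg 42 (by decide), t₁.reg 42 (by decide)]
  have a19 := t₄.holds_one (ι := ω.Pos) (g := fun i => s₀.reg 42 * (ω.initialInt i.2 *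
      boolInt (i.1 ∈ ω.aut.start))) fun i => by
    simp only [eval_mul, eval_get, eval_div, eval_mod, eval_reg, State.cursor_reg_zero,
      State.cursor_reg _ _ _ (show 2 ≤ 30 by decide), State.cursor_reg _ _ _ (show 2 ≤ 42 by decide),
      h42, h₃.r30, num_ediv, num_emod, State.cursor_arr, Int.toNat_natCast, h₃.a2 _, h₃.a3 _]
  have hD : (ω.denom : ℝ) ≠ 0 := by exact_mod_cast ω.denom_pos.ne'
  have hstart : ∀ i : ω.Pos, ((ω.initialInt i.2 * boolInt (i.1 ∈ ω.aut.start) : ℤ) : ℝ) =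
      ω.denom * productStart ω.chain ω.aut i := fun i => by
    classical
    simp only [Int.cast_mul, cast_initialInt, cast_boolInt, productStart, startWeight]
    ring
  -- The weights `c` are known as the integers `y₂` over `reg 42 * denom`. This product is the
  -- factor `e`, common to the matrix of the form and the initial weights.
  obtain ⟨y, hy, v, g₃, hyv, hv, hvg⟩ := exists_fixed_of_blockSpec t₅ ω.denom_pos.ne'
    (e := s₀.reg 42 * ω.denom) (mul_ne_zero hne ω.denom_pos.ne')
    (Y := fun i j => (if i.2 = j.2 then 1 else 0) * y₂ ((i.1, j.1), i.2)) (Y₀ := formMatrix c)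
    (b₀ := productStart ω.chain ω.aut) (L := liveMatrix ω.chain ω.aut u)
    (L' := (liveMatrix ω.chain ω.aut u).transpose)
    (((a16.congr (t₂.arr 16 (by decide))).congr (t₃.arr 16 (by decide))).congr (t₄.arr 16 (by decide)))
    (a17.congr (t₄.arr 17 (by decide)))
    ((a18.congr (t₃.arr 18 (by decide))).congr (t₄.arr 18 (by decide))) a19
    (fun i j => cast_liveInt u i j) (fun i j => cast_liveInt u j i)
    (fun i j => by
      rw [formMatrix]
      split_ifs
      · rw [one_mul, hy₂]; push_cast; ring
      · simp)
    (fun i => by rw [Int.cast_mul, hstart]; push_cast; ring) (by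
      obtain ⟨v, g₃, h⟩ := exists_isAcceptSolution ω.unambiguous hu hc
      exact ⟨v, g₃, h.fixed, h.add⟩)
  have hne5 : s₅.reg 4 ≠ 0 := t₅.ne_zero
  have h4 : s₆.reg 4 = s₅.reg 4 := t₆.reg 4 (by decide)
  have hd : (s₅.reg 4 : ℝ) ≠ 0 := by exact_mod_cast hne5
  have a27 : s₆.arr 27 0 = ∑ i : ω.Pos, ω.initialInt i.2 * boolInt (i.1 ∈ ω.aut.start) * y i := by
    rw [t₆.apply 0 Nat.one_pos, sum_range_card]
    refine Finset.sum_congr rfl fun i _ => ?_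
    change Expr.eval (s₅.cursor 0 (num i)) _ = _
    simp only [eval_mul, eval_get, eval_div, eval_mod, eval_reg, State.cursor_reg_one,
      State.cursor_reg _ _ _ (show 2 ≤ 30 by decide),
      h₅.r30, num_ediv, num_emod, State.cursor_arr, Int.toNat_natCast, h₅.a2 _, h₅.a3 _, hy _]
  have hr0 : ∀ x z, ((s₆.setReg 0 x).setReg 1 z).reg 0 = x := fun x z => by
    rw [State.setReg_reg_of_ne _ (by decide), State.setReg_reg_self]
  -- The denominator in register `4` may be negative; extending the fraction by it makes the
  -- denominator a positive multiple of a square.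
  have e1 : (reg 40 * (reg 4 * reg 4)).eval (s₆.setReg 0 ((get 27 (const 0) * reg 4).eval s₆)) =
      ω.denom * (s₅.reg 4 * s₅.reg 4) := by
    simp only [eval_mul, eval_reg, State.setReg_reg_of_ne _ (show 40 ≠ 0 by decide),
      State.setReg_reg_of_ne _ (show 4 ≠ 0 by decide), h₆.r40, h4]
  have e2 : (get 27 (const 0) * reg 4).eval s₆ = s₆.arr 27 0 * s₅.reg 4 := by
    simp only [eval_mul, eval_get, eval_const, eval_reg, h4, Int.toNat_zero]
  rw [Result, hr0, State.setReg_reg_self, e1, e2, a27]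
  refine ⟨mul_pos ω.denom_pos (mul_self_pos.2 hne5), ?_⟩
  rw [IsAcceptSolution.trajectoryLaw_real_language ω.unambiguous hu hc ⟨hv, hvg⟩, dotProduct,
    eq_div_iff (by push_cast; exact mul_ne_zero hD (mul_ne_zero hd hd))]
  rw [Int.cast_mul (Finset.sum _ _), Int.cast_sum, Finset.sum_mul, Finset.sum_mul]
  refine Finset.sum_congr rfl fun i _ => ?_
  rw [Int.cast_mul _ (y i), hstart, hyv]
  push_cast
  field_simp

/-- Compute the probability of the language. -/
def program : Program :=
  .seq baseProgram (.seq reachProgram (.seq edgesProgram (.seq liveProgram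
    (.seq pairProgram acceptProgram))))

theorem runs_program : Runs size (fun ω s => s = ω.startState) program Result :=
  runs_baseProgram.seq (runs_reachProgram.seq (runs_edgesProgram.seq (runs_liveProgram.seq
    (runs_pairProgram.seq runs_acceptProgram))))

end Instance

end Buchi

/-- There are one program and one polynomial such that, for every Markov chain `M` and every
unambiguous Büchi automaton `A` over the states of `M`, the program, run on the representations of
`M` and `A`, halts at a cost polynomial in their lengths, with the numerator and the (positive)
denominator of the probability of `L(A)` under `M` in registers `0` and `1`. -/
theorem theorem1 :
    ∃ (c : RAM.Program) (p : Polynomial ℕ),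
      ∀ (n m : ℕ) (M : MarkovChain n) (A : NFA (Fin n) (Fin m)), Buchi.IsUnambiguous A →
        ∃ (s : RAM.State) (t : ℕ),
          RAM.Exec c (RAM.start (M.encode ++ Buchi.encode A)) s t ∧
          t ≤ p.eval (RAM.inputLength M.encode + RAM.inputLength (Buchi.encode A)) ∧
          0 < s.reg 1 ∧
          M.trajectoryLaw.real (Buchi.language A) = (s.reg 0 : ℝ) / (s.reg 1 : ℝ) := by
  -- At the start the memory holds only the input and zeros; the added `1` allows for the length of
  -- a zero.
  obtain ⟨T, ⟨p, hp⟩, h⟩ := Buchi.Instance.runs_program (fun ω => ω.size + 1)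
    (RAM.PolyBdd.size.add (.const 1))
  refine ⟨Buchi.Instance.program, p, fun n m M A hA => ?_⟩
  obtain ⟨s, t, h1, h2, -, h3, h4⟩ := h ⟨n, m, M, A, hA⟩ _ rfl (by
    have := RAM.start_bdd (M.encode ++ Buchi.encode A)
    rwa [RAM.inputLength_append] at this)
  exact ⟨s, t, h1, h2.trans (hp _), h3, h4⟩
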